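/- **Setting.** Let $H=\sum_{i=1}^{N}H_i$ be a Hamiltonian on $n$ qubits, with Hermitian terms $H_i$ that act on at most $\ell=O(1)$ qubits each, $N\le\mathrm{poly}(n)$ and $\|H_i\|\le\mathrm{poly}(n)$. Let $|\Phi\rangle=U|0^n\rangle$, where $U$ is a circuit of at most $\mathrm{poly}(n)$ one- and two-qubit gates, and suppose that $$|\Phi\rangle=\sum_{j=1}^{S}a_j|\psi_j\rangle,\qquad H|\psi_j\rangle=E_j|\psi_j\rangle,$$ with orthonormal $|\psi_j\rangle$, $1\le S\le\mathrm{poly}(n)$, $|a_j|^2\ge 1/\mathrm{poly}(n)$ and $E_j\in[0,2\pi)$. Let $K$ be an even integer with $2S\le K\le\kappa S$, and suppose that for all $i\ne j$ $$\frac1{2\pi}\min_{m\in\mathbb Z}|E_i-E_j-2\pi m|\ \ge\ \frac CK ,$$ where $\kappa$ and $C>2$ are constants. For lists of $S$ energies let $$d(\{E_i\},\{\tilde E_j\})=\frac1{2\pi}\min_{p\in\mathrm{Perm}_S}\ \max_j\ \min_{m\in\mathbb Z}|\tilde E_{p(j)}-E_j-2\pi m|.$$ **Algorithm.** For parameters $M,R$,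 for $k=0,\dots,K$ and $\theta\in\{0,\pi/2\}$, execute $R$ times the Hadamard test circuit on $n+1$ qubits for the first-order Trotter formula $\big(\prod_l e^{-ikH_l/M}\big)^{M}$ of $e^{-iHk}$: prepare $|\Phi\rangle$ by $U$, apply a Hadamard gate to an ancilla in the state $|0\rangle$, apply the propagators $e^{-ikH_l/M}$ controlled by the ancilla, each compiled exactly into one- and two-qubit gates on the ancilla and the qubits of $H_l$, apply $e^{-i\theta Z/2}$ and a Hadamard gate to the ancilla, and measure the ancilla. With $f_{k,\theta}$ the fraction of outcomes $0$, put $y(k)=(2f_{k,0}-1)-i(2f_{k,\pi/2}-1)$. ESPRIT takes a singular value decomposition (decreasing singular values) of the Hankel matrix $(y(a+b))_{0\le a,b\le K/2}$, forms the matrix $U_S$ of the first $S$ left singular vectors and the matrices $U_0$, $U_1$ of the first and of the last $K/2$ rows of $U_S$, computes the eigenvalues $\tilde z_1,\dots,\tilde z_S$ of $U_0^{+}U_1$ ($^+$ is the Moore–Penrose inverse), and returns $\tilde E_j\in[0,2\pi)$ with $\tilde z_j=|\tilde z_j|e^{-i\tilde E_j}$. **Theorem.** For all constants $\ell,\kappa$,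 $C>2$, all polynomial bounds in the assumptions, and all polynomials $q,d$ in $n$, there are polynomials $M(n),R(n)\geq 1$, polynomial bounds on the quantum and on the classical effort, a constant bound on the number of gates per compiled controlled propagator, and one classical program, all of them independent of the instance $(H,U)$ and of $n$, $S$, $K$, such that for every instance as above: 1. the total number of one- and two-qubit gates in all executions of the circuits is at most $\mathrm{poly}(n)$; 2. the classical program, whose input consists of $n,S,K,R$ and the measured bits, always stops after at most $\mathrm{poly}(n)$ bit operations; 3. with probability at least $1-2^{-d(n)}$ over the (independent) measurements, ESPRIT has an output, every output $\{\tilde E_j\}$ of ESPRIT on $y$ (for any choice of the singular value decomposition) satisfies $d(\{E_i\},\{\tilde E_j\})\le 1/q(n)$, and the classical program returns energies $\{\hat E_j\}\subset[0,2\pi)$, as rational multiples of $2\pi$, with $d(\{\tilde E_i\},\{\hat E_j\})\le 1/q(n)$ for each such output and $d(\{E_i\},\{\hat E_j\})\le 1/q(n)$. (For $q(n)=0$ these bounds say nothing.) -/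

import Mathlib

open scoped Matrix Polynomial Real

noncomputable section

/-! ### Qubits, gates and circuits -/

/-- Computational basis states of a register whose qubits are labelled by `ι`. -/
abbrev Bits (ι : Type) : Type := ι → Fin 2

/-- Operators on the register, in the computational basis. -/
abbrev QOp (ι : Type) : Type := Matrix (Bits ι) (Bits ι) ℂ

/-- The operator `M` acts nontrivially only on the qubits in `T`: it is `m ⊗ 1` with `m` an operator
on the qubits in `T`. -/
def ActsOn {ι : Type} [Fintype ι] [DecidableEq ι] (T : Finset ι) (M : QOp ι) : Prop :=
  ∃ m : Matrix (T → Fin 2) (T → Fin 2) ℂ, ∀ x y : Bits ι,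
    M x y = if ∀ i, i ∉ T → x i = y i then m (fun i => x i) (fun i => y i) else 0

/-- `M` is a one- or two-qubit gate: a unitary that acts on at most two qubits, all of them in `A`. -/
def IsGateWithin {ι : Type} [Fintype ι] [DecidableEq ι] (A : Finset ι) (M : QOp ι) : Prop :=
  M ∈ Matrix.unitaryGroup (Bits ι) ℂ ∧ ∃ T : Finset ι, T ⊆ A ∧ T.card ≤ 2 ∧ ActsOn T M

/-- A one- or two-qubit gate. -/
def IsGate {ι : Type} [Fintype ι] [DecidableEq ι] (M : QOp ι) : Prop :=
  IsGateWithin Finset.univ M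

/-- The operator of a circuit, given as the list of its gates; the head of the list is applied first. -/
def circuitOp {ι : Type} [Fintype ι] [DecidableEq ι] (c : List (QOp ι)) : QOp ι :=
  c.reverse.prod

/-- The state vector `|0…0⟩`. -/
def ketZero (ι : Type) [Fintype ι] [DecidableEq ι] : Bits ι → ℂ :=
  Pi.single (fun _ => 0) 1

/-! ### Local Hamiltonians -/

/-- A Hamiltonian on `n` qubits given as a sum of `N` Hermitian terms, each of which acts on at most
`ℓ` qubits. -/
structure LocalHamiltonian (n N ℓ : ℕ) where
  term : Fin N → QOp (Fin n)
  supp : Fin N → Finset (Fin n)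
  isHermitian : ∀ i, (term i).IsHermitian
  actsOn : ∀ i, ActsOn (supp i) (term i)
  card_le : ∀ i, (supp i).card ≤ ℓ

/-- The Hamiltonian itself, the sum of its terms. -/
def LocalHamiltonian.op {n N ℓ : ℕ} (h : LocalHamiltonian n N ℓ) : QOp (Fin n) :=
  ∑ i, h.term i

/-- The operator norm (with respect to the Euclidean norm of the state space). -/
def opNorm {n : ℕ} (M : QOp (Fin n)) : ℝ :=
  ‖Matrix.toEuclideanCLM (n := Bits (Fin n)) (𝕜 := ℂ) M‖

/-- The local propagator `e^{-i k H_l / M}` of the first-order product formula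
`(∏_l e^{-i k H_l / M})^M` for `e^{-i k H}`. -/
def LocalHamiltonian.propagator {n N ℓ : ℕ} (h : LocalHamiltonian n N ℓ) (M k : ℕ) (l : Fin N) :
    QOp (Fin n) :=
  NormedSpace.exp ((-(Complex.I * (k : ℂ) / (M : ℂ))) • h.term l)

/-! ### The Hadamard test

The `n`-qubit register is labelled by `Fin n`, and the register together with the ancilla by
`Option (Fin n)`; the ancilla is `none`. -/

/-- The restriction of a basis state of register and ancilla to the register. -/
def regBits {n : ℕ} (x : Bits (Option (Fin n))) : Bits (Fin n) := fun i => x (some i)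

/-- `1 ⊗ G`: the operator `G` on the register. -/
def onRegister {n : ℕ} (G : QOp (Fin n)) : QOp (Option (Fin n)) :=
  Matrix.of fun x y => if x none = y none then G (regBits x) (regBits y) else 0

/-- `u ⊗ 1`: the one-qubit operator `u` on the ancilla. -/
def onAncilla {n : ℕ} (u : Matrix (Fin 2) (Fin 2) ℂ) : QOp (Option (Fin n)) :=
  Matrix.of fun x y => if regBits x = regBits y then u (x none) (y none) else 0

/-- `|0⟩⟨0| ⊗ 1 + |1⟩⟨1| ⊗ G`: the operator `G` on the register, controlled by the ancilla. -/
def controlled {n : ℕ} (G : QOp (Fin n)) : QOp (Option (Fin n)) :=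
  Matrix.of fun x y =>
    if x none = y none then
      (if x none = 1 then G (regBits x) (regBits y) else if regBits x = regBits y then 1 else 0)
    else 0

/-- The Hadamard gate. -/
def hadamardMat : Matrix (Fin 2) (Fin 2) ℂ :=
  ((Real.sqrt 2 : ℝ) : ℂ)⁻¹ • !![1, 1; 1, -1]

/-- The rotation `e^{-i θ Z / 2}`. -/
def rotZMat (θ : ℝ) : Matrix (Fin 2) (Fin 2) ℂ :=
  !![Complex.exp (-(Complex.I * θ / 2)), 0; 0, Complex.exp (Complex.I * θ / 2)]

/-- The circuit `B` implements the gate `G`, acting on the qubits in `A` and controlled by the ancilla,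
by one- and two-qubit gates on the ancilla and the qubits in `A`. -/
def CompilesControlled {n : ℕ} (A : Finset (Fin n)) (G : QOp (Fin n))
    (B : List (QOp (Option (Fin n)))) : Prop :=
  (∀ g ∈ B, IsGateWithin (Finset.insertNone A) g) ∧ circuitOp B = controlled G

/-- The Hadamard test circuit: prepare the input state on the register, bring the ancilla into
`|+⟩`, apply `M` rounds of the controlled propagators (`blk l` is the circuit for the controlled
propagator of the `l`-th term), rotate the ancilla by `θ`, apply a Hadamard gate to the ancilla.
Afterwards the ancilla is measured. -/
def hadamardTest {n N : ℕ} (prep : List (QOp (Fin n))) (M : ℕ)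
    (blk : Fin N → List (QOp (Option (Fin n)))) (θ : ℝ) : List (QOp (Option (Fin n))) :=
  prep.map onRegister ++ [onAncilla hadamardMat]
    ++ (List.replicate M (List.ofFn blk).flatten).flatten
    ++ [onAncilla (rotZMat θ), onAncilla hadamardMat]

/-- The probability (Born rule) that the measurement of the ancilla gives `b` after the circuit `c`
has been applied to `|0…0⟩`. -/
def bornProb {n : ℕ} (c : List (QOp (Option (Fin n)))) (b : Fin 2) : ℝ :=
  ∑ x : Bits (Option (Fin n)), if x none = b then ‖(circuitOp c *ᵥ ketZero _) x‖ ^ 2 else 0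

/-- The law of the measured bit. -/
def outcomeLaw {n : ℕ} (c : List (QOp (Option (Fin n)))) : MeasureTheory.Measure (Fin 2) :=
  ∑ b : Fin 2, ENNReal.ofReal (bornProb c b) • MeasureTheory.Measure.dirac b

/-- The two angles of the Hadamard test, for the real and for the imaginary part. -/
def testAngle : Fin 2 → ℝ := ![0, π / 2]

/-- The runs of the experiment: a time `k ∈ {0, …, 2L}`, an angle, and a repetition. -/
abbrev Run (L R : ℕ) : Type := Fin (2 * L + 1) × Fin 2 × Fin R

/-- The circuit that is executed in a run; `blk k l` is the circuit for the controlled propagator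
of the `l`-th term at time `k`. -/
def runCircuit {n N L R : ℕ} (prep : List (QOp (Fin n))) (M : ℕ)
    (blk : Fin (2 * L + 1) → Fin N → List (QOp (Option (Fin n)))) (ρ : Run L R) :
    List (QOp (Option (Fin n))) :=
  hadamardTest prep M (blk ρ.1) (testAngle ρ.2.1)

/-- The joint law of the measured bits of all runs, which are independent. -/
def experimentLaw {n N L R : ℕ} (prep : List (QOp (Fin n))) (M : ℕ)
    (blk : Fin (2 * L + 1) → Fin N → List (QOp (Option (Fin n)))) :
    MeasureTheory.Measure (Run L R → Fin 2) :=
  MeasureTheory.Measure.pi fun ρ => outcomeLaw (runCircuit prep M blk ρ)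

/-- The fraction of the repetitions with time `k` and angle number `t` that gave the outcome `0`. -/
def zeroFreq {L R : ℕ} (ω : Run L R → Fin 2) (k : Fin (2 * L + 1)) (t : Fin 2) : ℝ :=
  ((Finset.univ.filter fun r : Fin R => ω (k, t, r) = 0).card : ℝ) / (R : ℝ)

/-- The estimate of the signal `⟨Φ|e^{-iHk}|Φ⟩` obtained from the measured bits. -/
def estSignal {L R : ℕ} (ω : Run L R → Fin 2) (k : Fin (2 * L + 1)) : ℂ :=
  ((2 * zeroFreq ω k 0 - 1 : ℝ) : ℂ) - Complex.I * ((2 * zeroFreq ω k 1 - 1 : ℝ) : ℂ)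

/-! ### ESPRIT -/

/-- The square Hankel matrix of a signal `y(0), …, y(2L)`. -/
def hankel {L : ℕ} (y : Fin (2 * L + 1) → ℂ) : Matrix (Fin (L + 1)) (Fin (L + 1)) ℂ :=
  Matrix.of fun i j => y ⟨i.val + j.val, by have := i.isLt; have := j.isLt; omega⟩

/-- `A = U Σ W†` is a singular value decomposition, with singular values in decreasing order. -/
def IsSVD {m : ℕ} (A U : Matrix (Fin m) (Fin m) ℂ) (σ : Fin m → ℝ) (W : Matrix (Fin m) (Fin m) ℂ) :
    Prop :=
  U ∈ Matrix.unitaryGroup (Fin m) ℂ ∧ W ∈ Matrix.unitaryGroup (Fin m) ℂ ∧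
    (∀ i, 0 ≤ σ i) ∧ Antitone σ ∧ A = U * Matrix.diagonal (fun i => (σ i : ℂ)) * Wᴴ

/-- `X` is the Moore–Penrose inverse of `A`. -/
def IsMoorePenrose {m n : ℕ} (A : Matrix (Fin m) (Fin n) ℂ) (X : Matrix (Fin n) (Fin m) ℂ) : Prop :=
  A * X * A = A ∧ X * A * X = X ∧ (A * X).IsHermitian ∧ (X * A).IsHermitian

/-- `Et` is a list of energy estimates returned by ESPRIT for the signal `y(0), …, y(2L)` and `S`
components: with the first `S` left singular vectors of the Hankel matrix, and `U₀`, `U₁` their first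
and last `L` rows, the eigenvalues (with multiplicity) of `U₀⁺ U₁` have the phases `e^{-i Et j}`. -/
def IsEspritOutput {S L : ℕ} (hS : S ≤ L) (y : Fin (2 * L + 1) → ℂ) (Et : Fin S → ℝ) : Prop :=
  ∃ (U W : Matrix (Fin (L + 1)) (Fin (L + 1)) ℂ) (σ : Fin (L + 1) → ℝ)
    (U₀ U₁ : Matrix (Fin L) (Fin S) ℂ) (X : Matrix (Fin S) (Fin L) ℂ) (z : Fin S → ℂ),
    IsSVD (hankel y) U σ W ∧
    (∀ i j, U₀ i j = U i.castSucc (Fin.castLE (Nat.le_succ_of_le hS) j)) ∧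
    (∀ i j, U₁ i j = U i.succ (Fin.castLE (Nat.le_succ_of_le hS) j)) ∧
    IsMoorePenrose U₀ X ∧
    (X * U₁).charpoly.roots = Finset.univ.val.map z ∧
    ∀ j, 0 ≤ Et j ∧ Et j < 2 * π ∧ z j = (‖z j‖ : ℂ) * Complex.exp (-(Complex.I * (Et j : ℂ)))

/-- The distance of two energies modulo `2π`, in units of `2π`:
`(1 / 2π) min_{m ∈ ℤ} |a - b - 2π m|`. -/
def circDist (a b : ℝ) : ℝ := ‖((a - b : ℝ) : AddCircle (2 * π))‖ / (2 * π)

/-- The optimal matching distance of two lists of energies, modulo `2π` and in units of `2π`. -/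
def matchingDist {S : ℕ} (E E' : Fin S → ℝ) : ℝ :=
  ⨅ p : Equiv.Perm (Fin S), ⨆ j, circDist (E' (p j)) (E j)

/-! ### Classical computation

A random access machine on integer arrays, programmed with assignments, conditionals and bounded
loops; every step is charged by the lengths of the binary representations of the numbers involved. -/

/-- The memory: infinitely many arrays of integers. -/
abbrev Store : Type := ℕ → ℤ → ℤ

/-- Length of the binary representation of an integer. -/
def bitLen (z : ℤ) : ℕ := Nat.size z.natAbs

/-- Integer expressions; `get a i` is the entry of array `a` at index `i`, `div` is division with
remainder. -/
inductive IExpr : Type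
  | const (z : ℤ) : IExpr
  | get (a : ℕ) (i : IExpr) : IExpr
  | add (e f : IExpr) : IExpr
  | sub (e f : IExpr) : IExpr
  | mul (e f : IExpr) : IExpr
  | div (e f : IExpr) : IExpr

/-- The value of an expression. -/
def IExpr.eval (s : Store) : IExpr → ℤ
  | .const z => z
  | .get a i => s a (i.eval s)
  | .add e f => e.eval s + f.eval s
  | .sub e f => e.eval s - f.eval s
  | .mul e f => e.eval s * f.eval s
  | .div e f => e.eval s / f.eval s

/-- The number of bit operations for the evaluation of an expression. -/
def IExpr.cost (s : Store) : IExpr → ℕ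
  | .const z => 1 + bitLen z
  | .get a i => i.cost s + 1 + bitLen (i.eval s) + bitLen (s a (i.eval s))
  | .add e f => e.cost s + f.cost s + 1 + bitLen (e.eval s) + bitLen (f.eval s)
  | .sub e f => e.cost s + f.cost s + 1 + bitLen (e.eval s) + bitLen (f.eval s)
  | .mul e f => e.cost s + f.cost s + (1 + bitLen (e.eval s)) * (1 + bitLen (f.eval s))
  | .div e f => e.cost s + f.cost s + (1 + bitLen (e.eval s)) * (1 + bitLen (f.eval s))

/-- Programs: `set a i e` writes `e` to entry `i` of array `a`; `ite e c d` executes `c` if `0 < e`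
and `d` otherwise; `loop e c` evaluates `e` once and then executes `c` that many times. -/
inductive Program : Type
  | skip : Program
  | set (a : ℕ) (i e : IExpr) : Program
  | seq (c d : Program) : Program
  | ite (e : IExpr) (c d : Program) : Program
  | loop (e : IExpr) (c : Program) : Program

/-- The memory after the execution of a program, and the number of bit operations. -/
def Program.exec : Program → Store → Store × ℕ
  | .skip, s => (s, 1)
  | .set a i e, s =>
      (Function.update s a (Function.update (s a) (i.eval s) (e.eval s)),
        i.cost s + e.cost s + 1 + bitLen (i.eval s) + bitLen (e.eval s))
  | .seq c d, s => ((d.exec (c.exec s).1).1, (c.exec s).2 + (d.exec (c.exec s).1).2)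
  | .ite e c d, s =>
      if 0 < e.eval s then ((c.exec s).1, e.cost s + 1 + (c.exec s).2)
      else ((d.exec s).1, e.cost s + 1 + (d.exec s).2)
  | .loop e c, s =>
      (fun p : Store × ℕ => ((c.exec p.1).1, p.2 + 1 + (c.exec p.1).2))^[(e.eval s).toNat]
        (s, e.cost s + 1)

/-- The input of the classical post-processing: array `0` holds `n`, `S`, `K = 2L` and the number
`R` of repetitions, array `1` holds the measured bits, in lexicographic order of the runs. -/
def inputStore {L R : ℕ} (n S : ℕ) (ω : Run L R → Fin 2) : Store := fun a i =>
  if a = 0 then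
    (if i = 0 then (n : ℤ) else if i = 1 then (S : ℤ) else if i = 2 then ((2 * L : ℕ) : ℤ)
      else if i = 3 then (R : ℤ) else 0)
  else if a = 1 then
    ∑ ρ : Run L R, if i = (((ρ.1.val * 2 + ρ.2.1.val) * R + ρ.2.2.val : ℕ) : ℤ)
      then ((ω ρ).val : ℤ) else 0
  else 0

/-- The memory `s` holds the list `Eh` of energies in `[0, 2π)`, as rational multiples of `2π`: the
numerators in array `2`, the common denominator in entry `0` of array `3`. -/
def HoldsEnergies {S : ℕ} (s : Store) (Eh : Fin S → ℝ) : Prop :=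
  0 < s 3 0 ∧ ∀ j : Fin S, 0 ≤ s 2 (j.val : ℤ) ∧ s 2 (j.val : ℤ) < s 3 0 ∧
    Eh j = 2 * π * ((s 2 (j.val : ℤ) : ℝ) / (s 3 0 : ℝ))

end

/-! ### Distances on the circle of energies -/

section Circle

/-! Put p_j = |a_j|², K = 2L and z_j = e^{-iE_j}. The measured data approximate the exponential sum
f(k) = ∑ p_j z_j^k, and all estimates rest on one inequality of Ingham type,
`sum_sq_norm_le_exponential_sum`: if the energies are separated by 1/m of the circle, the
Vandermonde matrix V with m rows satisfies ‖Vc‖ ≥ ‖c‖. To prove it, weight the samples by a sine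
window. Its Fourier transform is a difference of two cosecants, so sums of off-diagonal entries
telescope and stay below the diagonal entry minus 1. Because C > 2, the separation is at least 1/L,
hence the inequality is available for L, L + 1, 2L and 2L + 1 rows.

Data. The real and the imaginary part of ⟨Φ|W|Φ⟩, with W the Trotter product, are read off the
Hadamard test (`bornProb_hadamardTest`). The Trotter error is O(1/M) because all factors are
contractions (`norm_prod_exp_pow_sub_le`), the statistical error is controlled by Hoeffding's
inequality and a union bound (`experiment_concentration`). So every y(k) is within an inverse
polynomial η of f(k), except with probability 2^(-d). What follows is deterministic.

ESPRIT. The Hankel matrix is V P Vᵀ plus a small error, with P the diagonal matrix of the weights.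
Its S-th singular value is bounded below by min-max, so the first S left singular vectors have the
form V G + F with F small (`exists_subspace_decomposition`). As V with its first row removed is V
with its last row removed times diag(z), the matrix U₀⁺U₁ is similar to diag(z) plus a small matrix
(`shift_invariance_perturbation`), and the eigenvalues of such a matrix correspond one to one to the
z_j (`exists_perm_of_perturbed_diagonal`).

Classical program. It does not compute a singular value decomposition. With m = 2L + 1 and the
Toeplitz matrix T = V P V†, the matrix 1 - T/m fixes the orthogonal complement of the range of V and
contracts the range. So (1 - T/m)^N v(θ), for the vector v(θ) = (e^{-iaθ})_a, is short when θ is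
extremely close to an energy, and if it is short then θ is close to an energy
(`lt_four_of_abs_sub_le`, `exists_circDist_le_of_lt`). The program evaluates this test on a grid of
rational points of the circle, in Gaussian integers modulo a power of two that exceeds all numbers
to be compared, and picks one grid point from each cluster of points that pass
(`IsSelection.exists_energies`). The picked points and the output of ESPRIT are both close to the
true energies, hence to each other; the rounding behaviour of ESPRIT is never analysed.

Effort. The machine's numbers stay below the modulus and loop lengths are read from an array that
the main part never changes, which gives a polynomial running time
(`Program.Clamped.exists_cost_bound`). A controlled propagator is the exponential of a Hermitian
operator on at most ℓ + 1 qubits; diagonalizing it and treating each eigenvector as a rank-one phase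
compiles it exactly with a number of gates that depends on ℓ only (`exists_compilesControlled`). -/

theorem circDist_mul_two_pi_le (a b : ℝ) (n : ℤ) : circDist a b * (2 * π) ≤ |a - b - 2 * π * n| := by
  have hp : (0 : ℝ) < 2 * π := by positivity
  unfold circDist
  rw [div_mul_cancel₀ _ hp.ne']
  rw [AddCircle.norm_eq' _ hp]
  have h := round_le ((2 * π)⁻¹ * (a - b)) n
  calc 2 * π * |(2 * π)⁻¹ * (a - b) - round ((2 * π)⁻¹ * (a - b))|
      ≤ 2 * π * |(2 * π)⁻¹ * (a - b) - n| := by gcongr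
    _ = |a - b - 2 * π * n| := by
      rw [← abs_of_pos hp, ← abs_mul, abs_of_pos hp]
      congr 1; field_simp

theorem exists_circDist_eq (a b : ℝ) : ∃ n : ℤ, circDist a b * (2 * π) = |a - b - 2 * π * n| := by
  have hp : (0 : ℝ) < 2 * π := by positivity
  refine ⟨round ((2 * π)⁻¹ * (a - b)), ?_⟩
  unfold circDist
  rw [div_mul_cancel₀ _ hp.ne', AddCircle.norm_eq]
  congr 1; ring

theorem circDist_nonneg (a b : ℝ) : 0 ≤ circDist a b := by unfold circDist; positivity

theorem circDist_le_half (a b : ℝ) : circDist a b ≤ 1 / 2 := by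
  have hp : (0 : ℝ) < 2 * π := by positivity
  unfold circDist
  rw [div_le_iff₀ hp]
  have := AddCircle.norm_le_half_period (2 * π) (x := ((a - b : ℝ) : AddCircle (2 * π))) hp.ne'
  rw [abs_of_pos hp] at this
  linarith

theorem circDist_comm (a b : ℝ) : circDist a b = circDist b a := by
  unfold circDist
  rw [← norm_neg, ← AddCircle.coe_neg, neg_sub]

theorem circDist_triangle (a b c : ℝ) : circDist a c ≤ circDist a b + circDist b c := by
  unfold circDist
  rw [← add_div]
  have : ((a - c : ℝ) : AddCircle (2 * π)) = ((a - b : ℝ) : AddCircle (2 * π)) + ((b - c : ℝ) : AddCircle (2 * π)) := by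
    rw [← AddCircle.coe_add]; congr 1; ring
  rw [this]
  have := norm_add_le ((a - b : ℝ) : AddCircle (2 * π)) ((b - c : ℝ) : AddCircle (2 * π))
  gcongr

end Circle

/-! ### The sine window, its Fourier transform, and Ingham's inequality -/

section Window

/-- `1 / sin t` on `(0, π/2]`, continued by the constant `1`. -/
noncomputable def cosecCut (t : ℝ) : ℝ := 1 / Real.sin (min t (π / 2))

theorem cosecCut_antitone {s t : ℝ} (hs : 0 < s) (hst : s ≤ t) : cosecCut t ≤ cosecCut s := by
  unfold cosecCut
  have hpi := Real.pi_pos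
  have h0 : 0 < min s (π / 2) := lt_min hs (by positivity)
  apply one_div_le_one_div_of_le
  · exact Real.sin_pos_of_pos_of_lt_pi h0 (by have := min_le_right s (π / 2); linarith)
  · apply Real.sin_le_sin_of_le_of_le_pi_div_two
    · linarith
    · exact min_le_right _ _
    · exact min_le_min_right _ hst

theorem one_le_cosecCut {t : ℝ} (ht : 0 < t) : 1 ≤ cosecCut t := by
  unfold cosecCut
  have h0 : 0 < min t (π / 2) := lt_min ht (by positivity)
  rw [le_div_iff₀]
  · have := Real.sin_le_one (min t (π / 2)); linarith
  · exact Real.sin_pos_of_pos_of_lt_pi h0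
      (by have := min_le_right t (π / 2); linarith [Real.pi_pos])

/-- The intervals of half-width x about the points u i do not overlap and lie between x and b + x. A
decreasing function loses on disjoint intervals at most what it loses altogether. -/
theorem sum_cosecCut_le {ι : Type*} [DecidableEq ι] (u : ι → ℝ) {x : ℝ} (hx : 0 < x)
    (T : Finset ι) : ∀ b : ℝ, 0 ≤ b → (∀ i ∈ T, u i ≤ b) → (∀ i ∈ T, 2 * x ≤ u i) →
    (∀ i ∈ T, ∀ j ∈ T, i ≠ j → 2 * x ≤ |u i - u j|) →
    ∑ i ∈ T, (cosecCut (u i - x) - cosecCut (u i + x)) ≤ cosecCut x - cosecCut (b + x) := by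
  induction T using Finset.induction_on_max_value u with
  | empty =>
    intro b hb _ _ _
    simp only [Finset.sum_empty, sub_nonneg]
    exact cosecCut_antitone hx (by linarith)
  | insert a s ha hmax ih =>
    intro b hb hle hge hsep
    rw [Finset.sum_insert ha]
    have hua := hge a (Finset.mem_insert_self _ _)
    -- `u a` is the largest point, so all others are at most u a - 2x and their intervals end where
    -- the interval about `u a` begins.
    have h1 := ih (u a - 2 * x) (by linarith) (fun i hi => by
        have h2 := hsep a (Finset.mem_insert_self _ _) i (Finset.mem_insert_of_mem hi)
          (fun h => ha (h ▸ hi))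
        have h3 := hmax i hi
        rw [abs_of_nonneg (by linarith)] at h2
        linarith)
      (fun i hi => hge i (Finset.mem_insert_of_mem hi))
      (fun i hi j hj => hsep i (Finset.mem_insert_of_mem hi) j (Finset.mem_insert_of_mem hj))
    have h2 : u a - 2 * x + x = u a - x := by ring
    rw [h2] at h1
    have h3 : cosecCut (b + x) ≤ cosecCut (u a + x) :=
      cosecCut_antitone (by linarith) (by linarith [hle a (Finset.mem_insert_self _ _)])
    linarith

/-- The Fourier transform of the sine window of length `m`. -/
noncomputable def windowKernel (m : ℕ) (φ : ℝ) : ℂ :=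
  ∑ k ∈ Finset.range m, (Real.sin (π / (2 * m) * (2 * k + 1)) : ℂ) *
    Complex.exp (-(Complex.I * φ)) ^ k

/-- Writing the sine as a difference of exponentials gives two geometric series with ratios
e^{±iπ/m} e^{-iφ}. The window is a half period of the sine, so both have the same numerator up to
sign, and what remains is a difference of two cosecants. -/
theorem windowKernel_eq {m : ℕ} (hm : 0 < m) (φ : ℝ)
    (h1 : Real.sin (φ / 2 - π / (2 * m)) ≠ 0) (h2 : Real.sin (φ / 2 + π / (2 * m)) ≠ 0) :
    windowKernel m φ = (1 / 4) * (1 + Complex.exp (-(Complex.I * φ)) ^ m) *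
      Complex.exp (Complex.I * (φ / 2 : ℝ)) *
      ((1 / Real.sin (φ / 2 + π / (2 * m)) - 1 / Real.sin (φ / 2 - π / (2 * m)) : ℝ) : ℂ) := by
  set x : ℝ := π / (2 * m) with hx
  set u : ℝ := φ / 2 with hu
  set a : ℂ := Complex.exp (Complex.I * x) with ha
  set b : ℂ := Complex.exp (Complex.I * u) with hb
  have ha0 : a ≠ 0 := Complex.exp_ne_zero _
  have hb0 : b ≠ 0 := Complex.exp_ne_zero _
  have hφ : Complex.exp (-(Complex.I * φ)) = (b ^ 2)⁻¹ := by
    rw [hb, ← Complex.exp_nat_mul, ← Complex.exp_neg]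
    congr 1; rw [hu]; push_cast; ring
  have hsin : ∀ t : ℝ, (Real.sin t : ℂ) =
      (Complex.exp (Complex.I * t) - (Complex.exp (Complex.I * t))⁻¹) / (2 * Complex.I) := by
    intro t
    rw [← Complex.exp_neg, Complex.ofReal_sin, Complex.sin]
    rw [div_eq_div_iff (by norm_num) (by simp)]
    have e1 : -(t : ℂ) * Complex.I = -(Complex.I * t) := by ring
    have e2 : (t : ℂ) * Complex.I = (Complex.I * t) := by ring
    rw [e1, e2]
    linear_combination (2 * (Complex.exp (-(Complex.I * t)) - Complex.exp (Complex.I * t))) * Complex.I_sq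
  -- The reason for the choice x = π / (2m): the m-th power of e^{2ix} is -1.
  have ham : (a ^ 2) ^ m = -1 := by
    rw [ha, ← Complex.exp_nat_mul, ← Complex.exp_nat_mul]
    rw [show ((m : ℕ) : ℂ) * (((2 : ℕ) : ℂ) * (Complex.I * x)) = π * Complex.I by
      have : (m : ℂ) ≠ 0 := by exact_mod_cast hm.ne'
      rw [hx]; push_cast; field_simp]
    exact Complex.exp_pi_mul_I
  have hexpadd : Complex.exp (Complex.I * ((u + x : ℝ) : ℂ)) = b * a := by
    rw [hb, ha, ← Complex.exp_add]; congr 1; push_cast; ring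
  have hexpsub : Complex.exp (Complex.I * ((u - x : ℝ) : ℂ)) = b * a⁻¹ := by
    rw [hb, ha, ← Complex.exp_neg, ← Complex.exp_add]; congr 1; push_cast; ring
  have hk : ∀ k : ℕ, (Real.sin (x * (2 * k + 1)) : ℂ) =
      (a * (a ^ 2) ^ k - a⁻¹ * ((a ^ 2)⁻¹) ^ k) / (2 * Complex.I) := by
    intro k
    rw [hsin]
    have : Complex.exp (Complex.I * ((x * (2 * k + 1) : ℝ) : ℂ)) = a * (a ^ 2) ^ k := by
      rw [ha, ← Complex.exp_nat_mul, ← Complex.exp_nat_mul, ← Complex.exp_add]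
      congr 1; push_cast; ring
    rw [this, mul_inv, inv_pow]
  have hs1 : (Real.sin (u - x) : ℂ) ≠ 0 := by exact_mod_cast h1
  have hs2 : (Real.sin (u + x) : ℂ) ≠ 0 := by exact_mod_cast h2
  rw [hsin, hexpsub] at hs1
  rw [hsin, hexpadd] at hs2
  have hI : (2 * Complex.I) ≠ 0 := by simp
  have hd1 : b * a⁻¹ - (b * a⁻¹)⁻¹ ≠ 0 := fun h => hs1 (by rw [h, zero_div])
  have hd2 : b * a - (b * a)⁻¹ ≠ 0 := fun h => hs2 (by rw [h, zero_div])
  have hq1 : b ^ 2 - a ^ 2 ≠ 0 := by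
    intro h; apply hd1; field_simp; linear_combination h
  have hq2 : a ^ 2 * b ^ 2 - 1 ≠ 0 := by
    intro h; apply hd2; field_simp; linear_combination h
  unfold windowKernel
  rw [← hx, hφ, Complex.ofReal_sub, Complex.ofReal_div, Complex.ofReal_div, Complex.ofReal_one, hsin,
    hsin, hexpadd, hexpsub]
  have hsum : ∀ k : ℕ, (Real.sin (x * (2 * k + 1)) : ℂ) * (b ^ 2)⁻¹ ^ k =
      a / (2 * Complex.I) * (a ^ 2 * (b ^ 2)⁻¹) ^ k
        - a⁻¹ / (2 * Complex.I) * ((a ^ 2)⁻¹ * (b ^ 2)⁻¹) ^ k := by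
    intro k; rw [hk, mul_pow, mul_pow]; ring
  simp_rw [hsum]
  rw [Finset.sum_sub_distrib, ← Finset.mul_sum, ← Finset.mul_sum, geom_sum_eq, geom_sum_eq]
  · rw [mul_pow, mul_pow, ham, inv_pow (a ^ 2), ham]
    generalize ((b ^ 2)⁻¹) ^ m = e
    have hI2 := Complex.I_sq
    have hq1' : a ^ 2 - b ^ 2 ≠ 0 := fun h => hq1 (by linear_combination -h)
    have hq2' : 1 - a ^ 2 * b ^ 2 ≠ 0 := fun h => hq2 (by linear_combination -h)
    have hq3' : 1 - b ^ 2 * a ^ 2 ≠ 0 := fun h => hq2 (by linear_combination -h)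
    have hq4' : b ^ 2 * a ^ 2 - 1 ≠ 0 := fun h => hq2 (by linear_combination h)
    have e1 : a ^ 2 * (b ^ 2)⁻¹ - 1 = (a ^ 2 - b ^ 2) / b ^ 2 := by field_simp
    have e2 : (a ^ 2)⁻¹ * (b ^ 2)⁻¹ - 1 = (1 - a ^ 2 * b ^ 2) / (a ^ 2 * b ^ 2) := by field_simp
    have e3 : b * a - (b * a)⁻¹ = (a ^ 2 * b ^ 2 - 1) / (b * a) := by field_simp
    have e4 : b * a⁻¹ - (b * a⁻¹)⁻¹ = (b ^ 2 - a ^ 2) / (b * a) := by field_simp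
    rw [e1, e2, e3, e4]
    field_simp
    rw [Complex.I_sq]; ring
  · intro h; apply hq2; field_simp at h; linear_combination -h
  · intro h; apply hq1; field_simp at h; linear_combination -h

theorem windowKernel_zero {m : ℕ} (hm : 0 < m) :
    windowKernel m 0 = ((1 / Real.sin (π / (2 * m)) : ℝ) : ℂ) := by
  have hx : 0 < Real.sin (π / (2 * m)) := by
    apply Real.sin_pos_of_pos_of_lt_pi
    · positivity
    · rw [div_lt_iff₀ (by positivity)]
      have : (1 : ℝ) ≤ m := by exact_mod_cast hm
      nlinarith [Real.pi_pos]
  rw [windowKernel_eq hm]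
  · simp only [Complex.ofReal_zero, mul_zero, neg_zero, Complex.exp_zero, one_pow, zero_div,
      zero_sub, zero_add, Real.sin_neg]
    push_cast
    ring
  · rw [zero_div, zero_sub, Real.sin_neg]; exact neg_ne_zero.mpr hx.ne'
  · rw [zero_div, zero_add]; exact hx.ne'

/-- Past π/2 the cosecant would grow again and the telescoping sum would fail. Cutting it there only
makes the subtracted term smaller, so the bound remains valid and is the decrement of a decreasing
function. -/
theorem norm_windowKernel_le {m : ℕ} (hm : 0 < m) {φ : ℝ} (hφ : |φ| ≤ π)
    (hφ' : 2 * (2 * (π / (2 * m))) ≤ |φ|) :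
    ‖windowKernel m φ‖ ≤
      (cosecCut (|φ / 2| - π / (2 * m)) - cosecCut (|φ / 2| + π / (2 * m))) / 2 := by
  have hpi := Real.pi_pos
  have hx : 0 < π / (2 * m) := by positivity
  set x := π / (2 * m) with hxdef
  have habs : |φ / 2| = |φ| / 2 := by rw [abs_div]; norm_num
  set v := |φ / 2| with hv
  have hvx : 2 * x ≤ v := by rw [habs]; linarith
  have hvpi : v ≤ π / 2 := by rw [habs]; linarith
  have hs1 : 0 < Real.sin (v - x) := Real.sin_pos_of_pos_of_lt_pi (by linarith) (by linarith)
  have hs2 : 0 < Real.sin (v + x) := Real.sin_pos_of_pos_of_lt_pi (by linarith) (by linarith)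
  have hle : Real.sin (v - x) ≤ Real.sin (v + x) := by
    rw [Real.sin_sub, Real.sin_add]
    have := Real.cos_nonneg_of_neg_pi_div_two_le_of_le (x := v) (by linarith) hvpi
    have := Real.sin_nonneg_of_nonneg_of_le_pi (x := x) hx.le (by linarith)
    nlinarith
  have key : (Real.sin (φ / 2 - x) ≠ 0 ∧ Real.sin (φ / 2 + x) ≠ 0) ∧
      1 / Real.sin (φ / 2 + x) - 1 / Real.sin (φ / 2 - x)
        = 1 / Real.sin (v + x) - 1 / Real.sin (v - x) := by
    rcases abs_cases (φ / 2) with ⟨h, -⟩ | ⟨h, -⟩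
    · rw [← hv] at h; rw [← h]; exact ⟨⟨hs1.ne', hs2.ne'⟩, rfl⟩
    · rw [← hv] at h
      have h' : φ / 2 = -v := by linarith
      have e1 : Real.sin (-v - x) = - Real.sin (v + x) := by rw [← Real.sin_neg]; congr 1; ring
      have e2 : Real.sin (-v + x) = - Real.sin (v - x) := by rw [← Real.sin_neg]; congr 1; ring
      rw [h', e1, e2]
      refine ⟨⟨neg_ne_zero.mpr hs2.ne', neg_ne_zero.mpr hs1.ne'⟩, ?_⟩
      rw [one_div_neg_eq_neg_one_div, one_div_neg_eq_neg_one_div]; ring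
  have hinv : 1 / Real.sin (v + x) ≤ 1 / Real.sin (v - x) := one_div_le_one_div_of_le hs1 hle
  rw [windowKernel_eq hm φ key.1.1 key.1.2, key.2, norm_mul, norm_mul, norm_mul, Complex.norm_real,
    Real.norm_eq_abs, abs_of_nonpos (by linarith)]
  have n1 : ‖Complex.exp (Complex.I * ((φ / 2 : ℝ) : ℂ))‖ = 1 := by
    rw [mul_comm]; exact Complex.norm_exp_ofReal_mul_I _
  have n2 : ‖Complex.exp (-(Complex.I * φ))‖ = 1 := by
    rw [show -(Complex.I * (φ : ℂ)) = ((-φ : ℝ) : ℂ) * Complex.I by push_cast; ring]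
    exact Complex.norm_exp_ofReal_mul_I _
  have n3 : ‖1 + Complex.exp (-(Complex.I * φ)) ^ m‖ ≤ 2 := by
    refine (norm_add_le _ _).trans ?_
    rw [norm_pow, n2]; norm_num
  have c1 : cosecCut (v - x) = 1 / Real.sin (v - x) := by
    unfold cosecCut; rw [min_eq_left (by linarith)]
  have c2 : cosecCut (v + x) ≤ 1 / Real.sin (v + x) := by
    unfold cosecCut
    rcases le_total (v + x) (π / 2) with h | h
    · rw [min_eq_left h]
    · rw [min_eq_right h, Real.sin_pi_div_two]
      exact one_div_le_one_div_of_le hs2 (Real.sin_le_one _)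
  rw [n1, c1]
  have h4 : ‖(1 / 4 : ℂ)‖ = 1 / 4 := by norm_num
  rw [h4]
  have hd : 0 ≤ -(1 / Real.sin (v + x) - 1 / Real.sin (v - x)) := by linarith
  calc 1 / 4 * ‖1 + Complex.exp (-(Complex.I * φ)) ^ m‖ * 1 *
        -(1 / Real.sin (v + x) - 1 / Real.sin (v - x))
      ≤ 1 / 4 * 2 * 1 * -(1 / Real.sin (v + x) - 1 / Real.sin (v - x)) := by gcongr
    _ ≤ _ := by linarith

/-- Positive and negative angles are treated separately, each side contributing at most half of the
bound by `sum_cosecCut_le`. The right side is the value of the kernel at 0 minus 1; this 1 becomes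
the constant in Ingham's inequality. -/
theorem sum_norm_windowKernel_le {ι : Type*} [DecidableEq ι] {m : ℕ} (hm : 0 < m) (T : Finset ι)
    (φ : ι → ℝ) (hφ : ∀ i ∈ T, |φ i| ≤ π) (hφ' : ∀ i ∈ T, 2 * π / m ≤ |φ i|)
    (hsep : ∀ i ∈ T, ∀ j ∈ T, i ≠ j → 2 * π / m ≤ |φ i - φ j|) :
    ∑ i ∈ T, ‖windowKernel m (φ i)‖ ≤ 1 / Real.sin (π / (2 * m)) - 1 := by
  have hpi := Real.pi_pos
  have hx : 0 < π / (2 * m) := by positivity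
  have hx4 : 2 * π / m = 2 * (2 * (π / (2 * m))) := by field_simp
  rw [hx4] at hφ' hsep
  set x := π / (2 * m) with hxdef
  have hxle : x ≤ π / 2 := by
    rw [hxdef]
    apply div_le_div_of_nonneg_left hpi.le (by norm_num)
    have : (1 : ℝ) ≤ m := by exact_mod_cast hm
    linarith
  have hF : cosecCut x = 1 / Real.sin x := by unfold cosecCut; rw [min_eq_left hxle]
  have half : ∀ (T' : Finset ι) (σ : ℝ), T' ⊆ T → |σ| = 1 → (∀ i ∈ T', |φ i / 2| = σ * (φ i / 2)) →
      ∑ i ∈ T', ‖windowKernel m (φ i)‖ ≤ (1 / Real.sin x - 1) / 2 := by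
    intro T' σ hT' hσ hsgn
    calc ∑ i ∈ T', ‖windowKernel m (φ i)‖
        ≤ ∑ i ∈ T', (cosecCut (σ * (φ i / 2) - x) - cosecCut (σ * (φ i / 2) + x)) / 2 := by
          apply Finset.sum_le_sum
          intro i hi
          rw [← hsgn i hi]
          exact norm_windowKernel_le hm (hφ i (hT' hi)) (hφ' i (hT' hi))
      _ = (∑ i ∈ T', (cosecCut (σ * (φ i / 2) - x) - cosecCut (σ * (φ i / 2) + x))) / 2 := by
          rw [Finset.sum_div]
      _ ≤ (cosecCut x - cosecCut (π / 2 + x)) / 2 := by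
          gcongr
          apply sum_cosecCut_le (fun i => σ * (φ i / 2)) hx T' (π / 2) (by positivity)
          · intro i hi
            have := hφ i (hT' hi)
            rw [← hsgn i hi, abs_div]; norm_num; linarith
          · intro i hi
            have := hφ' i (hT' hi)
            rw [← hsgn i hi, abs_div]; norm_num; linarith
          · intro i hi j hj hij
            have := hsep i (hT' hi) j (hT' hj) hij
            rw [← mul_sub, abs_mul, hσ, ← sub_div, abs_div]; norm_num; linarith
      _ ≤ _ := by
          rw [hF]
          have := one_le_cosecCut (t := π / 2 + x) (by positivity)
          linarith
  rw [← Finset.sum_filter_add_sum_filter_not T (fun i => 0 ≤ φ i)]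
  have h1 := half (T.filter (fun i => 0 ≤ φ i)) 1 (Finset.filter_subset _ _) (by norm_num)
    (by intro i hi
        rw [Finset.mem_filter] at hi
        rw [abs_of_nonneg (by linarith [hi.2]), one_mul])
  have h2 := half (T.filter (fun i => ¬ 0 ≤ φ i)) (-1) (Finset.filter_subset _ _) (by norm_num)
    (by intro i hi
        rw [Finset.mem_filter] at hi
        rw [abs_of_nonpos (by linarith [hi.2])]; ring)
  linarith

end Window

/-- Ingham's inequality in the discrete setting: exponential sums with frequencies separated by at
least the reciprocal of the number of samples. -/
theorem sum_sq_norm_le_exponential_sum {ι : Type*} [Fintype ι] [DecidableEq ι] {m : ℕ} (hm : 0 < m)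
    (θ : ι → ℝ) (hsep : ∀ i j, i ≠ j → 1 / (m : ℝ) ≤ circDist (θ i) (θ j)) (c : ι → ℂ) :
    ∑ i, ‖c i‖ ^ 2 ≤
      ∑ k ∈ Finset.range m, ‖∑ j, c j * Complex.exp (-(Complex.I * θ j)) ^ k‖ ^ 2 := by
  have hpi := Real.pi_pos
  choose n hn using fun i j => exists_circDist_eq (θ i) (θ j)
  set φ : ι → ι → ℝ := fun i j => θ i - θ j - 2 * π * n i j with hφ
  -- The representatives φ i j lie in [-π, π]. For fixed i two of them differ by a representative of
  -- θ k - θ j, so the separation on the circle carries over to the line.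
  have hrow : ∀ i, ∑ j ∈ Finset.univ.erase i, ‖windowKernel m (φ i j)‖
      ≤ 1 / Real.sin (π / (2 * m)) - 1 := by
    intro i
    apply sum_norm_windowKernel_le hm
    · intro j _
      have := circDist_le_half (θ i) (θ j)
      show |θ i - θ j - 2 * π * n i j| ≤ π
      rw [← hn]; nlinarith
    · intro j hj
      have := hsep i j (Finset.ne_of_mem_erase hj).symm
      show _ ≤ |θ i - θ j - 2 * π * n i j|
      rw [← hn]
      calc 2 * π / m = 1 / m * (2 * π) := by ring
        _ ≤ _ := by gcongr
    · intro j _ k _ hjk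
      have := hsep k j hjk.symm
      have h2 := circDist_mul_two_pi_le (θ k) (θ j) (n i j - n i k)
      calc 2 * π / m = 1 / m * (2 * π) := by ring
        _ ≤ circDist (θ k) (θ j) * (2 * π) := by gcongr
        _ ≤ _ := h2
        _ = _ := by simp only [hφ]; congr 1; push_cast; ring
  set z : ι → ℂ := fun j => Complex.exp (-(Complex.I * θ j)) with hz
  have hzz : ∀ i j, z i * star (z j) = Complex.exp (-(Complex.I * φ i j)) := by
    intro i j
    simp only [hz, hφ, RCLike.star_def]
    rw [← Complex.exp_conj, ← Complex.exp_add]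
    simp only [map_neg, map_mul, Complex.conj_I, Complex.conj_ofReal]
    rw [Complex.exp_eq_exp_iff_exists_int]
    refine ⟨-(n i j), ?_⟩
    push_cast; ring
  set w : ℕ → ℝ := fun k => Real.sin (π / (2 * m) * (2 * k + 1)) with hw
  have hw1 : ∀ k, w k ≤ 1 := fun k => Real.sin_le_one _
  set Sm : ℕ → ℂ := fun k => ∑ j, c j * z j ^ k with hS
  -- The weighted energy is a quadratic form in c whose matrix consists of values of the kernel.
  have hquad : ((∑ k ∈ Finset.range m, w k * ‖Sm k‖ ^ 2 : ℝ) : ℂ)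
      = ∑ i, ∑ j, c i * star (c j) * windowKernel m (φ i j) := by
    have h1 : ∀ k, ((w k * ‖Sm k‖ ^ 2 : ℝ) : ℂ)
        = ∑ i, ∑ j, c i * star (c j) * ((w k : ℂ) * Complex.exp (-(Complex.I * φ i j)) ^ k) := by
      intro k
      push_cast
      rw [← Complex.mul_conj', ← RCLike.star_def]
      simp only [hS]
      rw [star_sum, Finset.sum_mul_sum, Finset.mul_sum]
      refine Finset.sum_congr rfl fun i _ => ?_
      rw [Finset.mul_sum]
      refine Finset.sum_congr rfl fun j _ => ?_
      rw [← hzz, star_mul', star_pow, mul_pow]; ring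
    rw [Complex.ofReal_sum]
    simp_rw [h1]
    rw [Finset.sum_comm]
    refine Finset.sum_congr rfl fun i _ => ?_
    rw [Finset.sum_comm]
    refine Finset.sum_congr rfl fun j _ => ?_
    rw [windowKernel, Finset.mul_sum]
  have hdiag : ∀ i, windowKernel m (φ i i) = ((1 / Real.sin (π / (2 * m)) : ℝ) : ℂ) := by
    intro i
    rw [← windowKernel_zero hm]
    unfold windowKernel
    rw [← hzz]
    have : z i * star (z i) = 1 := by
      simp only [hz]
      rw [RCLike.star_def, ← Complex.exp_conj, ← Complex.exp_add]
      simp [Complex.conj_ofReal]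
    rw [this]; simp
  set K0 := 1 / Real.sin (π / (2 * m)) with hK0
  have hsym : ∀ i j, ‖windowKernel m (φ i j)‖ = ‖windowKernel m (φ j i)‖ := by
    intro i j
    rw [← norm_star]
    congr 1
    unfold windowKernel
    rw [star_sum]
    refine Finset.sum_congr rfl fun k _ => ?_
    rw [star_mul', star_pow, ← hzz, ← hzz, star_mul', star_star, RCLike.star_def,
      Complex.conj_ofReal, mul_comm (z j)]
  -- Diagonal dominance: the diagonal is K0 and the row sums off the diagonal are at most K0 - 1, so
  -- Schur's test bounds the form below by ∑ ‖c i‖².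
  have hlow : K0 * ∑ i, ‖c i‖ ^ 2 - (K0 - 1) * ∑ i, ‖c i‖ ^ 2
      ≤ ∑ k ∈ Finset.range m, w k * ‖Sm k‖ ^ 2 := by
    have hre : (∑ k ∈ Finset.range m, w k * ‖Sm k‖ ^ 2 : ℝ)
        = (∑ i, ∑ j, c i * star (c j) * windowKernel m (φ i j)).re := by
      rw [← hquad, Complex.ofReal_re]
    have hsplit : ∑ i, ∑ j, c i * star (c j) * windowKernel m (φ i j)
        = ((K0 * ∑ i, ‖c i‖ ^ 2 : ℝ) : ℂ)
          + ∑ i, ∑ j ∈ Finset.univ.erase i, c i * star (c j) * windowKernel m (φ i j) := by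
      rw [Finset.mul_sum, Complex.ofReal_sum, ← Finset.sum_add_distrib]
      refine Finset.sum_congr rfl fun i _ => ?_
      rw [← Finset.add_sum_erase _ _ (Finset.mem_univ i), hdiag, RCLike.star_def, Complex.mul_conj']
      push_cast; ring
    have hoff : ‖∑ i, ∑ j ∈ Finset.univ.erase i, c i * star (c j) * windowKernel m (φ i j)‖
        ≤ (K0 - 1) * ∑ i, ‖c i‖ ^ 2 := by
      calc ‖∑ i, ∑ j ∈ Finset.univ.erase i, c i * star (c j) * windowKernel m (φ i j)‖
          ≤ ∑ i, ∑ j ∈ Finset.univ.erase i, ‖c i‖ * ‖c j‖ * ‖windowKernel m (φ i j)‖ := by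
            refine (norm_sum_le _ _).trans (Finset.sum_le_sum fun i _ => ?_)
            refine (norm_sum_le _ _).trans (Finset.sum_le_sum fun j _ => ?_)
            rw [norm_mul, norm_mul, norm_star]
        _ ≤ ∑ i, ∑ j ∈ Finset.univ.erase i,
            (‖c i‖ ^ 2 / 2 * ‖windowKernel m (φ i j)‖ + ‖c j‖ ^ 2 / 2 * ‖windowKernel m (φ i j)‖) := by
            refine Finset.sum_le_sum fun i _ => Finset.sum_le_sum fun j _ => ?_
            rw [← add_mul]
            gcongr
            nlinarith [sq_nonneg (‖c i‖ - ‖c j‖)]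
        _ = ∑ i, ‖c i‖ ^ 2 / 2 * (∑ j ∈ Finset.univ.erase i, ‖windowKernel m (φ i j)‖)
            + ∑ i, ‖c i‖ ^ 2 / 2 * (∑ j ∈ Finset.univ.erase i, ‖windowKernel m (φ i j)‖) := by
            simp_rw [Finset.sum_add_distrib, Finset.mul_sum]
            congr 1
            rw [Finset.sum_comm' (t' := Finset.univ) (s' := fun j => Finset.univ.erase j)
              (by intro x y; simp [ne_comm])]
            refine Finset.sum_congr rfl fun i _ => Finset.sum_congr rfl fun j _ => ?_
            rw [hsym]
        _ ≤ ∑ i, ‖c i‖ ^ 2 / 2 * (K0 - 1) + ∑ i, ‖c i‖ ^ 2 / 2 * (K0 - 1) := by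
            gcongr with i _ i _
            · exact hrow i
            · exact hrow i
        _ = _ := by rw [← Finset.sum_add_distrib, Finset.mul_sum]
                    refine Finset.sum_congr rfl fun i _ => ?_
                    ring
    rw [hre, hsplit, Complex.add_re, Complex.ofReal_re]
    have := (abs_le.mp ((Complex.abs_re_le_norm _).trans hoff)).1
    linarith
  calc ∑ i, ‖c i‖ ^ 2 = K0 * ∑ i, ‖c i‖ ^ 2 - (K0 - 1) * ∑ i, ‖c i‖ ^ 2 := by ring
    _ ≤ _ := hlow
    _ ≤ ∑ k ∈ Finset.range m, ‖Sm k‖ ^ 2 := by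
      refine Finset.sum_le_sum fun k _ => ?_
      have := mul_le_mul_of_nonneg_right (hw1 k) (sq_nonneg ‖Sm k‖)
      linarith

/-! ### Euclidean norms of vectors and operator bounds -/

section VectorNorm

variable {ι κ : Type*} [Fintype ι] [Fintype κ]

/-- The Euclidean norm of a complex vector. -/
noncomputable def l2n (x : ι → ℂ) : ℝ := ‖WithLp.toLp 2 x‖

theorem l2n_sq (x : ι → ℂ) : l2n x ^ 2 = ∑ i, ‖x i‖ ^ 2 := by
  unfold l2n; rw [EuclideanSpace.norm_sq_eq]

theorem l2n_nonneg (x : ι → ℂ) : 0 ≤ l2n x := norm_nonneg _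

@[simp] theorem l2n_zero : l2n (0 : ι → ℂ) = 0 := by simp [l2n]

theorem l2n_eq_zero {x : ι → ℂ} : l2n x = 0 ↔ x = 0 := by simp [l2n]

theorem l2n_pos {x : ι → ℂ} (hx : x ≠ 0) : 0 < l2n x :=
  lt_of_le_of_ne (l2n_nonneg x) (fun h => hx (l2n_eq_zero.mp h.symm))

theorem l2n_add_le (x y : ι → ℂ) : l2n (x + y) ≤ l2n x + l2n y := by
  unfold l2n; rw [WithLp.toLp_add]; exact norm_add_le _ _

theorem l2n_sub_le (x y : ι → ℂ) : l2n (x - y) ≤ l2n x + l2n y := by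
  unfold l2n; rw [WithLp.toLp_sub]; exact norm_sub_le _ _

theorem l2n_sub_comm (x y : ι → ℂ) : l2n (x - y) = l2n (y - x) := by
  unfold l2n; rw [WithLp.toLp_sub, WithLp.toLp_sub]; exact norm_sub_rev _ _

theorem l2n_le_add_sub (x y : ι → ℂ) : l2n x ≤ l2n y + l2n (x - y) := by
  have := l2n_add_le y (x - y)
  rwa [add_sub_cancel] at this

theorem l2n_smul (c : ℂ) (x : ι → ℂ) : l2n (c • x) = ‖c‖ * l2n x := by
  unfold l2n; rw [WithLp.toLp_smul]; exact norm_smul _ _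

theorem norm_le_l2n (x : ι → ℂ) (i : ι) : ‖x i‖ ≤ l2n x := by
  apply le_of_sq_le_sq _ (l2n_nonneg _)
  rw [l2n_sq]
  exact Finset.single_le_sum (f := fun i => ‖x i‖ ^ 2) (fun i _ => sq_nonneg _) (Finset.mem_univ i)

theorem l2n_le_of_sq_le {x : ι → ℂ} {y : κ → ℂ} {c : ℝ} (hc : 0 ≤ c)
    (h : ∑ i, ‖x i‖ ^ 2 ≤ c ^ 2 * ∑ i, ‖y i‖ ^ 2) : l2n x ≤ c * l2n y := by
  apply le_of_sq_le_sq _ (mul_nonneg hc (l2n_nonneg _))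
  rw [mul_pow, l2n_sq, l2n_sq]; exact h

theorem norm_dotProduct_le (x y : ι → ℂ) : ‖x ⬝ᵥ y‖ ≤ l2n x * l2n y := by
  have h : ‖∑ i, x i * y i‖ ≤ ∑ i, ‖x i‖ * ‖y i‖ :=
    (norm_sum_le _ _).trans (Finset.sum_le_sum fun i _ => (norm_mul _ _).le)
  refine h.trans ?_
  apply le_of_sq_le_sq _ (mul_nonneg (l2n_nonneg _) (l2n_nonneg _))
  rw [mul_pow, l2n_sq, l2n_sq]
  exact Finset.sum_mul_sq_le_sq_mul_sq _ _ _

theorem l2n_star (x : ι → ℂ) : l2n (star x) = l2n x := by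
  rw [← sq_eq_sq₀ (l2n_nonneg _) (l2n_nonneg _), l2n_sq, l2n_sq]
  simp

theorem dotProduct_star_self (x : ι → ℂ) : star x ⬝ᵥ x = ((l2n x ^ 2 : ℝ) : ℂ) := by
  rw [l2n_sq, dotProduct]
  push_cast
  refine Finset.sum_congr rfl fun i _ => ?_
  rw [Pi.star_apply, RCLike.star_def, Complex.conj_mul']

/-- The operator norm of `A` is at most `c`. -/
def OpBound (A : Matrix ι κ ℂ) (c : ℝ) : Prop := ∀ x : κ → ℂ, l2n (A *ᵥ x) ≤ c * l2n x

theorem OpBound.mono {A : Matrix ι κ ℂ} {c c' : ℝ} (h : OpBound A c) (hc : c ≤ c') : OpBound A c' :=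
  fun x => (h x).trans (mul_le_mul_of_nonneg_right hc (l2n_nonneg x))

theorem OpBound.mul {μ : Type*} [Fintype μ] {A : Matrix ι κ ℂ} {B : Matrix κ μ ℂ} {a b : ℝ}
    (hA : OpBound A a) (hB : OpBound B b) (ha : 0 ≤ a) : OpBound (A * B) (a * b) := by
  intro x
  rw [← Matrix.mulVec_mulVec]
  calc _ ≤ a * l2n (B *ᵥ x) := hA _
    _ ≤ a * (b * l2n x) := by gcongr; exact hB x
    _ = _ := by ring

theorem OpBound.sub {A B : Matrix ι κ ℂ} {a b : ℝ}
    (hA : OpBound A a) (hB : OpBound B b) : OpBound (A - B) (a + b) := by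
  intro x
  rw [Matrix.sub_mulVec, add_mul]
  exact (l2n_sub_le _ _).trans (add_le_add (hA x) (hB x))

/-- The Frobenius norm dominates the operator norm; c plays the role of the square root of the
number of entries. -/
theorem opBound_of_entries {A : Matrix ι κ ℂ} {e : ℝ} (he : 0 ≤ e) (h : ∀ i j, ‖A i j‖ ≤ e) {c : ℝ}
    (hc : 0 ≤ c) (hcc : Fintype.card ι * Fintype.card κ ≤ c ^ 2) : OpBound A (c * e) := by
  intro x
  apply l2n_le_of_sq_le (by positivity)
  calc ∑ i, ‖(A *ᵥ x) i‖ ^ 2 ≤ ∑ i : ι, (Fintype.card κ * e ^ 2) * ∑ j, ‖x j‖ ^ 2 := by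
        refine Finset.sum_le_sum fun i _ => ?_
        calc ‖(A *ᵥ x) i‖ ^ 2 ≤ (∑ j, ‖A i j‖ * ‖x j‖) ^ 2 := by
              gcongr
              exact (norm_sum_le _ _).trans (Finset.sum_le_sum fun j _ => (norm_mul _ _).le)
          _ ≤ (∑ j, ‖A i j‖ ^ 2) * ∑ j, ‖x j‖ ^ 2 := Finset.sum_mul_sq_le_sq_mul_sq _ _ _
          _ ≤ _ := by
              gcongr
              calc ∑ j, ‖A i j‖ ^ 2 ≤ ∑ j : κ, e ^ 2 :=
                    Finset.sum_le_sum fun j _ => by gcongr; exact h i j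
                _ = _ := by simp
    _ = (Fintype.card ι * Fintype.card κ : ℝ) * (e ^ 2 * ∑ j, ‖x j‖ ^ 2) := by
        simp only [Finset.sum_const, Finset.card_univ, nsmul_eq_mul]; ring
    _ ≤ c ^ 2 * (e ^ 2 * ∑ j, ‖x j‖ ^ 2) := by gcongr
    _ = _ := by ring

theorem l2n_mulVec_of_isometry [DecidableEq κ] {A : Matrix ι κ ℂ} (hA : Aᴴ * A = 1) (x : κ → ℂ) :
    l2n (A *ᵥ x) = l2n x := by
  rw [← sq_eq_sq₀ (l2n_nonneg _) (l2n_nonneg _)]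
  have h : ((l2n (A *ᵥ x) ^ 2 : ℝ) : ℂ) = ((l2n x ^ 2 : ℝ) : ℂ) := by
    rw [← dotProduct_star_self, ← dotProduct_star_self, Matrix.star_mulVec, ← Matrix.dotProduct_mulVec,
      Matrix.mulVec_mulVec, hA, Matrix.one_mulVec]
  exact_mod_cast h

theorem OpBound.diagonal [DecidableEq ι] {d : ι → ℂ} {c : ℝ} (hc : 0 ≤ c) (h : ∀ i, ‖d i‖ ≤ c) :
    OpBound (Matrix.diagonal d) c := by
  intro x
  apply l2n_le_of_sq_le hc
  rw [Finset.mul_sum]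
  refine Finset.sum_le_sum fun i _ => ?_
  rw [Matrix.mulVec_diagonal, norm_mul, mul_pow]
  gcongr
  exact h i

/-- An invertible matrix bounded below has a bounded inverse. -/
theorem exists_inverse_of_lower_bound [DecidableEq ι] {G : Matrix ι ι ℂ} {c : ℝ} (hc : 0 < c)
    (h : ∀ x, c * l2n x ≤ l2n (G *ᵥ x)) :
    ∃ G' : Matrix ι ι ℂ, G * G' = 1 ∧ G' * G = 1 ∧ OpBound G' (1 / c) := by
  have hdet : IsUnit G.det := by
    rw [isUnit_iff_ne_zero]
    intro h0
    obtain ⟨v, hv, hv0⟩ := Matrix.exists_mulVec_eq_zero_iff.mpr h0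
    have := h v
    rw [hv0, l2n_zero] at this
    exact absurd this (not_le.mpr (mul_pos hc (l2n_pos hv)))
  refine ⟨G⁻¹, Matrix.mul_nonsing_inv _ hdet, Matrix.nonsing_inv_mul _ hdet, fun x => ?_⟩
  have := h (G⁻¹ *ᵥ x)
  rw [Matrix.mulVec_mulVec, Matrix.mul_nonsing_inv _ hdet, Matrix.one_mulVec] at this
  rw [div_mul_eq_mul_div, one_mul, le_div_iff₀ hc]; linarith

end VectorNorm

/-! ### Kernels belonging to two eigenvalues, with multiplicity -/

section Eigenvalues

variable {ι : Type*} [Fintype ι] [DecidableEq ι]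

/-- If `(X - μ)(X - μ')` divides the characteristic polynomial, then the kernel of `(A - μ)(A - μ')`
meets every hyperplane `d j = 0`. -/
theorem exists_kernel_of_two_roots (A : Matrix ι ι ℂ) (μ μ' : ℂ) (hroot : {μ, μ'} ≤ A.charpoly.roots)
    (j : ι) : ∃ d : ι → ℂ, d ≠ 0 ∧ d j = 0 ∧
      (A - μ' • 1) *ᵥ ((A - μ • 1) *ᵥ d) = 0 := by
  have hsub : ∀ (ν : ℂ) (x : ι → ℂ), (A - ν • 1) *ᵥ x = A *ᵥ x - ν • x := by
    intro ν x; rw [Matrix.sub_mulVec, Matrix.smul_mulVec, Matrix.one_mulVec]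
  have heig : ∀ ν ∈ A.charpoly.roots, ∃ x : ι → ℂ, x ≠ 0 ∧ A *ᵥ x = ν • x := by
    intro ν hν
    have h0 : (A - ν • 1).det = 0 := by
      have := (Polynomial.mem_roots'.mp hν).2
      rw [Polynomial.IsRoot, Matrix.eval_charpoly] at this
      rw [← neg_sub, Matrix.det_neg, show ν • (1 : Matrix ι ι ℂ) = Matrix.scalar ι ν by
        simp [Matrix.smul_one_eq_diagonal], this, mul_zero]
    obtain ⟨x, hx, hx0⟩ := Matrix.exists_mulVec_eq_zero_iff.mpr h0
    refine ⟨x, hx, ?_⟩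
    rw [hsub, sub_eq_zero] at hx0; exact hx0
  -- For a double root the kernel of the square of A - μ has dimension at least two, so some nonzero
  -- vector in it has j-th entry zero. For different roots a combination of two eigenvectors does
  -- it.
  by_cases hμ : μ = μ'
  · subst hμ
    set f : Module.End ℂ (ι → ℂ) := Matrix.toLin' (A - μ • 1) with hf
    have hmult : 2 ≤ Module.finrank ℂ (Module.End.maxGenEigenspace (Matrix.toLin' A) μ) := by
      rw [LinearMap.finrank_maxGenEigenspace_eq, Matrix.charpoly_toLin', ← Polynomial.count_roots]
      have := Multiset.count_le_of_le μ hroot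
      simpa using this
    have hfA : f = Matrix.toLin' A - μ • (1 : Module.End ℂ (ι → ℂ)) := by
      ext x i; simp [hf]
    have hker2 : 2 ≤ Module.finrank ℂ (LinearMap.ker (f ^ 2)) := by
      have hle : LinearMap.ker f ≤ LinearMap.ker (f ^ 2) := by
        intro x hx
        rw [LinearMap.mem_ker] at hx ⊢
        rw [pow_two, Module.End.mul_apply, hx, map_zero]
      -- If the kernels stop growing at once, ker f is already the generalized eigenspace, whose
      -- dimension is the multiplicity. Otherwise the dimension grows from at least one to at least
      -- two.
      by_cases heq : LinearMap.ker f = LinearMap.ker (f ^ 2)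
      · have hconst : ∀ k, LinearMap.ker (f ^ (1 + k)) = LinearMap.ker f := by
          intro k
          have := Module.End.ker_pow_constant (f := f) (k := 1) (by simpa using heq) k
          rw [← this, pow_one]
        have : Module.End.maxGenEigenspace (Matrix.toLin' A) μ ≤ LinearMap.ker (f ^ 2) := by
          rw [Module.End.maxGenEigenspace_eq_genEigenspace_finrank, Module.End.genEigenspace_nat]
          intro x hx
          rw [LinearMap.mem_ker] at hx
          have hx' : x ∈ LinearMap.ker (f ^ (1 + Module.finrank ℂ (ι → ℂ))) := by
            rw [LinearMap.mem_ker, pow_add, pow_one, Module.End.mul_apply, hfA]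
            erw [hx, map_zero]
          rw [hconst, heq] at hx'
          exact hx'
        exact hmult.trans (Submodule.finrank_mono this)
      · have hlt : LinearMap.ker f < LinearMap.ker (f ^ 2) := lt_of_le_of_ne hle heq
        have h1 := Submodule.finrank_lt_finrank_of_lt hlt
        have h2 : LinearMap.ker f ≠ ⊥ := by
          obtain ⟨x, hx, hx0⟩ := heig μ (Multiset.mem_of_le hroot (by simp))
          intro hbot
          have : x ∈ LinearMap.ker f := by
            rw [LinearMap.mem_ker, hf, Matrix.toLin'_apply, hsub, hx0, sub_self]
          rw [hbot] at this
          exact hx ((Submodule.mem_bot ℂ).mp this)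
        have h3 := Submodule.one_le_finrank_iff.mpr h2
        omega
    set g : LinearMap.ker (f ^ 2) →ₗ[ℂ] ℂ := (LinearMap.proj j) ∘ₗ (LinearMap.ker (f ^ 2)).subtype
    have hg : LinearMap.ker g ≠ ⊥ := LinearMap.ker_ne_bot_of_finrank_lt (by
      rw [Module.finrank_self]; omega)
    obtain ⟨⟨d, hdm⟩, hd, hd0⟩ := (Submodule.ne_bot_iff _).mp hg
    refine ⟨d, fun h => hd0 (Subtype.ext h), hd, ?_⟩
    have hd2 : f (f d) = 0 := by
      have := LinearMap.mem_ker.mp hdm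
      rwa [pow_two, Module.End.mul_apply] at this
    have hfd : ∀ v, f v = (A - μ • 1) *ᵥ v := fun v => Matrix.toLin'_apply _ _
    rw [← hfd, ← hfd, hd2]
  · obtain ⟨x, hx, hx0⟩ := heig μ (Multiset.mem_of_le hroot (by simp))
    obtain ⟨y, hy, hy0⟩ := heig μ' (Multiset.mem_of_le hroot (by simp))
    by_cases hxj : x j = 0
    · refine ⟨x, hx, hxj, ?_⟩
      rw [hsub μ, hx0, sub_self, Matrix.mulVec_zero]
    · refine ⟨y j • x - x j • y, ?_, by simp [mul_comm], ?_⟩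
      · intro h
        have h1 : y j • x = x j • y := sub_eq_zero.mp h
        have h2 := congrArg (fun v => A *ᵥ v) h1
        simp only [Matrix.mulVec_smul, hx0, hy0] at h2
        rw [smul_comm, h1, smul_comm (x j) μ' y, ← sub_eq_zero, ← sub_smul, smul_eq_zero] at h2
        rcases h2 with h2 | h2
        · exact hμ (sub_eq_zero.mp h2)
        · rcases smul_eq_zero.mp h2 with h3 | h3
          · exact hxj h3
          · exact hy h3
      · simp only [hsub, Matrix.mulVec_sub, Matrix.mulVec_smul, hx0, hy0, smul_sub]
        simp only [smul_smul]
        ext i; simp only [Pi.sub_apply, Pi.smul_apply, Pi.zero_apply, smul_eq_mul]; ring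

end Eigenvalues

/-! ### Eigenvalues of a perturbed diagonal matrix -/

section Perturbation

variable {ι : Type*} [Fintype ι] [DecidableEq ι]

theorem l2n_sq_erase (x : ι → ℂ) (j : ι) :
    l2n x ^ 2 = ‖x j‖ ^ 2 + ∑ i ∈ Finset.univ.erase j, ‖x i‖ ^ 2 := by
  rw [l2n_sq, Finset.add_sum_erase _ (fun i => ‖x i‖ ^ 2) (Finset.mem_univ j)]

theorem sub_smul_one_mulVec (A : Matrix ι ι ℂ) (ν : ℂ) (x : ι → ℂ) :
    (A - ν • 1) *ᵥ x = A *ᵥ x - ν • x := by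
  rw [Matrix.sub_mulVec, Matrix.smul_mulVec, Matrix.one_mulVec]

/-- Every eigenvalue of a perturbed diagonal matrix is close to a diagonal entry. -/
theorem exists_near_of_mem_roots {z : ι → ℂ} {E : Matrix ι ι ℂ} {η : ℝ} (hE : OpBound E η) {μ : ℂ}
    (hμ : μ ∈ (Matrix.diagonal z + E).charpoly.roots) : ∃ i, ‖μ - z i‖ ≤ η := by
  have h0 : (Matrix.diagonal z + E - μ • 1).det = 0 := by
    have := (Polynomial.mem_roots'.mp hμ).2
    rw [Polynomial.IsRoot, Matrix.eval_charpoly] at this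
    rw [← neg_sub, Matrix.det_neg, show μ • (1 : Matrix ι ι ℂ) = Matrix.scalar ι μ by
      simp [Matrix.smul_one_eq_diagonal], this, mul_zero]
  obtain ⟨x, hx, hx0⟩ := Matrix.exists_mulVec_eq_zero_iff.mpr h0
  by_contra! hfar
  have hcomp : ∀ i, (E *ᵥ x) i = (μ - z i) * x i := by
    intro i
    have := congrFun hx0 i
    rw [sub_smul_one_mulVec, Matrix.add_mulVec] at this
    simp only [Pi.sub_apply, Pi.add_apply, Matrix.mulVec_diagonal, Pi.smul_apply, smul_eq_mul,
      Pi.zero_apply] at this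
    linear_combination this
  have hη : 0 ≤ η := by
    by_contra! hneg
    have := hE x
    have h1 := l2n_pos hx
    have h2 := l2n_nonneg (E *ᵥ x)
    nlinarith
  have h1 : l2n (E *ᵥ x) ^ 2 ≤ η ^ 2 * l2n x ^ 2 := by
    rw [← mul_pow]; exact pow_le_pow_left₀ (l2n_nonneg _) (hE x) 2
  rw [l2n_sq, l2n_sq, Finset.mul_sum] at h1
  obtain ⟨i0, hi0⟩ : ∃ i, x i ≠ 0 := by
    by_contra! h; exact hx (funext h)
  refine absurd h1 (not_le.mpr (Finset.sum_lt_sum (fun i _ => ?_) ⟨i0, Finset.mem_univ _, ?_⟩))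
  · rw [hcomp, norm_mul, mul_pow]
    exact mul_le_mul_of_nonneg_right (pow_le_pow_left₀ hη (hfar i).le 2) (sq_nonneg _)
  · rw [hcomp, norm_mul, mul_pow]
    have : 0 < ‖x i0‖ := norm_pos_iff.mpr hi0
    exact mul_lt_mul_of_pos_right (pow_lt_pow_left₀ (hfar i0) hη (by norm_num)) (by positivity)

/-- Two eigenvalues (with multiplicity) of a perturbed diagonal matrix with separated diagonal
entries are not close to the same entry. -/
theorem not_two_roots_near {z : ι → ℂ} {E : Matrix ι ι ℂ} {η g : ℝ} (hE : OpBound E η)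
    (hη : 0 ≤ η) (hsep : ∀ i j, i ≠ j → g ≤ ‖z i - z j‖) (hg : 4 * η < g) {μ μ' : ℂ}
    (hroot : {μ, μ'} ≤ (Matrix.diagonal z + E).charpoly.roots) (j : ι)
    (h1 : ‖μ - z j‖ ≤ η) (h2 : ‖μ' - z j‖ ≤ η) : False := by
  -- With x = (A - μ) d, the entry x j equals (E d) j and is small, because d j = 0. Since x is
  -- annihilated by A - μ', its other entries are small compared with x, so all of x is at most
  -- 2η‖d‖. But away from j one has (z i - μ) d i = x i - (E d) i with |z i - μ| > 3η, which is too
  -- large for the right side.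
  obtain ⟨d, hd, hdj, hker⟩ := exists_kernel_of_two_roots _ μ μ' hroot j
  set x := (Matrix.diagonal z + E - μ • 1) *ᵥ d with hx
  have hxc : ∀ i, x i = (z i - μ) * d i + (E *ᵥ d) i := by
    intro i
    rw [hx, sub_smul_one_mulVec, Matrix.add_mulVec]
    simp only [Pi.sub_apply, Pi.add_apply, Matrix.mulVec_diagonal, Pi.smul_apply, smul_eq_mul]
    ring
  have hxk : ∀ i, (z i - μ') * x i = - (E *ᵥ x) i := by
    intro i
    have := congrFun hker i
    rw [sub_smul_one_mulVec, Matrix.add_mulVec] at this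
    simp only [Pi.sub_apply, Pi.add_apply, Matrix.mulVec_diagonal, Pi.smul_apply, smul_eq_mul,
      Pi.zero_apply] at this
    linear_combination this
  have hfar : ∀ ν : ℂ, ‖ν - z j‖ ≤ η → ∀ i, i ≠ j → 3 * η ≤ ‖z i - ν‖ ∧ g - η ≤ ‖z i - ν‖ := by
    intro ν hν i hij
    have h3 := hsep i j hij
    have h4 : ‖z i - z j‖ ≤ ‖z i - ν‖ + ‖ν - z j‖ := by
      have := norm_add_le (z i - ν) (ν - z j); rwa [sub_add_sub_cancel] at this
    constructor <;> linarith
  have hgη : 3 * η < g - η := by linarith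
  have hgη0 : 0 < g - η := by linarith
  have hdpos := l2n_pos hd
  -- `x` is dominated by its `j`-th entry
  have hxbound : (g - η) ^ 2 * ∑ i ∈ Finset.univ.erase j, ‖x i‖ ^ 2 ≤ (η * l2n x) ^ 2 := by
    calc (g - η) ^ 2 * ∑ i ∈ Finset.univ.erase j, ‖x i‖ ^ 2
        ≤ ∑ i ∈ Finset.univ.erase j, ‖(E *ᵥ x) i‖ ^ 2 := by
          rw [Finset.mul_sum]
          refine Finset.sum_le_sum fun i hi => ?_
          rw [← norm_neg ((E *ᵥ x) i), ← hxk, norm_mul, mul_pow]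
          have := (hfar μ' h2 i (Finset.ne_of_mem_erase hi)).2
          gcongr
      _ ≤ l2n (E *ᵥ x) ^ 2 := by rw [l2n_sq_erase _ j]; linarith [sq_nonneg ‖(E *ᵥ x) j‖]
      _ ≤ _ := pow_le_pow_left₀ (l2n_nonneg _) (hE x) 2
  have hxj : ‖x j‖ ≤ η * l2n d := by
    rw [hxc, hdj, mul_zero, zero_add]
    exact (norm_le_l2n _ _).trans (hE d)
  have hxle : l2n x ≤ 2 * η * l2n d := by
    apply le_of_sq_le_sq _ (by positivity)
    have e := l2n_sq_erase x j
    have h5 : ∑ i ∈ Finset.univ.erase j, ‖x i‖ ^ 2 ≤ l2n x ^ 2 / 9 := by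
      by_cases hη0 : η = 0
      · rw [hη0] at hxbound
        rw [zero_mul, sub_zero, zero_pow two_ne_zero] at hxbound
        have hs : 0 ≤ ∑ i ∈ Finset.univ.erase j, ‖x i‖ ^ 2 := Finset.sum_nonneg fun i _ => sq_nonneg _
        have hgp : 0 < g ^ 2 := by rw [hη0, sub_zero] at hgη0; positivity
        have : ∑ i ∈ Finset.univ.erase j, ‖x i‖ ^ 2 ≤ 0 := by
          by_contra! hpos
          have := mul_pos hgp hpos
          nlinarith
        linarith [sq_nonneg (l2n x)]
      · have hηp : 0 < η := lt_of_le_of_ne hη (Ne.symm hη0)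
        have hs : 0 ≤ ∑ i ∈ Finset.univ.erase j, ‖x i‖ ^ 2 := Finset.sum_nonneg fun i _ => sq_nonneg _
        have h6 : (3 * η) ^ 2 * ∑ i ∈ Finset.univ.erase j, ‖x i‖ ^ 2 ≤ (η * l2n x) ^ 2 :=
          (mul_le_mul_of_nonneg_right (pow_le_pow_left₀ (by positivity) hgη.le 2) hs).trans hxbound
        have h7 : η ^ 2 * (9 * ∑ i ∈ Finset.univ.erase j, ‖x i‖ ^ 2) ≤ η ^ 2 * l2n x ^ 2 := by
          nlinarith
        have := le_of_mul_le_mul_left h7 (by positivity)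
        linarith
    have h8 : ‖x j‖ ^ 2 ≤ (η * l2n d) ^ 2 := pow_le_pow_left₀ (norm_nonneg _) hxj 2
    nlinarith [sq_nonneg (l2n x), sq_nonneg (η * l2n d)]
  have hdbound : (g - η) ^ 2 * l2n d ^ 2 ≤ (3 * η * l2n d) ^ 2 := by
    calc (g - η) ^ 2 * l2n d ^ 2
        = ∑ i ∈ Finset.univ.erase j, (g - η) ^ 2 * ‖d i‖ ^ 2 := by
          rw [l2n_sq_erase d j, hdj, ← Finset.mul_sum]; simp
      _ ≤ ∑ i ∈ Finset.univ.erase j, ‖(x - E *ᵥ d) i‖ ^ 2 := by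
          refine Finset.sum_le_sum fun i hi => ?_
          have h9 : (x - E *ᵥ d) i = (z i - μ) * d i := by
            rw [Pi.sub_apply, hxc]; ring
          rw [h9, norm_mul, mul_pow]
          have := (hfar μ h1 i (Finset.ne_of_mem_erase hi)).2
          gcongr
      _ ≤ l2n (x - E *ᵥ d) ^ 2 := by rw [l2n_sq_erase _ j]; linarith [sq_nonneg ‖(x - E *ᵥ d) j‖]
      _ ≤ _ := by
          apply pow_le_pow_left₀ (l2n_nonneg _)
          have := l2n_sub_le x (E *ᵥ d)
          have := hE d
          linarith
  have : (3 * η * l2n d) ^ 2 < (g - η) ^ 2 * l2n d ^ 2 := by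
    rw [mul_pow]
    exact mul_lt_mul_of_pos_right (pow_lt_pow_left₀ hgη (by positivity) (by norm_num)) (by positivity)
  linarith

/-- Sending each eigenvalue to a nearby diagonal entry is injective by `not_two_roots_near`, and an
injective self-map of a finite set is a permutation. -/
theorem exists_perm_of_perturbed_diagonal {z w : ι → ℂ} {E : Matrix ι ι ℂ} {η g : ℝ}
    (hE : OpBound E η) (hη : 0 ≤ η) (hsep : ∀ i j, i ≠ j → g ≤ ‖z i - z j‖) (hg : 4 * η < g)
    (hw : (Matrix.diagonal z + E).charpoly.roots = Finset.univ.val.map w) :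
    ∃ p : Equiv.Perm ι, ∀ i, ‖w (p i) - z i‖ ≤ η := by
  have hmem : ∀ i, w i ∈ (Matrix.diagonal z + E).charpoly.roots := fun i => by
    rw [hw]; exact Multiset.mem_map_of_mem _ (Finset.mem_univ i)
  choose q hq using fun i => exists_near_of_mem_roots hE (hmem i)
  have hinj : Function.Injective q := by
    intro i i' h
    by_contra hne
    refine not_two_roots_near hE hη hsep hg (μ := w i) (μ' := w i') ?_ (q i) (hq i) (h ▸ hq i')
    rw [hw]
    -- The comparison is made for the indices, so that equal values w i = w i' count as a double
    -- root.
    have h1 : ({i, i'} : Multiset ι) ≤ Finset.univ.val := by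
      rw [Multiset.le_iff_subset (by simp [hne])]
      intro a _; exact Finset.mem_univ a
    have := Multiset.map_le_map (f := w) h1
    simpa using this
  refine ⟨(Equiv.ofBijective q (Finite.injective_iff_bijective.mp hinj)).symm, fun i => ?_⟩
  have := hq ((Equiv.ofBijective q (Finite.injective_iff_bijective.mp hinj)).symm i)
  rwa [Equiv.ofBijective_apply_symm_apply q] at this

end Perturbation

/-! ### Pseudoinverses and the shift invariance of ESPRIT -/

section Subspace

variable {m L S : ℕ}

/-- A (X A - 1) = 0 and A is injective by the lower bound. -/
theorem IsMoorePenrose.mul_self_eq_one {A : Matrix (Fin m) (Fin S) ℂ} {X : Matrix (Fin S) (Fin m) ℂ}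
    (h : IsMoorePenrose A X) {c : ℝ} (hc : 0 < c) (hA : ∀ x, c * l2n x ≤ l2n (A *ᵥ x)) :
    X * A = 1 := by
  have h1 : A * (X * A - 1) = 0 := by rw [Matrix.mul_sub, ← Matrix.mul_assoc, h.1, Matrix.mul_one, sub_self]
  rw [← sub_eq_zero]
  ext i j
  have h2 := hA ((X * A - 1) *ᵥ Pi.single j 1)
  rw [Matrix.mulVec_mulVec, h1, Matrix.zero_mulVec, l2n_zero] at h2
  have h3 : (X * A - 1) *ᵥ Pi.single j 1 = 0 := by
    rw [← l2n_eq_zero]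
    have := l2n_nonneg ((X * A - 1) *ᵥ Pi.single j 1)
    nlinarith
  have := congrFun h3 i
  simpa using this

/-- A X is an orthogonal projection, hence a contraction, and the lower bound of A transfers this to
X. -/
theorem IsMoorePenrose.opBound {A : Matrix (Fin m) (Fin S) ℂ} {X : Matrix (Fin S) (Fin m) ℂ}
    (h : IsMoorePenrose A X) {c : ℝ} (hc : 0 < c) (hA : ∀ x, c * l2n x ≤ l2n (A *ᵥ x)) :
    OpBound X (1 / c) := by
  intro w
  have hP : l2n ((A * X) *ᵥ w) ≤ l2n w := by
    have h1 : ((l2n ((A * X) *ᵥ w) ^ 2 : ℝ) : ℂ) = star w ⬝ᵥ ((A * X) *ᵥ w) := by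
      rw [← dotProduct_star_self, Matrix.star_mulVec, ← Matrix.dotProduct_mulVec,
        Matrix.mulVec_mulVec, h.2.2.1, ← Matrix.mul_assoc, h.1]
    have h2 : l2n ((A * X) *ᵥ w) ^ 2 ≤ l2n w * l2n ((A * X) *ᵥ w) := by
      calc l2n ((A * X) *ᵥ w) ^ 2 = ‖((l2n ((A * X) *ᵥ w) ^ 2 : ℝ) : ℂ)‖ := by
            rw [Complex.norm_real, Real.norm_eq_abs, abs_of_nonneg (sq_nonneg _)]
        _ ≤ l2n (star w) * l2n ((A * X) *ᵥ w) := by rw [h1]; exact norm_dotProduct_le _ _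
        _ = _ := by rw [l2n_star]
    by_cases h0 : l2n ((A * X) *ᵥ w) = 0
    · rw [h0]; exact l2n_nonneg _
    · have hpos : 0 < l2n ((A * X) *ᵥ w) := lt_of_le_of_ne (l2n_nonneg _) (Ne.symm h0)
      nlinarith
  have := hA (X *ᵥ w)
  rw [Matrix.mulVec_mulVec] at this
  rw [div_mul_eq_mul_div, one_mul, le_div_iff₀ hc]; linarith

theorem exists_isMoorePenrose {A : Matrix (Fin m) (Fin S) ℂ} {c : ℝ} (hc : 0 < c)
    (hA : ∀ x, c * l2n x ≤ l2n (A *ᵥ x)) : ∃ X, IsMoorePenrose A X := by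
  have hdet : IsUnit (Aᴴ * A).det := by
    rw [isUnit_iff_ne_zero]
    intro h0
    obtain ⟨v, hv, hv0⟩ := Matrix.exists_mulVec_eq_zero_iff.mpr h0
    have h1 : ((l2n (A *ᵥ v) ^ 2 : ℝ) : ℂ) = 0 := by
      rw [← dotProduct_star_self, Matrix.star_mulVec, ← Matrix.dotProduct_mulVec,
        Matrix.mulVec_mulVec, hv0, dotProduct_zero]
    have h2 : l2n (A *ᵥ v) = 0 := by
      have : l2n (A *ᵥ v) ^ 2 = 0 := by exact_mod_cast h1
      exact pow_eq_zero_iff (by norm_num) |>.mp this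
    have := hA v
    rw [h2] at this
    exact absurd this (not_le.mpr (mul_pos hc (l2n_pos hv)))
  have hXA : (Aᴴ * A)⁻¹ * Aᴴ * A = 1 := by rw [Matrix.mul_assoc, Matrix.nonsing_inv_mul _ hdet]
  refine ⟨(Aᴴ * A)⁻¹ * Aᴴ, ?_, ?_, ?_, ?_⟩
  · rw [Matrix.mul_assoc, hXA, Matrix.mul_one]
  · rw [hXA, Matrix.one_mul]
  · have hinv : ((Aᴴ * A)⁻¹)ᴴ = (Aᴴ * A)⁻¹ := (Matrix.isHermitian_conjTranspose_mul_self A).inv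
    rw [Matrix.IsHermitian, Matrix.conjTranspose_mul, Matrix.conjTranspose_mul, hinv,
      Matrix.conjTranspose_conjTranspose, Matrix.mul_assoc]
  · rw [hXA]; exact Matrix.isHermitian_one

/-- If the first `S` left singular vectors `Q` are close to the range of a matrix `V` with shift
structure, then the shift-invariance matrix is similar to a small perturbation of the diagonal matrix of
the nodes. -/
theorem shift_invariance_perturbation {V Q F : Matrix (Fin (L + 1)) (Fin S) ℂ} {G : Matrix (Fin S) (Fin S) ℂ}
    {z : Fin S → ℂ} {a e : ℝ} (ha : 1 ≤ a) (he : 0 ≤ e) (hea : 4 * a * e ≤ 1)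
    (hz : ∀ j, ‖z j‖ = 1) (hVa : OpBound V a) (hV : ∀ x, l2n x ≤ l2n (V *ᵥ x))
    (hV0 : ∀ x, l2n x ≤ l2n (V.submatrix Fin.castSucc id *ᵥ x))
    (hV1 : V.submatrix Fin.succ id = V.submatrix Fin.castSucc id * Matrix.diagonal z)
    (hQ : ∀ x, l2n (Q *ᵥ x) = l2n x) (hdec : Q = V * G + F) (hF : OpBound F e) :
    (∀ x, 1 / (4 * a) * l2n x ≤ l2n (Q.submatrix Fin.castSucc id *ᵥ x)) ∧
    ∀ X, IsMoorePenrose (Q.submatrix Fin.castSucc id) X →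
      ∃ E : Matrix (Fin S) (Fin S) ℂ, OpBound E (80 * a ^ 3 * e) ∧
        (X * Q.submatrix Fin.succ id).charpoly = (Matrix.diagonal z + E).charpoly := by
  have ha0 : 0 < a := by linarith
  have he4 : e ≤ 1 / (4 * a) := by rw [le_div_iff₀ (by positivity)]; linarith
  have he1 : e ≤ 1 / 4 := by nlinarith
  -- V G = Q - F is bounded below by 1 - e ≥ 1/2 because Q is an isometry, and V stretches by at
  -- most a.
  have hG : ∀ x, 1 / (2 * a) * l2n x ≤ l2n (G *ᵥ x) := by
    intro x
    have h1 : V *ᵥ (G *ᵥ x) = Q *ᵥ x - F *ᵥ x := by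
      rw [hdec, Matrix.add_mulVec, add_sub_cancel_right, Matrix.mulVec_mulVec]
    have h2 := hVa (G *ᵥ x)
    have h3 := l2n_le_add_sub (Q *ᵥ x) (Q *ᵥ x - F *ᵥ x)
    rw [sub_sub_cancel, ← h1, hQ] at h3
    have h4 := hF x
    have h5 := l2n_nonneg x
    rw [div_mul_eq_mul_div, one_mul, div_le_iff₀ (by positivity)]
    nlinarith
  have hGb : OpBound G 2 := by
    intro x
    have h1 : V *ᵥ (G *ᵥ x) = Q *ᵥ x - F *ᵥ x := by
      rw [hdec, Matrix.add_mulVec, add_sub_cancel_right, Matrix.mulVec_mulVec]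
    have h2 := hV (G *ᵥ x)
    have h3 := l2n_sub_le (Q *ᵥ x) (F *ᵥ x)
    rw [← h1, hQ] at h3
    have h4 := hF x
    have h5 := l2n_nonneg x
    nlinarith
  obtain ⟨G', hGG', hG'G, hG'b⟩ := exists_inverse_of_lower_bound (by positivity) hG
  have hsub : ∀ f : Fin L → Fin (L + 1), Function.Injective f → OpBound (F.submatrix f id) e := by
    intro f hf x
    apply le_trans _ (hF x)
    apply le_of_sq_le_sq _ (l2n_nonneg _)
    rw [l2n_sq, l2n_sq]
    calc ∑ i, ‖(F.submatrix f id *ᵥ x) i‖ ^ 2 = ∑ i, ‖(F *ᵥ x) (f i)‖ ^ 2 := rfl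
      _ = ∑ i ∈ Finset.univ.map ⟨f, hf⟩, ‖(F *ᵥ x) i‖ ^ 2 := by rw [Finset.sum_map]; rfl
      _ ≤ _ := Finset.sum_le_sum_of_subset_of_nonneg (Finset.subset_univ _) fun _ _ _ => sq_nonneg _
  set V₀ := V.submatrix Fin.castSucc id with hV₀
  set F₀ := F.submatrix Fin.castSucc id with hF₀
  set F₁ := F.submatrix Fin.succ id with hF₁
  have hF₀b : OpBound F₀ e := hsub _ (Fin.castSucc_injective L)
  have hF₁b : OpBound F₁ e := hsub _ (Fin.succ_injective L)
  have hQ0 : Q.submatrix Fin.castSucc id = V₀ * G + F₀ := by rw [hdec]; rfl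
  have hQ1 : Q.submatrix Fin.succ id = V₀ * Matrix.diagonal z * G + F₁ := by rw [hdec, ← hV1]; rfl
  have hlow : ∀ x, 1 / (4 * a) * l2n x ≤ l2n (Q.submatrix Fin.castSucc id *ᵥ x) := by
    intro x
    have h1 : V₀ *ᵥ (G *ᵥ x) = Q.submatrix Fin.castSucc id *ᵥ x - F₀ *ᵥ x := by
      rw [hQ0, Matrix.add_mulVec, add_sub_cancel_right, Matrix.mulVec_mulVec]
    have h2 := hV0 (G *ᵥ x)
    have h3 := l2n_sub_le (Q.submatrix Fin.castSucc id *ᵥ x) (F₀ *ᵥ x)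
    rw [← h1] at h3
    have h4 := hF₀b x
    have h5 := hG x
    have h6 := l2n_nonneg x
    have h7 : e * l2n x ≤ 1 / (4 * a) * l2n x := by gcongr
    have h8 : 1 / (2 * a) * l2n x = 1 / (4 * a) * l2n x + 1 / (4 * a) * l2n x := by field_simp; ring
    linarith
  refine ⟨hlow, fun X hX => ?_⟩
  have hXb := hX.opBound (by positivity) hlow
  have hX1 := hX.mul_self_eq_one (by positivity) hlow
  set Z := Matrix.diagonal z with hZ
  have hZb : OpBound Z 1 := OpBound.diagonal zero_le_one (fun i => (hz i).le)
  -- From X Q₀ = 1 one gets X V₀ = G' - X F₀ G', and then X Q₁ = X V₀ Z G + X F₁ = G' Z G + X (F₁ -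
  -- F₀ G' Z G). Conjugation by G turns this into Z plus the matrix chosen here.
  refine ⟨G * (X * (F₁ - F₀ * (G' * (Z * G)))) * G', ?_, ?_⟩
  · have h1 : OpBound (G' * (Z * G)) (1 / (1 / (2 * a)) * (1 * 2)) :=
      hG'b.mul (hZb.mul hGb zero_le_one) (by positivity)
    have h2 := hF₁b.sub (hF₀b.mul h1 he)
    have h3 := hGb.mul (hXb.mul h2 (by positivity)) zero_le_two
    have h4 := h3.mul hG'b (by positivity)
    refine h4.mono ?_
    have : 2 * (1 / (1 / (4 * a)) * (e + e * (1 / (1 / (2 * a)) * (1 * 2)))) * (1 / (1 / (2 * a)))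
        = 16 * a ^ 2 * e * (1 + 4 * a) := by field_simp; ring
    rw [this]
    have h5 : 16 * a ^ 2 * e * (1 + 4 * a) ≤ 16 * a ^ 2 * e * (a + 4 * a) := by gcongr
    linarith [show 16 * a ^ 2 * e * (a + 4 * a) = 80 * a ^ 3 * e by ring]
  · have hXV : X * V₀ = G' - X * F₀ * G' := by
      have h1 : X * V₀ * G = 1 - X * F₀ := by
        rw [← hX1, hQ0, Matrix.mul_add, Matrix.mul_assoc]; abel
      calc X * V₀ = X * V₀ * G * G' := by rw [Matrix.mul_assoc (X * V₀), hGG', Matrix.mul_one]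
        _ = _ := by rw [h1, Matrix.sub_mul, Matrix.one_mul]
    have hsim : X * Q.submatrix Fin.succ id =
        G' * (Z + G * (X * (F₁ - F₀ * (G' * (Z * G)))) * G') * G := by
      have e1 : G' * (Z + G * (X * (F₁ - F₀ * (G' * (Z * G)))) * G') * G
          = G' * Z * G + (G' * G) * (X * (F₁ - F₀ * (G' * (Z * G)))) * (G' * G) := by
        simp only [Matrix.mul_add, Matrix.add_mul, Matrix.mul_assoc]
      rw [e1, hG'G, hQ1, Matrix.mul_add, Matrix.one_mul, Matrix.mul_one, ← Matrix.mul_assoc X,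
        ← Matrix.mul_assoc X, hXV]
      simp only [Matrix.mul_sub, Matrix.sub_mul, Matrix.mul_assoc]
      abel
    rw [hsim, Matrix.charpoly_mul_comm, ← Matrix.mul_assoc, hGG', Matrix.one_mul]

end Subspace

/-! ### Existence of the singular value decomposition -/

section SVD

-- The eigenvectors of AᴴA, sorted by decreasing eigenvalue, form W. The columns of A W are
-- orthogonal with norms σ; the nonzero ones are normalized and completed to an orthonormal basis,
-- which is U.
open scoped ComplexOrder in
theorem exists_isSVD {m : ℕ} (A : Matrix (Fin m) (Fin m) ℂ) : ∃ U W σ, IsSVD A U σ W := by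
  classical
  have hH := Matrix.isHermitian_conjTranspose_mul_self A
  have hpsd := Matrix.posSemidef_conjTranspose_mul_self A
  set ev := hH.eigenvalues with hev
  set s := Tuple.sort (fun i => - ev i) with hs
  set W : Matrix (Fin m) (Fin m) ℂ := (hH.eigenvectorUnitary : Matrix (Fin m) (Fin m) ℂ).submatrix id s with hW
  have hWW : Wᴴ * W = 1 := by
    rw [hW, Matrix.conjTranspose_submatrix, ← Matrix.submatrix_mul _ _ _ id _ Function.bijective_id]
    have : (hH.eigenvectorUnitary : Matrix (Fin m) (Fin m) ℂ)ᴴ * hH.eigenvectorUnitary = 1 :=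
      Unitary.coe_star_mul_self hH.eigenvectorUnitary
    rw [this, Matrix.submatrix_one_equiv]
  have hWW' : W * Wᴴ = 1 := mul_eq_one_comm.mp hWW
  set σ : Fin m → ℝ := fun i => Real.sqrt (ev (s i)) with hσ
  have hev0 : ∀ i, 0 ≤ ev i := fun i => hpsd.eigenvalues_nonneg i
  have hanti : Antitone σ := by
    intro i j hij
    apply Real.sqrt_le_sqrt
    have := Tuple.monotone_sort (fun i => - ev i) hij
    simp only [Function.comp] at this
    linarith
  have hgram : (A * W)ᴴ * (A * W) = Matrix.diagonal (fun i => ((σ i ^ 2 : ℝ) : ℂ)) := by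
    have hspec := hH.spectral_theorem
    have h1 : Aᴴ * A * W = W * Matrix.diagonal (fun i => ((ev (s i) : ℝ) : ℂ)) := by
      ext i j
      have h2 : (Aᴴ * A) * (hH.eigenvectorUnitary : Matrix (Fin m) (Fin m) ℂ)
          = (hH.eigenvectorUnitary : Matrix (Fin m) (Fin m) ℂ) * Matrix.diagonal (fun i => ((ev i : ℝ) : ℂ)) := by
        refine (congrArg (fun M => M * (hH.eigenvectorUnitary : Matrix (Fin m) (Fin m) ℂ)) hspec).trans ?_
        rw [Unitary.conjStarAlgAut_apply, mul_assoc, Unitary.coe_star_mul_self, mul_one]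
        rfl
      have h3 := congrFun (congrFun h2 i) (s j)
      rw [Matrix.mul_diagonal] at h3
      rw [Matrix.mul_diagonal]
      exact h3
    rw [Matrix.conjTranspose_mul, mul_assoc, ← mul_assoc Aᴴ, h1, ← mul_assoc, hWW, one_mul]
    congr 1; ext i
    rw [hσ, Real.sq_sqrt (hev0 _)]
  -- If σ i = 0 the inverse is 0 by convention and v i = 0; only the indices with σ i ≠ 0 are kept
  -- below.
  set v : Fin m → EuclideanSpace ℂ (Fin m) :=
    fun i => WithLp.toLp 2 (((σ i : ℂ)⁻¹) • (A * W).col i) with hv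
  have hinner : ∀ i j, inner ℂ (v i) (v j) = (σ i : ℂ)⁻¹ * (σ j : ℂ)⁻¹ * (if i = j then ((σ i ^ 2 : ℝ) : ℂ) else 0) := by
    intro i j
    have h := congrFun (congrFun hgram i) j
    rw [Matrix.diagonal_apply] at h
    have h' : (A * W).col j ⬝ᵥ star ((A * W).col i) = ((A * W)ᴴ * (A * W)) i j := by
      rw [dotProduct_comm]; rfl
    rw [← h, ← h', EuclideanSpace.inner_eq_star_dotProduct]
    simp only [hv, star_smul, smul_dotProduct, dotProduct_smul, smul_eq_mul, star_inv₀,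
      RCLike.star_def, Complex.conj_ofReal]
    ring
  have horth : Orthonormal ℂ (Set.domRestrict {i | σ i ≠ 0} v) := by
    rw [orthonormal_iff_ite]
    rintro ⟨i, hi⟩ ⟨j, hj⟩
    simp only [Set.domRestrict_apply]
    rw [hinner]
    by_cases hij : i = j
    · subst hij
      have : (σ i : ℂ) ≠ 0 := by exact_mod_cast hi
      simp only [if_true]
      push_cast; field_simp
    · simp [hij]
  obtain ⟨b, hb⟩ := horth.exists_orthonormalBasis_extension_of_card_eq (by simp)
  set U : Matrix (Fin m) (Fin m) ℂ := Matrix.of fun i j => b j i with hU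
  have hUU : Uᴴ * U = 1 := by
    ext i j
    have := orthonormal_iff_ite.mp b.orthonormal i j
    rw [Matrix.one_apply, ← this, EuclideanSpace.inner_eq_star_dotProduct]
    simp only [Matrix.mul_apply, hU, Matrix.conjTranspose_apply, Matrix.of_apply, dotProduct, Pi.star_apply]
    exact Finset.sum_congr rfl fun k _ => mul_comm _ _
  refine ⟨U, W, σ, Matrix.mem_unitaryGroup_iff'.mpr hUU, Matrix.mem_unitaryGroup_iff'.mpr hWW,
    fun i => Real.sqrt_nonneg _, hanti, ?_⟩
  have hAW : A * W = U * Matrix.diagonal (fun i => (σ i : ℂ)) := by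
    ext i j
    rw [Matrix.mul_diagonal]
    -- A vanishing singular value means that the whole column of A W vanishes, so any basis vector
    -- may stand in U.
    by_cases hj : σ j = 0
    · have h0 : ((A * W)ᴴ * (A * W)) j j = 0 := by
        rw [hgram, Matrix.diagonal_apply_eq, hj]; simp
      have h1 : ((l2n ((A * W).col j) ^ 2 : ℝ) : ℂ) = 0 := by
        rw [← dotProduct_star_self, ← h0]; rfl
      have h2 : l2n ((A * W).col j) = 0 := by
        have : l2n ((A * W).col j) ^ 2 = 0 := by exact_mod_cast h1
        exact pow_eq_zero_iff (by norm_num) |>.mp this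
      have h3 := congrFun (l2n_eq_zero.mp h2) i
      rw [hj]; simpa using h3
    · have := hb j hj
      have hσc : (σ j : ℂ) ≠ 0 := by exact_mod_cast hj
      have h4 : U i j = (σ j : ℂ)⁻¹ * (A * W) i j := by
        simp only [hU, Matrix.of_apply]
        rw [this]; simp [hv]
      rw [h4]; field_simp
  rw [← hAW, mul_assoc, hWW', mul_one]

end SVD

/-! ### Vandermonde factorization of the Hankel matrix and the accuracy of ESPRIT -/

section Esprit

/-- The Vandermonde matrix of the nodes `e^{-iθ}`. -/
noncomputable def vandermonde {S : ℕ} (m : ℕ) (θ : Fin S → ℝ) : Matrix (Fin m) (Fin S) ℂ :=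
  Matrix.of fun k j => Complex.exp (-(Complex.I * θ j)) ^ (k : ℕ)

theorem norm_exp_neg_I_mul (t : ℝ) : ‖Complex.exp (-(Complex.I * t))‖ = 1 := by
  rw [show -(Complex.I * (t : ℂ)) = ((-t : ℝ) : ℂ) * Complex.I by push_cast; ring]
  exact Complex.norm_exp_ofReal_mul_I _

/-- Ingham's inequality, read as a lower bound 1 for the smallest singular value. -/
theorem l2n_le_vandermonde {S m : ℕ} (hm : 0 < m) {θ : Fin S → ℝ}
    (hsep : ∀ i j, i ≠ j → 1 / (m : ℝ) ≤ circDist (θ i) (θ j)) (c : Fin S → ℂ) :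
    l2n c ≤ l2n (vandermonde m θ *ᵥ c) := by
  apply le_of_sq_le_sq _ (l2n_nonneg _)
  rw [l2n_sq, l2n_sq]
  refine (sum_sq_norm_le_exponential_sum hm θ hsep c).trans ?_
  rw [← Fin.sum_univ_eq_sum_range (fun k => ‖∑ j, c j * Complex.exp (-(Complex.I * θ j)) ^ k‖ ^ 2) m]
  refine le_of_eq (Finset.sum_congr rfl fun k _ => ?_)
  congr 2
  exact Finset.sum_congr rfl fun j _ => mul_comm _ _

theorem opBound_vandermonde {S m : ℕ} (hSm : S ≤ m) (θ : Fin S → ℝ) :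
    OpBound (vandermonde m θ) m := by
  have := opBound_of_entries (A := vandermonde m θ) (e := 1) zero_le_one (c := m)
    (fun i j => by simp only [vandermonde, Matrix.of_apply, norm_pow, norm_exp_neg_I_mul, one_pow, le_refl])
    (by positivity) (by
      simp only [Fintype.card_fin]
      have : (S : ℝ) ≤ m := by exact_mod_cast hSm
      rw [pow_two]; gcongr)
  simpa using this

/-- S - 1 linear conditions on S unknowns. This is the dimension count behind the min-max bound for
the S-th singular value. -/
theorem exists_ne_zero_forall_lt {S m : ℕ} (hS : 0 < S) (hm : S ≤ m) (B : Matrix (Fin m) (Fin S) ℂ) :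
    ∃ c : Fin S → ℂ, c ≠ 0 ∧ ∀ i : Fin m, (i : ℕ) + 1 < S → (B *ᵥ c) i = 0 := by
  set f : (Fin S → ℂ) →ₗ[ℂ] (Fin (S - 1) → ℂ) :=
    Matrix.toLin' (B.submatrix (Fin.castLE (by omega)) id) with hf
  have hk : LinearMap.ker f ≠ ⊥ := LinearMap.ker_ne_bot_of_finrank_lt (by simp; omega)
  obtain ⟨c, hc, hc0⟩ := (Submodule.ne_bot_iff _).mp hk
  refine ⟨c, hc0, fun i hi => ?_⟩
  rw [LinearMap.mem_ker] at hc
  have := congrFun hc ⟨i, by omega⟩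
  rw [hf, Matrix.toLin'_apply] at this
  exact this

/-- The first `S` left singular vectors of a perturbed Hankel matrix are close to the range of the
Vandermonde matrix. -/
theorem exists_subspace_decomposition {S m : ℕ} (hS : 0 < S) (hSm : S ≤ m)
    {Y U W Δ : Matrix (Fin m) (Fin m) ℂ} {σ : Fin m → ℝ} (hsvd : IsSVD Y U σ W)
    {V : Matrix (Fin m) (Fin S) ℂ} (hV : ∀ x, l2n x ≤ l2n (V *ᵥ x)) {p : Fin S → ℝ} {p₀ e : ℝ}
    (hp : ∀ j, p₀ ≤ p j) (hY : Y = V * Matrix.diagonal (fun j => (p j : ℂ)) * Vᵀ + Δ)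
    (he : 0 ≤ e) (hΔ : OpBound Δ e) (hep : e < p₀) :
    ∃ (G : Matrix (Fin S) (Fin S) ℂ) (F : Matrix (Fin m) (Fin S) ℂ),
      U.submatrix id (Fin.castLE hSm) = V * G + F ∧ OpBound F (e / (p₀ - e)) := by
  obtain ⟨hU, hW, hσ0, hσ, hdec⟩ := hsvd
  have hUU := Matrix.mem_unitaryGroup_iff'.mp hU
  have hWW := Matrix.mem_unitaryGroup_iff'.mp hW
  have hWW' := Matrix.mem_unitaryGroup_iff.mp hW
  rw [Matrix.star_eq_conjTranspose] at hUU hWW hWW'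
  have hp₀ : 0 < p₀ := by linarith
  -- Min-max: some w ≠ 0 in the span of the conjugated columns of V is orthogonal to the first S - 1
  -- right singular vectors, so ‖Y w‖ ≤ σ_S ‖w‖. On this span ‖Vᵀ w‖ ≥ ‖w‖, hence also ‖Y w‖ ≥ (p₀ -
  -- e) ‖w‖. The conjugation is needed since Y involves Vᵀ and not the adjoint of V.
  have hσlow : ∀ j : Fin S, p₀ - e ≤ σ (Fin.castLE hSm j) := by
    set last : Fin m := ⟨S - 1, by omega⟩ with hlast
    have hle : ∀ j : Fin S, σ last ≤ σ (Fin.castLE hSm j) := by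
      intro j; apply hσ; rw [Fin.le_def]; simp [hlast]; omega
    refine fun j => le_trans ?_ (hle j)
    obtain ⟨c, hc0, hc⟩ := exists_ne_zero_forall_lt hS hSm (Wᴴ * V.map star)
    set w := V.map star *ᵥ c with hw
    have hstarw : star w = V *ᵥ star c := by
      rw [hw]; ext i
      simp [Matrix.mulVec, dotProduct]
    have hcw : l2n c ≤ l2n w := by
      rw [← l2n_star c, ← l2n_star w, hstarw]; exact hV _
    have hwpos : 0 < l2n w := (l2n_pos hc0).trans_le hcw
    have hVw : l2n w ≤ l2n (Vᵀ *ᵥ w) := by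
      have h1 : ((l2n w ^ 2 : ℝ) : ℂ) = star c ⬝ᵥ (Vᵀ *ᵥ w) := by
        rw [← dotProduct_star_self, Matrix.dotProduct_mulVec (star c), Matrix.vecMul_transpose, ← hstarw]
      have h2 : l2n w ^ 2 ≤ l2n w * l2n (Vᵀ *ᵥ w) := by
        calc l2n w ^ 2 = ‖((l2n w ^ 2 : ℝ) : ℂ)‖ := by
              rw [Complex.norm_real, Real.norm_eq_abs, abs_of_nonneg (sq_nonneg _)]
          _ ≤ l2n (star c) * l2n (Vᵀ *ᵥ w) := by rw [h1]; exact norm_dotProduct_le _ _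
          _ ≤ l2n w * l2n (Vᵀ *ᵥ w) := by rw [l2n_star]; gcongr; exact l2n_nonneg _
      nlinarith
    have hlow : p₀ * l2n w ≤ l2n (Y *ᵥ w) + e * l2n w := by
      have h1 : p₀ * l2n (Vᵀ *ᵥ w) ≤ l2n (Matrix.diagonal (fun j => (p j : ℂ)) *ᵥ (Vᵀ *ᵥ w)) := by
        apply le_of_sq_le_sq _ (l2n_nonneg _)
        rw [mul_pow, l2n_sq, l2n_sq, Finset.mul_sum]
        refine Finset.sum_le_sum fun i _ => ?_
        rw [Matrix.mulVec_diagonal, norm_mul, mul_pow]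
        gcongr
        rw [Complex.norm_real]
        exact (hp i).trans (le_abs_self _)
      have h2 := hV (Matrix.diagonal (fun j => (p j : ℂ)) *ᵥ (Vᵀ *ᵥ w))
      have h3 : V *ᵥ (Matrix.diagonal (fun j => (p j : ℂ)) *ᵥ (Vᵀ *ᵥ w)) = Y *ᵥ w - Δ *ᵥ w := by
        rw [hY, Matrix.add_mulVec, add_sub_cancel_right, Matrix.mulVec_mulVec, Matrix.mulVec_mulVec]
      rw [h3] at h2
      have h4 := l2n_sub_le (Y *ᵥ w) (Δ *ᵥ w)
      have h5 := hΔ w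
      nlinarith
    have hup : l2n (Y *ᵥ w) ≤ σ last * l2n w := by
      have h1 : Y *ᵥ w = U *ᵥ (Matrix.diagonal (fun i => (σ i : ℂ)) *ᵥ (Wᴴ *ᵥ w)) := by
        rw [hdec, mul_assoc, ← Matrix.mulVec_mulVec, ← Matrix.mulVec_mulVec]
      have h2 : l2n (Wᴴ *ᵥ w) = l2n w :=
        l2n_mulVec_of_isometry (by rw [Matrix.conjTranspose_conjTranspose]; exact hWW') w
      rw [h1, l2n_mulVec_of_isometry hUU, ← h2]
      apply l2n_le_of_sq_le (hσ0 _)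
      rw [Finset.mul_sum]
      refine Finset.sum_le_sum fun i _ => ?_
      rw [Matrix.mulVec_diagonal, norm_mul, mul_pow]
      by_cases hi : (i : ℕ) + 1 < S
      · have : (Wᴴ *ᵥ w) i = 0 := by rw [hw, Matrix.mulVec_mulVec]; exact hc i hi
        rw [this]; simp
      · gcongr
        rw [Complex.norm_real, Real.norm_eq_abs, abs_of_nonneg (hσ0 i)]
        apply hσ; rw [Fin.le_def]; simp [hlast]; omega
    have : p₀ * l2n w ≤ (σ last + e) * l2n w := by linarith
    have := le_of_mul_le_mul_right this hwpos
    linarith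
  set WS := W.submatrix id (Fin.castLE hSm) with hWS
  set US := U.submatrix id (Fin.castLE hSm) with hUS
  set D := Matrix.diagonal (fun j : Fin S => ((σ (Fin.castLE hSm j) : ℂ))⁻¹) with hD
  -- The singular vectors are written as Y applied to something bounded; inserting the two parts of
  -- Y gives the part in the range of V and the remainder.
  have hYW : Y * WS * D = US := by
    have h1 : Y * W = U * Matrix.diagonal (fun i => (σ i : ℂ)) := by
      rw [hdec, mul_assoc, hWW, mul_one]
    ext i j
    have h2 := congrFun (congrFun h1 i) (Fin.castLE hSm j)
    rw [Matrix.mul_diagonal] at h2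
    have h3 : (Y * WS) i j = (Y * W) i (Fin.castLE hSm j) := rfl
    have h4 : (σ (Fin.castLE hSm j) : ℂ) ≠ 0 := by
      have := hσlow j
      have : σ (Fin.castLE hSm j) ≠ 0 := by linarith
      exact_mod_cast this
    rw [hD, Matrix.mul_diagonal, h3, h2, mul_assoc, mul_inv_cancel₀ h4, mul_one]
    rfl
  refine ⟨Matrix.diagonal (fun j => (p j : ℂ)) * Vᵀ * WS * D, Δ * WS * D, ?_, ?_⟩
  · rw [← hYW, hY]
    simp only [Matrix.add_mul, Matrix.mul_assoc]
  · have hWSb : OpBound WS 1 := by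
      intro x
      rw [one_mul, l2n_mulVec_of_isometry]
      rw [hWS, Matrix.conjTranspose_submatrix, ← Matrix.submatrix_mul _ _ _ id _ Function.bijective_id, hWW]
      exact Matrix.submatrix_one _ (Fin.castLE_injective hSm)
    have hDb : OpBound D (1 / (p₀ - e)) := by
      apply OpBound.diagonal (by apply div_nonneg <;> linarith)
      intro j
      rw [norm_inv, Complex.norm_real, Real.norm_eq_abs, abs_of_nonneg (hσ0 _), ← one_div]
      exact one_div_le_one_div_of_le (by linarith) (hσlow j)
    refine ((hΔ.mul hWSb he).mul hDb (by linarith)).mono ?_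
    rw [mul_one, mul_one_div]

/-- The chord between two points of the circle is at least the scaled arc length. -/
theorem four_mul_circDist_le (a b : ℝ) :
    4 * circDist a b ≤ ‖Complex.exp (-(Complex.I * a)) - Complex.exp (-(Complex.I * b))‖ := by
  obtain ⟨n, hn⟩ := exists_circDist_eq a b
  have hpi := Real.pi_pos
  set t := a - b - 2 * π * n with ht
  have h1 : Complex.exp (-(Complex.I * a)) = Complex.exp (-(Complex.I * b)) * Complex.exp (-(Complex.I * t)) := by
    rw [← Complex.exp_add, Complex.exp_eq_exp_iff_exists_int]
    refine ⟨-n, ?_⟩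
    rw [ht]; push_cast; ring
  have h2 : ‖Complex.exp (-(Complex.I * a)) - Complex.exp (-(Complex.I * b))‖ = ‖Complex.exp (Complex.I * (-t : ℝ)) - 1‖ := by
    rw [h1, ← mul_sub_one, norm_mul, norm_exp_neg_I_mul, one_mul]
    congr 3; push_cast; ring
  rw [h2, Complex.norm_exp_I_mul_ofReal_sub_one, norm_mul, Real.norm_eq_abs, Real.norm_eq_abs, abs_two]
  have h3 : |t| ≤ π := by rw [← hn]; have := circDist_le_half a b; nlinarith
  have h4 : 2 / π * |(-t) / 2| ≤ |Real.sin ((-t) / 2)| := Real.mul_abs_le_abs_sin (by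
    rw [abs_div, abs_neg, abs_two]; linarith)
  rw [abs_div, abs_neg, abs_two, ← hn] at h4
  have : 2 / π * (circDist a b * (2 * π) / 2) = 2 * circDist a b := by field_simp
  linarith

theorem norm_exp_sub_exp_le (a b : ℝ) :
    ‖Complex.exp (-(Complex.I * a)) - Complex.exp (-(Complex.I * b))‖ ≤ circDist a b * (2 * π) := by
  obtain ⟨n, hn⟩ := exists_circDist_eq a b
  set t := a - b - 2 * π * n with ht
  have h1 : Complex.exp (-(Complex.I * a)) = Complex.exp (-(Complex.I * b)) * Complex.exp (-(Complex.I * t)) := by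
    rw [← Complex.exp_add, Complex.exp_eq_exp_iff_exists_int]
    refine ⟨-n, ?_⟩
    rw [ht]; push_cast; ring
  have h2 : ‖Complex.exp (-(Complex.I * a)) - Complex.exp (-(Complex.I * b))‖ = ‖Complex.exp (Complex.I * (-t : ℝ)) - 1‖ := by
    rw [h1, ← mul_sub_one, norm_mul, norm_exp_neg_I_mul, one_mul]
    congr 3; push_cast; ring
  rw [h2, hn]
  exact (Real.norm_exp_I_mul_ofReal_sub_one_le).trans (by rw [Real.norm_eq_abs, abs_neg])

/-- The exponential sum with weights `p` and frequencies `E`. -/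
noncomputable def expSignal {S : ℕ} (p E : Fin S → ℝ) (k : ℕ) : ℂ :=
  ∑ j, (p j : ℂ) * Complex.exp (-(Complex.I * E j)) ^ k

theorem vandermonde_succ_eq {S L : ℕ} (E : Fin S → ℝ) :
    (vandermonde (L + 1) E).submatrix Fin.succ id =
      (vandermonde (L + 1) E).submatrix Fin.castSucc id *
        Matrix.diagonal (fun j => Complex.exp (-(Complex.I * E j))) := by
  ext i j
  rw [Matrix.mul_diagonal]
  simp [vandermonde, pow_succ]

variable {S L : ℕ} {y : Fin (2 * L + 1) → ℂ} {E p : Fin S → ℝ} {p₀ ε : ℝ}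

/-- The exact Hankel matrix factorizes because z^(a+b) = z^a z^b. -/
theorem hankel_eq_add (hy : ∀ k, ‖y k - expSignal p E k‖ ≤ ε) :
    ∃ Δ : Matrix (Fin (L + 1)) (Fin (L + 1)) ℂ, (∀ i j, ‖Δ i j‖ ≤ ε) ∧
      hankel y = vandermonde (L + 1) E * Matrix.diagonal (fun j => (p j : ℂ)) *
        (vandermonde (L + 1) E)ᵀ + Δ := by
  refine ⟨hankel y - vandermonde (L + 1) E * Matrix.diagonal (fun j => (p j : ℂ)) *
    (vandermonde (L + 1) E)ᵀ, fun i j => ?_, by abel⟩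
  have h := hy ⟨i.val + j.val, by have := i.isLt; have := j.isLt; omega⟩
  convert h using 2
  rw [Matrix.sub_apply, Matrix.mul_apply]
  congr 1
  unfold expSignal
  refine Finset.sum_congr rfl fun l _ => ?_
  rw [Matrix.mul_diagonal, Matrix.transpose_apply]
  simp only [vandermonde, Matrix.of_apply]
  rw [pow_add]; ring

/-- With a = L + 1, the Hankel error is at most aε, the singular vectors deviate by e = 2aε/p₀, and
80a³e = 160a⁴ε/p₀. The separation is required for L and not L + 1 rows because the submatrix without
the last row has to be bounded below as well. -/
theorem singular_subspace_perturbation (hS : S ≤ L) (hS0 : 0 < S) (hp : ∀ j, p₀ ≤ p j)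
    (hsep : ∀ i j, i ≠ j → 1 / (L : ℝ) ≤ circDist (E i) (E j))
    (hy : ∀ k, ‖y k - expSignal p E k‖ ≤ ε) (hε0 : 0 ≤ ε) (hp₀ : 0 < p₀)
    (hε : 1000 * ((L : ℝ) + 1) ^ 5 * ε ≤ p₀) {U W : Matrix (Fin (L + 1)) (Fin (L + 1)) ℂ}
    {σ : Fin (L + 1) → ℝ} (hsvd : IsSVD (hankel y) U σ W) :
    (∀ x, 1 / (4 * ((L : ℝ) + 1)) * l2n x ≤
      l2n ((U.submatrix id (Fin.castLE (Nat.le_succ_of_le hS))).submatrix Fin.castSucc id *ᵥ x)) ∧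
    ∀ X, IsMoorePenrose ((U.submatrix id (Fin.castLE (Nat.le_succ_of_le hS))).submatrix Fin.castSucc id) X →
      ∃ M : Matrix (Fin S) (Fin S) ℂ, OpBound M (160 * ((L : ℝ) + 1) ^ 4 * ε / p₀) ∧
        (X * (U.submatrix id (Fin.castLE (Nat.le_succ_of_le hS))).submatrix Fin.succ id).charpoly =
          (Matrix.diagonal (fun j => Complex.exp (-(Complex.I * E j))) + M).charpoly := by
  have hL : 0 < L := by omega
  have hL' : (0 : ℝ) < L := by exact_mod_cast hL
  set a : ℝ := (L : ℝ) + 1 with ha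
  have ha1 : 1 ≤ a := by linarith
  have ha5 : a * ε ≤ a ^ 5 * ε ∧ a ^ 2 * ε ≤ a ^ 5 * ε := by
    refine ⟨?_, ?_⟩ <;> gcongr ?_ * ε
    · exact le_self_pow₀ ha1 (by norm_num)
    · exact pow_le_pow_right₀ ha1 (by norm_num)
  have hsep' : ∀ i j, i ≠ j → 1 / ((L + 1 : ℕ) : ℝ) ≤ circDist (E i) (E j) := by
    intro i j hij
    refine le_trans ?_ (hsep i j hij)
    apply one_div_le_one_div_of_le hL'
    push_cast; linarith
  have hV := l2n_le_vandermonde (m := L + 1) (by omega) hsep'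
  obtain ⟨Δ, hΔ, hdec⟩ := hankel_eq_add hy
  have hΔb : OpBound Δ (a * ε) := opBound_of_entries hε0 hΔ (by positivity) (by
    simp only [Fintype.card_fin]; push_cast; rw [ha]; linarith [sq ((L : ℝ) + 1)])
  have haε : a * ε ≤ p₀ / 2 := by linarith
  obtain ⟨G, F, hUS, hF⟩ := exists_subspace_decomposition hS0 (Nat.le_succ_of_le hS) hsvd hV hp hdec
    (by positivity) hΔb (by linarith)
  have hF' : OpBound F (2 * a * ε / p₀) := by
    refine hF.mono ?_
    rw [div_le_div_iff₀ (by linarith) hp₀]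
    nlinarith [mul_nonneg (by linarith : (0:ℝ) ≤ a) hε0]
  have hQ : ∀ x, l2n (U.submatrix id (Fin.castLE (Nat.le_succ_of_le hS)) *ᵥ x) = l2n x := by
    intro x
    apply l2n_mulVec_of_isometry
    have hUU := Matrix.mem_unitaryGroup_iff'.mp hsvd.1
    rw [Matrix.star_eq_conjTranspose] at hUU
    rw [Matrix.conjTranspose_submatrix, ← Matrix.submatrix_mul _ _ _ id _ Function.bijective_id, hUU]
    exact Matrix.submatrix_one _ (Fin.castLE_injective _)
  have hV0 : ∀ x, l2n x ≤ l2n ((vandermonde (L + 1) E).submatrix Fin.castSucc id *ᵥ x) := by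
    have : (vandermonde (L + 1) E).submatrix Fin.castSucc id = vandermonde L E := by
      ext i j; simp [vandermonde]
    rw [this]
    exact l2n_le_vandermonde hL hsep
  have hVa : OpBound (vandermonde (L + 1) E) a := by
    have := opBound_vandermonde (m := L + 1) (Nat.le_succ_of_le hS) E
    refine this.mono ?_
    push_cast; exact le_rfl
  have main := shift_invariance_perturbation ha1 (e := 2 * a * ε / p₀) (by positivity)
    (by rw [mul_div_assoc', div_le_one hp₀]; nlinarith) (fun j => norm_exp_neg_I_mul (E j)) hVa hV hV0
    (vandermonde_succ_eq E) hQ hUS hF'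
  refine ⟨main.1, fun X hX => ?_⟩
  obtain ⟨M, hM, hch⟩ := main.2 X hX
  refine ⟨M, hM.mono (le_of_eq ?_), hch⟩
  ring

/-- Every output of ESPRIT is close to the true frequencies if the noise is small. -/
theorem IsEspritOutput.exists_perm (hS : S ≤ L) (hS0 : 0 < S) (hp : ∀ j, p₀ ≤ p j)
    (hsep : ∀ i j, i ≠ j → 1 / (L : ℝ) ≤ circDist (E i) (E j))
    (hy : ∀ k, ‖y k - expSignal p E k‖ ≤ ε) (hε0 : 0 ≤ ε) (hp₀ : 0 < p₀)
    (hε : 1000 * ((L : ℝ) + 1) ^ 5 * ε ≤ p₀) {Et : Fin S → ℝ} (hEt : IsEspritOutput hS y Et) :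
    ∃ s : Equiv.Perm (Fin S), ∀ j, circDist (Et (s j)) (E j) ≤ 80 * ((L : ℝ) + 1) ^ 4 * ε / p₀ := by
  obtain ⟨U, W, σ, U₀, U₁, X, z, hsvd, hU₀, hU₁, hX, hroots, hz⟩ := hEt
  have hL' : (0 : ℝ) < L := by exact_mod_cast (by omega : 0 < L)
  have e0 : U₀ = (U.submatrix id (Fin.castLE (Nat.le_succ_of_le hS))).submatrix Fin.castSucc id := by
    ext i j; exact hU₀ i j
  have e1 : U₁ = (U.submatrix id (Fin.castLE (Nat.le_succ_of_le hS))).submatrix Fin.succ id := by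
    ext i j; exact hU₁ i j
  obtain ⟨-, h2⟩ := singular_subspace_perturbation hS hS0 hp hsep hy hε0 hp₀ hε hsvd
  rw [e0] at hX
  obtain ⟨M, hM, hch⟩ := h2 X hX
  rw [e1, hch] at hroots
  set η := 160 * ((L : ℝ) + 1) ^ 4 * ε / p₀ with hη
  have hη0 : 0 ≤ η := by positivity
  -- Separation 1/L on the circle makes the chords at least 4/L. The factor 1000 (L + 1)^5 in the
  -- hypothesis keeps the perturbation below a quarter of that.
  have hηg : 4 * η < 4 / (L : ℝ) := by
    have h3 : η * ((L : ℝ) + 1) ≤ 1 / 2 := by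
      rw [hη, div_mul_eq_mul_div, div_le_iff₀ hp₀]
      have : 160 * ((L : ℝ) + 1) ^ 4 * ε * (L + 1) = 160 * (((L : ℝ) + 1) ^ 5 * ε) := by ring
      rw [this]; linarith
    rw [lt_div_iff₀ hL']; nlinarith
  obtain ⟨s, hs⟩ := exists_perm_of_perturbed_diagonal (g := 4 / (L : ℝ)) hM hη0 (fun i j hij => by
    refine le_trans ?_ (four_mul_circDist_le (E i) (E j))
    have := hsep i j hij
    rw [show 4 / (L : ℝ) = 4 * (1 / L) by ring]; linarith) hηg hroots
  refine ⟨s, fun j => ?_⟩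
  have h4 := four_mul_circDist_le (Et (s j)) (E j)
  obtain ⟨-, -, hzj⟩ := hz (s j)
  -- Moving the eigenvalue radially to the unit circle costs the distance of its modulus from 1,
  -- which is at most η again. The total chord 2η corresponds to a circle distance η/2.
  have h5 : ‖Complex.exp (-(Complex.I * Et (s j))) - z (s j)‖ ≤ η := by
    have h6 : Complex.exp (-(Complex.I * Et (s j))) - z (s j)
        = ((1 - ‖z (s j)‖ : ℝ) : ℂ) * Complex.exp (-(Complex.I * Et (s j))) := by
      nth_rw 1 [hzj]; push_cast; ring
    rw [h6, norm_mul, norm_exp_neg_I_mul, mul_one, Complex.norm_real, Real.norm_eq_abs]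
    have h7 := abs_norm_sub_norm_le (z (s j)) (Complex.exp (-(Complex.I * E j)))
    rw [norm_exp_neg_I_mul, abs_sub_comm] at h7
    exact h7.trans (hs j)
  have h8 := norm_add_le (Complex.exp (-(Complex.I * Et (s j))) - z (s j))
    (z (s j) - Complex.exp (-(Complex.I * E j)))
  rw [sub_add_sub_cancel] at h8
  have h9 := hs j
  have : 80 * ((L : ℝ) + 1) ^ 4 * ε / p₀ = η / 2 := by rw [hη]; ring
  rw [this]
  linarith

theorem exists_polar_angle (w : ℂ) :
    ∃ t : ℝ, 0 ≤ t ∧ t < 2 * π ∧ w = (‖w‖ : ℂ) * Complex.exp (-(Complex.I * (t : ℂ))) := by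
  have hp := Real.two_pi_pos
  refine ⟨toIcoMod hp 0 (-Complex.arg w), (toIcoMod_mem_Ico hp 0 _).1, ?_, ?_⟩
  · have := (toIcoMod_mem_Ico hp 0 (-Complex.arg w)).2
    linarith
  · nth_rw 1 [← Complex.norm_mul_exp_arg_mul_I w]
    congr 1
    rw [Complex.exp_eq_exp_iff_exists_int, toIcoMod]
    refine ⟨- toIcoDiv hp 0 (-Complex.arg w), ?_⟩
    push_cast [zsmul_eq_mul]; ring

/-- The steps that could fail are the pseudoinverse, which exists since U₀ is injective, and the
list of eigenvalues, which is complete over ℂ. -/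
theorem exists_isEspritOutput (hS : S ≤ L) (hS0 : 0 < S) (hp : ∀ j, p₀ ≤ p j)
    (hsep : ∀ i j, i ≠ j → 1 / (L : ℝ) ≤ circDist (E i) (E j))
    (hy : ∀ k, ‖y k - expSignal p E k‖ ≤ ε) (hε0 : 0 ≤ ε) (hp₀ : 0 < p₀)
    (hε : 1000 * ((L : ℝ) + 1) ^ 5 * ε ≤ p₀) : ∃ Et : Fin S → ℝ, IsEspritOutput hS y Et := by
  obtain ⟨U, W, σ, hsvd⟩ := exists_isSVD (hankel y)
  obtain ⟨h1, -⟩ := singular_subspace_perturbation hS hS0 hp hsep hy hε0 hp₀ hε hsvd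
  obtain ⟨X, hX⟩ := exists_isMoorePenrose (by positivity) h1
  set A := X * (U.submatrix id (Fin.castLE (Nat.le_succ_of_le hS))).submatrix Fin.succ id
  have hcard : A.charpoly.roots.card = S := by
    rw [IsAlgClosed.card_roots_eq_natDegree, Matrix.charpoly_natDegree_eq_dim, Fintype.card_fin]
  obtain ⟨l, hl⟩ := Quot.exists_rep A.charpoly.roots
  have hlen : l.length = S := by rw [← hcard, ← hl]; rfl
  set z : Fin S → ℂ := fun i => l.get (Fin.cast hlen.symm i) with hz
  choose t ht using fun i => exists_polar_angle (z i)
  refine ⟨t, U, W, σ, _, _, X, z, hsvd, fun _ _ => rfl, fun _ _ => rfl, hX, ?_, ht⟩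
  change A.charpoly.roots = _
  rw [← hl]
  subst hlen
  change (l : Multiset ℂ) = Multiset.map _ ((List.finRange l.length : List (Fin l.length)) : Multiset (Fin l.length))
  rw [Multiset.map_coe, hz]
  congr 1
  exact (List.map_get_finRange l).symm

end Esprit

/-! ### Uniformly controlled one-qubit operators -/

section Blocks

variable {ι : Type} [Fintype ι] [DecidableEq ι]

/-- The operator that applies the one-qubit operator `w x` to qubit `t` of the basis state `x`. -/
def blockOp (t : ι) (w : Bits ι → Matrix (Fin 2) (Fin 2) ℂ) : QOp ι :=
  Matrix.of fun x y => if ∀ i, i ≠ t → x i = y i then w x (x t) (y t) else 0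

/-- The family `w` does not depend on qubit `t`. -/
def IndepOf (t : ι) {α : Type*} (w : Bits ι → α) : Prop := ∀ x b, w (Function.update x t b) = w x

theorem matrix_ext_mulVec {κ : Type*} [Fintype κ] [DecidableEq κ] {A B : Matrix κ κ ℂ} (h : ∀ v, A *ᵥ v = B *ᵥ v) :
    A = B := Matrix.toLin'.injective (LinearMap.ext h)

theorem blockOp_mulVec (t : ι) (w : Bits ι → Matrix (Fin 2) (Fin 2) ℂ) (v : Bits ι → ℂ) (x : Bits ι) :
    (blockOp t w *ᵥ v) x = ∑ b, w x (x t) b * v (Function.update x t b) := by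
  have hinj : Function.Injective (fun b : Fin 2 => Function.update x t b) := Function.update_injective x t
  rw [Matrix.mulVec, dotProduct, ← Finset.sum_subset (Finset.subset_univ (Finset.univ.map ⟨_, hinj⟩)),
    Finset.sum_map]
  · refine Finset.sum_congr rfl fun b _ => ?_
    have : ∀ i, i ≠ t → x i = Function.update x t b i := fun i hi => by
      rw [Function.update_of_ne hi]
    simp only [blockOp, Matrix.of_apply, Function.Embedding.coeFn_mk, if_pos this, Function.update_self]
  · intro y _ hy
    rw [Finset.mem_map] at hy
    push Not at hy
    have : ¬ ∀ i, i ≠ t → x i = y i := by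
      intro h
      refine hy (y t) (Finset.mem_univ _) ?_
      ext i
      by_cases hi : i = t
      · subst hi; simp
      · simp [Function.update_of_ne hi, h i hi]
    simp only [blockOp, Matrix.of_apply, if_neg this, zero_mul]

/-- The right factor reads its controls at a basis state whose qubit t has already been replaced, so
only w' has to be independent of t. -/
theorem blockOp_mul {t : ι} {w w' : Bits ι → Matrix (Fin 2) (Fin 2) ℂ} (hw' : IndepOf t w') :
    blockOp t w * blockOp t w' = blockOp t (fun x => w x * w' x) := by
  apply matrix_ext_mulVec
  intro v
  ext x
  rw [← Matrix.mulVec_mulVec, blockOp_mulVec, blockOp_mulVec]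
  simp_rw [blockOp_mulVec, hw' x, Function.update_self, Function.update_idem, Matrix.mul_apply,
    Finset.sum_mul, Finset.mul_sum]
  rw [Finset.sum_comm]
  refine Finset.sum_congr rfl fun b _ => Finset.sum_congr rfl fun c _ => ?_
  ring

theorem blockOp_one (t : ι) : blockOp t (fun _ => 1) = (1 : QOp ι) := by
  apply matrix_ext_mulVec
  intro v
  ext x
  rw [blockOp_mulVec, Matrix.one_mulVec]
  simp [Matrix.one_apply]

theorem blockOp_conjTranspose {t : ι} {w : Bits ι → Matrix (Fin 2) (Fin 2) ℂ} (hw : IndepOf t w) :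
    (blockOp t w)ᴴ = blockOp t (fun x => (w x)ᴴ) := by
  ext x y
  simp only [Matrix.conjTranspose_apply, blockOp, Matrix.of_apply]
  by_cases h : ∀ i, i ≠ t → x i = y i
  · have h' : ∀ i, i ≠ t → y i = x i := fun i hi => (h i hi).symm
    rw [if_pos h, if_pos h']
    have : y = Function.update x t (y t) := by
      ext i
      by_cases hi : i = t
      · subst hi; simp
      · simp [Function.update_of_ne hi, h' i hi]
    have h2 : w y = w x := by rw [this]; exact hw _ _
    rw [h2]
  · have h' : ¬ ∀ i, i ≠ t → y i = x i := fun h' => h fun i hi => (h' i hi).symm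
    rw [if_neg h, if_neg h', star_zero]

theorem blockOp_mem_unitaryGroup {t : ι} {w : Bits ι → Matrix (Fin 2) (Fin 2) ℂ} (hw : IndepOf t w)
    (hu : ∀ x, w x ∈ Matrix.unitaryGroup (Fin 2) ℂ) : blockOp t w ∈ Matrix.unitaryGroup (Bits ι) ℂ := by
  rw [Matrix.mem_unitaryGroup_iff, Matrix.star_eq_conjTranspose, blockOp_conjTranspose hw, blockOp_mul]
  · have : (fun x => w x * (w x)ᴴ) = fun _ => 1 := by
      ext1 x; exact Matrix.mem_unitaryGroup_iff.mp (hu x)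
    rw [this, blockOp_one]
  · intro x b; simp only [hw x b]

/-- Two basis states agree outside of `T`. -/
theorem actsOn_iff {T : Finset ι} {M : QOp ι} :
    ActsOn T M ↔ (∀ x y, (¬ ∀ i, i ∉ T → x i = y i) → M x y = 0) ∧
      ∀ x y x' y', (∀ i, i ∉ T → x i = y i) → (∀ i, i ∉ T → x' i = y' i) →
        (∀ i ∈ T, x i = x' i) → (∀ i ∈ T, y i = y' i) → M x y = M x' y' := by
  constructor
  · rintro ⟨m, hm⟩
    refine ⟨fun x y h => by rw [hm, if_neg h], fun x y x' y' h h' hx hy => ?_⟩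
    rw [hm, hm, if_pos h, if_pos h']
    congr 1
    · ext i; rw [hx i i.2]
    · ext i; rw [hy i i.2]
  · rintro ⟨h0, h1⟩
    refine ⟨Matrix.of fun a b => M (fun i => if h : i ∈ T then a ⟨i, h⟩ else 0)
      (fun i => if h : i ∈ T then b ⟨i, h⟩ else 0), fun x y => ?_⟩
    by_cases h : ∀ i, i ∉ T → x i = y i
    · rw [if_pos h, Matrix.of_apply]
      refine h1 _ _ _ _ h (fun i hi => by simp [hi]) (fun i hi => by simp [hi]) (fun i hi => by simp [hi])
    · rw [if_neg h, h0 _ _ h]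

theorem actsOn_blockOp {t : ι} {T : Finset ι} (ht : t ∈ T) {w : Bits ι → Matrix (Fin 2) (Fin 2) ℂ}
    (hw : ∀ x x', (∀ i ∈ T, i ≠ t → x i = x' i) → w x = w x') : ActsOn T (blockOp t w) := by
  rw [actsOn_iff]
  constructor
  · intro x y h
    have : ¬ ∀ i, i ≠ t → x i = y i := fun h' => h fun i hi => h' i (fun e => hi (e ▸ ht))
    simp only [blockOp, Matrix.of_apply, if_neg this]
  · intro x y x' y' h h' hx hy
    simp only [blockOp, Matrix.of_apply]
    have hiff : (∀ i, i ≠ t → x i = y i) ↔ (∀ i, i ≠ t → x' i = y' i) := by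
      refine forall_congr' fun i => imp_congr_right fun _ => ?_
      by_cases hi : i ∈ T
      · rw [hx i hi, hy i hi]
      · simp [h i hi, h' i hi]
    rw [hw x x' (fun i hi _ => hx i hi), hx t ht, hy t ht]
    simp only [hiff]

end Blocks

/-! ### Products of one- and two-qubit gates -/

section Compile

variable {ι : Type} [Fintype ι] [DecidableEq ι]

/-- The operator is a product of at most `k` one- and two-qubit gates. -/
def Compiles (k : ℕ) (M : QOp ι) : Prop :=
  ∃ B : List (QOp ι), (∀ g ∈ B, IsGate g) ∧ B.length ≤ k ∧ circuitOp B = M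

theorem circuitOp_append (A B : List (QOp ι)) : circuitOp (A ++ B) = circuitOp B * circuitOp A := by
  simp [circuitOp, List.reverse_append, List.prod_append]

theorem Compiles.mono {k k' : ℕ} {M : QOp ι} (h : Compiles k M) (hk : k ≤ k') : Compiles k' M := by
  obtain ⟨B, h1, h2, h3⟩ := h; exact ⟨B, h1, h2.trans hk, h3⟩

theorem Compiles.mul {k k' : ℕ} {M M' : QOp ι} (h : Compiles k M) (h' : Compiles k' M') :
    Compiles (k + k') (M * M') := by
  obtain ⟨B, h1, h2, h3⟩ := h
  obtain ⟨B', h1', h2', h3'⟩ := h'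
  refine ⟨B' ++ B, ?_, ?_, by rw [circuitOp_append, h3, h3']⟩
  · intro g hg
    rcases List.mem_append.mp hg with hg | hg
    · exact h1' g hg
    · exact h1 g hg
  · rw [List.length_append]; omega

theorem compiles_one (k : ℕ) : Compiles k (1 : QOp ι) := ⟨[], by simp, by simp, by simp [circuitOp]⟩

theorem IsGate.compiles {M : QOp ι} (h : IsGate M) : Compiles 1 M :=
  ⟨[M], by simpa using h, by simp, by simp [circuitOp]⟩

theorem ActsOn.conjTranspose {T : Finset ι} {M : QOp ι} (h : ActsOn T M) : ActsOn T Mᴴ := by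
  obtain ⟨m, hm⟩ := h
  refine ⟨mᴴ, fun x y => ?_⟩
  rw [Matrix.conjTranspose_apply, hm]
  by_cases h : ∀ i, i ∉ T → y i = x i
  · have h' : ∀ i, i ∉ T → x i = y i := fun i hi => (h i hi).symm
    rw [if_pos h, if_pos h', Matrix.conjTranspose_apply]
  · have h' : ¬ ∀ i, i ∉ T → x i = y i := fun h' => h fun i hi => (h' i hi).symm
    rw [if_neg h, if_neg h', star_zero]

theorem IsGate.conjTranspose {M : QOp ι} (h : IsGate M) : IsGate Mᴴ := by
  obtain ⟨hu, T, hT, hc, ha⟩ := h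
  exact ⟨Unitary.star_mem hu, T, hT, hc, ha.conjTranspose⟩

theorem Compiles.conjTranspose {k : ℕ} {M : QOp ι} (h : Compiles k M) : Compiles k Mᴴ := by
  obtain ⟨B, h1, h2, h3⟩ := h
  refine ⟨(B.map Matrix.conjTranspose).reverse, ?_, by simpa using h2, ?_⟩
  · intro g hg
    rw [List.mem_reverse, List.mem_map] at hg
    obtain ⟨g', hg', rfl⟩ := hg
    exact (h1 g' hg').conjTranspose
  · rw [← h3, circuitOp, circuitOp, Matrix.conjTranspose_list_prod, List.map_reverse]

/-- Every unitary matrix has a unitary square root. -/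
theorem exists_unitary_sqrt (u : Matrix (Fin 2) (Fin 2) ℂ) (hu : u ∈ Matrix.unitaryGroup (Fin 2) ℂ) :
    ∃ v ∈ Matrix.unitaryGroup (Fin 2) ℂ, v * v = u := by
  open scoped Matrix.Norms.L2Operator in
  have hn : IsStarNormal u := ⟨by
    have h1 := Matrix.mem_unitaryGroup_iff.mp hu
    have h2 := Matrix.mem_unitaryGroup_iff'.mp hu
    rw [Commute, SemiconjBy, h1, h2]⟩
  -- A square root on the unit circle. Its jump at the branch cut is harmless for the functional
  -- calculus since the spectrum is finite.
  set f : ℂ → ℂ := fun z => Complex.exp (Complex.I * (Complex.arg z / 2)) with hf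
  have hfin : (spectrum ℂ u).Finite := Matrix.finite_spectrum u
  have hcont : ∀ g : ℂ → ℂ, ContinuousOn g (spectrum ℂ u) := fun g => hfin.continuousOn g
  have hspec : ∀ z ∈ spectrum ℂ u, ‖z‖ = 1 := fun z hz => by
    have := spectrum.subset_circle_of_unitary hu hz
    simpa using this
  refine ⟨cfc f u, ?_, ?_⟩
  · rw [Matrix.mem_unitaryGroup_iff, ← cfc_star, ← cfc_mul _ _ u (hcont _) (hcont _)]
    rw [← cfc_one ℂ u]
    refine cfc_congr fun z hz => ?_
    simp only [hf, Pi.one_apply]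
    rw [RCLike.star_def, Complex.mul_conj']
    have : ‖Complex.exp (Complex.I * (Complex.arg z / 2))‖ = 1 := by
      rw [show Complex.I * ((Complex.arg z : ℂ) / 2) = ((Complex.arg z / 2 : ℝ) : ℂ) * Complex.I by
        push_cast; ring]
      exact Complex.norm_exp_ofReal_mul_I _
    rw [this]; simp
  · rw [← cfc_mul _ _ u (hcont _) (hcont _)]
    conv_rhs => rw [← cfc_id' ℂ u]
    refine cfc_congr fun z hz => ?_
    simp only [hf]
    rw [← Complex.exp_add]
    conv_rhs => rw [← Complex.norm_mul_exp_arg_mul_I z, hspec z hz]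
    rw [Complex.ofReal_one, one_mul]
    congr 1; ring

end Compile

/-! ### Exact compilation of unitaries by state preparation and rank-one phases -/

section Controlled

variable {ι : Type} [Fintype ι] [DecidableEq ι]

theorem fin_two_cases (b : Fin 2) : b = 0 ∨ b = 1 := by fin_cases b <;> simp

/-- The bit flip. -/
def flipMat : Matrix (Fin 2) (Fin 2) ℂ := !![0, 1; 1, 0]

theorem flipMat_mem : flipMat ∈ Matrix.unitaryGroup (Fin 2) ℂ := by
  rw [Matrix.mem_unitaryGroup_iff]
  ext i j
  fin_cases i <;> fin_cases j <;> simp [flipMat, Matrix.mul_apply, Matrix.star_eq_conjTranspose, Matrix.conjTranspose_apply]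

theorem isGate_blockOp {t : ι} {T : Finset ι} (ht : t ∈ T) (hT : T.card ≤ 2)
    {w : Bits ι → Matrix (Fin 2) (Fin 2) ℂ} (hw : ∀ x x', (∀ i ∈ T, i ≠ t → x i = x' i) → w x = w x')
    (hu : ∀ x, w x ∈ Matrix.unitaryGroup (Fin 2) ℂ) : IsGate (blockOp t w) := by
  refine ⟨blockOp_mem_unitaryGroup (fun x b => hw _ _ fun i _ hi => ?_) hu, T, Finset.subset_univ _, hT,
    actsOn_blockOp ht hw⟩
  rw [Function.update_of_ne hi]

/-- Apply `u` to qubit `t` if the qubits in `s` agree with the pattern `p`. -/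
def multiControlled (s : Finset ι) (p : Bits ι) (t : ι) (u : Matrix (Fin 2) (Fin 2) ℂ) : QOp ι :=
  blockOp t (fun x => if ∀ c ∈ s, x c = p c then u else 1)

/-- The conditional flip of qubit `c`. -/
def condFlip (s : Finset ι) (p : Bits ι) (c : ι) (x : Bits ι) : Bits ι :=
  if ∀ d ∈ s, x d = p d then Function.update x c (1 - x c) else x

theorem multiControlled_flip_mulVec (s : Finset ι) (p : Bits ι) (c : ι) (v : Bits ι → ℂ) (x : Bits ι) :
    (multiControlled s p c flipMat *ᵥ v) x = v (condFlip s p c x) := by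
  rw [multiControlled, blockOp_mulVec, condFlip]
  by_cases h : ∀ d ∈ s, x d = p d
  · simp only [if_pos h]
    generalize x c = e
    rcases fin_two_cases e with rfl | rfl
    · simp [flipMat, Fin.sum_univ_two]
    · simp [flipMat, Fin.sum_univ_two]
  · simp only [if_neg h]
    simp [Matrix.one_apply]

/-- The square root recursion for multiply controlled gates. From left to right the three factors on
qubit t act as v if s agrees with the pattern, as v if c agrees, and as vᴴ if c, flipped in case s
agrees, agrees. If s and c both agree this leaves v · v; in all other cases the factors cancel. -/
theorem multiControlled_insert {s : Finset ι} {p : Bits ι} {c t : ι} (hc : c ∉ s) (ht : t ∉ s) (hct : c ≠ t)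
    {v : Matrix (Fin 2) (Fin 2) ℂ} (hv : v ∈ Matrix.unitaryGroup (Fin 2) ℂ) :
    multiControlled (insert c s) p t (v * v) =
      multiControlled s p t v * (multiControlled {c} p t v *
        (multiControlled s p c flipMat * (multiControlled {c} p t vᴴ * multiControlled s p c flipMat))) := by
  have hv1 : v * vᴴ = 1 := Matrix.mem_unitaryGroup_iff.mp hv
  have hindep : ∀ (s' : Finset ι) (u : Matrix (Fin 2) (Fin 2) ℂ), t ∉ s' →
      IndepOf t (fun x : Bits ι => if ∀ d ∈ s', x d = p d then u else 1) := by
    intro s' u hs' x b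
    have : (∀ d ∈ s', Function.update x t b d = p d) ↔ ∀ d ∈ s', x d = p d := by
      refine forall₂_congr fun d hd => ?_
      rw [Function.update_of_ne (ne_of_mem_of_not_mem hd hs')]
    simp only [this]
  have htc : t ∉ ({c} : Finset ι) := by simp [hct.symm]
  -- the conjugated gate
  have hconj : multiControlled s p c flipMat * (multiControlled {c} p t vᴴ * multiControlled s p c flipMat)
      = blockOp t (fun x => if ∀ d ∈ ({c} : Finset ι), (condFlip s p c x) d = p d then vᴴ else 1) := by
    apply matrix_ext_mulVec
    intro φ
    ext x
    rw [← Matrix.mulVec_mulVec, ← Matrix.mulVec_mulVec, multiControlled_flip_mulVec, blockOp_mulVec]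
    rw [multiControlled, blockOp_mulVec]
    have hfx : condFlip s p c x t = x t := by
      unfold condFlip; split_ifs
      · rw [Function.update_of_ne hct.symm]
      · rfl
    rw [hfx]
    refine Finset.sum_congr rfl fun b _ => ?_
    rw [multiControlled_flip_mulVec]
    congr 2
    have h1 : ∀ y : Bits ι, (∀ d ∈ s, Function.update y t b d = p d) ↔ ∀ d ∈ s, y d = p d := by
      intro y
      refine forall₂_congr fun d hd => ?_
      rw [Function.update_of_ne (ne_of_mem_of_not_mem hd ht)]
    have h2 : ∀ (y : Bits ι) (e : Fin 2), (∀ d ∈ s, Function.update y c e d = p d) ↔ ∀ d ∈ s, y d = p d := by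
      intro y e
      refine forall₂_congr fun d hd => ?_
      rw [Function.update_of_ne (ne_of_mem_of_not_mem hd hc)]
    unfold condFlip
    by_cases hx : ∀ d ∈ s, x d = p d
    · rw [if_pos hx, if_pos ((h1 _).mpr ((h2 _ _).mpr hx)), Function.update_of_ne hct, Function.update_self,
        Function.update_comm hct, Function.update_idem]
      rw [sub_sub_cancel, Function.update_comm hct.symm, Function.update_eq_self]
    · rw [if_neg hx, if_neg (fun h => hx ((h1 _).mp h))]
  have hconjindep : IndepOf t (fun x => if ∀ d ∈ ({c} : Finset ι), (condFlip s p c x) d = p d then vᴴ else 1) := by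
    intro x b
    have h1 : (∀ d ∈ s, Function.update x t b d = p d) ↔ ∀ d ∈ s, x d = p d := by
      refine forall₂_congr fun d hd => ?_
      rw [Function.update_of_ne (ne_of_mem_of_not_mem hd ht)]
    have : condFlip s p c (Function.update x t b) c = condFlip s p c x c := by
      unfold condFlip
      simp only [h1]
      split_ifs
      · rw [Function.update_self, Function.update_self, Function.update_of_ne hct]
      · rw [Function.update_of_ne hct]
    simp only [Finset.mem_singleton, forall_eq, this]
  rw [hconj, multiControlled, multiControlled, multiControlled, blockOp_mul hconjindep, blockOp_mul]
  · congr 1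
    ext1 x
    simp only [Finset.mem_singleton, forall_eq, Finset.mem_insert, forall_eq_or_imp]
    unfold condFlip
    by_cases hx : ∀ d ∈ s, x d = p d
    · rw [if_pos hx, if_pos hx, Function.update_self]
      have h3 : 1 - x c = p c ↔ ¬ x c = p c := by
        generalize x c = e
        generalize p c = e'
        revert e e'; decide
      by_cases hxc : x c = p c
      · simp only [hxc, true_and, if_true]
        rw [hxc] at h3
        rw [if_neg (fun h => h3.mp h rfl), if_pos hx, mul_one]
      · rw [if_pos (h3.mpr hxc)]
        simp [hxc, hv1]
    · rw [if_neg hx, if_neg hx]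
      have : ¬ (x c = p c ∧ ∀ d ∈ s, x d = p d) := fun h => hx h.2
      rw [if_neg this, one_mul]
      by_cases hxc : x c = p c
      · simp [hxc, hv1]
      · simp [hxc]
  · intro x b
    have e1 := hindep {c} v htc x b
    have e2 := hconjindep x b
    simp only at e1 e2 ⊢
    rw [e1, e2]

/-- One more control needs three gates with the old number of controls and two two-qubit gates, and
3 · 2 · 5^k + 2 ≤ 2 · 5^(k+1). -/
theorem compiles_multiControlled (s : Finset ι) : ∀ (p : Bits ι) (t : ι), t ∉ s →
    ∀ u ∈ Matrix.unitaryGroup (Fin 2) ℂ, Compiles (2 * 5 ^ s.card) (multiControlled s p t u) := by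
  induction s using Finset.induction_on with
  | empty =>
    intro p t _ u hu
    refine (IsGate.compiles ?_).mono (by norm_num)
    exact isGate_blockOp (Finset.mem_singleton_self t) (by simp) (fun x x' _ => by simp) (fun x => by simpa using hu)
  | insert c s hc ih =>
    intro p t ht u hu
    have hct : c ≠ t := fun e => ht (e ▸ Finset.mem_insert_self _ _)
    have hts : t ∉ s := fun h => ht (Finset.mem_insert_of_mem h)
    obtain ⟨v, hv, rfl⟩ := exists_unitary_sqrt u hu
    rw [multiControlled_insert hc hts hct hv, Finset.card_insert_of_notMem hc]
    have hgate : ∀ u ∈ Matrix.unitaryGroup (Fin 2) ℂ, Compiles 1 (multiControlled {c} p t u) := by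
      intro u hu
      apply IsGate.compiles
      refine isGate_blockOp (T := {c, t}) (by simp) (Finset.card_le_two) (fun x x' h => ?_) (fun x => ?_)
      · have := h c (by simp) hct
        simp [this]
      · split_ifs
        · exact hu
        · exact one_mem _
    have h1 := ih p t hts v hv
    have h2 := hgate v hv
    have h3 := ih p c hc flipMat flipMat_mem
    have h4 := hgate vᴴ (Unitary.star_mem hv)
    refine (h1.mul (h2.mul (h3.mul (h4.mul h3)))).mono ?_
    have : 1 ≤ 5 ^ s.card := Nat.one_le_pow _ _ (by norm_num)
    rw [pow_succ]; omega

/-- Uniformly controlled one-qubit operators. -/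
theorem compiles_blockOp (t : ι) {w : Bits ι → Matrix (Fin 2) (Fin 2) ℂ} (hw : IndepOf t w)
    (hu : ∀ x, w x ∈ Matrix.unitaryGroup (Fin 2) ℂ) :
    Compiles (2 ^ Fintype.card ι * (2 * 5 ^ Fintype.card ι)) (blockOp t w) := by
  have hagree : ∀ x p : Bits ι, p t = 0 → ((∀ c ∈ Finset.univ.erase t, x c = p c) ↔ Function.update x t 0 = p) := by
    intro x p hp
    constructor
    · intro h
      ext c
      by_cases hc : c = t
      · subst hc; simp [hp]
      · rw [Function.update_of_ne hc, h c (by simp [hc])]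
    · intro h c hc
      rw [← h, Function.update_of_ne (Finset.ne_of_mem_erase hc)]
  -- The patterns of the control qubits are switched on one at a time. A pattern is represented by
  -- the basis state with qubit t equal to 0; other members of P have no effect.
  have key : ∀ P : Finset (Bits ι), Compiles (P.card * (2 * 5 ^ Fintype.card ι))
      (blockOp t (fun x => if Function.update x t 0 ∈ P then w x else 1)) := by
    intro P
    induction P using Finset.induction_on with
    | empty =>
      simp only [Finset.notMem_empty, if_false, blockOp_one]
      exact compiles_one _
    | insert p P hp ih =>
      rw [Finset.card_insert_of_notMem hp, add_mul, add_comm, one_mul]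
      by_cases hpt : p t = 0
      · have h1 : Compiles (2 * 5 ^ Fintype.card ι) (multiControlled (Finset.univ.erase t) p t (w p)) := by
          refine (compiles_multiControlled _ p t (by simp) _ (hu p)).mono ?_
          have : (Finset.univ.erase t).card ≤ Fintype.card ι := Finset.card_le_univ _
          gcongr
          norm_num
        have := h1.mul ih
        convert this using 1
        rw [multiControlled, blockOp_mul]
        · congr 1
          ext1 x
          simp only [hagree x p hpt, Finset.mem_insert]
          by_cases hx : Function.update x t 0 = p
          · have : w x = w p := by rw [← hx]; exact (hw x 0).symm
            rw [if_pos hx, if_pos (Or.inl hx), hx, if_neg hp, mul_one, this]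
          · rw [if_neg hx, one_mul]
            simp [hx]
        · intro x b
          simp only [Function.update_idem, hw x b]
      · have : (fun x => if Function.update x t 0 ∈ insert p P then w x else 1)
            = (fun x => if Function.update x t 0 ∈ P then w x else 1) := by
          ext1 x
          have hne : Function.update x t 0 ≠ p := fun h => hpt (by rw [← h]; simp)
          simp [Finset.mem_insert, hne]
        rw [this]
        exact ih.mono (by omega)
  have := key Finset.univ
  simpa [Finset.card_univ] using this

/-- The number of gates that `exists_state_preparation` uses. -/
def prepCount (k : ℕ) : ℕ := k * (2 ^ k * (2 * 5 ^ k))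

theorem exists_unitary_kill (a b : ℂ) : ∃ u ∈ Matrix.unitaryGroup (Fin 2) ℂ, u 1 0 * a + u 1 1 * b = 0 := by
  by_cases h : a = 0 ∧ b = 0
  · exact ⟨1, one_mem _, by simp [h.1, h.2]⟩
  set r : ℝ := Real.sqrt (‖a‖ ^ 2 + ‖b‖ ^ 2) with hr
  have hpos : 0 < ‖a‖ ^ 2 + ‖b‖ ^ 2 := by
    by_cases ha : a = 0
    · have hb : b ≠ 0 := fun hb => h ⟨ha, hb⟩
      have := norm_pos_iff.mpr hb
      positivity
    · have := norm_pos_iff.mpr ha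
      positivity
  have hr2 : (r : ℂ) ^ 2 = a * star a + b * star b := by
    have : r ^ 2 = ‖a‖ ^ 2 + ‖b‖ ^ 2 := Real.sq_sqrt hpos.le
    rw [RCLike.star_def, Complex.mul_conj', Complex.mul_conj']
    exact_mod_cast this
  have hr0 : (r : ℂ) ≠ 0 := by
    have : 0 < r := Real.sqrt_pos.mpr hpos
    exact_mod_cast this.ne'
  refine ⟨(r : ℂ)⁻¹ • !![star a, star b; -b, a], ?_, ?_⟩
  · rw [Matrix.mem_unitaryGroup_iff]
    ext i j
    rw [Matrix.star_eq_conjTranspose]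
    have hc : (starRingEnd ℂ) (r : ℂ) = r := Complex.conj_ofReal r
    fin_cases i <;> fin_cases j <;>
      simp [Matrix.mul_apply, Matrix.conjTranspose_apply, hc] <;> field_simp <;>
      simp only [RCLike.star_def] at hr2 <;> first | linear_combination -hr2 | ring
  · simp; ring

/-- Every vector can be rotated to a multiple of `|0…0⟩`. -/
theorem exists_state_preparation (v : Bits ι → ℂ) :
    ∃ Q : QOp ι, Q ∈ Matrix.unitaryGroup (Bits ι) ℂ ∧ Compiles (prepCount (Fintype.card ι)) Q ∧
      ∀ x, x ≠ 0 → (Q *ᵥ v) x = 0 := by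
  -- The qubits are cleared one by one. For each configuration of the other qubits, a rotation of
  -- qubit t moves both amplitudes to the state 0 of this qubit.
  have key : ∀ s : Finset ι, ∃ Q : QOp ι, Q ∈ Matrix.unitaryGroup (Bits ι) ℂ ∧
      Compiles (s.card * (2 ^ Fintype.card ι * (2 * 5 ^ Fintype.card ι))) Q ∧
      ∀ x, (∃ i ∈ s, x i ≠ 0) → (Q *ᵥ v) x = 0 := by
    intro s
    induction s using Finset.induction_on with
    | empty => exact ⟨1, one_mem _, compiles_one _, by simp⟩
    | insert t s ht ih =>
      obtain ⟨Q, hQ, hc, h0⟩ := ih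
      choose u hu hkill using exists_unitary_kill
      set w : Bits ι → Matrix (Fin 2) (Fin 2) ℂ := fun x =>
        u ((Q *ᵥ v) (Function.update x t 0)) ((Q *ᵥ v) (Function.update x t 1)) with hw
      have hind : IndepOf t w := fun x b => by simp only [hw, Function.update_idem]
      refine ⟨blockOp t w * Q, mul_mem (blockOp_mem_unitaryGroup hind fun x => hu _ _) hQ, ?_, ?_⟩
      · rw [Finset.card_insert_of_notMem ht, add_mul, add_comm, one_mul]
        exact (compiles_blockOp t hind fun x => hu _ _).mul hc
      · rintro x ⟨i, hi, hxi⟩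
        rw [← Matrix.mulVec_mulVec, blockOp_mulVec, Fin.sum_univ_two]
        -- Amplitudes that vanished earlier are mixed only with amplitudes that vanished for the
        -- same reason, since the rotation changes qubit t alone.
        by_cases hs : ∃ j ∈ s, x j ≠ 0
        · obtain ⟨j, hj, hxj⟩ := hs
          have hjt : j ≠ t := fun e => ht (e ▸ hj)
          rw [h0 _ ⟨j, hj, by rwa [Function.update_of_ne hjt]⟩,
            h0 _ ⟨j, hj, by rwa [Function.update_of_ne hjt]⟩]
          simp
        · have hit : i = t := by
            rcases Finset.mem_insert.mp hi with h | h
            · exact h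
            · exact absurd ⟨i, h, hxi⟩ hs
          subst hit
          have hx1 : x i = 1 := by
            rcases fin_two_cases (x i) with h | h
            · exact absurd h hxi
            · exact h
          rw [hx1]
          exact hkill _ _
  obtain ⟨Q, hQ, hc, h0⟩ := key Finset.univ
  refine ⟨Q, hQ, hc, fun x hx => h0 x ?_⟩
  by_contra! h
  exact hx (funext fun i => h i (Finset.mem_univ i))

/-- The number of gates that suffice for a rank-one phase on `k` qubits. -/
def phaseCount (k : ℕ) : ℕ := prepCount k + (2 ^ k * (2 * 5 ^ k) + prepCount k)

/-- If Q maps v to a multiple λ of |0…0⟩, the operator is Qᴴ D Q, where D multiplies |0…0⟩ by d. The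
scalar drops out because |λ| = 1. -/
theorem compiles_rank_one_phase [Nonempty ι] (v : Bits ι → ℂ) (hv : l2n v = 1) {d : ℂ} (hd : ‖d‖ = 1) :
    Compiles (phaseCount (Fintype.card ι)) (1 + (d - 1) • Matrix.vecMulVec v (star v)) := by
  obtain ⟨Q, hQ, hc, h0⟩ := exists_state_preparation v
  obtain ⟨t⟩ := ‹Nonempty ι›
  have hQ1 : Qᴴ * Q = 1 := Matrix.mem_unitaryGroup_iff'.mp hQ
  set lam := (Q *ᵥ v) 0 with hlam
  have hQv : Q *ᵥ v = lam • Pi.single 0 1 := by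
    ext x
    by_cases hx : x = 0
    · subst hx; simp [hlam]
    · rw [h0 x hx]; simp [hx]
  have hlam1 : lam * star lam = 1 := by
    have h1 : l2n (Q *ᵥ v) = 1 := by rw [l2n_mulVec_of_isometry hQ1, hv]
    have h2 : l2n (Q *ᵥ v) ^ 2 = ‖lam‖ ^ 2 := by
      rw [l2n_sq, Finset.sum_eq_single 0]
      · intro x _ hx; rw [h0 x hx]; simp
      · simp
    rw [RCLike.star_def, Complex.mul_conj', ← Complex.ofReal_pow, ← h2, h1]; simp
  set D : QOp ι := blockOp t (fun x => if ∀ i, i ≠ t → x i = 0 then !![d, 0; 0, 1] else 1) with hD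
  have hDc : Compiles (2 ^ Fintype.card ι * (2 * 5 ^ Fintype.card ι)) D := by
    apply compiles_blockOp
    · intro x b
      have : (∀ i, i ≠ t → Function.update x t b i = 0) ↔ ∀ i, i ≠ t → x i = 0 := by
        refine forall₂_congr fun i hi => ?_
        rw [Function.update_of_ne hi]
      simp only [this]
    · intro x
      split_ifs
      · rw [Matrix.mem_unitaryGroup_iff]
        have hdd : d * (starRingEnd ℂ) d = 1 := by rw [Complex.mul_conj', hd]; simp
        ext i j
        fin_cases i <;> fin_cases j <;>
          simp [Matrix.mul_apply, Matrix.star_eq_conjTranspose, Matrix.conjTranspose_apply, hdd]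
      · exact one_mem _
  have hDeq : D = 1 + (d - 1) • Matrix.vecMulVec (Pi.single 0 1) (Pi.single 0 1) := by
    apply matrix_ext_mulVec
    intro φ
    ext x
    rw [hD, blockOp_mulVec, Matrix.add_mulVec, Matrix.one_mulVec, Matrix.smul_mulVec,
      Matrix.vecMulVec_mulVec, Fin.sum_univ_two]
    by_cases hx : ∀ i, i ≠ t → x i = 0
    · rw [if_pos hx]
      rcases fin_two_cases (x t) with h | h
      · have hx0 : x = 0 := by
          funext i
          by_cases hi : i = t
          · subst hi; rw [h]; rfl
          · rw [hx i hi]; rfl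
        subst hx0
        have : Function.update (0 : Bits ι) t 0 = 0 := Function.update_eq_self t (0 : Bits ι)
        simp [this]; ring
      · have hx0 : x ≠ 0 := fun e => by rw [e] at h; simp at h
        have : Function.update x t 1 = x := by rw [← h]; exact Function.update_eq_self t x
        rw [this, h]; simp [hx0]
    · rw [if_neg hx]
      have hx0 : x ≠ 0 := fun e => hx fun i _ => by rw [e]; rfl
      have hxx : Function.update x t (x t) = x := Function.update_eq_self t x
      rcases fin_two_cases (x t) with h | h
      · rw [h] at hxx ⊢; rw [hxx]; simp [hx0]
      · rw [h] at hxx ⊢; rw [hxx]; simp [hx0]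
  have hfinal : 1 + (d - 1) • Matrix.vecMulVec v (star v) = Qᴴ * (D * Q) := by
    have hv' : v = lam • (Qᴴ *ᵥ Pi.single 0 1) := by
      rw [← Matrix.mulVec_smul, ← hQv, Matrix.mulVec_mulVec, hQ1, Matrix.one_mulVec]
    have hstar : star (Qᴴ *ᵥ (Pi.single 0 1 : Bits ι → ℂ)) = Pi.single 0 1 ᵥ* Q := by
      rw [Matrix.star_mulVec, Matrix.conjTranspose_conjTranspose]
      congr 1
      ext x
      by_cases hx : x = 0
      · subst hx; simp
      · simp [hx]
    have hvv : Matrix.vecMulVec v (star v) =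
        Matrix.vecMulVec (Qᴴ *ᵥ Pi.single 0 1) (Pi.single 0 1 ᵥ* Q) := by
      rw [hv', star_smul, hstar, Matrix.vecMulVec_smul, Matrix.smul_vecMulVec, smul_smul, mul_comm, hlam1,
        one_smul]
    rw [hvv, hDeq, add_mul, one_mul, mul_add, hQ1, Matrix.smul_mul, Matrix.mul_smul,
      Matrix.vecMulVec_mul, Matrix.mul_vecMulVec]
  rw [hfinal]
  exact hc.conjTranspose.mul (hDc.mul hc)

/-- The number of gates that suffice for a unitary on `k` qubits. -/
def unitaryCount (k : ℕ) : ℕ := 2 ^ k * phaseCount k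

/-- The operator is the product, over all columns of W, of commuting rank-one phases, one for each
diagonal entry. -/
theorem compiles_conj_diagonal [Nonempty ι] {W : QOp ι} (hW : W ∈ Matrix.unitaryGroup (Bits ι) ℂ)
    {d : Bits ι → ℂ} (hd : ∀ x, ‖d x‖ = 1) :
    Compiles (unitaryCount (Fintype.card ι)) (W * Matrix.diagonal d * Wᴴ) := by
  have hW1 : Wᴴ * W = 1 := Matrix.mem_unitaryGroup_iff'.mp hW
  have hW2 : W * Wᴴ = 1 := Matrix.mem_unitaryGroup_iff.mp hW
  have key : ∀ P : Finset (Bits ι), Compiles (P.card * phaseCount (Fintype.card ι))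
      (W * Matrix.diagonal (fun x => if x ∈ P then d x else 1) * Wᴴ) := by
    intro P
    induction P using Finset.induction_on with
    | empty =>
      simp only [Finset.notMem_empty, if_false, Matrix.diagonal_one, mul_one, hW2]
      exact compiles_one _
    | insert p P hp ih =>
      rw [Finset.card_insert_of_notMem hp, add_mul, add_comm, one_mul]
      have h1 := compiles_rank_one_phase (W.col p) (d := d p) (by
        rw [← Matrix.mulVec_single_one, l2n_mulVec_of_isometry hW1,
          ← sq_eq_sq₀ (l2n_nonneg _) zero_le_one, l2n_sq, Finset.sum_eq_single p] <;> simp +contextual) (hd p)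
      convert h1.mul ih using 1
      have h2 : 1 + (d p - 1) • Matrix.vecMulVec (W.col p) (star (W.col p))
          = W * Matrix.diagonal (fun x => if x = p then d p else 1) * Wᴴ := by
        have h3 : Matrix.diagonal (fun x => if x = p then d p else 1)
            = (1 : QOp ι) + (d p - 1) • Matrix.vecMulVec (Pi.single p 1) (star (Pi.single p 1)) := by
          ext x y
          by_cases hxy : x = y
          · subst hxy
            by_cases hxp : x = p
            · subst hxp; simp [Matrix.vecMulVec_apply]
            · simp [Matrix.vecMulVec_apply, hxp]
          · by_cases hxp : x = p
            · subst hxp; simp [Matrix.vecMulVec_apply, hxy, Ne.symm hxy]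
            · simp [Matrix.vecMulVec_apply, hxy, hxp]
        rw [h3, mul_add, mul_one, add_mul, hW2, Matrix.mul_smul, Matrix.smul_mul, Matrix.mul_vecMulVec,
          Matrix.vecMulVec_mul, Matrix.mulVec_single_one, ← Matrix.star_mulVec, Matrix.mulVec_single_one]
      rw [h2]
      have h4 : ∀ A B : QOp ι, W * A * Wᴴ * (W * B * Wᴴ) = W * (A * B) * Wᴴ := by
        intro A B
        calc W * A * Wᴴ * (W * B * Wᴴ) = W * A * (Wᴴ * W) * B * Wᴴ := by simp only [mul_assoc]
          _ = _ := by rw [hW1, mul_one]; simp only [mul_assoc]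
      rw [h4, Matrix.diagonal_mul_diagonal]
      congr 3
      ext x
      by_cases hxp : x = p
      · subst hxp; simp [hp]
      · simp [hxp]
  have := key Finset.univ
  simpa [unitaryCount, Finset.card_univ] using this

end Controlled

/-! ### Operators on a subset of the qubits -/

section Embedding

variable {ι : Type} [Fintype ι] [DecidableEq ι]

/-- The operator `m ⊗ 1`, with `m` an operator on the qubits in `T`. -/
def embOp (T : Finset ι) (m : QOp T) : QOp ι :=
  Matrix.of fun x y => if ∀ i, i ∉ T → x i = y i then m (fun i => x i) (fun i => y i) else 0

/-- Overwrite the qubits in `T`. -/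
def overwrite (T : Finset ι) (x : Bits ι) (a : Bits T) : Bits ι :=
  fun i => if h : i ∈ T then a ⟨i, h⟩ else x i

theorem overwrite_restrict (T : Finset ι) (x : Bits ι) (a : Bits T) :
    (fun i : T => overwrite T x a i) = a := by
  funext i; simp [overwrite]

theorem embOp_mulVec (T : Finset ι) (m : QOp T) (v : Bits ι → ℂ) (x : Bits ι) :
    (embOp T m *ᵥ v) x = ∑ a, m (fun i => x i) a * v (overwrite T x a) := by
  have hinj : Function.Injective (overwrite T x) := by
    intro a b h
    rw [← overwrite_restrict T x a, h, overwrite_restrict]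
  rw [Matrix.mulVec, dotProduct, ← Finset.sum_subset (Finset.subset_univ (Finset.univ.map ⟨_, hinj⟩)),
    Finset.sum_map]
  · refine Finset.sum_congr rfl fun a _ => ?_
    have : ∀ i, i ∉ T → x i = overwrite T x a i := fun i hi => by simp [overwrite, hi]
    simp only [embOp, Matrix.of_apply, Function.Embedding.coeFn_mk, if_pos this, overwrite_restrict]
  · intro y _ hy
    rw [Finset.mem_map] at hy
    push Not at hy
    have : ¬ ∀ i, i ∉ T → x i = y i := by
      intro h
      refine hy (fun i => y i) (Finset.mem_univ _) ?_
      funext i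
      by_cases hi : i ∈ T
      · simp [overwrite, hi]
      · simp [overwrite, hi, h i hi]
    simp only [embOp, Matrix.of_apply, if_neg this, zero_mul]

theorem embOp_mul (T : Finset ι) (m m' : QOp T) : embOp T (m * m') = embOp T m * embOp T m' := by
  apply matrix_ext_mulVec
  intro v
  funext x
  have hover : ∀ a b, overwrite T (overwrite T x a) b = overwrite T x b := by
    intro a b; funext i
    by_cases hi : i ∈ T <;> simp [overwrite, hi]
  rw [← Matrix.mulVec_mulVec, embOp_mulVec, embOp_mulVec]
  simp_rw [embOp_mulVec, overwrite_restrict, hover, Matrix.mul_apply, Finset.sum_mul, Finset.mul_sum]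
  rw [Finset.sum_comm]
  refine Finset.sum_congr rfl fun b _ => Finset.sum_congr rfl fun c _ => ?_
  ring

theorem embOp_one (T : Finset ι) : embOp T (1 : QOp T) = 1 := by
  apply matrix_ext_mulVec
  intro v
  funext x
  rw [embOp_mulVec, Matrix.one_mulVec]
  have : overwrite T x (fun i => x i) = x := by
    funext i; by_cases hi : i ∈ T <;> simp [overwrite, hi]
  simp [Matrix.one_apply, this]

/-- Tensoring with the identity, as a ring homomorphism. -/
def embHom (T : Finset ι) : QOp T →+* QOp ι where
  toFun := embOp T
  map_one' := embOp_one T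
  map_mul' := embOp_mul T
  map_zero' := by ext x y; simp [embOp]
  map_add' := by
    intro a b; ext x y
    simp only [embOp, Matrix.of_apply, Matrix.add_apply]
    split_ifs <;> simp

theorem embOp_smul (T : Finset ι) (c : ℂ) (m : QOp T) : embOp T (c • m) = c • embOp T m := by
  ext x y
  simp only [embOp, Matrix.of_apply, Matrix.smul_apply]
  split_ifs <;> simp

theorem continuous_embHom (T : Finset ι) : Continuous (embHom T) := by
  refine continuous_matrix fun x y => ?_
  change Continuous fun m : QOp T => embOp T m x y
  simp only [embOp, Matrix.of_apply]
  split_ifs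
  · fun_prop
  · fun_prop

theorem embOp_conjTranspose (T : Finset ι) (m : QOp T) : embOp T mᴴ = (embOp T m)ᴴ := by
  ext x y
  simp only [embOp, Matrix.of_apply, Matrix.conjTranspose_apply]
  by_cases h : ∀ i, i ∉ T → x i = y i
  · have h' : ∀ i, i ∉ T → y i = x i := fun i hi => (h i hi).symm
    rw [if_pos h, if_pos h']
  · have h' : ¬ ∀ i, i ∉ T → y i = x i := fun h' => h fun i hi => (h' i hi).symm
    rw [if_neg h, if_neg h', star_zero]

theorem IsGate.embOp {T : Finset ι} {g : QOp T} (hg : IsGate g) : IsGateWithin T (embOp T g) := by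
  obtain ⟨hu, T', -, hc, ha⟩ := hg
  refine ⟨?_, T'.map (Function.Embedding.subtype _), ?_, by rwa [Finset.card_map], ?_⟩
  · rw [Matrix.mem_unitaryGroup_iff, Matrix.star_eq_conjTranspose, ← embOp_conjTranspose, ← embOp_mul]
    rw [Matrix.mem_unitaryGroup_iff, Matrix.star_eq_conjTranspose] at hu
    rw [hu, embOp_one]
  · intro i hi
    obtain ⟨j, -, rfl⟩ := Finset.mem_map.mp hi
    exact j.2
  · obtain ⟨h0, h1⟩ := actsOn_iff.mp ha
    have hmem : ∀ (i : T), (i : ι) ∈ T'.map (Function.Embedding.subtype _) ↔ i ∈ T' := by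
      intro i; simp
    rw [actsOn_iff]
    constructor
    · intro x y h
      by_cases hT : ∀ i, i ∉ T → x i = y i
      · simp only [_root_.embOp, Matrix.of_apply, if_pos hT]
        apply h0
        intro h'
        apply h
        intro i hi
        by_cases hiT : i ∈ T
        · exact h' ⟨i, hiT⟩ (fun hc => hi ((hmem ⟨i, hiT⟩).mpr hc))
        · exact hT i hiT
      · simp only [_root_.embOp, Matrix.of_apply, if_neg hT]
    · intro x y x' y' h h' hx hy
      have hT : ∀ z w : Bits ι, (∀ i, i ∉ T'.map (Function.Embedding.subtype _) → z i = w i) →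
          ∀ i, i ∉ T → z i = w i := by
        intro z w hzw i hi
        refine hzw i (fun hm => ?_)
        obtain ⟨j, -, rfl⟩ := Finset.mem_map.mp hm
        exact hi j.2
      simp only [_root_.embOp, Matrix.of_apply, if_pos (hT x y h), if_pos (hT x' y' h')]
      apply h1
      · exact fun i hi => h i (fun hm => hi ((hmem i).mp hm))
      · exact fun i hi => h' i (fun hm => hi ((hmem i).mp hm))
      · exact fun i hi => hx i ((hmem i).mpr hi)
      · exact fun i hi => hy i ((hmem i).mpr hi)

/-- Compilation takes place on the register T alone and is then tensored with the identity, so the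
gate count depends on the size of T and not on the full register. -/
theorem Compiles.exists_within {T : Finset ι} {k : ℕ} {M : QOp T} (h : Compiles k M) :
    ∃ B : List (QOp ι), (∀ g ∈ B, IsGateWithin T g) ∧ B.length ≤ k ∧ circuitOp B = embOp T M := by
  obtain ⟨B, h1, h2, h3⟩ := h
  refine ⟨B.map (embOp T), ?_, by simpa using h2, ?_⟩
  · intro g hg
    obtain ⟨g', hg', rfl⟩ := List.mem_map.mp hg
    exact (h1 g' hg').embOp
  · rw [← h3, circuitOp, circuitOp, ← List.map_reverse]
    exact (map_list_prod (embHom T) B.reverse).symm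

theorem ActsOn.exists_embOp {T : Finset ι} {M : QOp ι} (h : ActsOn T M) : ∃ m, M = embOp T m := by
  obtain ⟨m, hm⟩ := h
  exact ⟨m, by ext x y; rw [hm]; rfl⟩

theorem embOp_injective (T : Finset ι) : Function.Injective (embOp T) := by
  intro m m' h
  ext a b
  have := congrFun (congrFun h (overwrite T 0 a)) (overwrite T 0 b)
  simp only [embOp, Matrix.of_apply] at this
  have h1 : ∀ i, i ∉ T → overwrite T 0 a i = overwrite T 0 b i := fun i hi => by simp [overwrite, hi]
  rw [if_pos h1, if_pos h1, overwrite_restrict, overwrite_restrict] at this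
  exact this

end Embedding

/-! ### Exponentials of Hermitian operators and their controlled versions -/

section Exponential

variable {ι : Type} [Fintype ι] [DecidableEq ι]

open scoped Matrix.Norms.L2Operator in
theorem map_exp_matrix {κ κ' : Type} [Fintype κ] [DecidableEq κ] [Fintype κ'] [DecidableEq κ']
    (f : Matrix κ κ ℂ →+* Matrix κ' κ' ℂ) (hf : Continuous f) (A : Matrix κ κ ℂ) :
    f (NormedSpace.exp A) = NormedSpace.exp (f A) := by
  let _ : NormedAlgebra ℚ (Matrix κ κ ℂ) := .restrictScalars ℚ ℂ _
  exact NormedSpace.map_exp f hf A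

theorem exp_smul_hermitian {κ : Type} [Fintype κ] [DecidableEq κ] {m : Matrix κ κ ℂ}
    (hm : m.IsHermitian) (τ : ℝ) :
    ∃ W ∈ Matrix.unitaryGroup κ ℂ, ∃ d : κ → ℂ, (∀ x, ‖d x‖ = 1) ∧
      NormedSpace.exp ((-(Complex.I * τ)) • m) = W * Matrix.diagonal d * Wᴴ := by
  set W : Matrix κ κ ℂ := hm.eigenvectorUnitary.1 with hW
  have hWm : W ∈ Matrix.unitaryGroup κ ℂ := hm.eigenvectorUnitary.2
  have hW1 : W * Wᴴ = 1 := Matrix.mem_unitaryGroup_iff.mp hWm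
  have hinv : W⁻¹ = Wᴴ := Matrix.inv_eq_right_inv hW1
  have hspec : m = W * Matrix.diagonal (fun x => (hm.eigenvalues x : ℂ)) * W⁻¹ := by
    rw [hinv]
    refine hm.spectral_theorem.trans ?_
    rw [Unitary.conjStarAlgAut_apply]
    rfl
  refine ⟨W, hWm, fun x => Complex.exp (-(Complex.I * (τ * hm.eigenvalues x : ℝ))), fun x =>
    norm_exp_neg_I_mul _, ?_⟩
  rw [← hinv]
  have : (-(Complex.I * τ)) • m = W * Matrix.diagonal (fun x => -(Complex.I * (τ * hm.eigenvalues x : ℝ))) * W⁻¹ := by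
    conv_lhs => rw [hspec]
    rw [← Matrix.smul_mul, ← Matrix.mul_smul, ← Matrix.diagonal_smul]
    congr 3
    funext x
    simp only [Pi.smul_apply, smul_eq_mul]
    push_cast; ring
  rw [this, Matrix.exp_conj _ _ ((Matrix.isUnit_iff_isUnit_det _).mpr (Matrix.isUnit_det_of_right_inverse hW1)), Matrix.exp_diagonal]
  congr 3
  funext x
  exact (Pi.coe_exp _ x).trans (congrFun Complex.exp_eq_exp_ℂ _).symm

theorem compiles_exp_hermitian [Nonempty ι] {m : QOp ι} (hm : m.IsHermitian) (τ : ℝ) :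
    Compiles (unitaryCount (Fintype.card ι)) (NormedSpace.exp ((-(Complex.I * τ)) • m)) := by
  obtain ⟨W, hW, d, hd, he⟩ := exp_smul_hermitian hm τ
  rw [he]
  exact compiles_conj_diagonal hW hd

theorem unitaryCount_mono {k k' : ℕ} (h : k ≤ k') : unitaryCount k ≤ unitaryCount k' := by
  unfold unitaryCount phaseCount prepCount
  gcongr <;> norm_num

variable {n : ℕ}

/-- The operator that is `B` if the ancilla is `0` and `A` if it is `1`. -/
def ancillaBlock (B A : QOp (Fin n)) : QOp (Option (Fin n)) :=
  Matrix.of fun x y => if x none = y none then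
    (if x none = 1 then A (regBits x) (regBits y) else B (regBits x) (regBits y)) else 0

/-- The basis state of register and ancilla with ancilla `b`. -/
def joinBits (b : Fin 2) (x : Bits (Fin n)) : Bits (Option (Fin n))
  | none => b
  | some i => x i

@[simp] theorem regBits_joinBits (b : Fin 2) (x : Bits (Fin n)) : regBits (joinBits b x) = x := rfl

@[simp] theorem joinBits_none (b : Fin 2) (x : Bits (Fin n)) : joinBits b x none = b := rfl

/-- Splitting off the ancilla. -/
def splitBits (n : ℕ) : Bits (Option (Fin n)) ≃ Fin 2 × Bits (Fin n) where
  toFun x := (x none, regBits x)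
  invFun p := joinBits p.1 p.2
  left_inv x := by funext i; cases i <;> rfl
  right_inv p := rfl

theorem sum_bits_option {M : Type*} [AddCommMonoid M] (f : Bits (Option (Fin n)) → M) :
    ∑ x, f x = ∑ b, ∑ x, f (joinBits b x) := by
  rw [← (splitBits n).symm.sum_comp, Fintype.sum_prod_type]
  rfl

theorem ancillaBlock_mulVec (B A : QOp (Fin n)) (v : Bits (Option (Fin n)) → ℂ) (x : Bits (Option (Fin n))) :
    (ancillaBlock B A *ᵥ v) x =
      ((if x none = 1 then A else B) *ᵥ (fun y => v (joinBits (x none) y))) (regBits x) := by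
  rw [Matrix.mulVec, dotProduct, sum_bits_option, Finset.sum_eq_single (x none)]
  · rw [Matrix.mulVec, dotProduct]
    refine Finset.sum_congr rfl fun y _ => ?_
    simp only [ancillaBlock, Matrix.of_apply, joinBits_none, if_true, regBits_joinBits]
    split_ifs <;> rfl
  · intro b _ hb
    refine Finset.sum_eq_zero fun y _ => ?_
    have hb' : x none ≠ joinBits b y none := Ne.symm hb
    simp only [ancillaBlock, Matrix.of_apply]
    rw [if_neg hb', zero_mul]
  · simp

theorem ancillaBlock_mul (B A B' A' : QOp (Fin n)) :
    ancillaBlock B A * ancillaBlock B' A' = ancillaBlock (B * B') (A * A') := by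
  apply matrix_ext_mulVec
  intro v
  funext x
  rw [← Matrix.mulVec_mulVec, ancillaBlock_mulVec, ancillaBlock_mulVec]
  have : (fun y => (ancillaBlock B' A' *ᵥ v) (joinBits (x none) y))
      = (if x none = 1 then A' else B') *ᵥ (fun y => v (joinBits (x none) y)) := by
    funext y
    rw [ancillaBlock_mulVec]; rfl
  rw [this, Matrix.mulVec_mulVec]
  split_ifs <;> rfl

theorem ancillaBlock_one : ancillaBlock (1 : QOp (Fin n)) 1 = 1 := by
  apply matrix_ext_mulVec
  intro v
  funext x
  rw [ancillaBlock_mulVec, Matrix.one_mulVec, ite_self, Matrix.one_mulVec]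
  congr 1
  funext i; cases i <;> rfl

theorem controlled_eq_ancillaBlock (G : QOp (Fin n)) : controlled G = ancillaBlock 1 G := by
  ext x y
  simp only [controlled, ancillaBlock, Matrix.of_apply, Matrix.one_apply]

/-- `ancillaBlock` as a ring homomorphism. -/
def ancillaHom (n : ℕ) : QOp (Fin n) × QOp (Fin n) →+* QOp (Option (Fin n)) where
  toFun p := ancillaBlock p.1 p.2
  map_one' := ancillaBlock_one
  map_mul' p q := (ancillaBlock_mul _ _ _ _).symm
  map_zero' := by ext x y; simp [ancillaBlock]
  map_add' p q := by
    ext x y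
    simp only [ancillaBlock, Matrix.of_apply, Matrix.add_apply, Prod.fst_add, Prod.snd_add]
    split_ifs <;> simp

theorem continuous_ancillaHom (n : ℕ) : Continuous (ancillaHom n) := by
  refine continuous_matrix fun x y => ?_
  change Continuous fun p : QOp (Fin n) × QOp (Fin n) => ancillaBlock p.1 p.2 x y
  simp only [ancillaBlock, Matrix.of_apply]
  split_ifs <;> fun_prop

-- Block-diagonal operators form the image of a product ring, and exp(0) = 1 in the block of ancilla
-- 0. So a controlled evolution is an evolution with one more qubit, and no separate construction
-- for controlled unitaries is needed.
open scoped Matrix.Norms.L2Operator in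
theorem controlled_exp (A : QOp (Fin n)) :
    controlled (NormedSpace.exp A) = NormedSpace.exp (ancillaBlock 0 A) := by
  let _ : NormedAlgebra ℚ (QOp (Fin n)) := .restrictScalars ℚ ℂ _
  have h := NormedSpace.map_exp (ancillaHom n) (continuous_ancillaHom n) (0, A)
  have h1 : NormedSpace.exp ((0, A) : QOp (Fin n) × QOp (Fin n)) = (1, NormedSpace.exp A) := by
    ext1
    · rw [Prod.fst_exp]; simp [NormedSpace.exp_zero]
    · rw [Prod.snd_exp]
  rw [h1] at h
  rw [controlled_eq_ancillaBlock]
  exact h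

theorem actsOn_ancillaBlock_zero {A : Finset (Fin n)} {G : QOp (Fin n)} (h : ActsOn A G) :
    ActsOn (Finset.insertNone A) (ancillaBlock 0 G) := by
  obtain ⟨h0, h1⟩ := actsOn_iff.mp h
  rw [actsOn_iff]
  constructor
  · intro x y hxy
    simp only [ancillaBlock, Matrix.of_apply]
    by_cases hn : x none = y none
    · rw [if_pos hn]
      split_ifs
      · apply h0
        intro h'
        apply hxy
        intro i hi
        cases i with
        | none => exact hn
        | some i => exact h' i (fun hm => hi (by simpa using hm))
      · rfl
    · rw [if_neg hn]
  · intro x y x' y' h h' hx hy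
    simp only [ancillaBlock, Matrix.of_apply]
    rw [hx none (by simp), hy none (by simp)]
    congr 2
    apply h1
    · exact fun i hi => h (some i) (by simpa using hi)
    · exact fun i hi => h' (some i) (by simpa using hi)
    · exact fun i hi => hx (some i) (by simpa using hi)
    · exact fun i hi => hy (some i) (by simpa using hi)

theorem isHermitian_ancillaBlock_zero {G : QOp (Fin n)} (h : G.IsHermitian) :
    (ancillaBlock 0 G).IsHermitian := by
  ext x y
  simp only [Matrix.conjTranspose_apply, ancillaBlock, Matrix.of_apply]
  by_cases hn : y none = x none
  · rw [if_pos hn, if_pos hn.symm, hn]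
    split_ifs
    · exact h.apply _ _
    · simp
  · rw [if_neg hn, if_neg (Ne.symm hn), star_zero]

/-- The generator is Hermitian and lives on the ancilla and the qubits in A, at most ℓ + 1 in all.
It is diagonalized there, compiled exactly, and embedded. -/
theorem exists_compilesControlled {A : Finset (Fin n)} {H : QOp (Fin n)} (hH : H.IsHermitian)
    (hA : ActsOn A H) {ℓ : ℕ} (hℓ : A.card ≤ ℓ) (τ : ℝ) :
    ∃ B, CompilesControlled A (NormedSpace.exp ((-(Complex.I * τ)) • H)) B ∧
      B.length ≤ unitaryCount (ℓ + 1) := by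
  obtain ⟨m, hm⟩ := (actsOn_ancillaBlock_zero hA).exists_embOp
  have hmh : m.IsHermitian := by
    apply embOp_injective (Finset.insertNone A)
    rw [embOp_conjTranspose, ← hm]
    exact isHermitian_ancillaBlock_zero hH
  have hne : Nonempty (Finset.insertNone A) := ⟨⟨none, by simp⟩⟩
  obtain ⟨B, h1, h2, h3⟩ := (compiles_exp_hermitian hmh τ).exists_within
  refine ⟨B, ⟨h1, ?_⟩, h2.trans (unitaryCount_mono ?_)⟩
  · rw [h3, controlled_exp]
    have h4 : ancillaBlock 0 ((-(Complex.I * τ)) • H) = (-(Complex.I * τ)) • ancillaBlock 0 H := by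
      ext x y
      simp only [ancillaBlock, Matrix.of_apply, Matrix.smul_apply]
      split_ifs <;> simp
    rw [h4, hm, ← embOp_smul]
    exact map_exp_matrix (embHom _) (continuous_embHom _) _
  · rw [Fintype.card_coe, Finset.card_insertNone]; omega

end Exponential

/-! ### Error of the first-order product formula -/

section ExponentialProducts

variable {𝔸 : Type*} [NormedRing 𝔸]

theorem norm_list_sum_le (l : List 𝔸) : ‖l.sum‖ ≤ (l.map norm).sum := by
  induction l with
  | nil => simp
  | cons A l ih =>
    simp only [List.sum_cons, List.map_cons]
    linarith [norm_add_le A l.sum]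

/-- Telescoping: contractions do not amplify the error of a single step, so the errors only add up.
-/
theorem norm_pow_sub_pow_le_of_contraction [NormOneClass 𝔸] {X Y : 𝔸} (hX : ‖X‖ ≤ 1) (hY : ‖Y‖ ≤ 1)
    (m : ℕ) : ‖X ^ m - Y ^ m‖ ≤ m * ‖X - Y‖ := by
  induction m with
  | zero => simp
  | succ m ih =>
    have hsplit : X ^ (m + 1) - Y ^ (m + 1) = X ^ m * (X - Y) + (X ^ m - Y ^ m) * Y := by
      rw [pow_succ, pow_succ]; noncomm_ring
    have h1 : ‖X ^ m * (X - Y)‖ ≤ 1 * ‖X - Y‖ :=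
      norm_mul_le_of_le ((norm_pow_le _ _).trans (pow_le_one₀ (norm_nonneg _) hX)) le_rfl
    have h2 : ‖(X ^ m - Y ^ m) * Y‖ ≤ (m * ‖X - Y‖) * 1 := norm_mul_le_of_le ih hY
    rw [hsplit]
    push_cast
    linarith [norm_add_le (X ^ m * (X - Y)) ((X ^ m - Y ^ m) * Y)]

variable [NormedAlgebra ℂ 𝔸] [CompleteSpace 𝔸]

theorem norm_exp_sub_one_sub_le (A : 𝔸) :
    ‖NormedSpace.exp A - 1 - A‖ ≤ Real.exp ‖A‖ - 1 - ‖A‖ := by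
  have h1 : HasSum (fun n => ((n + 2).factorial⁻¹ : ℂ) • A ^ (n + 2)) (NormedSpace.exp A - 1 - A) := by
    have := (hasSum_nat_add_iff' 2).mpr (NormedSpace.exp_series_hasSum_exp' (𝕂 := ℂ) A)
    simpa [Finset.sum_range_succ, sub_sub] using this
  have h2 : HasSum (fun n => ((n + 2).factorial⁻¹ : ℝ) • ‖A‖ ^ (n + 2)) (Real.exp ‖A‖ - 1 - ‖A‖) := by
    have := (hasSum_nat_add_iff' 2).mpr (NormedSpace.exp_series_hasSum_exp' (𝕂 := ℝ) ‖A‖)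
    rw [← Real.exp_eq_exp_ℝ] at this
    simpa [Finset.sum_range_succ, sub_sub] using this
  rw [← h1.tsum_eq]
  refine (tsum_of_norm_bounded h2 fun n => ?_)
  rw [norm_smul, smul_eq_mul]
  refine mul_le_mul (by simp) (norm_pow_le' A (by omega)) (norm_nonneg _) (by positivity)

theorem norm_exp_sub_one_le (A : 𝔸) : ‖NormedSpace.exp A - 1‖ ≤ Real.exp ‖A‖ - 1 := by
  have h := norm_exp_sub_one_sub_le A
  have h2 : ‖NormedSpace.exp A - 1‖ ≤ ‖NormedSpace.exp A - 1 - A‖ + ‖A‖ := by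
    have := norm_add_le (NormedSpace.exp A - 1 - A) A
    rwa [sub_add_cancel] at this
  linarith

/-- The noncommutative remainder is dominated by the scalar one. The induction closes because
e^(a+s) - 1 - (a+s) = (e^a - 1 - a) + (e^s - 1 - s) + (e^a - 1)(e^s - 1), which has the same shape
as the splitting of the product. -/
theorem norm_prod_exp_sub_le (l : List 𝔸) :
    ‖(l.map NormedSpace.exp).prod - 1 - l.sum‖
      ≤ Real.exp (l.map norm).sum - 1 - (l.map norm).sum ∧
    ‖(l.map NormedSpace.exp).prod - 1‖ ≤ Real.exp (l.map norm).sum - 1 := by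
  have hsnd : ∀ (P s : 𝔸) (σ : ℝ), ‖s‖ ≤ σ → ‖P - 1 - s‖ ≤ Real.exp σ - 1 - σ →
      ‖P - 1‖ ≤ Real.exp σ - 1 := by
    intro P s σ hs h
    have := norm_add_le (P - 1 - s) s
    rw [sub_add_cancel] at this
    linarith
  suffices H : ‖(l.map NormedSpace.exp).prod - 1 - l.sum‖
      ≤ Real.exp (l.map norm).sum - 1 - (l.map norm).sum from
    ⟨H, hsnd _ _ _ (norm_list_sum_le l) H⟩
  induction l with
  | nil => simp
  | cons A l ih =>
    simp only [List.map_cons, List.prod_cons, List.sum_cons]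
    set Q := (l.map NormedSpace.exp).prod
    set σ := (l.map norm).sum
    have hQ : ‖Q - 1‖ ≤ Real.exp σ - 1 := hsnd _ _ _ (norm_list_sum_le l) ih
    have hA := norm_exp_sub_one_sub_le A
    have hA1 := norm_exp_sub_one_le A
    have hsplit : NormedSpace.exp A * Q - 1 - (A + l.sum)
        = (NormedSpace.exp A - 1 - A) + (Q - 1 - l.sum) + (NormedSpace.exp A - 1) * (Q - 1) := by
      noncomm_ring
    rw [hsplit, Real.exp_add]
    have h3 := norm_mul_le_of_le hA1 hQ
    have h4 := norm_add₃_le (a := NormedSpace.exp A - 1 - A) (b := Q - 1 - l.sum)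
      (c := (NormedSpace.exp A - 1) * (Q - 1))
    nlinarith

/-- The error of the first-order product formula, for contractions. -/
theorem norm_prod_exp_pow_sub_le [NormOneClass 𝔸] (l : List 𝔸) (m : ℕ) {α : ℝ} (hα : (l.map norm).sum ≤ α)
    (hα1 : α ≤ 1) (hX : ‖(l.map NormedSpace.exp).prod‖ ≤ 1) (hY : ‖NormedSpace.exp l.sum‖ ≤ 1) :
    ‖(l.map NormedSpace.exp).prod ^ m - NormedSpace.exp l.sum ^ m‖ ≤ m * (2 * α ^ 2) := by
  refine (norm_pow_sub_pow_le_of_contraction hX hY m).trans ?_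
  refine mul_le_mul_of_nonneg_left ?_ (Nat.cast_nonneg m)
  have hkey : ∀ x : ℝ, 0 ≤ x → x ≤ α → Real.exp x - 1 - x ≤ α ^ 2 := by
    intro x hx hxα
    have := (le_abs_self _).trans (Real.abs_exp_sub_one_sub_id_le (x := x) (by
      rw [abs_of_nonneg hx]; linarith))
    nlinarith
  have hs0 : 0 ≤ (l.map norm).sum := List.sum_nonneg (by simp)
  have h1 := (norm_prod_exp_sub_le l).1.trans (hkey _ hs0 hα)
  have h2 := (norm_exp_sub_one_sub_le l.sum).trans
    (hkey _ (norm_nonneg _) ((norm_list_sum_le l).trans hα))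
  have := norm_sub_le ((l.map NormedSpace.exp).prod - 1 - l.sum) (NormedSpace.exp l.sum - 1 - l.sum)
  rw [sub_sub_sub_cancel_right, sub_sub_sub_cancel_right] at this
  linarith

end ExponentialProducts

/-! ### Exponentials on eigenvectors and their unitarity -/

section Trotter

variable {κ : Type} [Fintype κ] [DecidableEq κ]

open scoped Matrix.Norms.L2Operator in
theorem exp_mulVec_of_eigenvector {A : Matrix κ κ ℂ} {v : κ → ℂ} {μ : ℂ} (h : A *ᵥ v = μ • v) :
    NormedSpace.exp A *ᵥ v = Complex.exp μ • v := by
  have hpow : ∀ n : ℕ, A ^ n *ᵥ v = μ ^ n • v := by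
    intro n
    induction n with
    | zero => simp
    | succ n ih => rw [pow_succ, ← Matrix.mulVec_mulVec, h, Matrix.mulVec_smul, ih, smul_smul, pow_succ, mul_comm]
  have h1 := NormedSpace.exp_series_hasSum_exp' (𝕂 := ℂ) A
  have hc : Continuous fun B : Matrix κ κ ℂ => B *ᵥ v := Continuous.matrix_mulVec continuous_id continuous_const
  let f : Matrix κ κ ℂ →+ (κ → ℂ) :=
    { toFun := fun B => B *ᵥ v, map_zero' := Matrix.zero_mulVec v, map_add' := fun B C => Matrix.add_mulVec B C v }
  have h2 := h1.map f hc
  have h3 : HasSum (fun n => ((n.factorial⁻¹ : ℂ) • μ ^ n)) (Complex.exp μ) := by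
    have := NormedSpace.exp_series_hasSum_exp' (𝕂 := ℂ) μ
    rwa [← Complex.exp_eq_exp_ℂ] at this
  have h4 := h3.smul_const v
  refine h2.unique (h4.congr_fun ?_)
  intro n
  change ((n.factorial⁻¹ : ℂ) • A ^ n) *ᵥ v = _
  rw [Matrix.smul_mulVec, hpow, smul_smul, smul_eq_mul]

theorem pow_mulVec_of_eigenvector {A : Matrix κ κ ℂ} {v : κ → ℂ} {μ : ℂ} (h : A *ᵥ v = μ • v) (n : ℕ) :
    A ^ n *ᵥ v = μ ^ n • v := by
  induction n with
  | zero => simp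
  | succ n ih => rw [pow_succ, ← Matrix.mulVec_mulVec, h, Matrix.mulVec_smul, ih, smul_smul, pow_succ, mul_comm]

theorem exp_smul_hermitian_mem_unitaryGroup {m : Matrix κ κ ℂ} (hm : m.IsHermitian) (τ : ℝ) :
    NormedSpace.exp ((-(Complex.I * τ)) • m) ∈ Matrix.unitaryGroup κ ℂ := by
  obtain ⟨W, hW, d, hd, he⟩ := exp_smul_hermitian hm τ
  rw [he]
  have hD : Matrix.diagonal d ∈ Matrix.unitaryGroup κ ℂ := by
    rw [Matrix.mem_unitaryGroup_iff, Matrix.star_eq_conjTranspose, Matrix.diagonal_conjTranspose,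
      Matrix.diagonal_mul_diagonal, ← Matrix.diagonal_one]
    congr 1; funext x
    simp only [Pi.star_apply, RCLike.star_def, Complex.mul_conj, Complex.normSq_eq_norm_sq, hd x]
    norm_num
  exact mul_mem (mul_mem hW hD) (Unitary.star_mem hW)

end Trotter

/-! ### The signal of the Trotterized Hadamard test -/

section HadamardTest

variable {n N ℓ : ℕ}

-- Expanding φ in eigenvectors turns the exact overlap into the exponential sum with weights |a j|².
-- The number α bounds the norms of the exponents in one Trotter step. The product is reversed
-- because the head of a gate list acts first.
open scoped Matrix.Norms.L2Operator in
theorem trotter_overlap {S : ℕ} (h : LocalHamiltonian n N ℓ) (E : Fin S → ℝ)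
    (ψ : Fin S → EuclideanSpace ℂ (Bits (Fin n))) (a : Fin S → ℂ) (hψ : Orthonormal ℂ ψ)
    (heig : ∀ j, h.op *ᵥ (ψ j).ofLp = (E j : ℂ) • (ψ j).ofLp) {φ : Bits (Fin n) → ℂ}
    (hφ : φ = ∑ j, a j • (ψ j).ofLp) (hφ1 : l2n φ = 1) {M k : ℕ} (hM : 0 < M) {α : ℝ}
    (hα : ∑ i, (k : ℝ) / M * opNorm (h.term i) ≤ α) (hα1 : α ≤ 1) :
    ‖star φ ⬝ᵥ ((List.ofFn (h.propagator M k)).reverse.prod ^ M *ᵥ φ)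
      - expSignal (fun j => ‖a j‖ ^ 2) E k‖ ≤ M * (2 * α ^ 2) := by
  have hM0 : (M : ℂ) ≠ 0 := by exact_mod_cast hM.ne'
  have hherm : h.op.IsHermitian := by
    unfold LocalHamiltonian.op Matrix.IsHermitian
    rw [Matrix.conjTranspose_sum]
    exact Finset.sum_congr rfl fun i _ => h.isHermitian i
  have hc : -(Complex.I * (k : ℂ) / (M : ℂ)) = -(Complex.I * ((k / M : ℝ) : ℂ)) := by
    push_cast; ring
  set c : ℂ := -(Complex.I * (k : ℂ) / (M : ℂ)) with hcdef
  have hnc : ‖c‖ = (k : ℝ) / M := by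
    rw [hcdef, norm_neg, norm_div, norm_mul, Complex.norm_I, one_mul, Complex.norm_natCast, Complex.norm_natCast]
  set l : List (QOp (Fin n)) := (List.ofFn fun i => c • h.term i).reverse with hl
  have hmap : (List.ofFn (h.propagator M k)).reverse = l.map NormedSpace.exp := by
    rw [hl, List.map_reverse, List.map_ofFn]; rfl
  have hsum : l.sum = c • h.op := by
    rw [hl, List.sum_reverse, List.sum_ofFn, LocalHamiltonian.op, Finset.smul_sum]
  have hnorm : (l.map norm).sum ≤ α := by
    rw [hl, List.map_reverse, List.sum_reverse, List.map_ofFn, List.sum_ofFn]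
    refine le_trans (Finset.sum_le_sum fun i _ => ?_) hα
    rw [Function.comp_apply, norm_smul, hnc]
    exact le_rfl
  have hunit : ∀ U ∈ Matrix.unitaryGroup (Bits (Fin n)) ℂ, ‖U‖ ≤ 1 := fun U hU =>
    (CStarRing.norm_of_mem_unitary hU).le
  have hX : ‖(l.map NormedSpace.exp).prod‖ ≤ 1 := by
    apply hunit
    apply list_prod_mem
    intro U hU
    rw [← hmap, List.mem_reverse, List.mem_ofFn] at hU
    obtain ⟨i, rfl⟩ := hU
    unfold LocalHamiltonian.propagator
    rw [← hcdef, hc]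
    exact exp_smul_hermitian_mem_unitaryGroup (h.isHermitian i) _
  have hY : ‖NormedSpace.exp l.sum‖ ≤ 1 := by
    apply hunit
    rw [hsum, hc]
    exact exp_smul_hermitian_mem_unitaryGroup hherm _
  have hmain := norm_prod_exp_pow_sub_le l M hnorm hα1 hX hY
  have hsignal : star φ ⬝ᵥ (NormedSpace.exp l.sum ^ M *ᵥ φ) = expSignal (fun j => ‖a j‖ ^ 2) E k := by
    have hj : ∀ j, NormedSpace.exp l.sum ^ M *ᵥ (ψ j).ofLp
        = Complex.exp (-(Complex.I * E j)) ^ k • (ψ j).ofLp := by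
      intro j
      have h1 : l.sum *ᵥ (ψ j).ofLp = (c * E j) • (ψ j).ofLp := by
        rw [hsum, Matrix.smul_mulVec, heig, smul_smul]
      rw [pow_mulVec_of_eigenvector (exp_mulVec_of_eigenvector h1), ← Complex.exp_nat_mul,
        ← Complex.exp_nat_mul]
      congr 2
      rw [hcdef]; field_simp
    have h2 : NormedSpace.exp l.sum ^ M *ᵥ φ
        = ∑ j, (a j * Complex.exp (-(Complex.I * E j)) ^ k) • (ψ j).ofLp := by
      rw [hφ, Matrix.mulVec_sum]
      refine Finset.sum_congr rfl fun j _ => ?_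
      rw [Matrix.mulVec_smul, hj, smul_smul]
    have h3 : ∀ b : Fin S → ℂ, ∑ j, b j • (ψ j).ofLp = (∑ j, b j • ψ j).ofLp := by
      intro b; simp
    have h4 := hψ.inner_sum a (fun j => a j * Complex.exp (-(Complex.I * E j)) ^ k) Finset.univ
    rw [EuclideanSpace.inner_eq_star_dotProduct, ← h3, ← h3, ← hφ, ← h2, dotProduct_comm] at h4
    rw [h4]
    unfold expSignal
    refine Finset.sum_congr rfl fun j _ => ?_
    rw [← mul_assoc, ← Complex.normSq_eq_conj_mul_self, Complex.normSq_eq_norm_sq]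
  rw [← hsignal, hmap, ← dotProduct_sub, ← Matrix.sub_mulVec]
  refine (norm_dotProduct_le _ _).trans ?_
  rw [l2n_star, hφ1, one_mul]
  have := Matrix.l2_opNorm_mulVec ((l.map NormedSpace.exp).prod ^ M - NormedSpace.exp l.sum ^ M) (WithLp.toLp 2 φ)
  refine le_trans this ?_
  have h5 : ‖WithLp.toLp 2 φ‖ = 1 := hφ1
  rw [h5, mul_one]
  exact hmain

theorem onRegister_eq (G : QOp (Fin n)) : onRegister G = ancillaBlock G G := by
  ext x y
  simp only [onRegister, ancillaBlock, Matrix.of_apply, ite_self]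

theorem circuitOp_map_onRegister (B : List (QOp (Fin n))) :
    circuitOp (B.map onRegister) = onRegister (circuitOp B) := by
  let f : QOp (Fin n) →* QOp (Option (Fin n)) :=
    { toFun := onRegister
      map_one' := by rw [onRegister_eq, ancillaBlock_one]
      map_mul' := fun G G' => by simp only [onRegister_eq, ancillaBlock_mul] }
  rw [circuitOp, circuitOp, ← List.map_reverse]
  exact (map_list_prod f B.reverse).symm

/-- Controlling by the ancilla, as a monoid homomorphism. -/
def controlledHom (n : ℕ) : QOp (Fin n) →* QOp (Option (Fin n)) where
  toFun := controlled
  map_one' := by rw [controlled_eq_ancillaBlock, ancillaBlock_one]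
  map_mul' G G' := by simp only [controlled_eq_ancillaBlock, ancillaBlock_mul, mul_one]

theorem circuitOp_flatten {ι : Type} [Fintype ι] [DecidableEq ι] (B : List (List (QOp ι))) :
    circuitOp B.flatten = (B.map circuitOp).reverse.prod := by
  induction B with
  | nil => simp [circuitOp]
  | cons b B ih =>
    rw [List.flatten_cons, circuitOp_append, ih, List.map_cons, List.reverse_cons, List.prod_append,
      List.prod_singleton]

theorem circuitOp_rounds {A : Fin N → Finset (Fin n)} {G : Fin N → QOp (Fin n)}
    {blk : Fin N → List (QOp (Option (Fin n)))} (hblk : ∀ l, CompilesControlled (A l) (G l) (blk l)) (M : ℕ) :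
    circuitOp (List.replicate M (List.ofFn blk).flatten).flatten
      = controlled ((List.ofFn G).reverse.prod ^ M) := by
  have h1 : circuitOp (List.ofFn blk).flatten = controlled (List.ofFn G).reverse.prod := by
    rw [circuitOp_flatten, List.map_ofFn]
    have : circuitOp ∘ blk = controlled ∘ G := funext fun l => (hblk l).2
    rw [this, ← List.map_ofFn, ← List.map_reverse]
    exact (map_list_prod (controlledHom n) _).symm
  rw [circuitOp_flatten, List.map_replicate, List.reverse_replicate, List.prod_replicate, h1]
  exact (map_pow (controlledHom n) _ M).symm

theorem onAncilla_mulVec (u : Matrix (Fin 2) (Fin 2) ℂ) (v : Bits (Option (Fin n)) → ℂ)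
    (x : Bits (Option (Fin n))) :
    (onAncilla u *ᵥ v) x = ∑ b, u (x none) b * v (joinBits b (regBits x)) := by
  rw [Matrix.mulVec, dotProduct, sum_bits_option]
  refine Finset.sum_congr rfl fun b _ => ?_
  rw [Finset.sum_eq_single (regBits x)]
  · simp [onAncilla]
  · intro y _ hy
    have : regBits x ≠ regBits (joinBits b y) := Ne.symm hy
    simp only [onAncilla, Matrix.of_apply]
    rw [if_neg this, zero_mul]
  · simp

theorem circuitOp_singleton {ι : Type} [Fintype ι] [DecidableEq ι] (g : QOp ι) : circuitOp [g] = g := by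
  simp [circuitOp]

theorem hadamardTest_amplitude (prep : List (QOp (Fin n))) {M : ℕ}
    {blk : Fin N → List (QOp (Option (Fin n)))} (θ : ℝ) {W : QOp (Fin n)}
    (hW : circuitOp (List.replicate M (List.ofFn blk).flatten).flatten = controlled W)
    (x : Bits (Fin n)) :
    (circuitOp (hadamardTest prep M blk θ) *ᵥ ketZero _) (joinBits 0 x)
      = 1 / 2 * (Complex.exp (-(Complex.I * θ / 2)) * (circuitOp prep *ᵥ ketZero _) x
        + Complex.exp (Complex.I * θ / 2) * (W *ᵥ (circuitOp prep *ᵥ ketZero _)) x) := by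
  have hprep : ∀ b y, (circuitOp (prep.map onRegister) *ᵥ ketZero (Option (Fin n))) (joinBits b y)
      = if b = 0 then (circuitOp prep *ᵥ ketZero (Fin n)) y else 0 := by
    intro b y
    rw [circuitOp_map_onRegister, onRegister_eq, ancillaBlock_mulVec, ite_self, joinBits_none, regBits_joinBits]
    have hk : (fun y : Bits (Fin n) => ketZero (Option (Fin n)) (joinBits b y))
        = if b = 0 then ketZero (Fin n) else 0 := by
      funext y
      have h0 : joinBits b y = (fun _ => 0) ↔ b = 0 ∧ y = fun _ => 0 := by
        constructor
        · intro h
          exact ⟨congrFun h none, funext fun i => congrFun h (some i)⟩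
        · rintro ⟨rfl, rfl⟩
          funext i; cases i <;> rfl
      simp only [ketZero, Pi.single_apply, h0]
      by_cases hb : b = 0 <;> simp [hb, Pi.single_apply]
    rw [hk]
    split_ifs
    · rfl
    · rw [Matrix.mulVec_zero]; rfl
  have h2 : (((Real.sqrt 2 : ℝ) : ℂ)⁻¹) * (((Real.sqrt 2 : ℝ) : ℂ)⁻¹) = 1 / 2 := by
    rw [← mul_inv, ← Complex.ofReal_mul, Real.mul_self_sqrt (by norm_num)]; norm_num
  have hH : ∀ b y, (onAncilla hadamardMat *ᵥ (circuitOp (prep.map onRegister) *ᵥ ketZero (Option (Fin n))))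
      (joinBits b y) = ((Real.sqrt 2 : ℝ) : ℂ)⁻¹ * (circuitOp prep *ᵥ ketZero (Fin n)) y := by
    intro b y
    rw [onAncilla_mulVec, Fin.sum_univ_two, regBits_joinBits, hprep, hprep, joinBits_none]
    rcases fin_two_cases b with rfl | rfl <;> simp [hadamardMat]
  set χ := onAncilla hadamardMat *ᵥ (circuitOp (prep.map onRegister) *ᵥ ketZero (Option (Fin n))) with hχ
  have hC : ∀ b y, (controlled W *ᵥ χ) (joinBits b y) = ((Real.sqrt 2 : ℝ) : ℂ)⁻¹ *
      (if b = 1 then (W *ᵥ (circuitOp prep *ᵥ ketZero (Fin n))) y else (circuitOp prep *ᵥ ketZero (Fin n)) y) := by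
    intro b y
    have hv : (fun y => χ (joinBits b y)) = (((Real.sqrt 2 : ℝ) : ℂ)⁻¹) • (circuitOp prep *ᵥ ketZero (Fin n)) := by
      funext y; rw [hH]; rfl
    rw [controlled_eq_ancillaBlock, ancillaBlock_mulVec, joinBits_none, regBits_joinBits, hv, Matrix.mulVec_smul,
      Pi.smul_apply, smul_eq_mul]
    congr 1
    split_ifs
    · rfl
    · rw [Matrix.one_mulVec]
  have hR : ∀ b y, (onAncilla (rotZMat θ) *ᵥ (controlled W *ᵥ χ)) (joinBits b y)
      = rotZMat θ b b * (controlled W *ᵥ χ) (joinBits b y) := by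
    intro b y
    rw [onAncilla_mulVec, Fin.sum_univ_two, regBits_joinBits, joinBits_none]
    rcases fin_two_cases b with rfl | rfl <;> simp [rotZMat]
  have hsplit : circuitOp (hadamardTest prep M blk θ) *ᵥ ketZero _
      = onAncilla hadamardMat *ᵥ (onAncilla (rotZMat θ) *ᵥ (controlled W *ᵥ χ)) := by
    have h3 : circuitOp [onAncilla (rotZMat θ), onAncilla hadamardMat]
        = onAncilla hadamardMat * onAncilla (n := n) (rotZMat θ) := by simp [circuitOp]
    unfold hadamardTest
    rw [circuitOp_append, circuitOp_append, circuitOp_append, hW, h3, circuitOp_singleton, hχ]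
    simp only [Matrix.mulVec_mulVec, mul_assoc]
  rw [hsplit, onAncilla_mulVec, Fin.sum_univ_two, regBits_joinBits, joinBits_none, hR, hR, hC, hC]
  simp only [hadamardMat, rotZMat]
  simp [-Matrix.mulVec_mulVec]
  linear_combination (Complex.exp (-(Complex.I * θ / 2)) * (circuitOp prep *ᵥ ketZero _) x
        + Complex.exp (Complex.I * θ / 2) * (W *ᵥ (circuitOp prep *ᵥ ketZero _)) x) * h2

/-- The ancilla 0 branch carries half the sum of φ and W φ with relative phase e^{iθ}. The two
squared norms contribute 1/2 to the probability, the interference term is the overlap. -/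
theorem bornProb_hadamardTest (prep : List (QOp (Fin n))) {M : ℕ}
    {blk : Fin N → List (QOp (Option (Fin n)))} (θ : ℝ) {W : QOp (Fin n)}
    (hW : circuitOp (List.replicate M (List.ofFn blk).flatten).flatten = controlled W)
    {φ : Bits (Fin n) → ℂ} (hφ : φ = circuitOp prep *ᵥ ketZero _) (h1 : l2n φ = 1)
    (h2 : l2n (W *ᵥ φ) = 1) :
    2 * bornProb (hadamardTest prep M blk θ) 0 - 1
      = (Complex.exp (Complex.I * θ) * (star φ ⬝ᵥ (W *ᵥ φ))).re := by
  unfold bornProb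
  rw [sum_bits_option, Fin.sum_univ_two]
  simp only [joinBits_none, if_true, one_ne_zero, if_false, Finset.sum_const_zero, add_zero,
    hadamardTest_amplitude prep θ hW, ← hφ]
  have hterm : ∀ p q : ℂ, ‖1 / 2 * (Complex.exp (-(Complex.I * θ / 2)) * p + Complex.exp (Complex.I * θ / 2) * q)‖ ^ 2
      = 1 / 4 * (‖p‖ ^ 2 + ‖q‖ ^ 2 + 2 * (Complex.exp (Complex.I * θ) * (star p * q)).re) := by
    intro p q
    have e1 : ‖Complex.exp (-(Complex.I * θ / 2))‖ = 1 := by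
      have := norm_exp_neg_I_mul (θ / 2); push_cast at this; rwa [← mul_div_assoc] at this
    have e2 : ‖Complex.exp (Complex.I * θ / 2)‖ = 1 := by
      have := norm_exp_neg_I_mul (-(θ / 2)); push_cast at this
      rwa [mul_neg, neg_neg, ← mul_div_assoc] at this
    have e3 : Complex.exp (-(Complex.I * θ / 2)) * Complex.exp (Complex.I * θ / 2) = 1 := by
      rw [← Complex.exp_add]; simp
    have e4 : (starRingEnd ℂ) (Complex.exp (Complex.I * θ / 2)) = Complex.exp (-(Complex.I * θ / 2)) := by
      rw [← Complex.exp_conj]; congr 1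
      rw [map_div₀, map_mul, Complex.conj_I, Complex.conj_ofReal, Complex.conj_ofNat]; ring
    have e5 : Complex.exp (Complex.I * θ) = Complex.exp (Complex.I * θ / 2) * Complex.exp (Complex.I * θ / 2) := by
      rw [← Complex.exp_add]; congr 1; ring
    have e6 : (starRingEnd ℂ) (Complex.exp (-(Complex.I * θ / 2))) = Complex.exp (Complex.I * θ / 2) := by
      rw [← e4, Complex.conj_conj]
    rw [norm_mul, mul_pow, ← Complex.normSq_eq_norm_sq (_ + _), Complex.normSq_add, Complex.normSq_eq_norm_sq,
      Complex.normSq_eq_norm_sq, norm_mul, norm_mul, e1, e2, one_mul, one_mul]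
    have e7 : (Complex.exp (-(Complex.I * θ / 2)) * p * (starRingEnd ℂ) (Complex.exp (Complex.I * θ / 2) * q)).re
        = (Complex.exp (Complex.I * θ) * (star p * q)).re := by
      rw [← Complex.conj_re (Complex.exp (Complex.I * θ) * (star p * q)), e5]
      simp only [map_mul, RCLike.star_def, Complex.conj_conj, e4]
      congr 1; ring
    rw [e7]; norm_num
  simp_rw [hterm]
  rw [← Finset.mul_sum, Finset.sum_add_distrib, Finset.sum_add_distrib, ← l2n_sq, ← l2n_sq, h1, h2,
    ← Finset.mul_sum, ← Complex.re_sum, ← Finset.mul_sum]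
  simp only [dotProduct, Pi.star_apply]
  ring

end HadamardTest

/-! ### Gate counts, and circuits as unitaries -/

section Gates

variable {n N : ℕ}

theorem IsGateWithin.isGate {ι : Type} [Fintype ι] [DecidableEq ι] {A : Finset ι} {M : QOp ι}
    (h : IsGateWithin A M) : IsGate M := by
  obtain ⟨hu, T, _, h2, h3⟩ := h
  exact ⟨hu, T, Finset.subset_univ _, h2, h3⟩

theorem onRegister_conjTranspose (G : QOp (Fin n)) : onRegister Gᴴ = (onRegister G)ᴴ := by
  ext x y
  simp only [onRegister, Matrix.of_apply, Matrix.conjTranspose_apply]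
  by_cases h : x none = y none
  · rw [if_pos h, if_pos h.symm]
  · rw [if_neg h, if_neg (Ne.symm h), star_zero]

theorem IsGate.onRegister {G : QOp (Fin n)} (h : IsGate G) : IsGate (onRegister G) := by
  obtain ⟨hu, T, -, hc, ha⟩ := h
  refine ⟨?_, T.map Function.Embedding.some, Finset.subset_univ _, by rwa [Finset.card_map], ?_⟩
  · rw [Matrix.mem_unitaryGroup_iff, Matrix.star_eq_conjTranspose] at hu ⊢
    rw [← onRegister_conjTranspose, onRegister_eq, onRegister_eq, ancillaBlock_mul, hu, ancillaBlock_one]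
  · obtain ⟨h0, h1⟩ := actsOn_iff.mp ha
    rw [actsOn_iff]
    constructor
    · intro x y h
      simp only [_root_.onRegister, Matrix.of_apply]
      by_cases hn : x none = y none
      · rw [if_pos hn]
        apply h0
        intro h'
        apply h
        intro i hi
        cases i with
        | none => exact hn
        | some i => exact h' i (fun hm => hi (by simpa using hm))
      · rw [if_neg hn]
    · intro x y x' y' h h' hx hy
      simp only [_root_.onRegister, Matrix.of_apply]
      rw [if_pos (h none (by simp)), if_pos (h' none (by simp))]
      apply h1
      · exact fun i hi => h (some i) (by simpa using hi)
      · exact fun i hi => h' (some i) (by simpa using hi)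
      · exact fun i hi => hx (some i) (by simpa using hi)
      · exact fun i hi => hy (some i) (by simpa using hi)

theorem onAncilla_eq_blockOp (u : Matrix (Fin 2) (Fin 2) ℂ) :
    onAncilla (n := n) u = blockOp none (fun _ => u) := by
  ext x y
  have : regBits x = regBits y ↔ ∀ i, i ≠ none → x i = y i := by
    constructor
    · intro h i hi
      obtain ⟨j, rfl⟩ := Option.ne_none_iff_exists'.mp hi
      exact congrFun h j
    · exact fun h => funext fun i => h (some i) (by simp)
  simp only [onAncilla, blockOp, Matrix.of_apply, this]

theorem isGate_onAncilla {u : Matrix (Fin 2) (Fin 2) ℂ} (hu : u ∈ Matrix.unitaryGroup (Fin 2) ℂ) :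
    IsGate (onAncilla (n := n) u) := by
  rw [onAncilla_eq_blockOp]
  exact isGate_blockOp (T := {none}) (by simp) (by simp) (fun _ _ _ => rfl) (fun _ => hu)

theorem hadamardMat_mem : hadamardMat ∈ Matrix.unitaryGroup (Fin 2) ℂ := by
  have h2 : (((Real.sqrt 2 : ℝ) : ℂ)⁻¹) * (((Real.sqrt 2 : ℝ) : ℂ)⁻¹) = 1 / 2 := by
    rw [← mul_inv, ← Complex.ofReal_mul, Real.mul_self_sqrt (by norm_num)]; norm_num
  rw [Matrix.mem_unitaryGroup_iff]
  ext i j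
  fin_cases i <;> fin_cases j <;>
    simp [hadamardMat, Matrix.mul_apply, Matrix.star_eq_conjTranspose, Matrix.conjTranspose_apply,
      Complex.conj_ofReal, h2] <;> norm_num

theorem rotZMat_mem (θ : ℝ) : rotZMat θ ∈ Matrix.unitaryGroup (Fin 2) ℂ := by
  have e4 : (starRingEnd ℂ) (Complex.exp (Complex.I * θ / 2)) = Complex.exp (-(Complex.I * θ / 2)) := by
    rw [← Complex.exp_conj]; congr 1
    rw [map_div₀, map_mul, Complex.conj_I, Complex.conj_ofReal, Complex.conj_ofNat]; ring
  have e6 : (starRingEnd ℂ) (Complex.exp (-(Complex.I * θ / 2))) = Complex.exp (Complex.I * θ / 2) := by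
    rw [← e4, Complex.conj_conj]
  rw [Matrix.mem_unitaryGroup_iff]
  ext i j
  fin_cases i <;> fin_cases j <;>
    simp [rotZMat, Matrix.mul_apply, Matrix.star_eq_conjTranspose, Matrix.conjTranspose_apply,
      e4, e6, ← Complex.exp_add]

theorem isGate_of_mem_hadamardTest {prep : List (QOp (Fin n))} {M : ℕ}
    {blk : Fin N → List (QOp (Option (Fin n)))} {θ : ℝ} (hprep : ∀ g ∈ prep, IsGate g)
    (hblk : ∀ l, ∀ g ∈ blk l, IsGate g) : ∀ g ∈ hadamardTest prep M blk θ, IsGate g := by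
  intro g hg
  unfold hadamardTest at hg
  simp only [List.mem_append, List.mem_map, List.mem_flatten, List.mem_replicate, List.mem_cons,
    List.not_mem_nil, or_false] at hg
  rcases hg with ((⟨G, hG, rfl⟩ | rfl) | ⟨B, ⟨-, rfl⟩, hB⟩) | rfl | rfl
  · exact (hprep G hG).onRegister
  · exact isGate_onAncilla hadamardMat_mem
  · rw [List.mem_flatten] at hB
    obtain ⟨b, hb, hgb⟩ := hB
    rw [List.mem_ofFn] at hb
    obtain ⟨l, rfl⟩ := hb
    exact hblk l g hgb
  · exact isGate_onAncilla (rotZMat_mem θ)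
  · exact isGate_onAncilla hadamardMat_mem

theorem length_hadamardTest_le (prep : List (QOp (Fin n))) (M : ℕ)
    {blk : Fin N → List (QOp (Option (Fin n)))} (θ : ℝ) {c : ℕ} (hc : ∀ l, (blk l).length ≤ c) :
    (hadamardTest prep M blk θ).length ≤ prep.length + 3 + M * (N * c) := by
  have h1 : (List.ofFn blk).flatten.length ≤ N * c := by
    rw [List.length_flatten, List.map_ofFn, List.sum_ofFn]
    calc _ ≤ ∑ _l : Fin N, c := Finset.sum_le_sum fun l _ => hc l
      _ = N * c := by simp
  have h2 : (List.replicate M (List.ofFn blk).flatten).flatten.length ≤ M * (N * c) := by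
    rw [List.length_flatten, List.map_replicate, List.sum_replicate, smul_eq_mul]
    exact Nat.mul_le_mul_left _ h1
  unfold hadamardTest
  simp only [List.length_append, List.length_map, List.length_cons, List.length_nil]
  omega

theorem circuitOp_mem_unitaryGroup {ι : Type} [Fintype ι] [DecidableEq ι] {c : List (QOp ι)}
    (h : ∀ g ∈ c, IsGate g) : circuitOp c ∈ Matrix.unitaryGroup (Bits ι) ℂ := by
  unfold circuitOp
  apply list_prod_mem
  intro g hg
  exact (h g (List.mem_reverse.mp hg)).1

theorem l2n_ketZero (ι : Type) [Fintype ι] [DecidableEq ι] : l2n (ketZero ι) = 1 := by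
  rw [← sq_eq_sq₀ (l2n_nonneg _) zero_le_one, l2n_sq, Finset.sum_eq_single (fun _ => 0)]
  · simp [ketZero]
  · intro x _ hx
    simp [ketZero, hx]
  · simp

theorem l2n_mulVec_of_mem_unitaryGroup {κ : Type*} [Fintype κ] [DecidableEq κ] {U : Matrix κ κ ℂ}
    (hU : U ∈ Matrix.unitaryGroup κ ℂ) (v : κ → ℂ) : l2n (U *ᵥ v) = l2n v :=
  l2n_mulVec_of_isometry (Matrix.mem_unitaryGroup_iff'.mp hU) v

end Gates

/-! ### Concentration of the measured frequencies -/

section Measurement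

open MeasureTheory ProbabilityTheory

variable {n N : ℕ}

theorem bornProb_nonneg (c : List (QOp (Option (Fin n)))) (b : Fin 2) : 0 ≤ bornProb c b :=
  Finset.sum_nonneg fun x _ => by split_ifs <;> positivity

theorem bornProb_add {c : List (QOp (Option (Fin n)))} (hc : ∀ g ∈ c, IsGate g) :
    bornProb c 0 + bornProb c 1 = 1 := by
  have h : l2n (circuitOp c *ᵥ ketZero (Option (Fin n))) ^ 2 = 1 := by
    rw [l2n_mulVec_of_mem_unitaryGroup (circuitOp_mem_unitaryGroup hc), l2n_ketZero, one_pow]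
  rw [l2n_sq] at h
  rw [← h, bornProb, bornProb, ← Finset.sum_add_distrib]
  refine Finset.sum_congr rfl fun x _ => ?_
  rcases fin_two_cases (x none) with hx | hx <;> simp [hx]

theorem isProbabilityMeasure_outcomeLaw {c : List (QOp (Option (Fin n)))} (hc : ∀ g ∈ c, IsGate g) :
    IsProbabilityMeasure (outcomeLaw c) := by
  constructor
  simp only [outcomeLaw, Fin.sum_univ_two, Measure.add_apply, Measure.smul_apply, measure_univ, smul_eq_mul,
    mul_one]
  rw [← ENNReal.ofReal_add (bornProb_nonneg _ _) (bornProb_nonneg _ _), bornProb_add hc, ENNReal.ofReal_one]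

theorem integral_outcomeLaw (c : List (QOp (Option (Fin n)))) :
    ∫ b, (if b = 0 then (1 : ℝ) else 0) ∂outcomeLaw c = bornProb c 0 := by
  rw [outcomeLaw, Fin.sum_univ_two, integral_add_measure, integral_smul_measure, integral_smul_measure,
    integral_dirac, integral_dirac]
  · simp [ENNReal.toReal_ofReal (bornProb_nonneg c 0)]
  · exact Integrable.of_finite.smul_measure ENNReal.ofReal_ne_top
  · exact Integrable.of_finite.smul_measure ENNReal.ofReal_ne_top

variable {L R : ℕ}

/-- Hoeffding's inequality for R independent indicators with values in [0, 1], applied to both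
tails. -/
theorem hoeffding_zeroFreq (μ : Run L R → Measure (Fin 2)) [∀ ρ, IsProbabilityMeasure (μ ρ)]
    (p : ℝ) (k : Fin (2 * L + 1)) (t : Fin 2)
    (hp : ∀ r, ∫ b, (if b = 0 then (1 : ℝ) else 0) ∂μ (k, t, r) = p) (hR : 0 < R) {ε : ℝ} (hε : 0 ≤ ε) :
    (Measure.pi μ).real {ω | ε < |zeroFreq ω k t - p|} ≤ 2 * Real.exp (-(2 * ε ^ 2 * R)) := by
  have hR' : (0 : ℝ) < R := by exact_mod_cast hR
  let hit : Fin R → (Run L R → Fin 2) → ℝ := fun r ω => (if ω (k, t, r) = 0 then (1 : ℝ) else 0)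
  have hindep : iIndepFun (fun r ω => hit r ω - p) (Measure.pi μ) := by
    have h := iIndepFun_pi (μ := μ) (X := fun _ b => (if b = 0 then (1 : ℝ) else 0) - p)
      (fun _ => (measurable_of_countable _).aemeasurable)
    exact h.precomp (g := fun r : Fin R => ((k, t, r) : Run L R)) (fun a b h => by simpa using h)
  have hmean : ∀ r, (Measure.pi μ)[hit r] = p := by
    intro r
    rw [← hp r, ← (measurePreserving_eval μ (k, t, r)).map_eq, integral_map]
    · exact (measurable_pi_apply _).aemeasurable
    · exact (measurable_of_countable _).aestronglyMeasurable
  have hsub : ∀ r, HasSubgaussianMGF (fun ω => hit r ω - p) ((‖(1 : ℝ) - 0‖₊ / 2) ^ 2) (Measure.pi μ) := by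
    intro r
    have h := hasSubgaussianMGF_of_mem_Icc (μ := Measure.pi μ) (X := hit r) (a := 0) (b := 1)
      (measurable_of_countable _).aemeasurable
      (Filter.Eventually.of_forall fun ω => by simp only [hit]; split_ifs <;> simp)
    rwa [hmean r] at h
  have hexp : ∀ (Y : Fin R → (Run L R → Fin 2) → ℝ), iIndepFun Y (Measure.pi μ) →
      (∀ r, HasSubgaussianMGF (Y r) ((‖(1 : ℝ) - 0‖₊ / 2) ^ 2) (Measure.pi μ)) →
      (Measure.pi μ).real {ω | ε * R ≤ ∑ r, Y r ω} ≤ Real.exp (-(2 * ε ^ 2 * R)) := by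
    intro Y hY hs
    have h := HasSubgaussianMGF.measure_sum_ge_le_of_iIndepFun hY (s := Finset.univ) (fun i _ => hs i)
      (show 0 ≤ ε * R by positivity)
    refine h.trans (Real.exp_le_exp.mpr (le_of_eq ?_))
    simp
    field_simp
  have h1 := hexp _ hindep hsub
  have h2 := hexp (fun r ω => -(hit r ω - p)) (hindep.comp (fun _ x => -x) (fun _ => measurable_neg))
    (fun r => (hsub r).neg)
  have hfreq : ∀ ω : Run L R → Fin 2, ∑ r, (hit r ω - p) = (zeroFreq ω k t - p) * R := by
    intro ω
    rw [Finset.sum_sub_distrib, Finset.sum_boole, Finset.sum_const, Finset.card_univ, Fintype.card_fin, zeroFreq,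
      nsmul_eq_mul, sub_mul, div_mul_cancel₀ _ hR'.ne', mul_comm p]
  have hcover : {ω : Run L R → Fin 2 | ε < |zeroFreq ω k t - p|}
      ⊆ {ω | ε * R ≤ ∑ r, (hit r ω - p)} ∪ {ω | ε * R ≤ ∑ r, -(hit r ω - p)} := by
    intro ω hω
    simp only [Set.mem_ofPred_eq, Set.mem_union, Finset.sum_neg_distrib, hfreq] at hω ⊢
    rw [← neg_mul]
    rcases lt_abs.mp hω with h | h
    · exact Or.inl (mul_le_mul_of_nonneg_right h.le hR'.le)
    · exact Or.inr (mul_le_mul_of_nonneg_right h.le hR'.le)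
  calc _ ≤ _ := measureReal_mono hcover
    _ ≤ _ := measureReal_union_le _ _
    _ ≤ _ := by linarith

/-- A union bound over the 2(2L + 1) pairs of a time and an angle. The term 4(2L + 1) in `hd` pays
for the number of events and the two tails; e^{-x} ≤ 2^{-x} does the rest. -/
theorem experiment_concentration {prep : List (QOp (Fin n))} {M : ℕ}
    {blk : Fin (2 * L + 1) → Fin N → List (QOp (Option (Fin n)))}
    (hg : ∀ ρ : Run L R, ∀ g ∈ runCircuit prep M blk ρ, IsGate g) (hR : 0 < R) {ε : ℝ} (hε : 0 ≤ ε) {d : ℕ}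
    (hd : (d : ℝ) + 4 * (2 * L + 1) ≤ 2 * ε ^ 2 * R) :
    IsProbabilityMeasure (experimentLaw (R := R) prep M blk) ∧
    1 - (1 / 2 : ℝ) ^ d ≤ (experimentLaw (R := R) prep M blk).real
      {ω | ∀ k t, |zeroFreq ω k t - bornProb (hadamardTest prep M (blk k) (testAngle t)) 0| ≤ ε} := by
  have hprob : ∀ ρ : Run L R, IsProbabilityMeasure (outcomeLaw (runCircuit prep M blk ρ)) :=
    fun ρ => isProbabilityMeasure_outcomeLaw (hg ρ)
  have hpi : IsProbabilityMeasure (experimentLaw (R := R) prep M blk) := by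
    unfold experimentLaw; infer_instance
  refine ⟨hpi, ?_⟩
  set μ := experimentLaw (R := R) prep M blk with hμ
  set p : Fin (2 * L + 1) × Fin 2 → ℝ :=
    fun q => bornProb (hadamardTest prep M (blk q.1) (testAngle q.2)) 0 with hp
  set bad : Fin (2 * L + 1) × Fin 2 → Set (Run L R → Fin 2) := fun q => {ω | ε < |zeroFreq ω q.1 q.2 - p q|}
  have hbad : ∀ q, μ.real (bad q) ≤ 2 * Real.exp (-(2 * ε ^ 2 * R)) := by
    intro q
    exact hoeffding_zeroFreq _ (p q) q.1 q.2 (fun r => integral_outcomeLaw _) hR hε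
  have hunion : μ.real (⋃ q, bad q) ≤ (1 / 2 : ℝ) ^ d := by
    refine (measureReal_iUnion_fintype_le _).trans ((Finset.sum_le_sum fun q _ => hbad q).trans ?_)
    rw [Finset.sum_const, Finset.card_univ, Fintype.card_prod, Fintype.card_fin, Fintype.card_fin, nsmul_eq_mul]
    -- m is the number of events times two tails, and m ≤ 2^m, so m extra bits of confidence absorb
    -- the union bound.
    set m : ℕ := 4 * (2 * L + 1) with hm
    have h1 : ((2 * L + 1) * 2 * 2 : ℝ) ≤ 2 ^ m := by
      have := (Nat.lt_two_pow_self (n := m)).le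
      have h : (m : ℝ) ≤ 2 ^ m := by exact_mod_cast this
      refine le_trans (le_of_eq ?_) h
      rw [hm]; push_cast; ring
    have h2 : Real.exp (-(2 * ε ^ 2 * R)) ≤ (1 / 2 : ℝ) ^ (d + m) := by
      have h3 : (1 / 2 : ℝ) ^ (d + m) = Real.exp (-(Real.log 2 * ((d + m : ℕ) : ℝ))) := by
        rw [one_div, inv_pow, Real.exp_neg, ← Real.rpow_natCast, Real.rpow_def_of_pos (by norm_num)]
      rw [h3, Real.exp_le_exp, neg_le_neg_iff]
      refine le_trans ?_ hd
      have h4 : Real.log 2 ≤ 1 := by linarith [Real.log_two_lt_d9]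
      have h5 : ((d + m : ℕ) : ℝ) = d + 4 * (2 * L + 1) := by rw [hm]; push_cast; ring
      rw [← h5]
      exact mul_le_of_le_one_left (Nat.cast_nonneg _) h4
    have h6 : (2 : ℝ) ^ m * (1 / 2) ^ (d + m) = (1 / 2) ^ d := by
      rw [pow_add, mul_comm, mul_assoc, ← mul_pow]; norm_num
    push_cast
    calc (2 * (L : ℝ) + 1) * 2 * (2 * Real.exp (-(2 * ε ^ 2 * R)))
        = ((2 * L + 1) * 2 * 2) * Real.exp (-(2 * ε ^ 2 * R)) := by ring
      _ ≤ 2 ^ m * (1 / 2) ^ (d + m) := mul_le_mul h1 h2 (Real.exp_nonneg _) (by positivity)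
      _ = _ := h6
  have hset : {ω : Run L R → Fin 2 | ∀ k t, |zeroFreq ω k t - bornProb (hadamardTest prep M (blk k) (testAngle t)) 0| ≤ ε}
      = (⋃ q, bad q)ᶜ := by
    ext ω
    simp only [Set.mem_ofPred_eq, Set.mem_compl_iff, Set.mem_iUnion, not_exists, bad, not_lt, Prod.forall, hp]
  rw [hset, probReal_compl_eq_one_sub (MeasurableSet.of_discrete)]
  linarith

end Measurement

/-! ### Total error of the estimated signal -/

section Accuracy

variable {n N ℓ : ℕ}

theorem LocalHamiltonian.propagator_eq (h : LocalHamiltonian n N ℓ) (M k : ℕ) (l : Fin N) :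
    h.propagator M k l = NormedSpace.exp ((-(Complex.I * ((k / M : ℝ) : ℂ))) • h.term l) := by
  unfold LocalHamiltonian.propagator
  congr 2
  push_cast; ring

theorem LocalHamiltonian.exists_blocks (h : LocalHamiltonian n N ℓ) (L M : ℕ) :
    ∃ blk : Fin (2 * L + 1) → Fin N → List (QOp (Option (Fin n))),
      ∀ k l, CompilesControlled (h.supp l) (h.propagator M k.val l) (blk k l) ∧
        (blk k l).length ≤ unitaryCount (ℓ + 1) := by
  choose blk hblk using fun (k : Fin (2 * L + 1)) (l : Fin N) =>
    exists_compilesControlled (h.isHermitian l) (h.actsOn l) (h.card_le l) ((k.val : ℝ) / M)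
  refine ⟨blk, fun k l => ?_⟩
  rw [h.propagator_eq]
  exact hblk k l

/-- The real and the imaginary part each deviate by at most 2ε from the Trotterized overlap, and
this overlap deviates by the product formula error from the exact signal. -/
theorem estSignal_error {S L R : ℕ} (h : LocalHamiltonian n N ℓ) {prep : List (QOp (Fin n))}
    (hprep : ∀ g ∈ prep, IsGate g) (E : Fin S → ℝ)
    (ψ : Fin S → EuclideanSpace ℂ (Bits (Fin n))) (a : Fin S → ℂ) (hψ : Orthonormal ℂ ψ)
    (heig : ∀ j, h.op *ᵥ (ψ j).ofLp = (E j : ℂ) • (ψ j).ofLp)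
    (hφ : circuitOp prep *ᵥ ketZero (Fin n) = ∑ j, a j • (ψ j).ofLp) {M : ℕ} (hM : 0 < M) {α : ℝ}
    (hα : ∑ i, ((2 * L : ℕ) : ℝ) / M * opNorm (h.term i) ≤ α) (hα1 : α ≤ 1)
    {blk : Fin (2 * L + 1) → Fin N → List (QOp (Option (Fin n)))}
    (hblk : ∀ k l, CompilesControlled (h.supp l) (h.propagator M k.val l) (blk k l)) {ε : ℝ}
    {ω : Run L R → Fin 2}
    (hω : ∀ k t, |zeroFreq ω k t - bornProb (hadamardTest prep M (blk k) (testAngle t)) 0| ≤ ε)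
    (k : Fin (2 * L + 1)) :
    ‖estSignal ω k - expSignal (fun j => ‖a j‖ ^ 2) E k‖ ≤ 4 * ε + M * (2 * α ^ 2) := by
  set φ := circuitOp prep *ᵥ ketZero (Fin n) with hφdef
  set W := (List.ofFn (h.propagator M k)).reverse.prod ^ M with hWdef
  have hφ1 : l2n φ = 1 := by
    rw [hφdef, l2n_mulVec_of_mem_unitaryGroup (circuitOp_mem_unitaryGroup hprep), l2n_ketZero]
  have hWu : W ∈ Matrix.unitaryGroup (Bits (Fin n)) ℂ := by
    apply pow_mem
    apply list_prod_mem
    intro U hU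
    rw [List.mem_reverse, List.mem_ofFn] at hU
    obtain ⟨i, rfl⟩ := hU
    rw [h.propagator_eq]
    exact exp_smul_hermitian_mem_unitaryGroup (h.isHermitian i) _
  have hWφ : l2n (W *ᵥ φ) = 1 := by rw [l2n_mulVec_of_mem_unitaryGroup hWu, hφ1]
  have hαk : ∑ i, ((k : ℕ) : ℝ) / M * opNorm (h.term i) ≤ α := by
    refine le_trans (Finset.sum_le_sum fun i _ => ?_) hα
    refine mul_le_mul_of_nonneg_right ?_ (norm_nonneg _)
    refine div_le_div_of_nonneg_right ?_ (Nat.cast_nonneg M)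
    exact_mod_cast Nat.le_of_lt_succ k.isLt
  have htrot := trotter_overlap h E ψ a hψ heig hφ hφ1 hM hαk hα1
  rw [← hWdef] at htrot
  set z := star φ ⬝ᵥ (W *ᵥ φ) with hz
  have hcirc := circuitOp_rounds (hblk k) M
  have hb : ∀ θ, 2 * bornProb (hadamardTest prep M (blk k) θ) 0 - 1 = (Complex.exp (Complex.I * θ) * z).re :=
    fun θ => bornProb_hadamardTest prep θ hcirc hφdef hφ1 hWφ
  have hb0 := hb (testAngle 0)
  have hb1 := hb (testAngle 1)
  have h0 : (Complex.exp (Complex.I * (testAngle 0 : ℝ)) * z).re = z.re := by simp [testAngle]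
  -- The angle π/2 measures minus the imaginary part, which explains the minus sign in `estSignal`.
  have h1 : (Complex.exp (Complex.I * (testAngle 1 : ℝ)) * z).re = -z.im := by
    have : Complex.exp (Complex.I * (testAngle 1 : ℝ)) = Complex.I := by
      rw [mul_comm, Complex.exp_mul_I]
      simp [testAngle]
    rw [this]; simp
  rw [h0] at hb0
  rw [h1] at hb1
  set p0 := bornProb (hadamardTest prep M (blk k) (testAngle 0)) 0
  set p1 := bornProb (hadamardTest prep M (blk k) (testAngle 1)) 0
  have hsplit : estSignal ω k - z = ((2 * (zeroFreq ω k 0 - p0) : ℝ) : ℂ)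
      - Complex.I * ((2 * (zeroFreq ω k 1 - p1) : ℝ) : ℂ) := by
    have hzre : z = ((2 * p0 - 1 : ℝ) : ℂ) - Complex.I * ((2 * p1 - 1 : ℝ) : ℂ) := by
      rw [hb0, hb1]
      apply Complex.ext <;> simp
    rw [hzre, estSignal]
    push_cast; ring
  have hest : ‖estSignal ω k - z‖ ≤ 4 * ε := by
    rw [hsplit]
    refine (norm_sub_le _ _).trans ?_
    rw [norm_mul, Complex.norm_I, one_mul, Complex.norm_real, Complex.norm_real, norm_mul, norm_mul,
      Real.norm_eq_abs, Real.norm_eq_abs, Real.norm_eq_abs]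
    have e0 := hω k 0
    have e1 := hω k 1
    rw [abs_of_pos (by norm_num : (0 : ℝ) < 2)]
    linarith
  have := norm_add_le (estSignal ω k - z) (z - expSignal (fun j => ‖a j‖ ^ 2) E k)
  rw [sub_add_sub_cancel] at this
  linarith

end Accuracy

/-! ### Semantics and cost of the machine -/

section Machine

/-- The memory after the execution of a program. -/
noncomputable def Program.run (p : Program) (s : Store) : Store := (p.exec s).1

@[simp] theorem Program.run_skip (s : Store) : Program.skip.run s = s := rfl

@[simp] theorem Program.run_set (a : ℕ) (i e : IExpr) (s : Store) :
    (Program.set a i e).run s = Function.update s a (Function.update (s a) (i.eval s) (e.eval s)) := rfl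

@[simp] theorem Program.run_seq (c d : Program) (s : Store) : (Program.seq c d).run s = d.run (c.run s) := rfl

theorem Program.run_ite (e : IExpr) (c d : Program) (s : Store) :
    (Program.ite e c d).run s = if 0 < e.eval s then c.run s else d.run s := by
  simp only [Program.run, Program.exec]
  split_ifs <;> rfl

theorem Program.exec_loop_fst (c : Program) (n : ℕ) (q : Store × ℕ) :
    ((fun p : Store × ℕ => ((c.exec p.1).1, p.2 + 1 + (c.exec p.1).2))^[n] q).1 = c.run^[n] q.1 := by
  induction n generalizing q with
  | zero => rfl
  | succ n ih => rw [Function.iterate_succ_apply, Function.iterate_succ_apply, ih]; rfl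

theorem Program.run_loop (e : IExpr) (c : Program) (s : Store) :
    (Program.loop e c).run s = c.run^[(e.eval s).toNat] s :=
  Program.exec_loop_fst c _ _

/-- The arrays that a program may write to. -/
def Program.writes : Program → List ℕ
  | .skip => []
  | .set a _ _ => [a]
  | .seq c d => c.writes ++ d.writes
  | .ite _ c d => c.writes ++ d.writes
  | .loop _ c => c.writes

/-- The frame rule. For a concrete program the side condition is checked by `decide`, which keeps
the later correctness proofs modular. -/
theorem Program.run_of_not_mem_writes (p : Program) {a : ℕ} (ha : a ∉ p.writes) (s : Store) :
    p.run s a = s a := by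
  induction p generalizing s with
  | skip => rfl
  | set b i e =>
    have : a ≠ b := by simpa [Program.writes] using ha
    rw [Program.run_set, Function.update_of_ne this]
  | seq c d ihc ihd =>
    simp only [Program.writes, List.mem_append, not_or] at ha
    rw [Program.run_seq, ihd ha.2, ihc ha.1]
  | ite e c d ihc ihd =>
    simp only [Program.writes, List.mem_append, not_or] at ha
    rw [Program.run_ite]
    split_ifs
    · exact ihc ha.1 s
    · exact ihd ha.2 s
  | loop e c ih =>
    rw [Program.run_loop]
    generalize (e.eval s).toNat = n
    induction n generalizing s with
    | zero => rfl
    | succ n ihn => rw [Function.iterate_succ_apply, ihn, ih ha]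

/-- The value of the variable `a`, that is, of entry `0` of array `a`. -/
def IExpr.var (a : ℕ) : IExpr := .get a (.const 0)

/-- Reduction modulo the number in variable `6`. -/
def IExpr.clamp (e : IExpr) : IExpr := .sub e (.mul (.div e (.var 6)) (.var 6))

@[simp] theorem IExpr.eval_var (a : ℕ) (s : Store) : (IExpr.var a).eval s = s a 0 := rfl

theorem IExpr.eval_clamp (e : IExpr) (s : Store) : e.clamp.eval s = e.eval s % s 6 0 := by
  simp only [IExpr.clamp, IExpr.eval, IExpr.eval_var]
  rw [Int.emod_def, mul_comm]

/-- Write the value of `e`, reduced, to entry `i` of array `a`. -/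
def Program.put (a : ℕ) (i e : IExpr) : Program := .set a i e.clamp

/-- A loop with counter variable `c`, the number of rounds is entry `j` of array `4`. -/
def Program.for (c : ℕ) (j : ℤ) (p : Program) : Program :=
  .seq (.put c (.const 0) (.const 0))
    (.loop (.get 4 (.const j)) (.seq p (.put c (.const 0) (.add (.var c) (.const 1)))))

theorem Program.run_put (a : ℕ) (i e : IExpr) (s : Store) :
    (Program.put a i e).run s = Function.update s a (Function.update (s a) (i.eval s) (e.eval s % s 6 0)) := by
  rw [Program.put, Program.run_set, IExpr.eval_clamp]

/-- The invariant rule for counted loops. -/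
theorem Program.run_for {c : ℕ} {j : ℤ} {p : Program} {s : Store} {n : ℕ} (hn : s 4 j = n)
    (hP : (n : ℤ) < s 6 0) (hc : c ∉ p.writes) (h6 : 6 ∉ p.writes) (hc4 : c ≠ 4) (hc6 : c ≠ 6)
    (Inv : ℕ → Store → Prop) (hInv : ∀ i t x, Inv i t → Inv i (Function.update t c x)) (h0 : Inv 0 s)
    (hstep : ∀ i < n, ∀ t : Store, (∀ a, a ≠ c → a ∉ p.writes → t a = s a) → t c 0 = i → Inv i t →
      Inv (i + 1) (p.run t)) :
    Inv n ((Program.for c j p).run s) := by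
  have hP0 : 0 < s 6 0 := lt_of_le_of_lt (Int.natCast_nonneg n) hP
  rw [Program.for, Program.run_seq, Program.run_loop, Program.run_put]
  set s0 := Function.update s c (Function.update (s c) ((IExpr.const 0).eval s) ((IExpr.const 0).eval s % s 6 0))
    with hs0
  have hcount : ((IExpr.get 4 (.const j)).eval s0).toNat = n := by
    simp [IExpr.eval, hs0, Function.update_of_ne hc4.symm, hn]
  rw [hcount]
  have key : ∀ i ≤ n, (∀ a, a ≠ c → a ∉ p.writes →
      (Program.run (.seq p (.put c (.const 0) (.add (.var c) (.const 1)))))^[i] s0 a = s a) ∧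
      (Program.run (.seq p (.put c (.const 0) (.add (.var c) (.const 1)))))^[i] s0 c 0 = i ∧
      Inv i ((Program.run (.seq p (.put c (.const 0) (.add (.var c) (.const 1)))))^[i] s0) := by
    intro i
    induction i with
    | zero =>
      intro _
      refine ⟨fun a ha _ => ?_, ?_, hInv _ _ _ h0⟩
      · simp [hs0, Function.update_of_ne ha]
      · simp [hs0, IExpr.eval]
    | succ i ih =>
      intro hi
      obtain ⟨h1, h2, h3⟩ := ih (by omega)
      rw [Function.iterate_succ_apply', Program.run_seq, Program.run_put]
      set t := (Program.run (.seq p (.put c (.const 0) (.add (.var c) (.const 1)))))^[i] s0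
      have ht6 : p.run t 6 = s 6 := by rw [Program.run_of_not_mem_writes p h6, h1 6 hc6.symm h6]
      refine ⟨fun a ha hap => ?_, ?_, hInv _ _ _ (hstep i (by omega) t h1 h2 h3)⟩
      · rw [Function.update_of_ne ha, Program.run_of_not_mem_writes p hap, h1 a ha hap]
      -- The counter is reduced like every other number; it keeps its value because n is below the
      -- modulus.
      · simp only [IExpr.eval, IExpr.eval_var, Function.update_self]
        rw [Program.run_of_not_mem_writes p hc, h2, ht6, Int.emod_eq_of_lt (by omega) (by omega)]
        push_cast; rfl
  exact (key n le_rfl).2.2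

/-- All numbers in the memory have at most `β` bits. -/
def BitBound (β : ℕ) (s : Store) : Prop := ∀ a i, bitLen (s a i) ≤ β

theorem bitLen_le_iff {z : ℤ} {β : ℕ} : bitLen z ≤ β ↔ |z| < 2 ^ β := by
  rw [bitLen, Nat.size_le, Int.abs_eq_natAbs]
  exact_mod_cast Iff.rfl

theorem abs_lt_two_pow_bitLen (z : ℤ) : |z| < 2 ^ bitLen z := bitLen_le_iff.mp le_rfl

theorem bitLen_le_of_abs_le {x y : ℤ} (h : |x| ≤ |y|) : bitLen x ≤ bitLen y :=
  bitLen_le_iff.mpr (h.trans_lt (abs_lt_two_pow_bitLen y))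

theorem bitLen_add_le (x y : ℤ) : bitLen (x + y) ≤ bitLen x + bitLen y + 1 := by
  rw [bitLen_le_iff]
  have hx := abs_lt_two_pow_bitLen x
  have hy := abs_lt_two_pow_bitLen y
  have h1 : (2 : ℤ) ^ bitLen x ≤ 2 ^ (bitLen x + bitLen y) := pow_le_pow_right₀ (by norm_num) (by omega)
  have h2 : (2 : ℤ) ^ bitLen y ≤ 2 ^ (bitLen x + bitLen y) := pow_le_pow_right₀ (by norm_num) (by omega)
  rw [pow_succ]
  linarith [abs_add_le x y]

theorem bitLen_neg (x : ℤ) : bitLen (-x) = bitLen x := by simp [bitLen]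

theorem bitLen_mul_le (x y : ℤ) : bitLen (x * y) ≤ bitLen x + bitLen y := by
  rw [bitLen_le_iff, abs_mul, pow_add]
  exact mul_lt_mul'' (abs_lt_two_pow_bitLen x) (abs_lt_two_pow_bitLen y) (abs_nonneg _) (abs_nonneg _)

theorem bitLen_div_le (x y : ℤ) : bitLen (x / y) ≤ bitLen x + 1 := by
  have h : |x / y| ≤ |x| := Int.abs_ediv_le_abs x y
  exact (bitLen_le_of_abs_le h).trans (Nat.le_succ _)

/-- Each operation at most adds the lengths of its operands, up to a constant, so for a fixed
expression the lengths are linear and the schoolbook costs quadratic in the word length. -/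
theorem IExpr.exists_cost_bound (e : IExpr) : ∃ C : ℕ, ∀ (β : ℕ) (s : Store), BitBound β s →
    bitLen (e.eval s) ≤ C * (β + 1) ∧ e.cost s ≤ C * (β + 1) ^ 2 := by
  have hmul : ∀ A B C β : ℕ, A + B ≤ C → A * (β + 1) + B * (β + 1) ≤ C * (β + 1) := by
    intro A B C β h; rw [← add_mul]; exact Nat.mul_le_mul_right _ h
  have hbin : ∀ (e f : IExpr) (C D : ℕ), (∀ (β : ℕ) (s : Store), BitBound β s →
      bitLen (e.eval s) ≤ C * (β + 1) ∧ e.cost s ≤ C * (β + 1) ^ 2) →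
      (∀ (β : ℕ) (s : Store), BitBound β s →
      bitLen (f.eval s) ≤ D * (β + 1) ∧ f.cost s ≤ D * (β + 1) ^ 2) →
      ∀ (β : ℕ) (s : Store), BitBound β s →
        bitLen (e.eval s) + bitLen (f.eval s) + 1 ≤ (2 + 2 * C + 2 * D + C * D) * (β + 1) ∧
        e.cost s + f.cost s + 1 + bitLen (e.eval s) + bitLen (f.eval s)
          ≤ (2 + 2 * C + 2 * D + C * D) * (β + 1) ^ 2 ∧
        e.cost s + f.cost s + (1 + bitLen (e.eval s)) * (1 + bitLen (f.eval s))
          ≤ (2 + 2 * C + 2 * D + C * D) * (β + 1) ^ 2 := by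
    intro e f C D he hf β s hs
    obtain ⟨h1, h2⟩ := he β s hs
    obtain ⟨h3, h4⟩ := hf β s hs
    have h5 : (1 + bitLen (e.eval s)) * (1 + bitLen (f.eval s)) ≤ (1 + C * (β + 1)) * (1 + D * (β + 1)) :=
      Nat.mul_le_mul (by omega) (by omega)
    refine ⟨?_, ?_, ?_⟩
    · nlinarith [Nat.zero_le (C * D * (β + 1)), Nat.zero_le (C * (β + 1)), Nat.zero_le (D * (β + 1))]
    · nlinarith [Nat.zero_le (C * D * (β + 1) ^ 2), Nat.zero_le (C * β * (β + 1)), Nat.zero_le (D * β * (β + 1)),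
        Nat.zero_le (β * β)]
    · nlinarith [Nat.zero_le (C * D * (β + 1) ^ 2), Nat.zero_le (C * β * (β + 1)), Nat.zero_le (D * β * (β + 1)),
        Nat.zero_le (β * β)]
  induction e with
  | const z =>
    refine ⟨1 + bitLen z, fun β s hs => ⟨?_, ?_⟩⟩
    · simp only [IExpr.eval]; nlinarith [Nat.zero_le (bitLen z * β)]
    · simp only [IExpr.cost]; exact Nat.le_mul_of_pos_right _ (by positivity)
  | get a i ih =>
    obtain ⟨C, hC⟩ := ih
    refine ⟨2 * C + 1, fun β s hs => ?_⟩
    obtain ⟨h1, h2⟩ := hC β s hs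
    have h3 := hs a (i.eval s)
    refine ⟨?_, ?_⟩
    · simp only [IExpr.eval]; nlinarith [Nat.zero_le (C * (β + 1))]
    · simp only [IExpr.cost]
      nlinarith [Nat.zero_le (C * β * (β + 1)), Nat.zero_le (β * β)]
  | add e f ihe ihf =>
    obtain ⟨C, hC⟩ := ihe
    obtain ⟨D, hD⟩ := ihf
    refine ⟨2 + 2 * C + 2 * D + C * D, fun β s hs => ?_⟩
    obtain ⟨h1, h2, -⟩ := hbin e f C D hC hD β s hs
    exact ⟨(bitLen_add_le _ _).trans h1, h2⟩
  | sub e f ihe ihf =>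
    obtain ⟨C, hC⟩ := ihe
    obtain ⟨D, hD⟩ := ihf
    refine ⟨2 + 2 * C + 2 * D + C * D, fun β s hs => ?_⟩
    obtain ⟨h1, h2, -⟩ := hbin e f C D hC hD β s hs
    refine ⟨?_, h2⟩
    have := bitLen_add_le (e.eval s) (-f.eval s)
    rw [bitLen_neg, ← sub_eq_add_neg] at this
    exact this.trans h1
  | mul e f ihe ihf =>
    obtain ⟨C, hC⟩ := ihe
    obtain ⟨D, hD⟩ := ihf
    refine ⟨2 + 2 * C + 2 * D + C * D, fun β s hs => ?_⟩
    obtain ⟨h1, -, h2⟩ := hbin e f C D hC hD β s hs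
    exact ⟨(bitLen_mul_le _ _).trans (by omega), h2⟩
  | div e f ihe ihf =>
    obtain ⟨C, hC⟩ := ihe
    obtain ⟨D, hD⟩ := ihf
    refine ⟨2 + 2 * C + 2 * D + C * D, fun β s hs => ?_⟩
    obtain ⟨h1, -, h2⟩ := hbin e f C D hC hD β s hs
    exact ⟨(bitLen_div_le _ _).trans (by omega), h2⟩

/-- Every assignment is reduced, arrays `4` and `6` are not written, and the numbers of rounds of loops are
entries of array `4`. -/
def Program.Clamped : Program → Prop
  | .skip => True
  | .set a _ e => a ≠ 4 ∧ a ≠ 6 ∧ ∃ f : IExpr, e = f.clamp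
  | .seq c d => c.Clamped ∧ d.Clamped
  | .ite _ c d => c.Clamped ∧ d.Clamped
  | .loop e c => (∃ j, e = .get 4 (.const j)) ∧ c.Clamped

theorem BitBound.update {β : ℕ} {s : Store} (hs : BitBound β s) (a : ℕ) (i x : ℤ) (hx : bitLen x ≤ β) :
    BitBound β (Function.update s a (Function.update (s a) i x)) := by
  intro b j
  by_cases hb : b = a
  · subst hb
    rw [Function.update_self]
    by_cases hj : j = i
    · subst hj; rwa [Function.update_self]
    · rw [Function.update_of_ne hj]; exact hs b j
  · rw [Function.update_of_ne hb]; exact hs b j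

/-- Reduction keeps all entries within the word length, which is therefore invariant and cannot grow
along a loop. The loop lengths come from an array that stays fixed and is bounded by T, so each loop
raises the exponent D by one only. -/
theorem Program.Clamped.exists_cost_bound {p : Program} (hp : p.Clamped) :
    ∃ C D : ℕ, ∀ (β T : ℕ) (s : Store), BitBound β s → 0 < s 6 0 → (∀ j, s 4 j ≤ T) →
      (p.exec s).2 ≤ C * (β + 1) ^ 2 * (T + 1) ^ D ∧ BitBound β (p.run s) ∧ p.run s 4 = s 4 ∧ p.run s 6 = s 6 := by
  induction p with
  | skip =>
    refine ⟨1, 0, fun β T s hs h6 h4 => ⟨?_, hs, rfl, rfl⟩⟩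
    simp only [Program.exec, one_mul, pow_zero, mul_one]
    exact Nat.one_le_pow _ _ (by omega)
  | set a i e =>
    obtain ⟨ha4, ha6, f, rfl⟩ := hp
    obtain ⟨C, hC⟩ := i.exists_cost_bound
    obtain ⟨D, hD⟩ := f.clamp.exists_cost_bound
    refine ⟨2 * C + 2 * D + 1, 0, fun β T s hs h6 h4 => ⟨?_, ?_, ?_, ?_⟩⟩
    · obtain ⟨h1, h2⟩ := hC β s hs
      obtain ⟨h3, h5⟩ := hD β s hs
      simp only [Program.exec, pow_zero, mul_one]
      nlinarith [Nat.zero_le (C * β * (β + 1)), Nat.zero_le (D * β * (β + 1)), Nat.zero_le (β * β)]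
    · rw [Program.run_set]
      refine hs.update _ _ _ ?_
      rw [IExpr.eval_clamp]
      refine (bitLen_le_of_abs_le ?_).trans (hs 6 0)
      rw [abs_of_nonneg (Int.emod_nonneg _ h6.ne'), abs_of_pos h6]
      exact (Int.emod_lt_of_pos _ h6).le
    · rw [Program.run_set, Function.update_of_ne ha4.symm]
    · rw [Program.run_set, Function.update_of_ne ha6.symm]
  | seq c d ihc ihd =>
    obtain ⟨C, D, h⟩ := ihc hp.1
    obtain ⟨C', D', h'⟩ := ihd hp.2
    refine ⟨C + C', D + D', fun β T s hs h6 h4 => ?_⟩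
    obtain ⟨h1, h2, h3, h5⟩ := h β T s hs h6 h4
    obtain ⟨g1, g2, g3, g5⟩ := h' β T (c.run s) h2 (by rwa [h5]) (by rwa [h3])
    refine ⟨?_, g2, by rw [Program.run_seq, g3, h3], by rw [Program.run_seq, g5, h5]⟩
    have e1 : (T + 1) ^ D ≤ (T + 1) ^ (D + D') := Nat.pow_le_pow_right (by omega) (by omega)
    have e2 : (T + 1) ^ D' ≤ (T + 1) ^ (D + D') := Nat.pow_le_pow_right (by omega) (by omega)
    have e3 := Nat.mul_le_mul_left (C * (β + 1) ^ 2) e1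
    have e4 := Nat.mul_le_mul_left (C' * (β + 1) ^ 2) e2
    change (c.exec s).2 + (d.exec (c.run s)).2 ≤ _
    rw [add_mul, add_mul]
    omega
  | ite e c d ihc ihd =>
    obtain ⟨C, D, h⟩ := ihc hp.1
    obtain ⟨C', D', h'⟩ := ihd hp.2
    obtain ⟨C₀, hC₀⟩ := e.exists_cost_bound
    refine ⟨C + C' + C₀ + 1, D + D', fun β T s hs h6 h4 => ?_⟩
    obtain ⟨h1, h2, h3, h5⟩ := h β T s hs h6 h4
    obtain ⟨g1, g2, g3, g5⟩ := h' β T s hs h6 h4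
    have e1 : (T + 1) ^ D ≤ (T + 1) ^ (D + D') := Nat.pow_le_pow_right (by omega) (by omega)
    have e2 : (T + 1) ^ D' ≤ (T + 1) ^ (D + D') := Nat.pow_le_pow_right (by omega) (by omega)
    have e3 := Nat.mul_le_mul_left (C * (β + 1) ^ 2) e1
    have e4 := Nat.mul_le_mul_left (C' * (β + 1) ^ 2) e2
    have e5 : 1 ≤ (T + 1) ^ (D + D') := Nat.one_le_pow _ _ (by omega)
    have e6 := Nat.mul_le_mul_left (C₀ * (β + 1) ^ 2) e5
    have e7 := Nat.mul_le_mul_left (1 * (β + 1) ^ 2) e5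
    have e8 : 1 ≤ (β + 1) ^ 2 := Nat.one_le_pow _ _ (by omega)
    have e9 := (hC₀ β s hs).2
    rw [Program.run_ite]
    simp only [Program.exec, add_mul]
    split_ifs
    · exact ⟨by change e.cost s + 1 + (c.exec s).2 ≤ _; omega, h2, h3, h5⟩
    · exact ⟨by change e.cost s + 1 + (d.exec s).2 ≤ _; omega, g2, g3, g5⟩
  | loop e c ih =>
    obtain ⟨⟨j, rfl⟩, hc⟩ := hp
    obtain ⟨C, D, h⟩ := ih hc
    obtain ⟨C₀, hC₀⟩ := (IExpr.get 4 (.const j)).exists_cost_bound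
    refine ⟨C₀ + C + 2, D + 1, fun β T s hs h6 h4 => ?_⟩
    have key : ∀ (n : ℕ) (x : ℕ),
        ((fun p : Store × ℕ => ((c.exec p.1).1, p.2 + 1 + (c.exec p.1).2))^[n] (s, x)).2
          ≤ x + n * (1 + C * (β + 1) ^ 2 * (T + 1) ^ D) ∧ BitBound β (c.run^[n] s) ∧
        c.run^[n] s 4 = s 4 ∧ c.run^[n] s 6 = s 6 := by
      intro n x
      induction n with
      | zero => simp [hs]
      | succ n ihn =>
        obtain ⟨h1, h2, h3, h5⟩ := ihn
        obtain ⟨g1, g2, g3, g5⟩ := h β T (c.run^[n] s) h2 (by rwa [h5]) (by rwa [h3])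
        rw [Function.iterate_succ_apply', Function.iterate_succ_apply']
        refine ⟨?_, g2, g3.trans h3, g5.trans h5⟩
        rw [← Program.exec_loop_fst c n (s, x)] at g1
        simp only
        rw [add_mul, one_mul]
        omega
    obtain ⟨h1, h2, h3, h5⟩ := key ((IExpr.get 4 (.const j)).eval s).toNat ((IExpr.get 4 (.const j)).cost s + 1)
    rw [Program.run_loop]
    refine ⟨?_, h2, h3, h5⟩
    simp only [Program.exec]
    refine h1.trans ?_
    have hT : ((IExpr.get 4 (.const j)).eval s).toNat ≤ T := by
      simp only [IExpr.eval]
      have := h4 j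
      omega
    have e0 := (hC₀ β s hs).2
    have e1 := Nat.mul_le_mul_right (1 + C * (β + 1) ^ 2 * (T + 1) ^ D) hT
    have e2 : 1 ≤ (T + 1) ^ D := Nat.one_le_pow _ _ (by omega)
    have e3 : 1 ≤ (β + 1) ^ 2 := Nat.one_le_pow _ _ (by omega)
    rw [pow_succ (T + 1) D]
    generalize (T + 1) ^ D = Y at *
    generalize (β + 1) ^ 2 = B at *
    have e4 : 1 ≤ B * Y := Nat.one_le_iff_ne_zero.mpr (by positivity)
    have e5 : C₀ * B ≤ C₀ * B * Y * (T + 1) :=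
      (Nat.le_mul_of_pos_right _ (by omega)).trans (Nat.le_mul_of_pos_right _ (by omega))
    have e6 : T + 1 ≤ B * Y * (T + 1) := Nat.le_mul_of_pos_left _ (by omega)
    calc _ ≤ C₀ * B + 1 + T * (1 + C * B * Y) := by omega
      _ = C₀ * B + (T + 1) + C * (B * Y) * T := by ring
      _ ≤ C₀ * B * Y * (T + 1) + B * Y * (T + 1) + C * (B * Y) * (T + 1) :=
          Nat.add_le_add (Nat.add_le_add e5 e6) (Nat.mul_le_mul_left _ (Nat.le_succ T))
      _ ≤ (C₀ + C + 2) * B * (Y * (T + 1)) := by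
          have : (C₀ + C + 2) * B * (Y * (T + 1)) = C₀ * B * Y * (T + 1) + B * Y * (T + 1) + C * (B * Y) * (T + 1)
              + B * Y * (T + 1) := by ring
          omega

end Machine

/-! ### Subroutines: the symbol of the Toeplitz matrix and the table of powers -/

section Subroutines

instance : Add IExpr := ⟨IExpr.add⟩

instance : Sub IExpr := ⟨IExpr.sub⟩

instance : Mul IExpr := ⟨IExpr.mul⟩

@[simp] theorem IExpr.eval_add (e f : IExpr) (s : Store) : (e + f).eval s = e.eval s + f.eval s := rfl

@[simp] theorem IExpr.eval_sub (e f : IExpr) (s : Store) : (e - f).eval s = e.eval s - f.eval s := rfl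

@[simp] theorem IExpr.eval_mul (e f : IExpr) (s : Store) : (e * f).eval s = e.eval s * f.eval s := rfl

@[simp] theorem IExpr.eval_const (z : ℤ) (s : Store) : (IExpr.const z).eval s = z := rfl

@[simp] theorem IExpr.eval_get (a : ℕ) (e : IExpr) (s : Store) : (IExpr.get a e).eval s = s a (e.eval s) := rfl

/-- Entry `j` of the array of parameters. -/
def IExpr.par (j : ℕ) : IExpr := .get 4 (.const j)

@[simp] theorem IExpr.eval_par (j : ℕ) (s : Store) : (IExpr.par j).eval s = s 4 j := rfl

/-- The parameters: matrix size, repetitions, number of iterations, length of the tables, number of rounds,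
number of angles in a half turn, fineness of the grid, exclusion width, inverse threshold. -/
def parArray (m R N B W τ : ℕ) : ℤ → ℤ := fun i =>
  if i = 0 then m else if i = 1 then R else if i = 2 then N else if i = 3 then ((2 * B + m : ℕ) : ℤ)
  else if i = 4 then ((8 * B : ℕ) : ℤ) else if i = 5 then ((2 * B : ℕ) : ℤ) else if i = 6 then B
  else if i = 7 then W else if i = 8 then τ else 0

/-- Modulo `P`, entry `i` of the arrays `a` and `b` holds the Gaussian integer `x`. -/
def HoldsGauss (P : ℕ) (s : Store) (a b : ℕ) (i : ℤ) (x : GaussianInt) : Prop :=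
  ((s a i : ℤ) : ZMod P) = ((x.re : ℤ) : ZMod P) ∧ ((s b i : ℤ) : ZMod P) = ((x.im : ℤ) : ZMod P)

theorem HoldsGauss.congr {P : ℕ} {s t : Store} {a b : ℕ} {i : ℤ} {x : GaussianInt} (h : HoldsGauss P s a b i x)
    (ha : t a i = s a i) (hb : t b i = s b i) : HoldsGauss P t a b i x := by
  unfold HoldsGauss; rw [ha, hb]; exact h

variable {m R N B W τ P : ℕ}

/-- Add up the bits of time `44` for both angles. -/
def accumulateBits : Program :=
  .for 45 1 (.seq
    (.put 10 (.var 44) (.get 10 (.var 44) + .get 1 ((.var 44 * .const 2) * .par 1 + .var 45)))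
    (.put 11 (.var 44) (.get 11 (.var 44) + .get 1 ((.var 44 * .const 2 + .const 1) * .par 1 + .var 45))))

theorem run_accumulateBits {s : Store} (h4 : s 4 = parArray m R N B W τ) (h6 : s 6 0 = P) (hR : R < P) {j : ℕ}
    (hj : s 44 0 = j) :
    ((accumulateBits.run s 10 j : ℤ) : ZMod P)
        = (s 10 j : ZMod P) + ∑ r ∈ Finset.range R, ((s 1 ((j * 2) * R + r) : ℤ) : ZMod P) ∧
      ((accumulateBits.run s 11 j : ℤ) : ZMod P)
        = (s 11 j : ZMod P) + ∑ r ∈ Finset.range R, ((s 1 ((j * 2 + 1) * R + r) : ℤ) : ZMod P) ∧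
      ∀ i : ℤ, i ≠ j → accumulateBits.run s 10 i = s 10 i ∧ accumulateBits.run s 11 i = s 11 i := by
  refine Program.run_for (n := R) (by rw [h4]; simp [parArray]) (by rw [h6]; exact_mod_cast hR) (by decide)
    (by decide) (by decide) (by decide)
    (fun k t => ((t 10 j : ℤ) : ZMod P)
        = (s 10 j : ZMod P) + ∑ r ∈ Finset.range k, ((s 1 ((j * 2) * R + r) : ℤ) : ZMod P) ∧
      ((t 11 j : ℤ) : ZMod P)
        = (s 11 j : ZMod P) + ∑ r ∈ Finset.range k, ((s 1 ((j * 2 + 1) * R + r) : ℤ) : ZMod P) ∧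
      ∀ i : ℤ, i ≠ j → t 10 i = s 10 i ∧ t 11 i = s 11 i) ?_ ?_ ?_
  · intro i t x h
    simpa [Function.update_apply] using h
  · simp
  · rintro k hk t ht hk' ⟨h1, h2, h3⟩
    have e1 := ht 1 (by decide) (by decide)
    have e4 := ht 4 (by decide) (by decide)
    have e6 := ht 6 (by decide) (by decide)
    have e44 := ht 44 (by decide) (by decide)
    refine ⟨?_, ?_, ?_⟩
    · simp [Program.run_put, e44, hj, e1, e4, e6, h4, h6, hk', h1, Finset.sum_range_succ,
        parArray, add_assoc]
    · simp [Program.run_put, e44, hj, e1, e4, e6, h4, h6, hk', h2, Finset.sum_range_succ,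
        parArray, add_assoc]
    · intro i hi
      simp [Program.run_put, e44, hj, hi, h3 i hi]

/-- The symbol of the Toeplitz matrix `R (m - T)` as a function of the sums of the measured bits. -/
def symbol (m R : ℕ) (c : ℕ → ℕ → ℤ) (d : ℤ) : GaussianInt :=
  ⟨(if d = 0 then (m * R : ℤ) else 0) + (2 * c 0 d.natAbs - R),
    if 0 ≤ d then R - 2 * c 1 d.natAbs else 2 * c 1 d.natAbs - R⟩

/-- The sums of the measured bits, as read from the input array. -/
def bitSum (R : ℕ) (bits : ℤ → ℤ) (t j : ℕ) : ℤ :=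
  ∑ r ∈ Finset.range R, bits ((j * 2 + t) * R + r)

/-- Enter the values of the symbol at the time `44` and at its negative. -/
def symbolRound : Program :=
  .seq accumulateBits (.seq
    (.put 12 (.const 0 - .var 44) (.const 2 * .get 10 (.var 44) - .par 1)) (.seq
    (.put 12 (.var 44) (.const 2 * .get 10 (.var 44) - .par 1)) (.seq
    (.put 13 (.const 0 - .var 44) (.const 2 * .get 11 (.var 44) - .par 1))
    (.put 13 (.var 44) (.par 1 - .const 2 * .get 11 (.var 44))))))

/-- Compute the symbol. -/
def computeSymbol : Program :=
  .seq (.for 44 0 symbolRound) (.put 12 (.const 0) (.get 12 (.const 0) + .par 0 * .par 1))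

theorem run_computeSymbol {s : Store} (h4 : s 4 = parArray m R N B W τ) (h6 : s 6 0 = P) (hR : R < P) (hm : m < P)
    (hm0 : 0 < m) (h10 : s 10 = 0) (h11 : s 11 = 0) {d : ℤ} (hd : d.natAbs < m) :
    HoldsGauss P (computeSymbol.run s) 12 13 d (symbol m R (bitSum R (s 1)) d) := by
  set c := bitSum R (s 1) with hc
  have hloop := Program.run_for (c := 44) (j := 0) (n := m) (s := s) (p := symbolRound)
    (by rw [h4]; simp [parArray]) (by rw [h6]; exact_mod_cast hm) (by decide) (by decide) (by decide) (by decide)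
    (fun k t => (∀ i : ℤ, k ≤ i → t 10 i = 0 ∧ t 11 i = 0) ∧ ∀ d : ℤ, d.natAbs < k →
      ((t 12 d : ℤ) : ZMod P) = ((2 * c 0 d.natAbs - R : ℤ) : ZMod P) ∧
      ((t 13 d : ℤ) : ZMod P) = ((if 0 ≤ d then R - 2 * c 1 d.natAbs else 2 * c 1 d.natAbs - R : ℤ) : ZMod P))
    ?_ ?_ ?_
  · rw [computeSymbol, Program.run_seq]
    have e4 := Program.run_of_not_mem_writes (a := 4) (.for 44 0 symbolRound) (by decide) s
    have e6 := Program.run_of_not_mem_writes (a := 6) (.for 44 0 symbolRound) (by decide) s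
    set t := (Program.for 44 0 symbolRound).run s
    obtain ⟨h12, h13⟩ := hloop.2 d hd
    refine ⟨?_, ?_⟩
    · by_cases hd0 : d = 0
      · subst hd0
        simp only [Int.natAbs_zero] at h12
        simp [Program.run_put, e4, e6, h4, h6, parArray, symbol, h12]
        ring
      · simp [Program.run_put, Function.update_of_ne hd0, symbol, h12, hd0]
    · simp only [symbol]
      rw [← h13]
      simp [Program.run_put]
  · intro i t x h
    simpa [Function.update_apply] using h
  · exact ⟨fun i _ => by rw [h10, h11]; simp, fun d hd => by omega⟩
  · rintro k hk t ht hk' ⟨h1, h2⟩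
    have e1 := ht 1 (by decide) (by decide)
    have e4 := ht 4 (by decide) (by decide)
    have e6 := ht 6 (by decide) (by decide)
    obtain ⟨a1, a2, a3⟩ := run_accumulateBits (m := m) (R := R) (N := N) (B := B) (W := W) (τ := τ) (P := P) (s := t)
      (by rw [e4, h4]) (by rw [e6, h6]) hR hk'
    rw [symbolRound]
    simp only [Program.run_seq]
    have f4 := Program.run_of_not_mem_writes (a := 4) accumulateBits (by decide) t
    have f6 := Program.run_of_not_mem_writes (a := 6) accumulateBits (by decide) t
    have f44 := Program.run_of_not_mem_writes (a := 44) accumulateBits (by decide) t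
    have f12 := Program.run_of_not_mem_writes (a := 12) accumulateBits (by decide) t
    have f13 := Program.run_of_not_mem_writes (a := 13) accumulateBits (by decide) t
    set t' := accumulateBits.run t
    have b1 : ((t' 10 k : ℤ) : ZMod P) = ((c 0 k : ℤ) : ZMod P) := by
      rw [a1, (h1 k le_rfl).1, e1, hc, bitSum]; simp
    have b2 : ((t' 11 k : ℤ) : ZMod P) = ((c 1 k : ℤ) : ZMod P) := by
      rw [a2, (h1 k le_rfl).2, e1, hc, bitSum]; simp
    refine ⟨?_, ?_⟩
    · intro i hi
      push_cast at hi
      have hik : i ≠ k := by omega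
      simp [Program.run_put, a3 i hik, h1 i (by omega)]
    · intro d hd
      by_cases hdk : d.natAbs < k
      · have hd1 : d ≠ k := by omega
        have hd2 : d ≠ -k := by omega
        obtain ⟨g1, g2⟩ := h2 d hdk
        simp [Program.run_put, f44, hk', Function.update_of_ne hd1, Function.update_of_ne hd2, f12, f13, g1, g2]
      · have hdk' : d.natAbs = k := by omega
        rw [hdk']
        -- At time 0 both writes hit entry 0. The write for the nonnegative sign comes last and
        -- prevails, in agreement with `symbol`.
        by_cases hd0 : 0 ≤ d
        · have hd1 : d = k := by omega
          subst hd1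
          simp [Program.run_put, f44, hk', f4, f6, e4, e6, h4, h6, parArray, b1, b2]
        · have hd1 : d = -k := by omega
          have hd2 : d ≠ k := by omega
          subst hd1
          simp [Program.run_put, f44, hk', f4, f6, e4, e6, h4, h6, parArray, b1, b2, Function.update_of_ne hd2, hd0]
          omega

/-- The numerator of the rotation by one step of the grid. -/
def gridStep (B : ℕ) : GaussianInt := ⟨(B : ℤ) ^ 2 - 1, -2 * B⟩

/-- The denominator of the rotation by one step of the grid. -/
def gridDenom (B : ℕ) : ℤ := (B : ℤ) ^ 2 + 1

/-- One step of the computation of the powers. -/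
def powersRound : Program := .seq
  (.put 14 (.var 42 + .const 1) (.get 14 (.var 42) * (.par 6 * .par 6 - .const 1) + .get 15 (.var 42) * (.const 2 * .par 6)))
  (.seq
  (.put 15 (.var 42 + .const 1) (.get 15 (.var 42) * (.par 6 * .par 6 - .const 1) - .get 14 (.var 42) * (.const 2 * .par 6)))
  (.put 16 (.var 42 + .const 1) (.get 16 (.var 42) * (.par 6 * .par 6 + .const 1))))

/-- Compute the powers of the rotation. -/
def computePowers : Program :=
  .seq (.put 14 (.const 0) (.const 1)) (.seq (.put 15 (.const 0) (.const 0)) (.seq (.put 16 (.const 0) (.const 1))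
    (.for 42 3 powersRound)))

/-- The table has two uses: up to 2B for counting the grid points in a quadrant, up to m - 1 for
rotating the vector. Its length 2B + m serves both. -/
theorem run_computePowers {s : Store} (h4 : s 4 = parArray m R N B W τ) (h6 : s 6 0 = P) (hl : 2 * B + m < P)
    {a : ℕ} (ha : a ≤ 2 * B + m) :
    HoldsGauss P (computePowers.run s) 14 15 a (gridStep B ^ a) ∧
      ((computePowers.run s 16 a : ℤ) : ZMod P) = ((gridDenom B ^ a : ℤ) : ZMod P) := by
  rw [computePowers]
  simp only [Program.run_seq]
  set s' := (Program.put 16 (.const 0) (.const 1)).run ((Program.put 15 (.const 0) (.const 0)).run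
    ((Program.put 14 (.const 0) (.const 1)).run s)) with hs'
  have e4 : s' 4 = s 4 := by simp [hs', Program.run_put]
  have e6 : s' 6 = s 6 := by simp [hs', Program.run_put]
  have hloop := Program.run_for (c := 42) (j := 3) (n := 2 * B + m) (s := s') (p := powersRound)
    (by rw [e4, h4]; simp [parArray]) (by rw [e6, h6]; exact_mod_cast hl) (by decide) (by decide) (by decide) (by decide)
    (fun k t => ∀ a : ℕ, a ≤ k → HoldsGauss P t 14 15 a (gridStep B ^ a) ∧
      ((t 16 a : ℤ) : ZMod P) = ((gridDenom B ^ a : ℤ) : ZMod P)) ?_ ?_ ?_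
  · exact hloop a ha
  · intro i t x h
    simpa [Function.update_apply, HoldsGauss] using h
  · intro a ha
    obtain rfl : a = 0 := by omega
    simp [hs', Program.run_put, HoldsGauss, h6]
  · intro k hk t ht hk' h a ha
    have f4 := ht 4 (by decide) (by decide)
    have f6 := ht 6 (by decide) (by decide)
    by_cases hak : a ≤ k
    · have hne : (a : ℤ) ≠ k + 1 := by omega
      obtain ⟨g1, g2⟩ := h a hak
      refine ⟨g1.congr ?_ ?_, ?_⟩
      · simp [powersRound, Program.run_put, hk', hne]
      · simp [powersRound, Program.run_put, hk', hne]
      · rw [← g2]; simp [powersRound, Program.run_put, hk', hne]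
    · obtain rfl : a = k + 1 := by omega
      obtain ⟨⟨g1, g2⟩, g3⟩ := h k le_rfl
      have hne : (k : ℤ) ≠ k + 1 := by omega
      simp only [HoldsGauss, powersRound, Program.run_seq, Program.run_put]
      refine ⟨⟨?_, ?_⟩, ?_⟩
      · simp [hk', f4, f6, e4, e6, h4, h6, parArray, hne, g1, g2, gridStep, pow_succ]
      · simp [hk', f4, f6, e4, e6, h4, h6, parArray, hne, g1, g2, gridStep, pow_succ]
        ring
      · simp [hk', f4, f6, e4, e6, h4, h6, parArray, hne, g3, gridDenom, pow_succ]

end Subroutines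

/-! ### Subroutines: grid size, Toeplitz iteration, rotation of the grid vector -/

section Iteration

variable {m R N B W τ P : ℕ}

/-- Residues in the lower half stand for positive numbers, so the sign survives the reduction if P
exceeds twice the absolute value. -/
theorem emod_pos_iff {x z : ℤ} (hP : 0 < P) (h : (x : ZMod P) = (z : ZMod P)) (hz : 2 * |z| < P) :
    (0 < x % P ∧ 2 * (x % P) < P) ↔ 0 < z := by
  have hx : x % P = z % P := (ZMod.intCast_eq_intCast_iff' x z P).mp h
  rw [hx]
  have := abs_lt.mp (show |2 * z| < P by rw [abs_mul]; simpa using hz)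
  by_cases h0 : 0 ≤ z
  · rw [Int.emod_eq_of_lt h0 (by omega)]; omega
  · have : z % P = z + P := by
      rw [← Int.add_emod_right, Int.emod_eq_of_lt (by omega) (by omega)]
    rw [this]; omega

/-- Count the angle `42` if its cosine is positive. -/
def countRound : Program :=
  .ite (IExpr.clamp (.get 14 (.var 42)))
    (.ite (.var 6 - .const 2 * IExpr.clamp (.get 14 (.var 42))) (.put 17 (.const 0) (.var 17 + .const 1)) .skip) .skip

/-- Count the grid points in the first quadrant. -/
def countQuadrant : Program := .for 42 5 countRound

/-- The number of grid points in the first quadrant. -/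
def quadrantCount (B : ℕ) : ℕ := ((Finset.range (2 * B)).filter fun j => 0 < (gridStep B ^ j).re).card

theorem run_countQuadrant {s : Store} (h4 : s 4 = parArray m R N B W τ) (h6 : s 6 0 = P) (hl : 2 * B < P)
    (h17 : s 17 0 = 0) (hpow : ∀ a < 2 * B, HoldsGauss P s 14 15 a (gridStep B ^ a))
    (hbd : ∀ a < 2 * B, 2 * |(gridStep B ^ a).re| < P) :
    countQuadrant.run s 17 0 = quadrantCount B := by
  refine Program.run_for (n := 2 * B) (by rw [h4]; simp [parArray]) (by rw [h6]; exact_mod_cast hl) (by decide)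
    (by decide) (by decide) (by decide)
    (fun k t => t 17 0 = ((Finset.range k).filter fun j => 0 < (gridStep B ^ j).re).card) ?_ ?_ ?_
  · intro i t x h
    simpa [Function.update_apply] using h
  · simpa using h17
  · intro k hk t ht hk' h
    have e6 := ht 6 (by decide) (by decide)
    have e14 := ht 14 (by decide) (by decide)
    have hP : 0 < P := by omega
    have hiff := emod_pos_iff hP (hpow k hk).1 (hbd k hk)
    have hcard : ((Finset.range k).filter fun j => 0 < (gridStep B ^ j).re).card ≤ k :=
      (Finset.card_filter_le _ _).trans (by simp)
    rw [Finset.range_add_one, Finset.filter_insert]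
    simp only [countRound, Program.run_ite, IExpr.eval_clamp, IExpr.eval_sub, IExpr.eval_mul, IExpr.eval_const,
      IExpr.eval_get, IExpr.eval_var, hk', e6, e14, h6, Program.run_skip, sub_pos]
    by_cases hpos : 0 < (gridStep B ^ k).re
    · obtain ⟨g1, g2⟩ := hiff.mpr hpos
      rw [if_pos g1, if_pos g2, if_pos hpos, Finset.card_insert_of_notMem (by simp)]
      simp only [Program.run_put, IExpr.eval_const, IExpr.eval_add, IExpr.eval_var, Function.update_self, h, e6, h6]
      rw [Int.emod_eq_of_lt (by omega) (by omega)]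
      push_cast; rfl
    · rw [if_neg hpos]
      by_cases g1 : 0 < s 14 k % P
      · have g2 : ¬ 2 * (s 14 k % P) < P := fun g2 => hpos (hiff.mp ⟨g1, g2⟩)
        rw [if_pos g1, if_neg g2, h]
      · rw [if_neg g1, h]

/-- Compute the scale of the threshold. -/
def computeScale : Program :=
  .seq (.put 18 (.const 0) (.const 1)) (.for 41 2 (.put 18 (.const 0) (.var 18 * (.par 0 * .par 1 * (.par 0 * .par 1)))))

theorem run_computeScale {s : Store} (h4 : s 4 = parArray m R N B W τ) (h6 : s 6 0 = P) (hN : N < P) :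
    ((computeScale.run s 18 0 : ℤ) : ZMod P) = (((m * R * (m * R)) ^ N : ℤ) : ZMod P) := by
  rw [computeScale, Program.run_seq]
  have e4 : (Program.put 18 (.const 0) (.const 1)).run s 4 = s 4 := by simp [Program.run_put]
  have e6 : (Program.put 18 (.const 0) (.const 1)).run s 6 = s 6 := by simp [Program.run_put]
  refine Program.run_for (n := N) (by rw [e4, h4]; simp [parArray]) (by rw [e6, h6]; exact_mod_cast hN) (by decide)
    (by decide) (by decide) (by decide)
    (fun k t => ((t 18 0 : ℤ) : ZMod P) = (((m * R * (m * R)) ^ k : ℤ) : ZMod P)) ?_ ?_ ?_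
  · intro i t x h
    simpa [Function.update_apply] using h
  · simp [Program.run_put, h6]
  · intro k hk t ht hk' h
    have f4 := ht 4 (by decide) (by decide)
    have f6 := ht 6 (by decide) (by decide)
    simp [Program.run_put, f4, e4, f6, e6, h4, h6, parArray, h, pow_succ]

/-- Initialize the vector, its scale, and the number that excludes the end of the grid. -/
def initVectors : Program :=
  .seq (.for 42 0 (.seq (.put 19 (.var 42) (.const 1)) (.put 20 (.var 42) (.const 0))))
    (.seq (.put 21 (.const 0) (.const 1)) (.put 27 (.const 0) (.par 7)))

theorem run_initVectors {s : Store} (h4 : s 4 = parArray m R N B W τ) (h6 : s 6 0 = P) (hm : m < P) (hW : W < P) :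
    (∀ a < m, HoldsGauss P (initVectors.run s) 19 20 a 1) ∧ ((initVectors.run s 21 0 : ℤ) : ZMod P) = 1 ∧
      initVectors.run s 27 0 = W := by
  rw [initVectors, Program.run_seq]
  have e4 := Program.run_of_not_mem_writes (a := 4)
    (.for 42 0 (.seq (.put 19 (.var 42) (.const 1)) (.put 20 (.var 42) (.const 0)))) (by decide) s
  have e6 := Program.run_of_not_mem_writes (a := 6)
    (.for 42 0 (.seq (.put 19 (.var 42) (.const 1)) (.put 20 (.var 42) (.const 0)))) (by decide) s
  have hloop := Program.run_for (c := 42) (j := 0) (n := m) (s := s)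
    (p := .seq (.put 19 (.var 42) (.const 1)) (.put 20 (.var 42) (.const 0)))
    (by rw [h4]; simp [parArray]) (by rw [h6]; exact_mod_cast hm) (by decide) (by decide) (by decide) (by decide)
    (fun k t => ∀ a < k, HoldsGauss P t 19 20 a 1) ?_ ?_ ?_
  · set t := (Program.for 42 0 (.seq (.put 19 (.var 42) (.const 1)) (.put 20 (.var 42) (.const 0)))).run s
    refine ⟨fun a ha => (hloop a ha).congr ?_ ?_, ?_, ?_⟩
    · simp [Program.run_put]
    · simp [Program.run_put]
    · simp [Program.run_put, e6, h6]
    · simp only [Program.run_seq, Program.run_put]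
      simp [e4, e6, h4, h6, parArray]
      exact Int.emod_eq_of_lt (by omega) (by omega)
  · intro i t x h
    simpa [Function.update_apply, HoldsGauss] using h
  · simp
  · intro k hk t ht hk' h a ha
    have f6 := ht 6 (by decide) (by decide)
    by_cases hak : a = k
    · subst hak
      simp [HoldsGauss, Program.run_put, hk', f6, h6]
    · exact (h a (by omega)).congr (by simp [Program.run_put, hk', hak]) (by simp [Program.run_put, hk', hak])

/-- Copy a vector to the work space. -/
def copyToWork (a b : ℕ) : Program :=
  .for 42 0 (.seq (.put 22 (.var 42) (.get a (.var 42))) (.put 23 (.var 42) (.get b (.var 42))))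

theorem run_copyToWork {s : Store} (h4 : s 4 = parArray m R N B W τ) (h6 : s 6 0 = P) (hm : m < P) {a b : ℕ}
    (ha : a ∉ [22, 23, 42]) (hb : b ∉ [22, 23, 42]) {x : ℕ → GaussianInt} (hx : ∀ i < m, HoldsGauss P s a b i (x i)) :
    ∀ i < m, HoldsGauss P ((copyToWork a b).run s) 22 23 i (x i) := by
  simp only [List.mem_cons, List.not_mem_nil, or_false, not_or] at ha hb
  refine Program.run_for (n := m) (by rw [h4]; simp [parArray]) (by rw [h6]; exact_mod_cast hm)
    (by simp [Program.writes, Program.put]) (by simp [Program.writes, Program.put]) (by decide) (by decide)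
    (fun k t => ∀ i < k, HoldsGauss P t 22 23 i (x i)) ?_ ?_ ?_
  · intro i t x h
    simpa [Function.update_apply, HoldsGauss] using h
  · simp
  · intro k hk t ht hk' h i hi
    have f6 := ht 6 (by decide) (by simp [Program.writes, Program.put])
    have fa := ht a ha.2.2 (by simp [Program.writes, Program.put, ha])
    have fb := ht b hb.2.2 (by simp [Program.writes, Program.put, hb])
    by_cases hik : i = k
    · subst hik
      obtain ⟨g1, g2⟩ := hx i hk
      have hb22 : b ≠ 22 := hb.1
      simp [HoldsGauss, Program.run_put, hk', f6, h6, fa, g1, g2, Function.update_of_ne hb22, fb]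
    · exact (h i (by omega)).congr (by simp [Program.run_put, hk', hik]) (by simp [Program.run_put, hk', hik])

/-- One step of the computation of a row of the matrix-vector product. -/
def rowRound : Program := .seq
  (.put 24 (.var 42) (.get 24 (.var 42) +
    (.get 12 (.var 42 - .var 43) * .get 22 (.var 43) - .get 13 (.var 42 - .var 43) * .get 23 (.var 43))))
  (.put 25 (.var 42) (.get 25 (.var 42) +
    (.get 12 (.var 42 - .var 43) * .get 23 (.var 43) + .get 13 (.var 42 - .var 43) * .get 22 (.var 43))))

/-- Row `42` of the product of the Toeplitz matrix and the vector in the work space. -/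
def computeRow : Program :=
  .seq (.put 24 (.var 42) (.const 0)) (.seq (.put 25 (.var 42) (.const 0)) (.for 43 0 rowRound))

theorem run_computeRow {s : Store} (h4 : s 4 = parArray m R N B W τ) (h6 : s 6 0 = P) (hm : m < P)
    {A : ℤ → GaussianInt} (hA : ∀ d : ℤ, d.natAbs < m → HoldsGauss P s 12 13 d (A d)) {x : ℕ → GaussianInt}
    (hx : ∀ i < m, HoldsGauss P s 22 23 i (x i)) {a : ℕ} (ha : a < m) (h42 : s 42 0 = a) :
    HoldsGauss P (computeRow.run s) 24 25 a (∑ b ∈ Finset.range m, A (a - b) * x b) ∧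
      ∀ i : ℤ, i ≠ a → computeRow.run s 24 i = s 24 i ∧ computeRow.run s 25 i = s 25 i := by
  rw [computeRow]
  simp only [Program.run_seq]
  set s' := (Program.put 25 (.var 42) (.const 0)).run ((Program.put 24 (.var 42) (.const 0)).run s) with hs'
  have e4 : s' 4 = s 4 := by simp [hs', Program.run_put]
  have e6 : s' 6 = s 6 := by simp [hs', Program.run_put]
  have e12 : s' 12 = s 12 := by simp [hs', Program.run_put]
  have e13 : s' 13 = s 13 := by simp [hs', Program.run_put]
  have e22 : s' 22 = s 22 := by simp [hs', Program.run_put]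
  have e23 : s' 23 = s 23 := by simp [hs', Program.run_put]
  have e42 : s' 42 = s 42 := by simp [hs', Program.run_put]
  refine Program.run_for (n := m) (by rw [e4, h4]; simp [parArray]) (by rw [e6, h6]; exact_mod_cast hm) (by decide)
    (by decide) (by decide) (by decide)
    (fun k t => HoldsGauss P t 24 25 a (∑ b ∈ Finset.range k, A (a - b) * x b) ∧
      ∀ i : ℤ, i ≠ a → t 24 i = s 24 i ∧ t 25 i = s 25 i) ?_ ?_ ?_
  · intro i t x h
    simpa [Function.update_apply, HoldsGauss] using h
  · refine ⟨?_, fun i hi => ?_⟩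
    · simp [hs', HoldsGauss, Program.run_put, h42, h6]
    · simp [hs', Program.run_put, h42, hi]
  · rintro k hk t ht hk' ⟨⟨g1, g2⟩, g3⟩
    have f4 := ht 4 (by decide) (by decide)
    have f6 := ht 6 (by decide) (by decide)
    have f12 := ht 12 (by decide) (by decide)
    have f13 := ht 13 (by decide) (by decide)
    have f22 := ht 22 (by decide) (by decide)
    have f23 := ht 23 (by decide) (by decide)
    have f42 := ht 42 (by decide) (by decide)
    obtain ⟨a1, a2⟩ := hA (a - k) (by omega)
    obtain ⟨x1, x2⟩ := hx k hk
    refine ⟨⟨?_, ?_⟩, fun i hi => ?_⟩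
    · simp [rowRound, Program.run_put, hk', f42, e42, h42, f6, e6, h6, f12, e12, f13, e13, f22, e22, f23, e23,
        g1, a1, a2, x1, x2, Finset.sum_range_succ]
      ring
    · simp [rowRound, Program.run_put, hk', f42, e42, h42, f6, e6, h6, f12, e12, f13, e13, f22, e22, f23, e23,
        g2, a1, a2, x1, x2, Finset.sum_range_succ]
    · simp [rowRound, Program.run_put, f42, e42, h42, hi, g3 i hi]

/-- The iterates of the Toeplitz matrix. -/
noncomputable def toeplitzIter (m : ℕ) (A : ℤ → GaussianInt) (x : ℕ → GaussianInt) : ℕ → ℕ → GaussianInt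
  | 0 => x
  | t + 1 => fun a => ∑ b ∈ Finset.range m, A (a - b) * toeplitzIter m A x t b

/-- Multiply the vector in the work space by the Toeplitz matrix. -/
def iterateRound : Program := .seq (.for 42 0 computeRow) (copyToWork 24 25)

theorem run_iterateRound {s : Store} (h4 : s 4 = parArray m R N B W τ) (h6 : s 6 0 = P) (hm : m < P)
    {A : ℤ → GaussianInt} (hA : ∀ d : ℤ, d.natAbs < m → HoldsGauss P s 12 13 d (A d)) {x : ℕ → GaussianInt}
    (hx : ∀ i < m, HoldsGauss P s 22 23 i (x i)) :
    ∀ i < m, HoldsGauss P (iterateRound.run s) 22 23 i (∑ b ∈ Finset.range m, A (i - b) * x b) := by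
  rw [iterateRound, Program.run_seq]
  have e4 := Program.run_of_not_mem_writes (a := 4) (.for 42 0 computeRow) (by decide) s
  have e6 := Program.run_of_not_mem_writes (a := 6) (.for 42 0 computeRow) (by decide) s
  refine run_copyToWork (by rw [e4, h4]) (by rw [e6, h6]) hm (by decide) (by decide)
    (x := fun i => ∑ b ∈ Finset.range m, A (i - b) * x b) ?_
  refine Program.run_for (n := m) (by rw [h4]; simp [parArray]) (by rw [h6]; exact_mod_cast hm) (by decide)
    (by decide) (by decide) (by decide)
    (fun k t => ∀ i < k, HoldsGauss P t 24 25 i (∑ b ∈ Finset.range m, A (i - b) * x b)) ?_ ?_ ?_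
  · intro i t x h
    simpa [Function.update_apply, HoldsGauss] using h
  · simp
  · intro k hk t ht hk' h i hi
    have f4 := ht 4 (by decide) (by decide)
    have f6 := ht 6 (by decide) (by decide)
    have f12 := ht 12 (by decide) (by decide)
    have f13 := ht 13 (by decide) (by decide)
    have f22 := ht 22 (by decide) (by decide)
    have f23 := ht 23 (by decide) (by decide)
    obtain ⟨g1, g2⟩ := run_computeRow (s := t) (by rw [f4, h4]) (by rw [f6, h6]) hm
      (fun d hd => (hA d hd).congr (by rw [f12]) (by rw [f13]))
      (fun i hi => (hx i hi).congr (by rw [f22]) (by rw [f23])) hk hk'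
    by_cases hik : i = k
    · subst hik; exact g1
    · obtain ⟨g3, g4⟩ := g2 i (by exact_mod_cast hik)
      exact (h i (by omega)).congr g3 g4

/-- Apply the Toeplitz matrix repeatedly to the vector in the work space. -/
def iterateAll : Program := .for 41 2 iterateRound

theorem run_iterateAll {s : Store} (h4 : s 4 = parArray m R N B W τ) (h6 : s 6 0 = P) (hm : m < P) (hN : N < P)
    {A : ℤ → GaussianInt} (hA : ∀ d : ℤ, d.natAbs < m → HoldsGauss P s 12 13 d (A d)) {x : ℕ → GaussianInt}
    (hx : ∀ i < m, HoldsGauss P s 22 23 i (x i)) :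
    ∀ i < m, HoldsGauss P (iterateAll.run s) 22 23 i (toeplitzIter m A x N i) := by
  refine Program.run_for (n := N) (by rw [h4]; simp [parArray]) (by rw [h6]; exact_mod_cast hN) (by decide)
    (by decide) (by decide) (by decide)
    (fun k t => ∀ i < m, HoldsGauss P t 22 23 i (toeplitzIter m A x k i)) ?_ hx ?_
  · intro i t x h
    simpa [Function.update_apply, HoldsGauss] using h
  · intro k hk t ht hk' h
    have f4 := ht 4 (by decide) (by decide)
    have f6 := ht 6 (by decide) (by decide)
    have f12 := ht 12 (by decide) (by decide)
    have f13 := ht 13 (by decide) (by decide)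
    exact run_iterateRound (by rw [f4, h4]) (by rw [f6, h6]) hm
      (fun d hd => (hA d hd).congr (by rw [f12]) (by rw [f13])) h

/-- The squared norm of a vector of Gaussian integers. -/
def gaussNormSq (m : ℕ) (x : ℕ → GaussianInt) : ℤ := ∑ a ∈ Finset.range m, ((x a).re ^ 2 + (x a).im ^ 2)

/-- The squared norm of the vector in the work space. -/
def computeNorm : Program :=
  .seq (.put 26 (.const 0) (.const 0)) (.for 42 0 (.put 26 (.const 0) (.var 26 +
    (.get 22 (.var 42) * .get 22 (.var 42) + .get 23 (.var 42) * .get 23 (.var 42)))))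

theorem run_computeNorm {s : Store} (h4 : s 4 = parArray m R N B W τ) (h6 : s 6 0 = P) (hm : m < P)
    {x : ℕ → GaussianInt} (hx : ∀ i < m, HoldsGauss P s 22 23 i (x i)) :
    ((computeNorm.run s 26 0 : ℤ) : ZMod P) = ((gaussNormSq m x : ℤ) : ZMod P) := by
  rw [computeNorm, Program.run_seq]
  set s' := (Program.put 26 (.const 0) (.const 0)).run s with hs'
  have e4 : s' 4 = s 4 := by simp [hs', Program.run_put]
  have e6 : s' 6 = s 6 := by simp [hs', Program.run_put]
  have e22 : s' 22 = s 22 := by simp [hs', Program.run_put]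
  have e23 : s' 23 = s 23 := by simp [hs', Program.run_put]
  refine Program.run_for (n := m) (by rw [e4, h4]; simp [parArray]) (by rw [e6, h6]; exact_mod_cast hm) (by decide)
    (by decide) (by decide) (by decide)
    (fun k t => ((t 26 0 : ℤ) : ZMod P) = ((gaussNormSq k x : ℤ) : ZMod P)) ?_ ?_ ?_
  · intro i t x h
    simpa [Function.update_apply] using h
  · simp [hs', Program.run_put, gaussNormSq, h6]
  · intro k hk t ht hk' h
    have f6 := ht 6 (by decide) (by decide)
    have f22 := ht 22 (by decide) (by decide)
    have f23 := ht 23 (by decide) (by decide)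
    obtain ⟨x1, x2⟩ := hx k hk
    simp [Program.run_put, hk', f6, e6, h6, f22, e22, f23, e23, h, x1, x2, gaussNormSq, Finset.sum_range_succ, pow_two]

/-- Rotate one entry of the vector. -/
def rotateRound : Program := .seq
  (.put 28 (.const 0) ((.get 19 (.var 42) * .get 14 (.var 42) - .get 20 (.var 42) * .get 15 (.var 42))
    * .get 16 (.par 0 - .const 1 - .var 42))) (.seq
  (.put 20 (.var 42) ((.get 19 (.var 42) * .get 15 (.var 42) + .get 20 (.var 42) * .get 14 (.var 42))
    * .get 16 (.par 0 - .const 1 - .var 42)))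
  (.put 19 (.var 42) (.var 28)))

/-- Proceed to the vector of the next grid point. -/
def rotate : Program :=
  .seq (.for 42 0 rotateRound)
    (.put 21 (.const 0) (.var 21 * (.get 16 (.par 0 - .const 1) * .get 16 (.par 0 - .const 1))))

/-- The scaled vector of a grid point. -/
def gridVector (m B k a : ℕ) : GaussianInt := (gridStep B ^ a * (gridDenom B : GaussianInt) ^ (m - 1 - a)) ^ k

/-- Entry a is multiplied by the a-th power of the numerator and the (m - 1 - a)-th power of the
denominator of the rotation. So all entries keep one common denominator, whose square is stored in
variable 21. -/
theorem run_rotate {s : Store} (h4 : s 4 = parArray m R N B W τ) (h6 : s 6 0 = P) (hm : m < P) (hm0 : 0 < m)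
    (h14 : ∀ a < m, HoldsGauss P s 14 15 a (gridStep B ^ a))
    (h16 : ∀ a < m, ((s 16 a : ℤ) : ZMod P) = ((gridDenom B ^ a : ℤ) : ZMod P)) {k : ℕ}
    (hv : ∀ a < m, HoldsGauss P s 19 20 a (gridVector m B k a))
    (h21 : ((s 21 0 : ℤ) : ZMod P) = (((gridDenom B ^ (m - 1) * gridDenom B ^ (m - 1)) ^ k : ℤ) : ZMod P)) :
    (∀ a < m, HoldsGauss P (rotate.run s) 19 20 a (gridVector m B (k + 1) a)) ∧
      ((rotate.run s 21 0 : ℤ) : ZMod P)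
        = (((gridDenom B ^ (m - 1) * gridDenom B ^ (m - 1)) ^ (k + 1) : ℤ) : ZMod P) := by
  rw [rotate, Program.run_seq]
  have e4 := Program.run_of_not_mem_writes (a := 4) (.for 42 0 rotateRound) (by decide) s
  have e6 := Program.run_of_not_mem_writes (a := 6) (.for 42 0 rotateRound) (by decide) s
  have e16 := Program.run_of_not_mem_writes (a := 16) (.for 42 0 rotateRound) (by decide) s
  have e21 := Program.run_of_not_mem_writes (a := 21) (.for 42 0 rotateRound) (by decide) s
  have hcast : (m : ℤ) - 1 = ((m - 1 : ℕ) : ℤ) := by omega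
  have hloop := Program.run_for (c := 42) (j := 0) (n := m) (s := s) (p := rotateRound)
    (by rw [h4]; simp [parArray]) (by rw [h6]; exact_mod_cast hm) (by decide) (by decide) (by decide) (by decide)
    (fun j t => (∀ a < j, HoldsGauss P t 19 20 a (gridVector m B (k + 1) a)) ∧
      ∀ a < m, j ≤ a → HoldsGauss P t 19 20 a (gridVector m B k a)) ?_ ?_ ?_
  · set t := (Program.for 42 0 rotateRound).run s
    refine ⟨fun a ha => (hloop.1 a ha).congr ?_ ?_, ?_⟩
    · simp [Program.run_put]
    · simp [Program.run_put]
    · have hD := h16 (m - 1) (by omega)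
      simp [Program.run_put, e4, e6, e16, e21, h4, h6, parArray, h21, hcast, hD, pow_succ]
  · intro i t x h
    simpa [Function.update_apply, HoldsGauss] using h
  · exact ⟨fun a ha => by omega, fun a ha _ => hv a ha⟩
  · rintro j hj t ht hj' ⟨g1, g2⟩
    have f4 := ht 4 (by decide) (by decide)
    have f6 := ht 6 (by decide) (by decide)
    have f14 := ht 14 (by decide) (by decide)
    have f15 := ht 15 (by decide) (by decide)
    have f16 := ht 16 (by decide) (by decide)
    refine ⟨fun a ha => ?_, fun a ha hja => ?_⟩
    · by_cases haj : a = j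
      · subst haj
        obtain ⟨v1, v2⟩ := g2 a hj le_rfl
        obtain ⟨w1, w2⟩ := h14 a hj
        have hD := h16 (m - 1 - a) (by omega)
        have hcast' : ((m - 1 : ℕ) : ℤ) - a = ((m - 1 - a : ℕ) : ℤ) := by omega
        have hsucc : gridVector m B (k + 1) a
            = gridVector m B k a * gridStep B ^ a * ((gridDenom B ^ (m - 1 - a) : ℤ) : GaussianInt) := by
          rw [gridVector, pow_succ, gridVector]; push_cast; ring
        rw [hsucc]
        clear hsucc
        generalize gridDenom B ^ (m - 1 - a) = δ at hD ⊢
        refine ⟨?_, ?_⟩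
        · simp [rotateRound, Program.run_put, hj', f4, f6, h4, h6, parArray, f14, f15, f16, hcast, hcast', hD, v1, v2, w1, w2]
          ring
        · simp [rotateRound, Program.run_put, hj', f4, f6, h4, h6, parArray, f14, f15, f16, hcast, hcast', hD, v1, v2, w1, w2]
      · exact (g1 a (by omega)).congr (by simp [rotateRound, Program.run_put, hj', haj])
          (by simp [rotateRound, Program.run_put, hj', haj])
    · have haj : a ≠ j := by omega
      exact (g2 a ha (by omega)).congr (by simp [rotateRound, Program.run_put, hj', haj])
        (by simp [rotateRound, Program.run_put, hj', haj])

end Iteration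

/-! ### Selection of grid points and the main program -/

section Selection

variable {m R N B W τ P : ℕ}

/-- Output the grid point `40`. -/
def pick : Program :=
  .seq (.put 2 (.var 30) (.var 40)) (.seq (.put 29 (.const 0) (.var 40 + .par 7 + .const 1))
    (.seq (.ite (.par 7 - .var 40) (.put 27 (.const 0) (.var 40)) .skip) (.put 30 (.const 0) (.var 30 + .const 1))))

/-- Output the grid point `40` if it passes the test and is not close to an earlier output. -/
def selectRound : Program :=
  .ite (IExpr.clamp (.const 16 * .var 18 * .var 21) - IExpr.clamp (.par 8 * .par 8 * .var 26))
    (.ite (.var 40 + .const 1 - .var 29) (.ite (.var 3 + .var 27 - (.var 40 + .par 7)) pick .skip) .skip) .skip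

/-- The outputs among the first `k` points of a grid of `G` points: they pass the test, are cyclically further than
`W` apart, and every point that passes the test is cyclically within `W` of one of them. -/
structure IsSelection (pass : ℕ → Prop) (G W k : ℕ) (s : Store) (c : ℕ) (κ : ℕ → ℕ) : Prop where
  out : ∀ i < c, s 2 i = κ i
  passes : ∀ i < c, pass (κ i)
  lt : ∀ i < c, κ i < k
  lt_grid : ∀ i < c, κ i < G
  sep : ∀ i j, i < j → j < c → κ i + W < κ j ∧ κ j + W < κ i + G
  cover : ∀ k' < k, k' < G → pass k' → ∃ i < c, (κ i ≤ k' ∧ k' ≤ κ i + W) ∨ κ i + G ≤ k' + W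

/-- The selection together with the variables that are used to compute it. -/
def SelectionState (pass : ℕ → Prop) (G W k : ℕ) (s : Store) : Prop :=
  ∃ c κ, IsSelection pass G W k s c κ ∧ s 30 0 = (c : ℤ) ∧ c ≤ k ∧
    s 29 0 = ((if c = 0 then 0 else κ (c - 1) + W + 1 : ℕ) : ℤ) ∧
    s 27 0 = ((if c = 0 then W else min W (κ 0) : ℕ) : ℤ)

theorem SelectionState.congr {pass : ℕ → Prop} {G W k : ℕ} {s t : Store} (h : SelectionState pass G W k s)
    (h2 : t 2 = s 2) (h30 : t 30 = s 30) (h29 : t 29 = s 29) (h27 : t 27 = s 27) : SelectionState pass G W k t := by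
  obtain ⟨c, κ, ⟨a1, a2, a3, a4, a5, a6⟩, b1, b2, b3, b4⟩ := h
  exact ⟨c, κ, ⟨by rw [h2]; exact a1, a2, a3, a4, a5, a6⟩, by rw [h30]; exact b1, b2, by rw [h29]; exact b3,
    by rw [h27]; exact b4⟩

/-- The outputs are increasing, so a new point need only be compared with the last one and, around
the circle, with the first one. Variable 29 is the first index far enough beyond the last output.
Variable 27 is the smaller of W and the first output, which combines the wrap-around test with the
test that k lies on the grid. -/
theorem run_selectRound {pass : ℕ → Prop} {G k : ℕ} {s : Store} (h4 : s 4 = parArray m R N B W τ) (h6 : s 6 0 = P)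
    (h3 : s 3 0 = G) (h40 : s 40 0 = k) (hP : k + W + 2 < P)
    (hpass : (τ * τ * s 26 0) % P < (16 * s 18 0 * s 21 0) % P ↔ pass k) (h : SelectionState pass G W k s) :
    SelectionState pass G W (k + 1) (selectRound.run s) := by
  obtain ⟨c, κ, ⟨a1, a2, a3, a4, a5, a6⟩, b1, b2, b3, b4⟩ := h
  have hlast : ∀ i < c, κ i ≤ κ (c - 1) := by
    intro i hi
    rcases Nat.lt_or_ge i (c - 1) with h | h
    · have := (a5 i (c - 1) h (by omega)).1; omega
    · obtain rfl : i = c - 1 := by omega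
      rfl
  have hfirst : ∀ i < c, κ 0 ≤ κ i := by
    intro i hi
    rcases Nat.eq_zero_or_pos i with rfl | h
    · rfl
    · have := (a5 0 i h hi).1; omega
  have hskip : (k < G → pass k → ∃ i < c, (κ i ≤ k ∧ k ≤ κ i + W) ∨ κ i + G ≤ k + W) →
      SelectionState pass G W (k + 1) s := by
    intro hk
    refine ⟨c, κ, ⟨a1, a2, fun i hi => (a3 i hi).trans (Nat.lt_succ_self k), a4, a5, ?_⟩, b1, by omega, b3, b4⟩
    intro k' hk' hG hp
    rcases Nat.lt_succ_iff_lt_or_eq.mp hk' with h | rfl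
    · exact a6 k' h hG hp
    · exact hk hG hp
  have e7 : s 4 7 = W := by rw [h4]; simp [parArray]
  have e8 : s 4 8 = τ := by rw [h4]; simp [parArray]
  simp only [selectRound, Program.run_ite, IExpr.eval_clamp, IExpr.eval_sub, IExpr.eval_add, IExpr.eval_mul,
    IExpr.eval_const, IExpr.eval_var, IExpr.eval_par, Program.run_skip, h6, h3, h40, sub_pos, Nat.cast_ofNat, e7, e8]
  obtain ⟨lp, hlp⟩ : ∃ lp, lp = if c = 0 then 0 else κ (c - 1) + W + 1 := ⟨_, rfl⟩
  obtain ⟨fr, hfr⟩ : ∃ fr, fr = if c = 0 then W else min W (κ 0) := ⟨_, rfl⟩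
  rw [b3, b4, ← hlp, ← hfr]
  split_ifs with c1 c2 c3
  · have hpk : pass k := hpass.mp c1
    have hW : (if c = 0 then W else min W (κ 0)) ≤ W := by split_ifs <;> omega
    have hk3 : k + W < G + (if c = 0 then W else min W (κ 0)) := by rw [← hfr]; exact_mod_cast c3
    have hk2 : (if c = 0 then 0 else κ (c - 1) + W + 1) ≤ k := by
      have : (if c = 0 then 0 else κ (c - 1) + W + 1) < k + 1 := by rw [← hlp]; exact_mod_cast c2
      omega
    have hkG : k < G := by omega
    have hfar : ∀ i < c, κ i + W < k ∧ k + W < κ i + G := by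
      intro i hi
      have hc : c ≠ 0 := by omega
      rw [if_neg hc] at hk2 hk3
      have := hlast i hi
      have := hfirst i hi
      omega
    refine ⟨c + 1, Function.update κ c k, ⟨?_, ?_, ?_, ?_, ?_, ?_⟩, ?_, by omega, ?_, ?_⟩
    · intro i hi
      rcases Nat.lt_succ_iff_lt_or_eq.mp hi with h | rfl
      · have hne : (i : ℤ) ≠ c := by omega
        have hne' : i ≠ c := by omega
        simp only [pick, Program.run_seq, Program.run_put, Program.run_ite]
        split_ifs <;> simp [b1, hne, hne', a1 i h, Program.run_put]
      · simp only [pick, Program.run_seq, Program.run_put, Program.run_ite]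
        have : (k : ℤ) % P = k := Int.emod_eq_of_lt (by omega) (by omega)
        split_ifs <;> simp [b1, h40, h6, this, Program.run_put]
    · intro i hi
      rcases Nat.lt_succ_iff_lt_or_eq.mp hi with h | rfl
      · rw [Function.update_of_ne (by omega)]; exact a2 i h
      · rw [Function.update_self]; exact hpk
    · intro i hi
      rcases Nat.lt_succ_iff_lt_or_eq.mp hi with h | rfl
      · rw [Function.update_of_ne (by omega)]; exact (a3 i h).trans (Nat.lt_succ_self k)
      · rw [Function.update_self]; omega
    · intro i hi
      rcases Nat.lt_succ_iff_lt_or_eq.mp hi with h | rfl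
      · rw [Function.update_of_ne (by omega)]; exact a4 i h
      · rw [Function.update_self]; exact hkG
    · intro i j hij hj
      rw [Function.update_of_ne (by omega : i ≠ c)]
      rcases Nat.lt_succ_iff_lt_or_eq.mp hj with h | rfl
      · rw [Function.update_of_ne (by omega : j ≠ c)]; exact a5 i j hij h
      · rw [Function.update_self]; exact hfar i hij
    · intro k' hk' hG hp
      rcases Nat.lt_succ_iff_lt_or_eq.mp hk' with h | rfl
      · obtain ⟨i, hi, hi'⟩ := a6 k' h hG hp
        exact ⟨i, by omega, by rwa [Function.update_of_ne (by omega : i ≠ c)]⟩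
      · exact ⟨c, by omega, by rw [Function.update_self]; omega⟩
    · simp only [pick, Program.run_seq, Program.run_put, Program.run_ite]
      have : ((c : ℤ) + 1) % P = c + 1 := Int.emod_eq_of_lt (by omega) (by omega)
      split_ifs <;> simp [b1, h6, this, Program.run_put]
    · rw [if_neg (by omega), show c + 1 - 1 = c from rfl, Function.update_self]
      simp only [pick, Program.run_seq, Program.run_put, Program.run_ite]
      have : ((k : ℤ) + W + 1) % P = k + W + 1 := Int.emod_eq_of_lt (by omega) (by omega)
      split_ifs <;> simp [h40, h6, e7, this, Program.run_put]
    · rw [if_neg (by omega)]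
      have hkm : (k : ℤ) % P = k := Int.emod_eq_of_lt (by omega) (by omega)
      simp only [pick, Program.run_seq, Program.run_put, Program.run_ite]
      by_cases hc : c = 0
      · subst hc
        rw [Function.update_self]
        rw [if_pos rfl] at b4
        by_cases hkW : k < W
        · have hkW' : (k : ℤ) < W := by exact_mod_cast hkW
          simp [h40, h6, e7, hkW, hkm, Program.run_put, hkW.le]
        · simp [h40, h6, e7, hkW, b4, Program.run_put, not_lt.mp hkW]
      · have hkW : ¬ k < W := by
          have := (hfar 0 (by omega)).1
          omega
        rw [Function.update_of_ne (Ne.symm hc)]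
        rw [if_neg hc] at b4
        simp [h40, h6, e7, hkW, b4, Program.run_put]
  · refine hskip fun hG hp => ?_
    have hk3 : ¬ k + W < G + (if c = 0 then W else min W (κ 0)) := by rw [← hfr]; exact_mod_cast c3
    -- A grid point that fails the last test must lie within W of the first output across the end of
    -- the grid; if there is no output yet, the test only says k < G.
    by_cases hc : c = 0
    · rw [if_pos hc] at hk3; omega
    · rw [if_neg hc] at hk3
      exact ⟨0, by omega, by omega⟩
  · refine hskip fun hG hp => ?_
    have hk2 : ¬ (if c = 0 then 0 else κ (c - 1) + W + 1) < k + 1 := by rw [← hlp]; exact_mod_cast c2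
    by_cases hc : c = 0
    · rw [if_pos hc] at hk2; omega
    · rw [if_neg hc] at hk2
      have := a3 (c - 1) (by omega)
      exact ⟨c - 1, by omega, by omega⟩
  · exact hskip fun _ hp => absurd (hpass.mpr hp) c1

/-- The treatment of a grid point. -/
def gridRound : Program :=
  .seq (copyToWork 19 20) (.seq iterateAll (.seq computeNorm (.seq selectRound rotate)))

/-- The test of a grid point, in exact integer arithmetic. -/
def PassesTest (m R N B τ : ℕ) (A : ℤ → GaussianInt) (k : ℕ) : Prop :=
  (τ * τ : ℤ) * gaussNormSq m (toeplitzIter m A (gridVector m B k) N)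
    < 16 * (m * R * (m * R)) ^ N * (gridDenom B ^ (m - 1) * gridDenom B ^ (m - 1)) ^ k

theorem gaussNormSq_nonneg (m : ℕ) (x : ℕ → GaussianInt) : 0 ≤ gaussNormSq m x :=
  Finset.sum_nonneg fun _ _ => by positivity

theorem emod_eq_of_cast_eq {x z : ℤ} (h : (x : ZMod P) = (z : ZMod P)) (h0 : 0 ≤ z) (hz : z < P) : x % P = z := by
  rw [(ZMod.intCast_eq_intCast_iff' x z P).mp h, Int.emod_eq_of_lt h0 hz]

theorem run_gridRound {A : ℤ → GaussianInt} {G k : ℕ} {s : Store} (h4 : s 4 = parArray m R N B W τ) (h6 : s 6 0 = P)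
    (hm0 : 0 < m) (hm : m < P) (hN : N < P) (hP : k + W + 2 < P) (h3 : s 3 0 = G) (h40 : s 40 0 = k)
    (hA : ∀ d : ℤ, d.natAbs < m → HoldsGauss P s 12 13 d (A d))
    (h14 : ∀ a < m, HoldsGauss P s 14 15 a (gridStep B ^ a))
    (h16 : ∀ a < m, ((s 16 a : ℤ) : ZMod P) = ((gridDenom B ^ a : ℤ) : ZMod P))
    (h18 : ((s 18 0 : ℤ) : ZMod P) = (((m * R * (m * R)) ^ N : ℤ) : ZMod P))
    (hv : ∀ a < m, HoldsGauss P s 19 20 a (gridVector m B k a))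
    (h21 : ((s 21 0 : ℤ) : ZMod P) = (((gridDenom B ^ (m - 1) * gridDenom B ^ (m - 1)) ^ k : ℤ) : ZMod P))
    (hl : (τ * τ : ℤ) * gaussNormSq m (toeplitzIter m A (gridVector m B k) N) < P)
    (hr : 16 * (m * R * (m * R) : ℤ) ^ N * (gridDenom B ^ (m - 1) * gridDenom B ^ (m - 1)) ^ k < P)
    (hsel : SelectionState (PassesTest m R N B τ A) G W k s) :
    (∀ a < m, HoldsGauss P (gridRound.run s) 19 20 a (gridVector m B (k + 1) a)) ∧
    ((gridRound.run s 21 0 : ℤ) : ZMod P)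
      = (((gridDenom B ^ (m - 1) * gridDenom B ^ (m - 1)) ^ (k + 1) : ℤ) : ZMod P) ∧
    SelectionState (PassesTest m R N B τ A) G W (k + 1) (gridRound.run s) := by
  rw [gridRound]
  simp only [Program.run_seq]
  have f1 : ∀ a ∉ (copyToWork 19 20).writes, (copyToWork 19 20).run s a = s a :=
    fun a ha => Program.run_of_not_mem_writes _ ha s
  have w1 := run_copyToWork (s := s) h4 h6 hm (by decide) (by decide) hv
  set s1 := (copyToWork 19 20).run s
  have f2 : ∀ a ∉ iterateAll.writes, iterateAll.run s1 a = s1 a := fun a ha => Program.run_of_not_mem_writes _ ha s1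
  have w2 := run_iterateAll (s := s1) (P := P) (A := A) (by rw [f1 4 (by decide), h4]) (by rw [f1 6 (by decide), h6]) hm hN
    (fun d hd => (hA d hd).congr (by rw [f1 12 (by decide)]) (by rw [f1 13 (by decide)])) w1
  set s2 := iterateAll.run s1
  have f3 : ∀ a ∉ computeNorm.writes, computeNorm.run s2 a = s2 a := fun a ha => Program.run_of_not_mem_writes _ ha s2
  have w3 := run_computeNorm (s := s2) (P := P)
    (by rw [f2 4 (by decide), f1 4 (by decide), h4]) (by rw [f2 6 (by decide), f1 6 (by decide), h6]) hm w2
  set s3 := computeNorm.run s2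
  have f123 : ∀ a ∉ (copyToWork 19 20).writes, a ∉ iterateAll.writes → a ∉ computeNorm.writes → s3 a = s a :=
    fun a h1 h2 h3 => by rw [f3 a h3, f2 a h2, f1 a h1]
  have g4 : s3 4 = parArray m R N B W τ := by rw [f123 4 (by decide) (by decide) (by decide), h4]
  have g6 : s3 6 0 = P := by rw [f123 6 (by decide) (by decide) (by decide), h6]
  -- Both numbers are nonnegative and below P, so comparing the residues compares the integers
  -- themselves.
  have hpass : (τ * τ * s3 26 0) % P < (16 * s3 18 0 * s3 21 0) % P ↔ PassesTest m R N B τ A k := by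
    have hD : 0 < gridDenom B := by unfold gridDenom; positivity
    rw [f123 18 (by decide) (by decide) (by decide), f123 21 (by decide) (by decide) (by decide)]
    rw [emod_eq_of_cast_eq (P := P)
        (z := (τ * τ : ℤ) * gaussNormSq m (toeplitzIter m A (gridVector m B k) N)) (by push_cast; rw [w3])
        (mul_nonneg (by positivity) (gaussNormSq_nonneg _ _)) hl,
      emod_eq_of_cast_eq (P := P)
        (z := 16 * (m * R * (m * R) : ℤ) ^ N * (gridDenom B ^ (m - 1) * gridDenom B ^ (m - 1)) ^ k)
        (by push_cast; rw [h18, h21]; push_cast; rfl) (by positivity) hr, PassesTest]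
  have w4 := run_selectRound (s := s3) g4 g6 (by rw [f123 3 (by decide) (by decide) (by decide), h3])
    (by rw [f123 40 (by decide) (by decide) (by decide), h40]) hP hpass
    (hsel.congr (f123 2 (by decide) (by decide) (by decide)) (f123 30 (by decide) (by decide) (by decide))
      (f123 29 (by decide) (by decide) (by decide)) (f123 27 (by decide) (by decide) (by decide)))
  have f4 : ∀ a ∉ selectRound.writes, selectRound.run s3 a = s3 a :=
    fun a ha => Program.run_of_not_mem_writes _ ha s3
  set s4 := selectRound.run s3
  have f1234 : ∀ a ∉ (copyToWork 19 20).writes, a ∉ iterateAll.writes → a ∉ computeNorm.writes →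
      a ∉ selectRound.writes → s4 a = s a :=
    fun a h1 h2 h3 h5 => by rw [f4 a h5, f123 a h1 h2 h3]
  have e := fun a (h1 : a ∉ (copyToWork 19 20).writes) => f1234 a h1
  obtain ⟨w5, w6⟩ := run_rotate (s := s4) (P := P) (B := B) (k := k) (by rw [f4 4 (by decide), g4]) (by rw [f4 6 (by decide), g6])
    hm hm0
    (fun a ha => (h14 a ha).congr (by rw [e 14 (by decide) (by decide) (by decide) (by decide)])
      (by rw [e 15 (by decide) (by decide) (by decide) (by decide)]))
    (fun a ha => by rw [e 16 (by decide) (by decide) (by decide) (by decide)]; exact h16 a ha)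
    (fun a ha => (hv a ha).congr (by rw [e 19 (by decide) (by decide) (by decide) (by decide)])
      (by rw [e 20 (by decide) (by decide) (by decide) (by decide)]))
    (by rw [e 21 (by decide) (by decide) (by decide) (by decide)]; exact h21)
  have f5 : ∀ a ∉ rotate.writes, rotate.run s4 a = s4 a := fun a ha => Program.run_of_not_mem_writes _ ha s4
  exact ⟨w5, w6, w4.congr (f5 2 (by decide)) (f5 30 (by decide)) (f5 29 (by decide)) (f5 27 (by decide))⟩

/-- The main part of the classical program. -/
def coreProgram : Program :=
  .seq computeSymbol (.seq computePowers (.seq countQuadrant (.seq (.put 3 (.const 0) (.const 4 * .var 17))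
    (.seq computeScale (.seq initVectors (.for 40 4 gridRound))))))

theorem quadrantCount_le (B : ℕ) : quadrantCount B ≤ 2 * B :=
  (Finset.card_filter_le _ _).trans (by simp)

/-- The grid has 4 · `quadrantCount B` points, a number that is known only during the run, whereas
loop lengths are fixed parameters. The loop therefore makes 8B rounds, which is enough, and points
beyond the grid are rejected by the selection. -/
theorem run_coreProgram {s : Store} (h4 : s 4 = parArray m R N B W τ) (h6 : s 6 0 = P) (hm0 : 0 < m)
    (hP : 8 * B + W + m + N + R + 2 < P)
    (hzero : ∀ a ∈ [10, 11, 17, 29, 30], s a = 0)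
    (hbd : ∀ a < 2 * B, 2 * |(gridStep B ^ a).re| < P)
    (hl : ∀ k < 8 * B, (τ * τ : ℤ) *
      gaussNormSq m (toeplitzIter m (symbol m R (bitSum R (s 1))) (gridVector m B k) N) < P)
    (hr : ∀ k < 8 * B, 16 * (m * R * (m * R) : ℤ) ^ N * (gridDenom B ^ (m - 1) * gridDenom B ^ (m - 1)) ^ k < P) :
    coreProgram.run s 3 0 = (4 * quadrantCount B : ℕ) ∧ ∃ c κ,
      IsSelection (PassesTest m R N B τ (symbol m R (bitSum R (s 1)))) (4 * quadrantCount B) W (8 * B)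
        (coreProgram.run s) c κ := by
  set A := symbol m R (bitSum R (s 1)) with hAdef
  have hq := quadrantCount_le B
  rw [coreProgram]
  simp only [Program.run_seq]
  have f1 : ∀ a ∉ computeSymbol.writes, computeSymbol.run s a = s a := fun a ha => Program.run_of_not_mem_writes _ ha s
  have w1 := fun d hd => run_computeSymbol (s := s) (d := d) h4 h6 (by omega) (by omega) hm0
    (hzero 10 (by simp)) (hzero 11 (by simp)) hd
  set s1 := computeSymbol.run s
  have f2 : ∀ a ∉ computePowers.writes, computePowers.run s1 a = s1 a :=
    fun a ha => Program.run_of_not_mem_writes _ ha s1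
  have w2 := fun a ha => run_computePowers (s := s1) (P := P) (B := B) (m := m) (a := a) (by rw [f1 4 (by decide), h4])
    (by rw [f1 6 (by decide), h6]) (by omega) ha
  set s2 := computePowers.run s1
  have f3 : ∀ a ∉ countQuadrant.writes, countQuadrant.run s2 a = s2 a :=
    fun a ha => Program.run_of_not_mem_writes _ ha s2
  have w3 := run_countQuadrant (s := s2) (P := P) (B := B) (by rw [f2 4 (by decide), f1 4 (by decide), h4])
    (by rw [f2 6 (by decide), f1 6 (by decide), h6]) (by omega)
    (by rw [f2 17 (by decide), f1 17 (by decide), hzero 17 (by simp)]; rfl) (fun a ha => (w2 a (by omega)).1) hbd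
  set s3 := countQuadrant.run s2
  have g6 : s3 6 0 = P := by rw [f3 6 (by decide), f2 6 (by decide), f1 6 (by decide), h6]
  have w4 : (Program.put 3 (.const 0) (.const 4 * .var 17)).run s3 3 0 = (4 * quadrantCount B : ℕ) := by
    simp only [Program.run_put, IExpr.eval_const, IExpr.eval_mul, IExpr.eval_var, Function.update_self, w3, g6]
    rw [Int.emod_eq_of_lt (by omega) (by omega)]
    push_cast; rfl
  have f4 : ∀ a ∉ (Program.put 3 (.const 0) (.const 4 * .var 17)).writes,
      (Program.put 3 (.const 0) (.const 4 * .var 17)).run s3 a = s3 a := fun a ha => Program.run_of_not_mem_writes _ ha s3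
  set s4 := (Program.put 3 (.const 0) (.const 4 * .var 17)).run s3
  have f1234 : ∀ a ∉ computeSymbol.writes ++ computePowers.writes ++ countQuadrant.writes ++
      (Program.put 3 (.const 0) (.const 4 * .var 17)).writes, s4 a = s a := by
    intro a ha
    simp only [List.mem_append, not_or] at ha
    rw [f4 a ha.2, f3 a ha.1.2, f2 a ha.1.1.2, f1 a ha.1.1.1]
  have w5 := run_computeScale (s := s4) (P := P) (by rw [f1234 4 (by decide), h4])
    (by rw [f1234 6 (by decide), h6]) (by omega)
  have f5 : ∀ a ∉ computeScale.writes, computeScale.run s4 a = s4 a :=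
    fun a ha => Program.run_of_not_mem_writes _ ha s4
  set s5 := computeScale.run s4
  have w6 := run_initVectors (s := s5) (P := P) (by rw [f5 4 (by decide), f1234 4 (by decide), h4])
    (by rw [f5 6 (by decide), f1234 6 (by decide), h6]) (by omega) (by omega)
  have f6 : ∀ a ∉ initVectors.writes, initVectors.run s5 a = s5 a :=
    fun a ha => Program.run_of_not_mem_writes _ ha s5
  set s6 := initVectors.run s5
  have g4 : s6 4 = parArray m R N B W τ := by rw [f6 4 (by decide), f5 4 (by decide), f1234 4 (by decide), h4]
  have g6' : s6 6 0 = P := by rw [f6 6 (by decide), f5 6 (by decide), f1234 6 (by decide), h6]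
  have g3 : s6 3 0 = (4 * quadrantCount B : ℕ) := by rw [f6 3 (by decide), f5 3 (by decide), w4]
  have gA : ∀ d : ℤ, d.natAbs < m → HoldsGauss P s6 12 13 d (A d) := fun d hd => (w1 d hd).congr
    (by rw [f6 12 (by decide), f5 12 (by decide), f4 12 (by decide), f3 12 (by decide), f2 12 (by decide)])
    (by rw [f6 13 (by decide), f5 13 (by decide), f4 13 (by decide), f3 13 (by decide), f2 13 (by decide)])
  have gp : ∀ a < m, HoldsGauss P s6 14 15 a (gridStep B ^ a) ∧
      ((s6 16 a : ℤ) : ZMod P) = ((gridDenom B ^ a : ℤ) : ZMod P) := by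
    intro a ha
    obtain ⟨p1, p2⟩ := w2 a (by omega)
    refine ⟨p1.congr ?_ ?_, ?_⟩
    · rw [f6 14 (by decide), f5 14 (by decide), f4 14 (by decide), f3 14 (by decide)]
    · rw [f6 15 (by decide), f5 15 (by decide), f4 15 (by decide), f3 15 (by decide)]
    · rw [f6 16 (by decide), f5 16 (by decide), f4 16 (by decide), f3 16 (by decide)]; exact p2
  have g18 : ((s6 18 0 : ℤ) : ZMod P) = (((m * R * (m * R)) ^ N : ℤ) : ZMod P) := by rw [f6 18 (by decide)]; exact w5
  refine ⟨?_, ?_⟩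
  · rw [Program.run_of_not_mem_writes (a := 3) (.for 40 4 gridRound) (by decide), g3]
  · have hloop := Program.run_for (c := 40) (j := 4) (n := 8 * B) (s := s6) (p := gridRound)
      (by rw [g4]; simp [parArray]) (by rw [g6']; exact_mod_cast (by omega : 8 * B < P)) (by decide) (by decide)
      (by decide) (by decide)
      (fun k t => (∀ a < m, HoldsGauss P t 19 20 a (gridVector m B k a)) ∧
        ((t 21 0 : ℤ) : ZMod P) = (((gridDenom B ^ (m - 1) * gridDenom B ^ (m - 1)) ^ k : ℤ) : ZMod P) ∧
        SelectionState (PassesTest m R N B τ A) (4 * quadrantCount B) W k t) ?_ ?_ ?_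
    · obtain ⟨-, -, c, κ, hs, -⟩ := hloop
      exact ⟨c, κ, hs⟩
    · rintro i t x ⟨h1, h2, h3⟩
      exact ⟨fun a ha => (h1 a ha).congr (by simp) (by simp), by simpa using h2,
        h3.congr (by simp) (by simp) (by simp) (by simp)⟩
    · refine ⟨fun a ha => ?_, ?_, 0, fun _ => 0, ?_, ?_, by omega, ?_, ?_⟩
      · simpa [gridVector] using w6.1 a ha
      · simpa using w6.2.1
      · constructor <;> intros <;> omega
      · rw [f6 30 (by decide), f5 30 (by decide), f1234 30 (by decide), hzero 30 (by simp)]; rfl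
      · rw [f6 29 (by decide), f5 29 (by decide), f1234 29 (by decide), hzero 29 (by simp)]; rfl
      · rw [w6.2.2]; simp
    · rintro k hk t ht hk' ⟨h1, h2, h3⟩
      refine run_gridRound (s := t) (by rw [ht 4 (by decide) (by decide), g4]) (by rw [ht 6 (by decide) (by decide), g6'])
        hm0 (by omega) (by omega) (by omega) (by rw [ht 3 (by decide) (by decide), g3]) hk'
        (fun d hd => (gA d hd).congr (by rw [ht 12 (by decide) (by decide)]) (by rw [ht 13 (by decide) (by decide)]))
        (fun a ha => (gp a ha).1.congr (by rw [ht 14 (by decide) (by decide)]) (by rw [ht 15 (by decide) (by decide)]))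
        (fun a ha => by rw [ht 16 (by decide) (by decide)]; exact (gp a ha).2)
        (by rw [ht 18 (by decide) (by decide)]; exact g18) h1 h2 (hl k hk) (hr k hk) h3

theorem clamped_coreProgram : coreProgram.Clamped := by
  simp [coreProgram, computeSymbol, symbolRound, accumulateBits, computePowers, powersRound, countQuadrant, countRound,
    computeScale, initVectors, gridRound, copyToWork, iterateAll, iterateRound, computeRow, rowRound, computeNorm,
    selectRound, pick, rotate, rotateRound, Program.for, Program.put, Program.Clamped]

end Selection

/-! ### Bounds for the integers in the test -/

section Sizes

/-- The sum of the absolute values of the real and the imaginary part. -/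
def gaussAbs (x : GaussianInt) : ℤ := |x.re| + |x.im|

theorem gaussAbs_nonneg (x : GaussianInt) : 0 ≤ gaussAbs x := add_nonneg (abs_nonneg _) (abs_nonneg _)

theorem gaussAbs_add_le (x y : GaussianInt) : gaussAbs (x + y) ≤ gaussAbs x + gaussAbs y := by
  unfold gaussAbs
  rw [Zsqrtd.re_add, Zsqrtd.im_add]
  linarith [abs_add_le x.re y.re, abs_add_le x.im y.im]

/-- Submultiplicativity is what the iteration needs, and this absolute value stays in the integers,
unlike the modulus. -/
theorem gaussAbs_mul_le (x y : GaussianInt) : gaussAbs (x * y) ≤ gaussAbs x * gaussAbs y := by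
  unfold gaussAbs
  rw [Zsqrtd.re_mul, Zsqrtd.im_mul]
  have h1 := abs_add_le (x.re * y.re) (-1 * x.im * y.im)
  have h2 := abs_add_le (x.re * y.im) (x.im * y.re)
  simp only [abs_mul, abs_neg, abs_one, one_mul] at h1 h2
  nlinarith

theorem gaussAbs_sum_le (f : ℕ → GaussianInt) (k : ℕ) :
    gaussAbs (∑ b ∈ Finset.range k, f b) ≤ ∑ b ∈ Finset.range k, gaussAbs (f b) := by
  induction k with
  | zero => simp [gaussAbs]
  | succ k ih =>
    rw [Finset.sum_range_succ, Finset.sum_range_succ]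
    exact (gaussAbs_add_le _ _).trans (by linarith)

theorem gaussAbs_toeplitzIter_le {m : ℕ} {A : ℤ → GaussianInt} {x : ℕ → GaussianInt} {α β : ℤ} (hα : 0 ≤ α)
    (hA : ∀ d : ℤ, d.natAbs < m → gaussAbs (A d) ≤ α) (hx : ∀ a < m, gaussAbs (x a) ≤ β) (t : ℕ) :
    ∀ a < m, gaussAbs (toeplitzIter m A x t a) ≤ (m * α) ^ t * β := by
  induction t with
  | zero => intro a ha; simpa [toeplitzIter] using hx a ha
  | succ t ih =>
    intro a ha
    rw [toeplitzIter]
    refine (gaussAbs_sum_le _ _).trans ?_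
    calc ∑ b ∈ Finset.range m, gaussAbs (A (a - b) * toeplitzIter m A x t b)
        ≤ ∑ b ∈ Finset.range m, α * ((m * α) ^ t * β) := by
          refine Finset.sum_le_sum fun b hb => (gaussAbs_mul_le _ _).trans ?_
          have hb' := Finset.mem_range.mp hb
          exact mul_le_mul (hA _ (by omega)) (ih b hb') (gaussAbs_nonneg _) hα
      _ = (m * α) ^ (t + 1) * β := by simp; ring

theorem gaussNormSq_le {m : ℕ} {x : ℕ → GaussianInt} {β : ℤ} (hx : ∀ a < m, gaussAbs (x a) ≤ β) :
    gaussNormSq m x ≤ m * β ^ 2 := by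
  unfold gaussNormSq
  calc _ ≤ ∑ a ∈ Finset.range m, β ^ 2 := by
        refine Finset.sum_le_sum fun a ha => ?_
        have h1 := hx a (Finset.mem_range.mp ha)
        have h2 : gaussAbs (x a) ^ 2 ≤ β ^ 2 := pow_le_pow_left₀ (gaussAbs_nonneg _) h1 2
        refine le_trans ?_ h2
        unfold gaussAbs
        nlinarith [sq_abs (x a).re, sq_abs (x a).im, abs_nonneg (x a).re, abs_nonneg (x a).im,
          mul_nonneg (abs_nonneg (x a).re) (abs_nonneg (x a).im)]
    _ = _ := by simp

theorem abs_re_le_of_norm {x : GaussianInt} {r : ℤ} (hr : 0 ≤ r) (h : Zsqrtd.norm x = r ^ 2) :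
    |x.re| ≤ r ∧ |x.im| ≤ r := by
  rw [Zsqrtd.norm_def] at h
  constructor <;> apply abs_le_of_sq_le_sq _ hr <;> nlinarith [sq_nonneg x.re, sq_nonneg x.im]

theorem norm_gridStep (B : ℕ) : Zsqrtd.norm (gridStep B) = gridDenom B ^ 2 := by
  rw [Zsqrtd.norm_def, gridStep, gridDenom]; ring

theorem gridDenom_pos (B : ℕ) : 0 < gridDenom B := by unfold gridDenom; positivity

theorem norm_gridStep_pow (B a : ℕ) : Zsqrtd.norm (gridStep B ^ a) = (gridDenom B ^ a) ^ 2 := by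
  have : Zsqrtd.norm (gridStep B ^ a) = Zsqrtd.norm (gridStep B) ^ a := map_pow Zsqrtd.normMonoidHom _ _
  rw [this, norm_gridStep]; ring

theorem norm_gridVector {m B k a : ℕ} (ha : a < m) :
    Zsqrtd.norm (gridVector m B k a) = ((gridDenom B ^ (m - 1)) ^ k) ^ 2 := by
  have h1 : Zsqrtd.norm (gridVector m B k a)
      = Zsqrtd.norm (gridStep B ^ a * (gridDenom B : GaussianInt) ^ (m - 1 - a)) ^ k := map_pow Zsqrtd.normMonoidHom _ _
  have h2 : Zsqrtd.norm ((gridDenom B : GaussianInt) ^ (m - 1 - a)) = Zsqrtd.norm (gridDenom B : GaussianInt) ^ (m - 1 - a) :=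
    map_pow Zsqrtd.normMonoidHom _ _
  have h3 : m - 1 = a + (m - 1 - a) := by omega
  rw [h1, Zsqrtd.norm_mul, norm_gridStep_pow, h2, Zsqrtd.norm_intCast]
  conv_rhs => rw [h3, pow_add]
  ring

theorem le_two_pow_self (x : ℕ) : x ≤ 2 ^ x := (Nat.lt_two_pow_self).le

theorem pow_le_two_pow {x y e : ℕ} (h : x ≤ y) : x ^ e ≤ 2 ^ (y * e) := by
  rw [pow_mul]; exact Nat.pow_le_pow_left (h.trans (le_two_pow_self y)) e

/-- Any base x is bounded by 2^x, hence x^e by 2^(xe). This is wasteful but keeps Λ, the number of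
bits of the modulus, polynomial. -/
theorem test_bounds {m R N B τ Λ : ℕ} {A : ℤ → GaussianInt}
    (hA : ∀ d : ℤ, d.natAbs < m → gaussAbs (A d) ≤ ((3 * m * R : ℕ) : ℤ))
    (hΛ : 2 * τ + m + (3 * m * m * R) * (2 * N) + 16 * (B ^ 2 + 1) * m * B + 4 * (B ^ 2 + 1) * B + 5 ≤ Λ) :
    (∀ a < 2 * B, 2 * |(gridStep B ^ a).re| < ((2 ^ Λ : ℕ) : ℤ)) ∧
    (∀ k < 8 * B, (τ * τ : ℤ) * gaussNormSq m (toeplitzIter m A (gridVector m B k) N) < ((2 ^ Λ : ℕ) : ℤ)) ∧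
    (∀ k < 8 * B, 16 * (m * R * (m * R) : ℤ) ^ N * (gridDenom B ^ (m - 1) * gridDenom B ^ (m - 1)) ^ k
      < ((2 ^ Λ : ℕ) : ℤ)) := by
  have hD : gridDenom B = ((B ^ 2 + 1 : ℕ) : ℤ) := by unfold gridDenom; push_cast; ring
  have hDp := gridDenom_pos B
  have hDk : ∀ k < 8 * B, (gridDenom B ^ (m - 1) * gridDenom B ^ (m - 1)) ^ k
      ≤ ((2 ^ (16 * (B ^ 2 + 1) * m * B) : ℕ) : ℤ) := by
    intro k hk
    rw [hD, ← pow_add, ← pow_mul]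
    norm_cast
    refine (pow_le_two_pow le_rfl).trans (Nat.pow_le_pow_right (by norm_num) ?_)
    calc (B ^ 2 + 1) * ((m - 1 + (m - 1)) * k) ≤ (B ^ 2 + 1) * ((m + m) * (8 * B)) := by
          gcongr <;> omega
      _ = _ := by ring
  refine ⟨fun a ha => ?_, fun k hk => ?_, fun k hk => ?_⟩
  · have h1 := (abs_re_le_of_norm (by positivity) (norm_gridStep_pow B a)).1
    have h2 : gridDenom B ^ a ≤ ((2 ^ ((B ^ 2 + 1) * a) : ℕ) : ℤ) := by
      rw [hD]; exact_mod_cast pow_le_two_pow le_rfl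
    have h3 : 2 * 2 ^ ((B ^ 2 + 1) * a) < 2 ^ Λ := by
      rw [mul_comm, ← pow_succ]
      refine Nat.pow_lt_pow_right (by norm_num) ?_
      have h5 : (B ^ 2 + 1) * a ≤ 4 * (B ^ 2 + 1) * B :=
        calc (B ^ 2 + 1) * a ≤ (B ^ 2 + 1) * (4 * B) := Nat.mul_le_mul_left _ (by omega)
          _ = _ := by ring
      omega
    have h4 : (2 * (2 ^ ((B ^ 2 + 1) * a) : ℕ) : ℤ) < ((2 ^ Λ : ℕ) : ℤ) := by exact_mod_cast h3
    linarith
  · set δ : ℤ := (gridDenom B ^ (m - 1)) ^ k with hδ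
    have hδ0 : 0 ≤ δ := by positivity
    have hv : ∀ a < m, gaussAbs (gridVector m B k a) ≤ 2 * δ := by
      intro a ha
      obtain ⟨h1, h2⟩ := abs_re_le_of_norm hδ0 (norm_gridVector (B := B) (k := k) ha)
      unfold gaussAbs; linarith
    have hn := gaussNormSq_le (gaussAbs_toeplitzIter_le (by positivity) hA hv N)
    have hδ2 : δ ^ 2 ≤ ((2 ^ (16 * (B ^ 2 + 1) * m * B) : ℕ) : ℤ) := by
      refine le_trans (le_of_eq ?_) (hDk k hk)
      rw [hδ]; ring
    have hτ : (τ : ℤ) * τ ≤ ((2 ^ (2 * τ) : ℕ) : ℤ) := by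
      have := Nat.mul_le_mul (le_two_pow_self τ) (le_two_pow_self τ)
      rw [← pow_add, ← two_mul] at this
      exact_mod_cast this
    have hm : (m : ℤ) ≤ ((2 ^ m : ℕ) : ℤ) := by exact_mod_cast le_two_pow_self m
    have hpow : ((m : ℤ) * ((3 * m * R : ℕ) : ℤ)) ^ (2 * N) ≤ ((2 ^ ((3 * m * m * R) * (2 * N)) : ℕ) : ℤ) := by
      have := pow_le_two_pow (x := m * (3 * m * R)) (y := 3 * m * m * R) (e := 2 * N) (le_of_eq (by ring))
      exact_mod_cast this
    calc (τ * τ : ℤ) * gaussNormSq m (toeplitzIter m A (gridVector m B k) N)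
        ≤ (τ * τ) * (m * ((m * ((3 * m * R : ℕ) : ℤ)) ^ N * (2 * δ)) ^ 2) :=
          mul_le_mul_of_nonneg_left hn (by positivity)
      _ = (τ * τ) * m * (m * ((3 * m * R : ℕ) : ℤ)) ^ (2 * N) * δ ^ 2 * 4 := by ring
      _ ≤ ((2 ^ (2 * τ) : ℕ) : ℤ) * ((2 ^ m : ℕ) : ℤ) * ((2 ^ ((3 * m * m * R) * (2 * N)) : ℕ) : ℤ)
          * ((2 ^ (16 * (B ^ 2 + 1) * m * B) : ℕ) : ℤ) * 4 := by
          gcongr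
      _ = ((2 ^ (2 * τ + m + (3 * m * m * R) * (2 * N) + 16 * (B ^ 2 + 1) * m * B + 2) : ℕ) : ℤ) := by
          push_cast; ring
      _ < _ := by
          have : 2 ^ (2 * τ + m + (3 * m * m * R) * (2 * N) + 16 * (B ^ 2 + 1) * m * B + 2) < 2 ^ Λ :=
            Nat.pow_lt_pow_right (by norm_num) (by omega)
          exact_mod_cast this
  · have hpow : ((m : ℤ) * R * (m * R)) ^ N ≤ ((2 ^ ((3 * m * m * R) * (2 * N)) : ℕ) : ℤ) := by
      have h1 : m * R ≤ 3 * m * m * R := by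
        rcases Nat.eq_zero_or_pos m with rfl | h
        · simp
        · nlinarith [Nat.zero_le (m * R), Nat.zero_le R, Nat.mul_le_mul_right (m * R) h]
      have := pow_le_two_pow (e := 2 * N) h1
      have h2 : (m * R * (m * R)) ^ N = (m * R) ^ (2 * N) := by rw [pow_mul, pow_two]
      rw [← h2] at this
      exact_mod_cast this
    calc 16 * (m * R * (m * R) : ℤ) ^ N * (gridDenom B ^ (m - 1) * gridDenom B ^ (m - 1)) ^ k
        ≤ 16 * ((2 ^ ((3 * m * m * R) * (2 * N)) : ℕ) : ℤ) * ((2 ^ (16 * (B ^ 2 + 1) * m * B) : ℕ) : ℤ) :=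
          mul_le_mul (mul_le_mul_of_nonneg_left hpow (by norm_num)) (hDk k hk) (by positivity) (by positivity)
      _ = ((2 ^ ((3 * m * m * R) * (2 * N) + 16 * (B ^ 2 + 1) * m * B + 4) : ℕ) : ℤ) := by push_cast; ring
      _ < _ := by
          have : 2 ^ ((3 * m * m * R) * (2 * N) + 16 * (B ^ 2 + 1) * m * B + 4) < 2 ^ Λ :=
            Nat.pow_lt_pow_right (by norm_num) (by omega)
          exact_mod_cast this

end Sizes

/-! ### The input array -/

section Input

variable {L R : ℕ}

/-- The position is a mixed radix expansion with digits k, t, r, so exactly one term of the sum in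
`inputStore` survives. -/
theorem inputStore_bit {n S : ℕ} (ω : Run L R → Fin 2) (k : Fin (2 * L + 1)) (t : Fin 2) (r : Fin R) :
    inputStore n S ω 1 ((k.val * 2 + t.val) * R + r.val) = (ω (k, t, r)).val := by
  have hinj : ∀ ρ : Run L R, (((k.val * 2 + t.val) * R + r.val : ℕ) : ℤ)
      = (((ρ.1.val * 2 + ρ.2.1.val) * R + ρ.2.2.val : ℕ) : ℤ) ↔ ρ = (k, t, r) := by
    rintro ⟨k', t', r'⟩
    constructor
    · intro h
      have h : (k.val * 2 + t.val) * R + r.val = (k'.val * 2 + t'.val) * R + r'.val := by exact_mod_cast h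
      have hR : 0 < R := lt_of_le_of_lt (Nat.zero_le _) r.isLt
      have h1 := congrArg (· / R) h
      have h2 := congrArg (· % R) h
      simp only [mul_comm _ R, Nat.mul_add_mod, Nat.mod_eq_of_lt r.isLt, Nat.mod_eq_of_lt r'.isLt] at h2
      simp only [mul_comm _ R, Nat.mul_add_div hR, Nat.div_eq_of_lt r.isLt, Nat.div_eq_of_lt r'.isLt, add_zero] at h1
      have ht := t.isLt
      have ht' := t'.isLt
      ext <;> simp <;> omega
    · rintro h; cases h; rfl
  have hval : inputStore n S ω 1 ((k.val * 2 + t.val) * R + r.val)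
      = ∑ ρ : Run L R, if ρ = (k, t, r) then ((ω ρ).val : ℤ) else 0 := by
    simp only [inputStore, if_neg one_ne_zero, if_true]
    refine Finset.sum_congr rfl fun ρ _ => ?_
    have := hinj ρ
    push_cast at this
    push_cast
    simp only [this]
  rw [hval, Finset.sum_ite_eq' Finset.univ]
  simp

theorem bitSum_inputStore {n S : ℕ} (ω : Run L R → Fin 2) (t : Fin 2) (k : Fin (2 * L + 1)) :
    bitSum R (inputStore n S ω 1) t k = ∑ r : Fin R, ((ω (k, t, r)).val : ℤ) := by
  rw [bitSum, Finset.sum_range]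
  exact Finset.sum_congr rfl fun r _ => inputStore_bit ω k t r

/-- The sum of the bits counts the ones while the frequency refers to the zeros; this is the origin
of the signs in `symbol`. -/
theorem bitSum_eq_zeroFreq {n S : ℕ} (hR : 0 < R) (ω : Run L R → Fin 2) (t : Fin 2) (k : Fin (2 * L + 1)) :
    (R : ℝ) - 2 * (bitSum R (inputStore n S ω 1) t k : ℝ) = R * (2 * zeroFreq ω k t - 1) := by
  have hR' : (R : ℝ) ≠ 0 := by exact_mod_cast hR.ne'
  have h1 : ∑ r : Fin R, (((ω (k, t, r)).val : ℤ) : ℝ)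
      = R - ((Finset.univ.filter fun r : Fin R => ω (k, t, r) = 0).card : ℝ) := by
    have : ∀ r : Fin R, (((ω (k, t, r)).val : ℤ) : ℝ) = 1 - if ω (k, t, r) = 0 then 1 else 0 := by
      intro r
      rcases fin_two_cases (ω (k, t, r)) with h | h <;> simp [h]
    simp_rw [this]
    rw [Finset.sum_sub_distrib, Finset.sum_boole]
    simp
  rw [bitSum_inputStore]
  push_cast at h1 ⊢
  rw [h1, zeroFreq]
  field_simp
  ring

theorem bitSum_mem {n S : ℕ} (ω : Run L R → Fin 2) (t : Fin 2) {j : ℕ} (hj : j < 2 * L + 1) :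
    0 ≤ bitSum R (inputStore n S ω 1) t j ∧ bitSum R (inputStore n S ω 1) t j ≤ R := by
  have h := bitSum_inputStore (n := n) (S := S) ω t ⟨j, hj⟩
  simp only at h
  rw [h]
  refine ⟨Finset.sum_nonneg fun r _ => by positivity, ?_⟩
  calc _ ≤ ∑ _r : Fin R, (1 : ℤ) := Finset.sum_le_sum fun r _ => by
        have := (ω (⟨j, hj⟩, t, r)).isLt; omega
    _ = R := by simp

theorem gaussAbs_symbol_le {n S : ℕ} (ω : Run L R → Fin 2) {d : ℤ} (hd : d.natAbs < 2 * L + 1) :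
    gaussAbs (symbol (2 * L + 1) R (bitSum R (inputStore n S ω 1)) d) ≤ ((3 * (2 * L + 1) * R : ℕ) : ℤ) := by
  obtain ⟨h1, h2⟩ := bitSum_mem (n := n) (S := S) ω 0 hd
  obtain ⟨h3, h4⟩ := bitSum_mem (n := n) (S := S) ω 1 hd
  have hz : ((0 : Fin 2) : ℕ) = 0 := rfl
  have ho : ((1 : Fin 2) : ℕ) = 1 := rfl
  rw [hz] at h1 h2
  rw [ho] at h3 h4
  unfold gaussAbs symbol
  simp only
  set c0 := bitSum R (inputStore n S ω 1) 0 d.natAbs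
  set c1 := bitSum R (inputStore n S ω 1) 1 d.natAbs
  have hLR : (0 : ℤ) ≤ (L : ℤ) * R := by positivity
  have e1 : |(if d = 0 then (((2 * L + 1 : ℕ) : ℤ) * R) else 0) + (2 * c0 - R)| ≤ (2 * L + 1) * R + R := by
    rw [abs_le]; push_cast; split_ifs <;> constructor <;> nlinarith
  have e2 : |if 0 ≤ d then (R : ℤ) - 2 * c1 else 2 * c1 - R| ≤ R := by
    rw [abs_le]; split_ifs <;> constructor <;> linarith
  push_cast at e1 ⊢
  nlinarith

theorem bitBound_inputStore {n S β : ℕ} (ω : Run L R → Fin 2) (hn : n < 2 ^ β) (hS : S < 2 ^ β)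
    (hL : 2 * L < 2 ^ β) (hR : R < 2 ^ β) (hβ : 0 < β) : BitBound β (inputStore n S ω) := by
  have h1 : (1 : ℤ) < 2 ^ β := one_lt_pow₀ (by norm_num) hβ.ne'
  intro a i
  rw [bitLen_le_iff]
  by_cases ha0 : a = 0
  · simp only [inputStore, if_pos ha0]
    split_ifs
    · rw [abs_of_nonneg (by positivity)]; exact_mod_cast hn
    · rw [abs_of_nonneg (by positivity)]; exact_mod_cast hS
    · rw [abs_of_nonneg (by positivity)]; exact_mod_cast hL
    · rw [abs_of_nonneg (by positivity)]; exact_mod_cast hR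
    · rw [abs_zero]; linarith
  · by_cases ha1 : a = 1
    · subst ha1
      by_cases hi : ∃ (k : Fin (2 * L + 1)) (t : Fin 2) (r : Fin R), i = (k.val * 2 + t.val) * R + r.val
      · obtain ⟨k, t, r, rfl⟩ := hi
        rw [inputStore_bit, abs_of_nonneg (by positivity)]
        have := (ω (k, t, r)).isLt
        omega
      · have : inputStore n S ω 1 i = 0 := by
          simp only [inputStore, if_neg one_ne_zero, if_true]
          refine Finset.sum_eq_zero fun ρ _ => if_neg fun h => hi ⟨ρ.1, ρ.2.1, ρ.2.2, ?_⟩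
          rw [h]; push_cast; ring
        rw [this, abs_zero]; linarith
    · simp only [inputStore, if_neg ha0, if_neg ha1, abs_zero]; linarith

end Input

/-! ### Computing the parameters, and the running time -/

section Prelude

/-- The program evaluates its own parameters from n, so that a single program serves all instances.
-/
theorem exists_polynomial_expr (p : ℕ[X]) :
    ∃ e : IExpr, ∀ (s : Store) (n : ℕ), s 0 0 = n → e.eval s = (p.eval n : ℕ) := by
  induction p using Polynomial.induction_on' with
  | add p q hp hq =>
    obtain ⟨e, he⟩ := hp
    obtain ⟨f, hf⟩ := hq
    exact ⟨e + f, fun s n hs => by rw [IExpr.eval_add, he s n hs, hf s n hs, Polynomial.eval_add]; push_cast; rfl⟩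
  | monomial k a =>
    have hpow : ∃ e : IExpr, ∀ (s : Store) (n : ℕ), s 0 0 = n → e.eval s = (n : ℤ) ^ k := by
      induction k with
      | zero => exact ⟨.const 1, fun s n _ => by simp⟩
      | succ k ih =>
        obtain ⟨e, he⟩ := ih
        exact ⟨e * .var 0, fun s n hs => by rw [IExpr.eval_mul, he s n hs, IExpr.eval_var, hs, pow_succ]⟩
    obtain ⟨e, he⟩ := hpow
    exact ⟨.const a * e, fun s n hs => by
      rw [IExpr.eval_mul, he s n hs, IExpr.eval_const, Polynomial.eval_monomial]; push_cast; rfl⟩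

/-- Write the values of the expressions in the list to array `4`, starting at entry `j`. -/
def storeParams : List IExpr → ℕ → Program
  | [], _ => .skip
  | e :: es, j => .seq (.set 4 (.const j) e) (storeParams es (j + 1))

theorem exec_set_le (a : ℕ) (i e : IExpr) : ∃ C : ℕ, ∀ (β : ℕ) (s : Store), BitBound β s →
    ((Program.set a i e).exec s).2 ≤ C * (β + 1) ^ 2 := by
  obtain ⟨C, hC⟩ := i.exists_cost_bound
  obtain ⟨D, hD⟩ := e.exists_cost_bound
  refine ⟨2 * C + 2 * D + 1, fun β s hs => ?_⟩
  obtain ⟨h1, h2⟩ := hC β s hs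
  obtain ⟨h3, h5⟩ := hD β s hs
  simp only [Program.exec]
  nlinarith [Nat.zero_le (C * β * (β + 1)), Nat.zero_le (D * β * (β + 1)), Nat.zero_le (β * β)]

/-- These assignments write the array of parameters and are not reduced, so they are outside the
scope of `Program.Clamped` and are estimated by hand. The expressions must depend on array 0 alone
in order not to see the earlier writes. -/
theorem storeParams_spec (es : List IExpr) (j : ℕ) : ∃ C : ℕ, ∀ (β : ℕ) (s : Store) (v : List ℕ), BitBound β s →
    (∀ x ∈ v, bitLen x ≤ β) → (∀ t : Store, t 0 = s 0 → List.Forall₂ (fun (e : IExpr) (x : ℕ) => e.eval t = x) es v) →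
    ((storeParams es j).exec s).2 ≤ C * (β + 1) ^ 2 ∧ BitBound β ((storeParams es j).run s) ∧
    (∀ a, a ≠ 4 → (storeParams es j).run s a = s a) ∧
    (∀ i : ℕ, i < j → (storeParams es j).run s 4 i = s 4 i) ∧
    (∀ i : ℕ, i < v.length → (storeParams es j).run s 4 (j + i : ℕ) = (v.getD i 0 : ℕ)) ∧
    (∀ i : ℤ, (i < 0 ∨ ((j + v.length : ℕ) : ℤ) ≤ i) → (storeParams es j).run s 4 i = s 4 i) := by
  induction es generalizing j with
  | nil =>
    refine ⟨1, fun β s v hs _ hv => ?_⟩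
    have h := hv s rfl
    rw [List.forall₂_nil_left_iff] at h
    subst h
    refine ⟨?_, hs, fun a _ => rfl, fun i _ => rfl, fun i hi => absurd hi (by simp), fun i _ => rfl⟩
    simp only [storeParams, Program.exec, one_mul]
    exact Nat.one_le_pow _ _ (by omega)
  | cons e es ih =>
    obtain ⟨C, hC⟩ := ih (j + 1)
    obtain ⟨D, hD⟩ := exec_set_le 4 (.const j) e
    refine ⟨C + D, fun β s v hs hb hv => ?_⟩
    have h := hv s rfl
    obtain ⟨x, v', hx, -, rfl⟩ := List.forall₂_cons_left_iff.mp h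
    have hs1 : BitBound β ((Program.set 4 (.const j) e).run s) := by
      rw [Program.run_set, hx]
      exact hs.update _ _ _ (hb x (by simp))
    have f0 : (Program.set 4 (.const j) e).run s 0 = s 0 := by simp
    obtain ⟨h1, h2, h3, h4, h5, h6⟩ := hC β _ v' hs1 (fun y hy => hb y (by simp [hy]))
      (fun t ht => ((List.forall₂_cons).mp (hv t (ht.trans f0))).2)
    change ((Program.set 4 (.const j) e).exec s).2 + ((storeParams es (j + 1)).exec ((Program.set 4 (.const j) e).run s)).2 ≤ _ ∧
      BitBound β ((storeParams es (j + 1)).run ((Program.set 4 (.const j) e).run s)) ∧ _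
    simp only [storeParams, Program.run_seq]
    refine ⟨?_, h2, fun a ha => ?_, fun i hi => ?_, fun i hi => ?_, fun i hi => ?_⟩
    · rw [add_mul]; have := hD β s hs; omega
    · rw [h3 a ha, Program.run_set, Function.update_of_ne ha]
    · rw [h4 i (by omega)]
      have : (i : ℤ) ≠ j := by omega
      simp [this]
    · cases i with
      | zero => rw [show j + 0 = j from rfl, h4 j (by omega)]; simp [hx]
      | succ i =>
        have := h5 i (by simpa using hi)
        rw [show j + (i + 1) = j + 1 + i by ring, this]; simp
    · rw [h6 i (by simp at hi ⊢; omega)]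
      have : i ≠ (j : ℤ) := by simp at hi; omega
      simp [this]

/-- Set variable `6` to the power of two with the exponent `e`. -/
def storeModulus (e : IExpr) : Program :=
  .seq (.set 6 (.const 0) (.const 1)) (.loop e (.set 6 (.const 0) (.const 2 * .var 6)))

theorem bitLen_two_pow_le (Λ : ℕ) : bitLen ((2 ^ Λ : ℕ) : ℤ) ≤ Λ + 1 := by
  rw [bitLen_le_iff, abs_of_nonneg (by positivity)]
  exact_mod_cast Nat.pow_lt_pow_right (by norm_num) (Nat.lt_succ_self Λ)

/-- The modulus 2^Λ is produced by Λ doublings. Its length Λ + 1 has to fit in the word length β. -/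
theorem storeModulus_spec (e : IExpr) : ∃ C : ℕ, ∀ (β Λ : ℕ) (s : Store), BitBound β s → Λ + 1 ≤ β →
    (∀ t : Store, t 0 = s 0 → e.eval t = Λ) →
    ((storeModulus e).exec s).2 ≤ C * (β + 1) ^ 2 * (Λ + 1) ∧ BitBound β ((storeModulus e).run s) ∧
    (∀ a, a ≠ 6 → (storeModulus e).run s a = s a) ∧ (storeModulus e).run s 6 0 = (2 ^ Λ : ℕ) := by
  obtain ⟨C₁, hC₁⟩ := exec_set_le 6 (.const 0) (.const 1)
  obtain ⟨C₂, hC₂⟩ := exec_set_le 6 (.const 0) (.const 2 * .var 6)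
  obtain ⟨C₃, hC₃⟩ := e.exists_cost_bound
  refine ⟨C₁ + C₂ + C₃ + 2, fun β Λ s hs hΛ he => ?_⟩
  set s1 := (Program.set 6 (.const 0) (.const 1)).run s with hs1
  have hb1 : BitBound β s1 := by
    rw [hs1, Program.run_set]
    refine hs.update _ _ _ ?_
    have := bitLen_two_pow_le 0
    simp only [IExpr.eval_const]
    simp at this
    omega
  have h1a : ∀ a, a ≠ 6 → s1 a = s a := fun a ha => by rw [hs1, Program.run_set, Function.update_of_ne ha]
  have h16 : s1 6 0 = 1 := by simp [hs1]
  set c := Program.set 6 (.const 0) (.const 2 * .var 6)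
  have key : ∀ k ≤ Λ, ∀ x : ℕ,
      ((fun p : Store × ℕ => ((c.exec p.1).1, p.2 + 1 + (c.exec p.1).2))^[k] (s1, x)).2
        ≤ x + k * (1 + C₂ * (β + 1) ^ 2) ∧ BitBound β (c.run^[k] s1) ∧
      (∀ a, a ≠ 6 → c.run^[k] s1 a = s1 a) ∧ c.run^[k] s1 6 0 = (2 ^ k : ℕ) := by
    intro k hk x
    induction k with
    | zero => simp [hb1, h16]
    | succ k ih =>
      obtain ⟨g1, g2, g3, g4⟩ := ih (by omega)
      rw [Function.iterate_succ_apply', Function.iterate_succ_apply']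
      refine ⟨?_, ?_, fun a ha => ?_, ?_⟩
      · have := hC₂ β _ g2
        rw [← Program.exec_loop_fst c k (s1, x)] at this
        simp only
        rw [add_mul, one_mul]
        omega
      · rw [Program.run_set]
        refine g2.update _ _ _ ?_
        have : (IExpr.const 2 * IExpr.var 6).eval (c.run^[k] s1) = ((2 ^ (k + 1) : ℕ) : ℤ) := by
          rw [IExpr.eval_mul, IExpr.eval_const, IExpr.eval_var, g4]; push_cast; ring
        rw [this]
        exact (bitLen_two_pow_le _).trans (by omega)
      · rw [Program.run_set, Function.update_of_ne ha, g3 a ha]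
      · rw [Program.run_set, Function.update_self]
        simp only [IExpr.eval_const, Function.update_self, IExpr.eval_mul, IExpr.eval_var, g4]
        push_cast; ring
  have hcount : (e.eval s1).toNat = Λ := by rw [he s1 (h1a 0 (by norm_num))]; simp
  obtain ⟨g1, g2, g3, g4⟩ := key Λ le_rfl (e.cost s1 + 1)
  have hrun : (storeModulus e).run s = c.run^[Λ] s1 := by
    rw [storeModulus, Program.run_seq, Program.run_loop, hcount]
  rw [hrun]
  refine ⟨?_, g2, fun a ha => (g3 a ha).trans (h1a a ha), g4⟩
  have e0 : ((storeModulus e).exec s).2 = ((Program.set 6 (.const 0) (.const 1)).exec s).2 +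
      ((fun p : Store × ℕ => ((c.exec p.1).1, p.2 + 1 + (c.exec p.1).2))^[(e.eval s1).toNat] (s1, e.cost s1 + 1)).2 := rfl
  rw [e0, hcount]
  have e1 := hC₁ β s hs
  have e2 := (hC₃ β s1 hb1).2
  have e3 : 1 ≤ (β + 1) ^ 2 := Nat.one_le_pow _ _ (by omega)
  generalize (β + 1) ^ 2 = Y at *
  nlinarith [Nat.zero_le (C₁ * Y * Λ), Nat.zero_le (C₃ * Y * Λ), Nat.zero_le (C₂ * Y), Nat.mul_le_mul_right Λ e3,
    Nat.zero_le (Y * Λ)]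

/-- A polynomial that bounds the lengths of all numbers which occur in the classical program. -/
noncomputable def lengthBound (mb pS R N B W τ : ℕ[X]) : ℕ[X] :=
  Polynomial.X + pS + 8 * B + W + mb + N + R + 2 * τ + (3 * mb * mb * R) * (2 * N) + 16 * (B ^ 2 + 1) * mb * B
    + 4 * (B ^ 2 + 1) * B + mb + 10

theorem parArray_le {m R N B W τ Λ : ℕ} (h : 2 * m + R + N + 8 * B + W + τ ≤ Λ) (j : ℤ) :
    parArray m R N B W τ j ≤ Λ := by
  simp only [parArray]
  split_ifs <;> omega

-- One polynomial Λ(n) serves as the exponent of the modulus, as a bound for all parameters and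
-- hence for the loop lengths, and, up to one, as the word length. The setup is estimated
-- separately; `clamped_coreProgram` covers the main part.
set_option maxHeartbeats 1000000 in
theorem exists_selection_program (mb pS R N B W τ : ℕ[X]) : ∃ (time : ℕ[X]) (post : Program),
    ∀ (n S L : ℕ) (ω : Run L (R.eval n) → Fin 2), 2 * L + 1 ≤ mb.eval n → S ≤ pS.eval n →
      (post.exec (inputStore n S ω)).2 ≤ time.eval n ∧
      post.run (inputStore n S ω) 3 0 = (4 * quadrantCount (B.eval n) : ℕ) ∧
      ∃ c κ, IsSelection (PassesTest (2 * L + 1) (R.eval n) (N.eval n) (B.eval n) (τ.eval n)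
          (symbol (2 * L + 1) (R.eval n) (bitSum (R.eval n) (inputStore n S ω 1))))
        (4 * quadrantCount (B.eval n)) (W.eval n) (8 * B.eval n) (post.run (inputStore n S ω)) c κ := by
  obtain ⟨eR, hR⟩ := exists_polynomial_expr R
  obtain ⟨eN, hN⟩ := exists_polynomial_expr N
  obtain ⟨eB, hB⟩ := exists_polynomial_expr B
  obtain ⟨eW, hW⟩ := exists_polynomial_expr W
  obtain ⟨eτ, hτ⟩ := exists_polynomial_expr τ
  obtain ⟨eΛ, hΛ⟩ := exists_polynomial_expr (lengthBound mb pS R N B W τ)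
  set em : IExpr := .get 0 (.const 2) + .const 1 with hem
  set es : List IExpr := [em, eR, eN, .const 2 * eB + em, .const 8 * eB, .const 2 * eB, eB, eW, eτ] with hes
  obtain ⟨C₁, h₁⟩ := storeParams_spec es 0
  obtain ⟨C₂, h₂⟩ := storeModulus_spec eΛ
  obtain ⟨C₃, D, h₃⟩ := clamped_coreProgram.exists_cost_bound
  -- With word length β = Λ + 1 the cost bounds contain (β + 1)² = (Λ + 2)², and the extra factor Λ
  -- + 1 beyond the power D covers the doublings of the modulus.
  refine ⟨Polynomial.C (C₁ + C₂ + C₃) * (lengthBound mb pS R N B W τ + 2) ^ 2 *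
    (lengthBound mb pS R N B W τ + 1) ^ (D + 1), .seq (.seq (storeParams es 0) (storeModulus eΛ)) coreProgram,
    fun n S L ω hm hS => ?_⟩
  set Λ := (lengthBound mb pS R N B W τ).eval n with hΛdef
  have hΛ' : Λ = n + pS.eval n + 8 * B.eval n + W.eval n + mb.eval n + N.eval n + R.eval n + 2 * τ.eval n
      + (3 * mb.eval n * mb.eval n * R.eval n) * (2 * N.eval n) + 16 * ((B.eval n) ^ 2 + 1) * mb.eval n * B.eval n
      + 4 * ((B.eval n) ^ 2 + 1) * B.eval n + mb.eval n + 10 := by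
    rw [hΛdef, lengthBound]; simp
  have hlt : ∀ x, x ≤ Λ → x < 2 ^ (Λ + 1) := fun x hx =>
    lt_of_lt_of_le (Nat.lt_two_pow_self) (Nat.pow_le_pow_right (by norm_num) (by omega))
  set s := inputStore n S ω with hs
  have hb0 : BitBound (Λ + 1) s := bitBound_inputStore ω (hlt _ (by omega)) (hlt _ (by omega)) (hlt _ (by omega))
    (hlt _ (by omega)) (by omega)
  set v : List ℕ := [2 * L + 1, R.eval n, N.eval n, 2 * B.eval n + (2 * L + 1), 8 * B.eval n, 2 * B.eval n, B.eval n,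
    W.eval n, τ.eval n] with hv
  have hvb : ∀ x ∈ v, bitLen x ≤ Λ + 1 := by
    intro x hx
    rw [bitLen_le_iff, abs_of_nonneg (by positivity)]
    have : x ≤ Λ := by
      simp only [hv, List.mem_cons, List.not_mem_nil, or_false] at hx
      omega
    exact_mod_cast hlt x this
  have h00 : s 0 0 = n := rfl
  have h02 : s 0 2 = ((2 * L : ℕ) : ℤ) := rfl
  have hev : ∀ t : Store, t 0 = s 0 → List.Forall₂ (fun (e : IExpr) (x : ℕ) => e.eval t = x) es v := by
    intro t ht
    have t00 : t 0 0 = n := by rw [ht]; exact h00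
    have t02 : t 0 2 = ((2 * L : ℕ) : ℤ) := by rw [ht]; exact h02
    simp [hes, hv, hem, hR t n t00, hN t n t00, hB t n t00, hW t n t00, hτ t n t00, t02]
  obtain ⟨p1, p2, p3, -, p5, p6⟩ := h₁ (Λ + 1) s v hb0 hvb hev
  set s1 := (storeParams es 0).run s
  obtain ⟨q1, q2, q3, q4⟩ := h₂ (Λ + 1) Λ s1 p2 le_rfl (fun t ht => hΛ t n (by rw [ht, p3 0 (by norm_num)]; exact h00))
  set s2 := (storeModulus eΛ).run s1
  have hs4 : s2 4 = parArray (2 * L + 1) (R.eval n) (N.eval n) (B.eval n) (W.eval n) (τ.eval n) := by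
    rw [q3 4 (by norm_num)]
    funext i
    by_cases hi : i < 0 ∨ (9 : ℤ) ≤ i
    · rw [p6 i (by simpa [hv] using hi)]
      have : s 4 i = 0 := rfl
      rw [this]
      simp only [parArray]
      repeat rw [if_neg (by omega)]
    · obtain ⟨k, rfl⟩ : ∃ k : ℕ, (k : ℤ) = i := ⟨i.toNat, by omega⟩
      have hk : k < 9 := by omega
      have := p5 k (by simpa [hv] using hk)
      rw [Nat.zero_add] at this
      rw [this]
      interval_cases k <;> simp [hv, parArray]
  have hs6 : s2 6 0 = ((2 ^ Λ : ℕ) : ℤ) := q4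
  have hpos : 0 < s2 6 0 := by rw [hs6]; positivity
  have hsa : ∀ a, a ≠ 4 → a ≠ 6 → s2 a = s a := fun a h4 h6 => (q3 a h6).trans (p3 a h4)
  have hpar : ∀ j, s2 4 j ≤ Λ := by
    intro j
    rw [hs4]
    exact parArray_le (by omega) j
  obtain ⟨r1, -, -, -⟩ := h₃ (Λ + 1) Λ s2 q2 hpos hpar
  have htest := test_bounds (m := 2 * L + 1) (R := R.eval n) (N := N.eval n) (B := B.eval n) (τ := τ.eval n) (Λ := Λ)
    (A := symbol (2 * L + 1) (R.eval n) (bitSum (R.eval n) (s 1)))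
    (fun d hd => gaussAbs_symbol_le ω hd) (by
      have e1 : 3 * (2 * L + 1) * (2 * L + 1) * R.eval n * (2 * N.eval n)
          ≤ 3 * mb.eval n * mb.eval n * R.eval n * (2 * N.eval n) := by gcongr
      have e2 : 16 * ((B.eval n) ^ 2 + 1) * (2 * L + 1) * B.eval n
          ≤ 16 * ((B.eval n) ^ 2 + 1) * mb.eval n * B.eval n := by gcongr
      omega)
  have hcore := run_coreProgram (s := s2) (P := 2 ^ Λ) hs4 hs6 (by omega)
    (lt_of_le_of_lt (by omega : _ ≤ Λ) Nat.lt_two_pow_self)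
    (fun a ha => by
      have : a ≠ 4 ∧ a ≠ 6 ∧ s a = 0 := by
        simp only [List.mem_cons, List.not_mem_nil, or_false] at ha
        refine ⟨by omega, by omega, ?_⟩
        funext i
        rw [hs, inputStore, if_neg (by omega), if_neg (by omega)]; rfl
      rw [hsa a this.1 this.2.1, this.2.2])
    htest.1 (by rw [hsa 1 (by norm_num) (by norm_num)]; exact htest.2.1) htest.2.2
  rw [hsa 1 (by norm_num) (by norm_num)] at hcore
  refine ⟨?_, hcore.1, hcore.2⟩
  change ((storeParams es 0).exec s).2 + ((storeModulus eΛ).exec s1).2 + (coreProgram.exec s2).2 ≤ _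
  have e1 : 1 ≤ Λ + 1 := by omega
  have e2 : 1 ≤ (Λ + 1) ^ D := Nat.one_le_pow _ _ e1
  simp only [Polynomial.eval_mul, Polynomial.eval_C, Polynomial.eval_pow, Polynomial.eval_add, Polynomial.eval_ofNat,
    Polynomial.eval_one, ← hΛdef, pow_succ (Λ + 1) D]
  rw [show Λ + 1 + 1 = Λ + 2 from rfl] at p1 q1 r1
  generalize (Λ + 2) ^ 2 = Y at *
  generalize (Λ + 1) ^ D = Z at *
  have e3 : C₁ * Y ≤ C₁ * Y * (Z * (Λ + 1)) := Nat.le_mul_of_pos_right _ (by positivity)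
  have e4 : C₂ * Y * (Λ + 1) ≤ C₂ * Y * (Z * (Λ + 1)) := Nat.mul_le_mul_left _ (Nat.le_mul_of_pos_left _ e2)
  have e5 : C₃ * Y * Z ≤ C₃ * Y * (Z * (Λ + 1)) := Nat.mul_le_mul_left _ (Nat.le_mul_of_pos_right _ e1)
  have e6 : (C₁ + C₂ + C₃) * Y * (Z * (Λ + 1))
    = C₁ * Y * (Z * (Λ + 1)) + C₂ * Y * (Z * (Λ + 1)) + C₃ * Y * (Z * (Λ + 1)) := by ring
  exact (Nat.add_le_add (Nat.add_le_add (p1.trans e3) (q1.trans e4)) (r1.trans e5)).trans_eq e6.symm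

end Prelude

/-! ### Powers of 1 - T/m and the distance from the range of the Vandermonde matrix -/

section Deflation

theorem l2n_sub_sq {ι : Type*} [Fintype ι] (x y : ι → ℂ) :
    l2n (x - y) ^ 2 = l2n x ^ 2 - 2 * (star x ⬝ᵥ y).re + l2n y ^ 2 := by
  rw [l2n_sq, l2n_sq, l2n_sq, dotProduct, Complex.re_sum, Finset.mul_sum, ← Finset.sum_sub_distrib,
    ← Finset.sum_add_distrib]
  refine Finset.sum_congr rfl fun i _ => ?_
  simp only [Pi.sub_apply, Pi.star_apply, ← Complex.normSq_eq_norm_sq, Complex.normSq_apply, Complex.sub_re,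
    Complex.sub_im, Complex.mul_re, RCLike.star_def, Complex.conj_re, Complex.conj_im]
  ring

theorem star_dotProduct_mulVec_eq {ι κ : Type*} [Fintype ι] [Fintype κ] (V : Matrix ι κ ℂ) (x : ι → ℂ) (y : κ → ℂ) :
    star x ⬝ᵥ (V *ᵥ y) = star (Vᴴ *ᵥ x) ⬝ᵥ y := by
  rw [Matrix.dotProduct_mulVec, Matrix.star_mulVec, Matrix.conjTranspose_conjTranspose]

variable {S m : ℕ} {p E : Fin S → ℝ}

/-- The matrix `1 - T / m`, where `T` is the Toeplitz matrix of the signal with weights `p` and energies `E`. -/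
noncomputable def deflation (m : ℕ) (p E : Fin S → ℝ) : Matrix (Fin m) (Fin m) ℂ :=
  1 - (m : ℂ)⁻¹ • (vandermonde m E * Matrix.diagonal (fun j => (p j : ℂ)) * (vandermonde m E)ᴴ)

theorem deflation_mulVec (x : Fin m → ℂ) :
    deflation m p E *ᵥ x
      = x - vandermonde m E *ᵥ ((m : ℂ)⁻¹ • fun j => (p j : ℂ) * ((vandermonde m E)ᴴ *ᵥ x) j) := by
  rw [deflation, Matrix.sub_mulVec, Matrix.one_mulVec, Matrix.smul_mulVec, Matrix.mulVec_smul, ← Matrix.mulVec_mulVec,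
    ← Matrix.mulVec_mulVec]
  congr 3
  ext j
  rw [Matrix.mulVec_diagonal]

theorem norm_vandermonde (a : Fin m) (j : Fin S) : ‖vandermonde m E a j‖ = 1 := by
  simp only [vandermonde, Matrix.of_apply, norm_pow, norm_exp_neg_I_mul, one_pow]

/-- The weights form a probability distribution and the entries of the Vandermonde matrix have
modulus 1, so each entry is estimated by Jensen's inequality. -/
theorem l2n_vandermonde_mulVec_sq_le (hp : ∀ j, 0 ≤ p j) (hsum : ∑ j, p j = 1) (c : Fin S → ℂ) :
    l2n (vandermonde m E *ᵥ fun j => (p j : ℂ) * c j) ^ 2 ≤ m * ∑ j, p j * ‖c j‖ ^ 2 := by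
  rw [l2n_sq]
  calc _ ≤ ∑ _a : Fin m, ∑ j, p j * ‖c j‖ ^ 2 := by
        refine Finset.sum_le_sum fun a _ => ?_
        have h1 : ‖(vandermonde m E *ᵥ fun j => (p j : ℂ) * c j) a‖ ≤ ∑ j, p j * ‖c j‖ := by
          rw [Matrix.mulVec, dotProduct]
          refine (norm_sum_le _ _).trans (Finset.sum_le_sum fun j _ => ?_)
          rw [norm_mul, norm_vandermonde, one_mul, norm_mul, Complex.norm_real, Real.norm_of_nonneg (hp j)]
        have h2 := Finset.sum_sq_le_sum_mul_sum_of_sq_le_mul Finset.univ (r := fun j => p j * ‖c j‖) (f := p)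
          (g := fun j => p j * ‖c j‖ ^ 2) (fun j _ => hp j) (fun j _ => mul_nonneg (hp j) (sq_nonneg _))
          (fun j _ => le_of_eq (by ring))
        rw [hsum, one_mul] at h2
        exact (pow_le_pow_left₀ (norm_nonneg _) h1 2).trans h2
    _ = _ := by simp

/-- ‖x - Tx/m‖² = ‖x‖² - 2⟨x, Tx⟩/m + ‖Tx‖²/m², and ‖Tx‖² ≤ m⟨x, Tx⟩ by
`l2n_vandermonde_mulVec_sq_le`, so half of the gain is kept. -/
theorem l2n_deflation_sq_le (hm : 0 < m) (hp : ∀ j, 0 ≤ p j) (hsum : ∑ j, p j = 1) (x : Fin m → ℂ) :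
    l2n (deflation m p E *ᵥ x) ^ 2
      ≤ l2n x ^ 2 - (∑ j, p j * ‖((vandermonde m E)ᴴ *ᵥ x) j‖ ^ 2) / m := by
  have hm' : (0 : ℝ) < m := by exact_mod_cast hm
  set c := (vandermonde m E)ᴴ *ᵥ x with hc
  rw [deflation_mulVec, l2n_sub_sq, ← hc, Matrix.mulVec_smul, l2n_smul, dotProduct_smul, star_dotProduct_mulVec_eq, ← hc]
  have h1 := l2n_vandermonde_mulVec_sq_le (m := m) (E := E) hp hsum c
  have h2 : ((m : ℂ)⁻¹ • (star c ⬝ᵥ fun j => (p j : ℂ) * c j)).re = (∑ j, p j * ‖c j‖ ^ 2) / m := by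
    have : (star c ⬝ᵥ fun j => (p j : ℂ) * c j) = ((∑ j, p j * ‖c j‖ ^ 2 : ℝ) : ℂ) := by
      rw [dotProduct]
      push_cast
      refine Finset.sum_congr rfl fun j _ => ?_
      rw [Pi.star_apply, RCLike.star_def, ← Complex.conj_mul']
      ring
    rw [this, smul_eq_mul, ← Complex.ofReal_natCast, ← Complex.ofReal_inv, ← Complex.ofReal_mul, Complex.ofReal_re]
    ring
  rw [h2, norm_inv, Complex.norm_natCast, mul_pow]
  have h3 : ((m : ℝ)⁻¹) ^ 2 * l2n (vandermonde m E *ᵥ fun j => (p j : ℂ) * c j) ^ 2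
      ≤ (∑ j, p j * ‖c j‖ ^ 2) / m := by
    calc _ ≤ ((m : ℝ)⁻¹) ^ 2 * (m * ∑ j, p j * ‖c j‖ ^ 2) := by gcongr
      _ = _ := by field_simp
  linarith

theorem opBound_deflation (hm : 0 < m) (hp : ∀ j, 0 ≤ p j) (hsum : ∑ j, p j = 1) :
    OpBound (deflation m p E) 1 := by
  intro x
  rw [one_mul]
  apply le_of_sq_le_sq _ (l2n_nonneg _)
  refine (l2n_deflation_sq_le hm hp hsum x).trans ?_
  have : 0 ≤ (∑ j, p j * ‖((vandermonde m E)ᴴ *ᵥ x) j‖ ^ 2) / m :=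
    div_nonneg (Finset.sum_nonneg fun j _ => mul_nonneg (hp j) (sq_nonneg _)) (by positivity)
  linarith

theorem opBound_deflation_pow (hm : 0 < m) (hp : ∀ j, 0 ≤ p j) (hsum : ∑ j, p j = 1) (N : ℕ) :
    OpBound (deflation m p E ^ N) 1 := by
  induction N with
  | zero => intro x; simp
  | succ N ih =>
    rw [pow_succ]
    have := ih.mul (opBound_deflation (E := E) hm hp hsum) zero_le_one
    rwa [one_mul] at this

theorem exists_deflation_vandermonde (u : Fin S → ℂ) (N : ℕ) :
    ∃ u', deflation m p E ^ N *ᵥ (vandermonde m E *ᵥ u) = vandermonde m E *ᵥ u' := by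
  induction N with
  | zero => exact ⟨u, by simp⟩
  | succ N ih =>
    obtain ⟨u', hu⟩ := ih
    rw [pow_succ', ← Matrix.mulVec_mulVec, hu, deflation_mulVec]
    exact ⟨_, (Matrix.mulVec_sub _ _ _).symm⟩

theorem deflation_pow_of_orthogonal {w : Fin m → ℂ} (hw : (vandermonde m E)ᴴ *ᵥ w = 0) (N : ℕ) :
    deflation m p E ^ N *ᵥ w = w := by
  induction N with
  | zero => simp
  | succ N ih =>
    rw [pow_succ', ← Matrix.mulVec_mulVec, ih, deflation_mulVec, hw]
    simp only [Pi.zero_apply, mul_zero]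
    have : ((m : ℂ)⁻¹ • fun _ : Fin S => (0 : ℂ)) = 0 := by ext; simp
    rw [this, Matrix.mulVec_zero, sub_zero]

/-- The range of V is invariant, and on it ‖V†x‖ ≥ ‖x‖, dual to Ingham's inequality. So each
application reduces the squared norm by the factor 1 - p₀/m. -/
theorem l2n_deflation_pow_vandermonde_sq_le (hm : 0 < m)
    (hsep : ∀ i j, i ≠ j → 1 / (m : ℝ) ≤ circDist (E i) (E j)) {p₀ : ℝ} (hp₀ : 0 ≤ p₀) (hp₁ : p₀ ≤ 1) (hp : ∀ j, p₀ ≤ p j)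
    (hsum : ∑ j, p j = 1) (u : Fin S → ℂ) (N : ℕ) :
    l2n (deflation m p E ^ N *ᵥ (vandermonde m E *ᵥ u)) ^ 2 ≤ (1 - p₀ / m) ^ N * l2n (vandermonde m E *ᵥ u) ^ 2 := by
  have hm' : (0 : ℝ) < m := by exact_mod_cast hm
  have hm1 : (1 : ℝ) ≤ m := by exact_mod_cast hm
  have hx : 0 ≤ 1 - p₀ / m := by
    have : p₀ / m ≤ 1 := by rw [div_le_one hm']; linarith
    linarith
  induction N with
  | zero => simp
  | succ N ih =>
    obtain ⟨u', hu⟩ := exists_deflation_vandermonde (m := m) (p := p) (E := E) u N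
    rw [pow_succ' (deflation m p E), ← Matrix.mulVec_mulVec]
    rw [hu] at ih ⊢
    set x := vandermonde m E *ᵥ u' with hxdef
    have h1 := l2n_deflation_sq_le (E := E) hm (fun j => hp₀.trans (hp j)) hsum x
    have h2 : l2n x ≤ l2n ((vandermonde m E)ᴴ *ᵥ x) := by
      rcases eq_or_ne (l2n x) 0 with h0 | h0
      · rw [h0]; exact l2n_nonneg _
      have h3 : ((l2n x ^ 2 : ℝ) : ℂ) = star ((vandermonde m E)ᴴ *ᵥ x) ⬝ᵥ u' := by
        rw [← dotProduct_star_self, ← star_dotProduct_mulVec_eq]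
      have h4 := norm_dotProduct_le (star ((vandermonde m E)ᴴ *ᵥ x)) u'
      rw [← h3, l2n_star, Complex.norm_real, Real.norm_of_nonneg (sq_nonneg _)] at h4
      have h5 := l2n_le_vandermonde hm hsep u'
      have h6 : 0 < l2n x := lt_of_le_of_ne (l2n_nonneg x) h0.symm
      have h7 : l2n x ^ 2 ≤ l2n ((vandermonde m E)ᴴ *ᵥ x) * l2n x :=
        h4.trans (mul_le_mul_of_nonneg_left h5 (l2n_nonneg _))
      nlinarith
    have h8 : p₀ * l2n x ^ 2 ≤ ∑ j, p j * ‖((vandermonde m E)ᴴ *ᵥ x) j‖ ^ 2 := by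
      calc p₀ * l2n x ^ 2 ≤ p₀ * l2n ((vandermonde m E)ᴴ *ᵥ x) ^ 2 :=
            mul_le_mul_of_nonneg_left (pow_le_pow_left₀ (l2n_nonneg _) h2 2) hp₀
        _ = ∑ j, p₀ * ‖((vandermonde m E)ᴴ *ᵥ x) j‖ ^ 2 := by rw [l2n_sq, Finset.mul_sum]
        _ ≤ _ := Finset.sum_le_sum fun j _ => mul_le_mul_of_nonneg_right (hp j) (sq_nonneg _)
    have h9 : p₀ / m * l2n x ^ 2 ≤ (∑ j, p j * ‖((vandermonde m E)ᴴ *ᵥ x) j‖ ^ 2) / m := by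
      rw [div_mul_eq_mul_div]; gcongr
    calc _ ≤ (1 - p₀ / m) * l2n x ^ 2 := by linarith
      _ ≤ (1 - p₀ / m) * ((1 - p₀ / m) ^ N * l2n (vandermonde m E *ᵥ u) ^ 2) := mul_le_mul_of_nonneg_left ih hx
      _ = _ := by ring

/-- The vector `(e^{-iaθ})_a`. -/
noncomputable def steering (m : ℕ) (θ : ℝ) : Fin m → ℂ := fun a => Complex.exp (-(Complex.I * θ)) ^ (a : ℕ)

theorem l2n_steering_sq (m : ℕ) (θ : ℝ) : l2n (steering m θ) ^ 2 = m := by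
  rw [l2n_sq]
  simp [steering, norm_exp_neg_I_mul]

theorem steering_eq_vandermonde (j : Fin S) : steering m (E j) = vandermonde m E *ᵥ Pi.single j 1 := by
  ext a; simp [steering, vandermonde]

theorem norm_sub_pow_le {z w : ℂ} (hz : ‖z‖ = 1) (hw : ‖w‖ = 1) (k : ℕ) : ‖z ^ k - w ^ k‖ ≤ k * ‖z - w‖ := by
  induction k with
  | zero => simp
  | succ k ih =>
    have : z ^ (k + 1) - w ^ (k + 1) = z * (z ^ k - w ^ k) + (z - w) * w ^ k := by ring
    rw [this]
    refine (norm_add_le _ _).trans ?_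
    rw [norm_mul, norm_mul, norm_pow, hz, hw, one_pow]
    push_cast; linarith

theorem l2n_steering_sub_le (m : ℕ) (θ φ : ℝ) : l2n (steering m θ - steering m φ) ≤ m ^ 2 * |θ - φ| := by
  have hz := norm_exp_neg_I_mul θ
  have hw := norm_exp_neg_I_mul φ
  have h0 : ‖Complex.exp (-(Complex.I * θ)) - Complex.exp (-(Complex.I * φ))‖ ≤ |θ - φ| := by
    have h1 := norm_exp_sub_exp_le θ φ
    have h2 := circDist_mul_two_pi_le θ φ 0
    simp only [Int.cast_zero, mul_zero, sub_zero] at h2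
    exact h1.trans h2
  apply le_of_sq_le_sq _ (by positivity)
  rw [l2n_sq]
  calc _ ≤ ∑ _a : Fin m, ((m : ℝ) * |θ - φ|) ^ 2 := by
        refine Finset.sum_le_sum fun a _ => pow_le_pow_left₀ (norm_nonneg _) ?_ 2
        refine (norm_sub_pow_le hz hw a).trans (mul_le_mul ?_ h0 (norm_nonneg _) (by positivity))
        exact_mod_cast a.isLt.le
    _ = m ^ 3 * |θ - φ| ^ 2 := by rw [Finset.sum_const, Finset.card_univ, Fintype.card_fin, nsmul_eq_mul]; ring
    _ ≤ (m ^ 2 * |θ - φ|) ^ 2 := by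
        rw [mul_pow, ← pow_mul]
        refine mul_le_mul_of_nonneg_right ?_ (by positivity)
        rcases Nat.eq_zero_or_pos m with rfl | h
        · simp
        · exact pow_le_pow_right₀ (by exact_mod_cast h) (by norm_num)

/-- The component orthogonal to the range of V is fixed, and what becomes of the other component
remains orthogonal to it. -/
theorem l2n_le_l2n_deflation_pow_add {w : Fin m → ℂ} (hw : (vandermonde m E)ᴴ *ᵥ w = 0) (u : Fin S → ℂ) (N : ℕ) :
    l2n w ≤ l2n (deflation m p E ^ N *ᵥ (vandermonde m E *ᵥ u + w)) := by
  obtain ⟨u', hu⟩ := exists_deflation_vandermonde (m := m) (p := p) (E := E) u N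
  rw [Matrix.mulVec_add, deflation_pow_of_orthogonal hw, hu]
  have h1 : star w ⬝ᵥ (vandermonde m E *ᵥ u' + w) = ((l2n w ^ 2 : ℝ) : ℂ) := by
    rw [dotProduct_add, star_dotProduct_mulVec_eq, hw, star_zero, zero_dotProduct, zero_add, dotProduct_star_self]
  have h2 := norm_dotProduct_le (star w) (vandermonde m E *ᵥ u' + w)
  rw [h1, l2n_star, Complex.norm_real, Real.norm_of_nonneg (sq_nonneg _)] at h2
  rcases eq_or_ne (l2n w) 0 with h0 | h0
  · rw [h0]; exact l2n_nonneg _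
  · have h6 : 0 < l2n w := lt_of_le_of_ne (l2n_nonneg w) h0.symm
    nlinarith

theorem exists_orthogonal_decomposition (hm : 0 < m) (hsep : ∀ i j, i ≠ j → 1 / (m : ℝ) ≤ circDist (E i) (E j))
    (v : Fin m → ℂ) : ∃ u w, v = vandermonde m E *ᵥ u + w ∧ (vandermonde m E)ᴴ *ᵥ w = 0 := by
  obtain ⟨G, hG, -, -⟩ := exists_inverse_of_lower_bound (G := (vandermonde m E)ᴴ * vandermonde m E) one_pos (fun x => by
    have h1 := l2n_le_vandermonde hm hsep x
    rw [one_mul]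
    have h3 : ((l2n (vandermonde m E *ᵥ x) ^ 2 : ℝ) : ℂ) = star (((vandermonde m E)ᴴ * vandermonde m E) *ᵥ x) ⬝ᵥ x := by
      rw [← dotProduct_star_self, ← Matrix.mulVec_mulVec, ← star_dotProduct_mulVec_eq]
    have h2 := norm_dotProduct_le (star (((vandermonde m E)ᴴ * vandermonde m E) *ᵥ x)) x
    rw [← h3, l2n_star, Complex.norm_real, Real.norm_of_nonneg (sq_nonneg _)] at h2
    rcases eq_or_ne (l2n x) 0 with h0 | h0
    · rw [h0]; exact l2n_nonneg _
    · have h6 : 0 < l2n x := lt_of_le_of_ne (l2n_nonneg x) h0.symm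
      nlinarith [l2n_nonneg (vandermonde m E *ᵥ x)])
  refine ⟨(G * (vandermonde m E)ᴴ) *ᵥ v, v - vandermonde m E *ᵥ ((G * (vandermonde m E)ᴴ) *ᵥ v), by abel, ?_⟩
  rw [Matrix.mulVec_sub, Matrix.mulVec_mulVec, Matrix.mulVec_mulVec, ← Matrix.mul_assoc, hG,
    Matrix.one_mul, sub_self]

/-- If v(θ) is close to the range of V, then θ is close to its nearest energy E i. With w the
difference, the filter w(k+1) - z_i w(k) removes the node z_i and leaves an exponential sum with
frequency θ in its place, whose coefficient at θ is z - z_i. Ingham's inequality with 2L samples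
bounds this coefficient; the filter costs the factor 2. -/
theorem norm_sub_le_two_mul_l2n {L : ℕ} (hL : 0 < L) {E : Fin S → ℝ} {θ : ℝ} {i : Fin S}
    (hsep : ∀ j k, j ≠ k → 1 / (L : ℝ) ≤ circDist (E j) (E k))
    (hi : ∀ j, circDist θ (E i) ≤ circDist θ (E j)) (u : Fin S → ℂ) :
    ‖Complex.exp (-(Complex.I * θ)) - Complex.exp (-(Complex.I * E i))‖
      ≤ 2 * l2n (steering (2 * L + 1) θ - vandermonde (2 * L + 1) E *ᵥ u) := by
  have hL' : (0 : ℝ) < L := by exact_mod_cast hL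
  set z := Complex.exp (-(Complex.I * θ)) with hz
  set zE : Fin S → ℂ := fun j => Complex.exp (-(Complex.I * E j)) with hzE
  set w := steering (2 * L + 1) θ - vandermonde (2 * L + 1) E *ᵥ u with hw
  set θ' : Fin S → ℝ := Function.update E i θ with hθ'
  -- The filter kills the term at i, so slot i is free for the frequency θ.
  set c : Fin S → ℂ := Function.update (fun j => -((zE j - zE i) * u j)) i (z - zE i) with hc
  -- As E i is nearest to θ, the distance from E j to E i is at most twice the distance from θ to E
  -- j. This halves the separation, and explains why 2L samples are used.
  have hnear : ∀ j, j ≠ i → 1 / ((2 * L : ℕ) : ℝ) ≤ circDist θ (E j) := by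
    intro j hj
    have h1 := hsep j i hj
    have h2 := circDist_triangle (E j) θ (E i)
    rw [circDist_comm (E j) θ] at h2
    have h3 := hi j
    have h4 : 1 / ((2 * L : ℕ) : ℝ) = 1 / (L : ℝ) / 2 := by push_cast; field_simp
    rw [h4]; linarith
  have hsep' : ∀ j k, j ≠ k → 1 / ((2 * L : ℕ) : ℝ) ≤ circDist (θ' j) (θ' k) := by
    intro j k hjk
    by_cases hj : j = i
    · subst hj
      rw [hθ', Function.update_self, Function.update_of_ne hjk.symm]
      exact hnear k hjk.symm
    · by_cases hk : k = i
      · subst hk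
        rw [hθ', Function.update_self, Function.update_of_ne hj, circDist_comm]
        exact hnear j hj
      · rw [hθ', Function.update_of_ne hj, Function.update_of_ne hk]
        refine le_trans ?_ (hsep j k hjk)
        apply one_div_le_one_div_of_le hL'
        push_cast; linarith
  have hsum := sum_sq_norm_le_exponential_sum (m := 2 * L) (by omega) θ' hsep' c
  have h1 : ‖z - zE i‖ ^ 2 ≤ ∑ j, ‖c j‖ ^ 2 := by
    have := Finset.single_le_sum (f := fun j => ‖c j‖ ^ 2) (fun j _ => sq_nonneg _) (Finset.mem_univ i)
    simpa [hc] using this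
  have hfilter : ∀ k : Fin (2 * L), ∑ j, c j * Complex.exp (-(Complex.I * θ' j)) ^ (k : ℕ)
      = w k.succ - zE i * w k.castSucc := by
    intro k
    have hwk : ∀ a : Fin (2 * L + 1), w a = z ^ (a : ℕ) - ∑ j, zE j ^ (a : ℕ) * u j := by
      intro a; rw [hw]; rfl
    rw [hwk, hwk, Fin.val_succ, Fin.val_castSucc, ← Finset.add_sum_erase _ _ (Finset.mem_univ i)]
    have e1 : ∑ j ∈ Finset.univ.erase i, c j * Complex.exp (-(Complex.I * θ' j)) ^ (k : ℕ)
        = ∑ j ∈ Finset.univ.erase i, -((zE j - zE i) * u j) * zE j ^ (k : ℕ) := by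
      refine Finset.sum_congr rfl fun j hj => ?_
      have hj' := Finset.ne_of_mem_erase hj
      rw [hc, hθ', Function.update_of_ne hj', Function.update_of_ne hj']
    have e2 : ∑ j, -((zE j - zE i) * u j) * zE j ^ (k : ℕ)
        = ∑ j ∈ Finset.univ.erase i, -((zE j - zE i) * u j) * zE j ^ (k : ℕ) := by
      rw [← Finset.add_sum_erase _ _ (Finset.mem_univ i)]; simp
    rw [e1, ← e2]
    simp only [hc, hθ', Function.update_self]
    have e3 : ∑ j, -((zE j - zE i) * u j) * zE j ^ (k : ℕ)
        = -(∑ j, zE j ^ ((k : ℕ) + 1) * u j) + zE i * ∑ j, zE j ^ (k : ℕ) * u j := by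
      rw [Finset.mul_sum, ← Finset.sum_neg_distrib, ← Finset.sum_add_distrib]
      exact Finset.sum_congr rfl fun j _ => by ring
    rw [e3]; ring
  have h2 : ∑ k ∈ Finset.range (2 * L), ‖∑ j, c j * Complex.exp (-(Complex.I * θ' j)) ^ k‖ ^ 2
      ≤ (2 * l2n w) ^ 2 := by
    rw [Finset.sum_range]
    simp only [hfilter]
    have hzi : ‖zE i‖ = 1 := norm_exp_neg_I_mul _
    have e1 : ∑ k : Fin (2 * L), ‖w k.succ‖ ^ 2 ≤ l2n w ^ 2 := by
      rw [l2n_sq, Fin.sum_univ_succ]; linarith [sq_nonneg ‖w 0‖]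
    have e2 : ∑ k : Fin (2 * L), ‖w k.castSucc‖ ^ 2 ≤ l2n w ^ 2 := by
      rw [l2n_sq, Fin.sum_univ_castSucc]; linarith [sq_nonneg ‖w (Fin.last _)‖]
    calc _ ≤ ∑ k : Fin (2 * L), (2 * ‖w k.succ‖ ^ 2 + 2 * ‖w k.castSucc‖ ^ 2) := by
          refine Finset.sum_le_sum fun k _ => ?_
          have := norm_sub_le (w k.succ) (zE i * w k.castSucc)
          rw [norm_mul, hzi, one_mul] at this
          nlinarith [norm_nonneg (w k.succ - zE i * w k.castSucc), sq_nonneg (‖w k.succ‖ - ‖w k.castSucc‖)]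
      _ = 2 * ∑ k : Fin (2 * L), ‖w k.succ‖ ^ 2 + 2 * ∑ k : Fin (2 * L), ‖w k.castSucc‖ ^ 2 := by
          rw [Finset.sum_add_distrib, Finset.mul_sum, Finset.mul_sum]
      _ ≤ _ := by rw [mul_pow]; linarith
  exact le_of_sq_le_sq (h1.trans (hsum.trans h2)) (mul_nonneg two_pos.le (l2n_nonneg _))

/-- The deviation satisfies d(N+1) ≤ (1 + ε) d(N) + ε‖x‖ since powers of A are contractions. While
2Nε ≤ 1 the deviation is at most ‖x‖, so each step adds no more than 2ε‖x‖. -/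
theorem pow_mulVec_sub_le {A A' : Matrix (Fin m) (Fin m) ℂ} {ε : ℝ} (hε : 0 ≤ ε) (hA' : OpBound (A' - A) ε)
    (hA : ∀ N, OpBound (A ^ N) 1) {N : ℕ} (hN : 2 * N * ε ≤ 1) (x : Fin m → ℂ) :
    l2n (A' ^ N *ᵥ x - A ^ N *ᵥ x) ≤ 2 * N * ε * l2n x := by
  induction N with
  | zero => simp
  | succ N ih =>
    have hN' : 2 * (N : ℝ) * ε ≤ 1 := by push_cast at hN; linarith
    have ih := ih hN'
    set d := A' ^ N *ᵥ x - A ^ N *ᵥ x with hd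
    have e1 : A' ^ (N + 1) *ᵥ x - A ^ (N + 1) *ᵥ x = A *ᵥ d + (A' - A) *ᵥ d + (A' - A) *ᵥ (A ^ N *ᵥ x) := by
      rw [pow_succ', pow_succ', ← Matrix.mulVec_mulVec, ← Matrix.mulVec_mulVec, hd, Matrix.mulVec_sub, Matrix.sub_mulVec,
        Matrix.sub_mulVec, Matrix.mulVec_sub, Matrix.mulVec_sub]
      abel
    have e2 : l2n (A *ᵥ d) ≤ l2n d := by have := hA 1 d; rwa [pow_one, one_mul] at this
    have e3 := hA' d
    have e4 := hA' (A ^ N *ᵥ x)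
    have e5 := hA N x
    have e6 : ε * l2n (A ^ N *ᵥ x) ≤ ε * l2n x := mul_le_mul_of_nonneg_left (by linarith) hε
    have e7 : ε * l2n d ≤ ε * l2n x := by
      refine mul_le_mul_of_nonneg_left (ih.trans ?_) hε
      have := mul_le_mul_of_nonneg_right hN' (l2n_nonneg x); linarith
    rw [e1]
    calc _ ≤ l2n d + ε * l2n d + ε * l2n (A ^ N *ᵥ x) :=
          (l2n_add_le _ _).trans (add_le_add ((l2n_add_le _ _).trans (add_le_add e2 e3)) e4)
      _ ≤ _ := by push_cast; linarith

end Deflation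

/-! ### Soundness and completeness of the test -/

section Criterion

variable {S L N : ℕ} {p E : Fin S → ℝ} {τ ε p₀ : ℝ} {A' : Matrix (Fin (2 * L + 1)) (Fin (2 * L + 1)) ℂ}

theorem l2n_steering_le (m : ℕ) (θ : ℝ) : l2n (steering m θ) ≤ m := by
  apply le_of_sq_le_sq _ (by positivity)
  rw [l2n_steering_sq]
  rcases Nat.eq_zero_or_pos m with rfl | h
  · simp
  · exact le_self_pow₀ (by exact_mod_cast h) (by norm_num)

/-- Bernoulli's inequality for (1 + x)^N together with (1 - x)(1 + x) ≤ 1. The decay 1/(1 + Nx) that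
it yields is enough for a polynomial N. -/
theorem one_sub_pow_mul_le {x : ℝ} (h0 : 0 ≤ x) (h1 : x ≤ 1) (N : ℕ) : (1 - x) ^ N * (1 + N * x) ≤ 1 := by
  have h2 := one_add_mul_le_pow (show (-2 : ℝ) ≤ x by linarith) N
  calc (1 - x) ^ N * (1 + N * x) ≤ (1 - x) ^ N * (1 + x) ^ N :=
        mul_le_mul_of_nonneg_left h2 (pow_nonneg (by linarith) N)
    _ = ((1 - x) * (1 + x)) ^ N := (mul_pow _ _ _).symm
    _ ≤ 1 := pow_le_one₀ (mul_nonneg (by linarith) (by linarith)) (by nlinarith)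

theorem l2n_pow_mulVec_steering_sub_le (hp : ∀ j, 0 ≤ p j) (hsum : ∑ j, p j = 1) (hε : 0 ≤ ε) (hτ : 1 ≤ τ)
    (hA' : OpBound (A' - deflation (2 * L + 1) p E) ε) (hNε : 2 * N * ε * (2 * L + 1) * τ ≤ 1) (θ : ℝ) :
    l2n (A' ^ N *ᵥ steering (2 * L + 1) θ - deflation (2 * L + 1) p E ^ N *ᵥ steering (2 * L + 1) θ) ≤ 1 / τ := by
  have h0 : 0 ≤ 2 * N * ε := by positivity
  have h1 : (1 : ℝ) ≤ (2 * L + 1) * τ := by nlinarith [Nat.cast_nonneg (α := ℝ) L]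
  have hN : 2 * N * ε ≤ 1 := by
    calc 2 * N * ε ≤ 2 * N * ε * ((2 * L + 1) * τ) := le_mul_of_one_le_right h0 h1
      _ ≤ 1 := by linarith
  refine (pow_mulVec_sub_le hε hA' (opBound_deflation_pow (by omega) hp hsum) hN _).trans ?_
  rw [le_div_iff₀ (by linarith)]
  have h2 := l2n_steering_le (2 * L + 1) θ
  push_cast at h2
  calc _ ≤ 2 * N * ε * (2 * L + 1) * τ := by gcongr
    _ ≤ 1 := hNε

/-- Passing the test bounds the component orthogonal to the range of V by 5/τ: 4/τ from the test and
1/τ from the noise. The filter argument doubles it, and the passage from chord to circle distance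
divides by 4. -/
theorem exists_circDist_le_of_lt (hL : 0 < L) (hS : 0 < S) (hsep : ∀ i j, i ≠ j → 1 / (L : ℝ) ≤ circDist (E i) (E j))
    (hp : ∀ j, 0 ≤ p j) (hsum : ∑ j, p j = 1) (hε : 0 ≤ ε) (hτ : 1 ≤ τ)
    (hA' : OpBound (A' - deflation (2 * L + 1) p E) ε) (hNε : 2 * N * ε * (2 * L + 1) * τ ≤ 1) {θ : ℝ}
    (h : τ * l2n (A' ^ N *ᵥ steering (2 * L + 1) θ) < 4) : ∃ i, circDist θ (E i) ≤ 5 / (2 * τ) := by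
  have hL' : (0 : ℝ) < L := by exact_mod_cast hL
  haveI : Nonempty (Fin S) := ⟨⟨0, hS⟩⟩
  obtain ⟨i, hi⟩ := Finite.exists_min fun j => circDist θ (E j)
  refine ⟨i, ?_⟩
  have hsep' : ∀ i j, i ≠ j → 1 / ((2 * L + 1 : ℕ) : ℝ) ≤ circDist (E i) (E j) := fun i j hij => by
    refine le_trans ?_ (hsep i j hij)
    apply one_div_le_one_div_of_le hL'
    push_cast; linarith
  obtain ⟨u, w, hv, hw⟩ := exists_orthogonal_decomposition (by omega) hsep' (steering (2 * L + 1) θ)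
  have h1 := l2n_le_l2n_deflation_pow_add (p := p) hw u N
  rw [← hv] at h1
  have h2 := norm_sub_le_two_mul_l2n hL hsep hi u
  rw [hv, add_sub_cancel_left] at h2
  have h3 := l2n_pow_mulVec_steering_sub_le hp hsum hε hτ hA' hNε θ
  have h4 := l2n_le_add_sub (deflation (2 * L + 1) p E ^ N *ᵥ steering (2 * L + 1) θ) (A' ^ N *ᵥ steering (2 * L + 1) θ)
  rw [l2n_sub_comm] at h4
  have h5 := four_mul_circDist_le θ (E i)
  have h6 : l2n (A' ^ N *ᵥ steering (2 * L + 1) θ) < 4 / τ := by rw [lt_div_iff₀ (by linarith)]; linarith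
  have h7 : 5 / (2 * τ) = (4 / τ + 1 / τ) / 2 := by ring
  rw [h7]; linarith

/-- Three errors of size 1/τ each: the noise in the matrix, moving θ to the energy, and the
remainder after N contractions. The gap between 3 and 4 makes the strict test pass. -/
theorem lt_four_of_abs_sub_le (hL : 0 < L) (hsep : ∀ i j, i ≠ j → 1 / (L : ℝ) ≤ circDist (E i) (E j))
    (hp₀ : 0 < p₀) (hp : ∀ j, p₀ ≤ p j) (hsum : ∑ j, p j = 1) (hε : 0 ≤ ε) (hτ : 1 ≤ τ)
    (hA' : OpBound (A' - deflation (2 * L + 1) p E) ε) (hNε : 2 * N * ε * (2 * L + 1) * τ ≤ 1)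
    (hN : (2 * L + 1) ^ 2 * τ ^ 2 ≤ N * p₀) {θ : ℝ} {j : Fin S} (hj : (2 * L + 1) ^ 2 * |θ - E j| * τ ≤ 1) :
    τ * l2n (A' ^ N *ᵥ steering (2 * L + 1) θ) < 4 := by
  have hL' : (0 : ℝ) < L := by exact_mod_cast hL
  have hτ0 : 0 < τ := by linarith
  have hpp : ∀ j, 0 ≤ p j := fun j => hp₀.le.trans (hp j)
  have hp₁ : p₀ ≤ 1 := by
    rw [← hsum]
    exact (hp j).trans (Finset.single_le_sum (fun i _ => hpp i) (Finset.mem_univ j))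
  have hsep' : ∀ i j, i ≠ j → 1 / ((2 * L + 1 : ℕ) : ℝ) ≤ circDist (E i) (E j) := fun i j hij => by
    refine le_trans ?_ (hsep i j hij)
    apply one_div_le_one_div_of_le hL'
    push_cast; linarith
  set A := deflation (2 * L + 1) p E
  have h1 := l2n_pow_mulVec_steering_sub_le hpp hsum hε hτ hA' hNε θ
  have h2 : l2n (A ^ N *ᵥ steering (2 * L + 1) θ - A ^ N *ᵥ steering (2 * L + 1) (E j)) ≤ 1 / τ := by
    rw [← Matrix.mulVec_sub]
    have e1 := opBound_deflation_pow (E := E) (show 0 < 2 * L + 1 by omega) hpp hsum N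
      (steering (2 * L + 1) θ - steering (2 * L + 1) (E j))
    rw [one_mul] at e1
    refine e1.trans ((l2n_steering_sub_le _ _ _).trans ?_)
    rw [le_div_iff₀ hτ0]
    push_cast; exact hj
  have h3 : l2n (A ^ N *ᵥ steering (2 * L + 1) (E j)) ≤ 1 / τ := by
    apply le_of_sq_le_sq _ (by positivity)
    have e1 := l2n_deflation_pow_vandermonde_sq_le (p := p) (show 0 < 2 * L + 1 by omega) hsep' hp₀.le hp₁ hp hsum
      (Pi.single j 1) N
    rw [← steering_eq_vandermonde, l2n_steering_sq] at e1
    refine e1.trans ?_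
    push_cast
    have hm1 : (1 : ℝ) ≤ 2 * L + 1 := by linarith
    have hx0 : 0 ≤ p₀ / (2 * L + 1) := by positivity
    have hx1 : p₀ / (2 * L + 1) ≤ 1 := by rw [div_le_one (by linarith)]; linarith
    have e2 := one_sub_pow_mul_le hx0 hx1 N
    -- The squared length of v(θ) is 2L + 1, so the contraction has to gain the factor (2L + 1)τ².
    have e3 : (2 * L + 1) * τ ^ 2 ≤ 1 + N * (p₀ / (2 * L + 1)) := by
      have : (2 * L + 1) * τ ^ 2 ≤ N * (p₀ / (2 * L + 1)) := by
        rw [← mul_div_assoc, le_div_iff₀ (by linarith)]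
        linarith
      linarith
    rw [one_div, inv_pow, ← one_div, le_div_iff₀ (by positivity)]
    calc (1 - p₀ / (2 * L + 1)) ^ N * (2 * L + 1) * τ ^ 2 = (1 - p₀ / (2 * L + 1)) ^ N * ((2 * L + 1) * τ ^ 2) := by ring
      _ ≤ (1 - p₀ / (2 * L + 1)) ^ N * (1 + N * (p₀ / (2 * L + 1))) :=
          mul_le_mul_of_nonneg_left e3 (pow_nonneg (by linarith) N)
      _ ≤ 1 := e2
  have h4 := l2n_le_add_sub (A' ^ N *ᵥ steering (2 * L + 1) θ) (A ^ N *ᵥ steering (2 * L + 1) θ)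
  have h5 := l2n_le_add_sub (A ^ N *ᵥ steering (2 * L + 1) θ) (A ^ N *ᵥ steering (2 * L + 1) (E j))
  have h6 : l2n (A' ^ N *ᵥ steering (2 * L + 1) θ) ≤ 3 * (1 / τ) := by linarith
  calc _ ≤ τ * (3 * (1 / τ)) := mul_le_mul_of_nonneg_left h6 hτ0.le
    _ = 3 := by field_simp
    _ < 4 := by norm_num

end Criterion

/-! ### The test in exact integer arithmetic -/

section IntegerTest

/-- The Toeplitz matrix of a symbol with values in the Gaussian integers. -/
noncomputable def toeplitzMatrix (m : ℕ) (A : ℤ → GaussianInt) : Matrix (Fin m) (Fin m) ℂ :=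
  Matrix.of fun a b => GaussianInt.toComplex (A ((a : ℤ) - (b : ℤ)))

theorem toComplex_toeplitzIter (m : ℕ) (A : ℤ → GaussianInt) (x : ℕ → GaussianInt) (t : ℕ) :
    (fun a : Fin m => GaussianInt.toComplex (toeplitzIter m A x t a))
      = toeplitzMatrix m A ^ t *ᵥ fun a : Fin m => GaussianInt.toComplex (x a) := by
  induction t with
  | zero => ext a; simp [toeplitzIter]
  | succ t ih =>
    rw [pow_succ', ← Matrix.mulVec_mulVec, ← ih]
    ext a
    rw [toeplitzIter, map_sum, Finset.sum_range]
    simp [Matrix.mulVec, dotProduct, toeplitzMatrix]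

theorem gaussNormSq_eq (m : ℕ) (x : ℕ → GaussianInt) :
    (gaussNormSq m x : ℝ) = l2n (fun a : Fin m => GaussianInt.toComplex (x a)) ^ 2 := by
  rw [l2n_sq, gaussNormSq, Finset.sum_range]
  push_cast
  refine Finset.sum_congr rfl fun a _ => ?_
  rw [← Complex.normSq_eq_norm_sq, Complex.normSq_apply, GaussianInt.toComplex_def]
  simp
  ring

/-- The angle between neighbouring points of the grid. -/
noncomputable def gridAngle (B : ℕ) : ℝ := 2 * Real.arctan (1 / B)

/-- The numerator is (B - i)², with modulus B² + 1 and argument -2 arctan(1/B). So one step of the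
grid is a rotation with rational entries. -/
theorem toComplex_gridStep {B : ℕ} (hB : 0 < B) :
    GaussianInt.toComplex (gridStep B) = (gridDenom B : ℂ) * Complex.exp (-(Complex.I * gridAngle B)) := by
  have hB' : (0 : ℝ) < B := by exact_mod_cast hB
  have hc : Real.cos (gridAngle B) * ((B : ℝ) ^ 2 + 1) = (B : ℝ) ^ 2 - 1 := by
    rw [gridAngle, Real.cos_two_mul, Real.cos_sq_arctan]
    field_simp; ring
  have hs : Real.sin (gridAngle B) * ((B : ℝ) ^ 2 + 1) = 2 * B := by
    have h1 : Real.sin (Real.arctan (1 / B)) = 1 / B * Real.cos (Real.arctan (1 / B)) := by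
      have := Real.tan_arctan (1 / (B : ℝ))
      rw [Real.tan_eq_sin_div_cos] at this
      have hcos := (Real.cos_arctan_pos (1 / (B : ℝ))).ne'
      field_simp at this ⊢
      linarith
    rw [gridAngle, Real.sin_two_mul, h1]
    rw [show 2 * (1 / (B : ℝ) * Real.cos (Real.arctan (1 / B))) * Real.cos (Real.arctan (1 / B))
      = 2 / B * Real.cos (Real.arctan (1 / B)) ^ 2 by ring, Real.cos_sq_arctan]
    field_simp
  have hcC := congrArg Complex.ofReal hc
  have hsC := congrArg Complex.ofReal hs
  push_cast at hcC hsC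
  rw [show -(Complex.I * (gridAngle B : ℂ)) = (-gridAngle B : ℂ) * Complex.I by ring, Complex.exp_mul_I,
    Complex.cos_neg, Complex.sin_neg, GaussianInt.toComplex_def, gridStep, gridDenom]
  push_cast
  linear_combination -hcC + Complex.I * hsC

theorem toComplex_gridVector {m B k : ℕ} (hB : 0 < B) (a : Fin m) :
    GaussianInt.toComplex (gridVector m B k a)
      = ((gridDenom B : ℂ) ^ ((m - 1) * k)) * steering m (k * gridAngle B) a := by
  have h1 : Complex.exp (-(Complex.I * ((k * gridAngle B : ℝ) : ℂ))) = Complex.exp (-(Complex.I * gridAngle B)) ^ k := by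
    rw [← Complex.exp_nat_mul]; congr 1; push_cast; ring
  have h2 : (gridDenom B : ℂ) ^ (m - 1) = (gridDenom B : ℂ) ^ (a : ℕ) * (gridDenom B : ℂ) ^ (m - 1 - a) := by
    rw [← pow_add]; congr 1; omega
  rw [gridVector, map_pow, map_mul, map_pow, map_pow, toComplex_gridStep hB, map_intCast, steering, h1, pow_mul, h2]
  ring

/-- Both sides are squared and multiplied by the square of the common denominator c of matrix powers
and grid vector, which makes them integers. -/
theorem passesTest_iff {m R N B τ : ℕ} {A : ℤ → GaussianInt} {k : ℕ} (hm : 0 < m) (hR : 0 < R) (hB : 0 < B) :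
    PassesTest m R N B τ A k ↔
      (τ : ℝ) * l2n (((m * R : ℂ)⁻¹ • toeplitzMatrix m A) ^ N *ᵥ steering m (k * gridAngle B)) < 4 := by
  have hm' : (0 : ℝ) < m := by exact_mod_cast hm
  have hR' : (0 : ℝ) < R := by exact_mod_cast hR
  have hmc : (m : ℂ) ≠ 0 := by exact_mod_cast hm.ne'
  have hRc : (R : ℂ) ≠ 0 := by exact_mod_cast hR.ne'
  have hD : (0 : ℝ) < gridDenom B := by exact_mod_cast gridDenom_pos B
  set A' := (m * R : ℂ)⁻¹ • toeplitzMatrix m A with hA'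
  have hM : toeplitzMatrix m A = (m * R : ℂ) • A' := by
    rw [hA', smul_smul, mul_inv_cancel₀ (mul_ne_zero hmc hRc), one_smul]
  set l := l2n (A' ^ N *ᵥ steering m (k * gridAngle B)) with hl
  have hvec : (fun a : Fin m => GaussianInt.toComplex (gridVector m B k a))
      = ((gridDenom B : ℂ) ^ ((m - 1) * k)) • steering m (k * gridAngle B) := by
    ext a; rw [toComplex_gridVector hB]; rfl
  have hnorm : (gaussNormSq m (toeplitzIter m A (gridVector m B k) N) : ℝ)
      = ((m * R : ℝ) ^ N * (gridDenom B : ℝ) ^ ((m - 1) * k)) ^ 2 * l ^ 2 := by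
    rw [gaussNormSq_eq, toComplex_toeplitzIter, hvec, hM, smul_pow, Matrix.smul_mulVec, Matrix.mulVec_smul, l2n_smul,
      l2n_smul, ← hl, norm_pow, norm_pow, norm_mul, Complex.norm_natCast, Complex.norm_natCast, Complex.norm_intCast,
      abs_of_pos hD]
    ring
  have hc : 0 < (m * R : ℝ) ^ N * (gridDenom B : ℝ) ^ ((m - 1) * k) := by positivity
  set c := (m * R : ℝ) ^ N * (gridDenom B : ℝ) ^ ((m - 1) * k) with hcdef
  have hcast : PassesTest m R N B τ A k ↔ (τ * τ : ℝ) * (c ^ 2 * l ^ 2) < 16 * c ^ 2 := by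
    rw [← hnorm, PassesTest, ← Int.cast_lt (R := ℝ)]
    push_cast
    rw [show 16 * c ^ 2 = 16 * ((m : ℝ) * R * (m * R)) ^ N * ((gridDenom B : ℝ) ^ (m - 1) * (gridDenom B : ℝ) ^ (m - 1)) ^ k by
      rw [hcdef, pow_mul]; ring]
  have hl0 : 0 ≤ l := l2n_nonneg _
  have hτ0 : (0 : ℝ) ≤ τ := Nat.cast_nonneg _
  rw [hcast, show (τ * τ : ℝ) * (c ^ 2 * l ^ 2) = (τ * l) ^ 2 * c ^ 2 by ring, mul_lt_mul_iff_left₀ (by positivity),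
    show (16 : ℝ) = 4 ^ 2 by norm_num]
  exact pow_lt_pow_iff_left₀ (by positivity) (by norm_num) (by norm_num)

theorem toComplex_symbol {n S L R : ℕ} (hR : 0 < R) (ω : Run L R → Fin 2) (d : ℤ) (hd : d.natAbs < 2 * L + 1) :
    GaussianInt.toComplex (symbol (2 * L + 1) R (bitSum R (inputStore n S ω 1)) d)
      = (((2 * L + 1 : ℕ) : ℂ) * R) * (if d = 0 then 1 else 0)
        - R * (if 0 ≤ d then estSignal ω ⟨d.natAbs, hd⟩ else star (estSignal ω ⟨d.natAbs, hd⟩)) := by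
  have h0 := congrArg Complex.ofReal (bitSum_eq_zeroFreq (n := n) (S := S) hR ω 0 ⟨d.natAbs, hd⟩)
  have h1 := congrArg Complex.ofReal (bitSum_eq_zeroFreq (n := n) (S := S) hR ω 1 ⟨d.natAbs, hd⟩)
  have hz : ((0 : Fin 2) : ℕ) = 0 := rfl
  have ho : ((1 : Fin 2) : ℕ) = 1 := rfl
  rw [hz] at h0
  rw [ho] at h1
  simp only at h0 h1
  push_cast at h0 h1
  rw [GaussianInt.toComplex_def, symbol]
  simp only [estSignal, star_sub, star_mul, RCLike.star_def, Complex.conj_I, Complex.conj_ofReal]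
  by_cases hd0 : d = 0
  · have hd1 : 0 ≤ d := hd0.ge
    simp only [if_pos hd0, if_pos hd1]
    push_cast
    linear_combination -h0 + Complex.I * h1
  · by_cases hd1 : 0 ≤ d
    · simp only [if_neg hd0, if_pos hd1]
      push_cast
      linear_combination -h0 + Complex.I * h1
    · simp only [if_neg hd0, if_neg hd1]
      push_cast
      linear_combination -h0 - Complex.I * h1

theorem deflation_apply {S m : ℕ} (p E : Fin S → ℝ) (a b : Fin m) :
    deflation m p E a b = (if a = b then 1 else 0) - (m : ℂ)⁻¹ *
      (if b ≤ a then expSignal p E ((a : ℕ) - b) else star (expSignal p E ((b : ℕ) - a))) := by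
  have hunit : ∀ j, Complex.exp (-(Complex.I * E j)) * star (Complex.exp (-(Complex.I * E j))) = 1 := by
    intro j
    rw [RCLike.star_def, Complex.mul_conj', norm_exp_neg_I_mul]; simp
  have hunit' : ∀ j (k : ℕ), Complex.exp (-(Complex.I * E j)) ^ k * star (Complex.exp (-(Complex.I * E j))) ^ k = 1 := by
    intro j k; rw [← mul_pow, hunit, one_pow]
  rw [deflation, Matrix.sub_apply, Matrix.one_apply, Matrix.smul_apply, smul_eq_mul, Matrix.mul_apply]
  congr 2
  have hentry : ∀ j, (vandermonde m E * Matrix.diagonal fun j => (p j : ℂ)) a j * (vandermonde m E)ᴴ j b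
      = p j * (Complex.exp (-(Complex.I * E j)) ^ (a : ℕ) * star (Complex.exp (-(Complex.I * E j))) ^ (b : ℕ)) := by
    intro j
    rw [Matrix.mul_diagonal, Matrix.conjTranspose_apply]
    simp only [vandermonde, Matrix.of_apply, star_pow]
    ring
  simp_rw [hentry]
  split_ifs with h
  · rw [expSignal]
    refine Finset.sum_congr rfl fun j _ => ?_
    have hab : (a : ℕ) = (a - b : ℕ) + b := by have : (b : ℕ) ≤ a := h; omega
    conv_lhs => rw [hab, pow_add, mul_assoc, hunit', mul_one]
  · rw [expSignal, star_sum]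
    refine Finset.sum_congr rfl fun j _ => ?_
    have hab : (b : ℕ) = a + (b - a : ℕ) := by have : (a : ℕ) < b := not_le.mp h; omega
    conv_lhs => rw [hab, pow_add, ← mul_assoc (Complex.exp _ ^ (a : ℕ)), hunit', one_mul]
    rw [star_mul, star_pow, RCLike.star_def, Complex.conj_ofReal]; ring

/-- The entries differ by the error of the signal divided by m, and the Frobenius bound for an m by
m matrix restores exactly the factor m. -/
theorem opBound_toeplitzMatrix_sub_deflation {n S L R : ℕ} {p E : Fin S → ℝ} {ε : ℝ} (hR : 0 < R) (hε : 0 ≤ ε)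
    (ω : Run L R → Fin 2) (hω : ∀ k, ‖estSignal ω k - expSignal p E k‖ ≤ ε) :
    OpBound ((((2 * L + 1 : ℕ) : ℂ) * R)⁻¹ •
        toeplitzMatrix (2 * L + 1) (symbol (2 * L + 1) R (bitSum R (inputStore n S ω 1)))
      - deflation (2 * L + 1) p E) ε := by
  have hRc : (R : ℂ) ≠ 0 := by exact_mod_cast hR.ne'
  set m := 2 * L + 1 with hm
  have hm0 : 0 < m := by omega
  have hmc : (m : ℂ) ≠ 0 := by exact_mod_cast hm0.ne'
  have hm' : (0 : ℝ) < m := by exact_mod_cast hm0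
  have hmain : OpBound (((m : ℂ) * R)⁻¹ • toeplitzMatrix m (symbol m R (bitSum R (inputStore n S ω 1)))
      - deflation m p E) (m * (ε / m)) := by
    refine opBound_of_entries (by positivity) (fun a b => ?_) (by positivity) (by simp [pow_two])
    have hd : ((a : ℤ) - (b : ℤ)).natAbs < m := by omega
    rw [Matrix.sub_apply, Matrix.smul_apply, deflation_apply, toeplitzMatrix, Matrix.of_apply, toComplex_symbol hR ω _ hd,
      smul_eq_mul]
    have hab : ((a : ℤ) - (b : ℤ) = 0) ↔ a = b := by rw [Fin.ext_iff]; omega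
    have hle : (0 ≤ (a : ℤ) - (b : ℤ)) ↔ b ≤ a := by rw [Fin.le_iff_val_le_val]; omega
    simp only [hab, hle]
    have hdist : ∀ x y u : ℂ, ((m : ℂ) * R)⁻¹ * (m * R * u - R * x) - (u - (m : ℂ)⁻¹ * y) = -((m : ℂ)⁻¹ * (x - y)) := by
      intro x y u; field_simp; ring
    rw [hdist, norm_neg, norm_mul, norm_inv, Complex.norm_natCast, div_eq_inv_mul]
    refine mul_le_mul_of_nonneg_left ?_ (by positivity)
    have hk := hω ⟨((a : ℤ) - (b : ℤ)).natAbs, hd⟩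
    split_ifs with h
    · have : ((a : ℤ) - (b : ℤ)).natAbs = (a : ℕ) - b := by have : (b : ℕ) ≤ a := h; omega
      simp only [this] at hk ⊢; exact hk
    · have : ((a : ℤ) - (b : ℤ)).natAbs = (b : ℕ) - a := by have : (a : ℕ) < b := not_le.mp h; omega
      simp only [this] at hk ⊢
      rw [← star_sub, norm_star]; exact hk
  rwa [mul_div_cancel₀ _ hm'.ne'] at hmain

end IntegerTest

/-! ### Grid points on the circle and the selected energies -/

section Grid

theorem circDist_ge {a b δ : ℝ} (h1 : δ ≤ a - b) (h2 : a - b ≤ 2 * π - δ) : δ ≤ circDist a b * (2 * π) := by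
  obtain ⟨n, hn⟩ := exists_circDist_eq a b
  have hpi := Real.pi_pos
  rw [hn]
  rcases le_or_gt n 0 with h | h
  · have : (n : ℝ) ≤ 0 := by exact_mod_cast h
    refine le_trans ?_ (le_abs_self _)
    nlinarith
  · have : (1 : ℝ) ≤ n := by exact_mod_cast h
    refine le_trans ?_ (neg_le_abs _)
    nlinarith

theorem gridAngle_pos {B : ℕ} (hB : 0 < B) : 0 < gridAngle B := by
  have hB' : (0 : ℝ) < B := by exact_mod_cast hB
  have : 0 < Real.arctan (1 / B) := Real.arctan_pos.mpr (by positivity)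
  unfold gridAngle; linarith

theorem gridAngle_le (B : ℕ) : gridAngle B ≤ 2 / B := by
  have : Real.arctan (1 / B) ≤ 1 / B := by
    have := Real.le_tan (Real.arctan_nonneg.mpr (by positivity)) (Real.arctan_lt_pi_div_two (1 / (B : ℝ)))
    rwa [Real.tan_arctan] at this
  unfold gridAngle
  calc _ ≤ 2 * (1 / (B : ℝ)) := by linarith
    _ = _ := by ring

theorem toComplex_gridStep_pow {B : ℕ} (hB : 0 < B) (j : ℕ) :
    ((gridStep B ^ j).re : ℝ) = (gridDenom B : ℝ) ^ j * Real.cos (j * gridAngle B) := by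
  have h1 : GaussianInt.toComplex (gridStep B ^ j)
      = ((gridDenom B : ℝ) ^ j : ℝ) * Complex.exp (((-(j * gridAngle B) : ℝ) : ℂ) * Complex.I) := by
    rw [map_pow, toComplex_gridStep hB, mul_pow, ← Complex.exp_nat_mul]
    push_cast
    congr 2; ring
  rw [GaussianInt.intCast_re, h1, Complex.re_ofReal_mul, Complex.exp_ofReal_mul_I_re, Real.cos_neg]

/-- The sine of the angle is 2B/(B² + 1) ≥ 1/B. -/
theorem le_gridAngle {B : ℕ} (hB : 0 < B) : 1 / (B : ℝ) ≤ gridAngle B := by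
  have hB' : (1 : ℝ) ≤ B := by exact_mod_cast hB
  have h1 := congrArg Complex.im (toComplex_gridStep hB)
  rw [show -(Complex.I * (gridAngle B : ℂ)) = ((-gridAngle B : ℝ) : ℂ) * Complex.I by push_cast; ring,
    show ((gridDenom B : ℤ) : ℂ) = ((gridDenom B : ℝ) : ℂ) by push_cast; rfl, Complex.im_ofReal_mul,
    Complex.exp_ofReal_mul_I_im, Real.sin_neg, ← GaussianInt.intCast_im, gridStep, gridDenom] at h1
  push_cast at h1
  have h2 := Real.sin_le (gridAngle_pos hB).le
  have h3 : Real.sin (gridAngle B) = 2 * B / ((B : ℝ) ^ 2 + 1) := by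
    rw [eq_div_iff (by positivity)]; linarith
  refine le_trans ?_ h2
  rw [h3, div_le_div_iff₀ (by linarith) (by positivity)]
  nlinarith

theorem filter_range_eq_range_card {n : ℕ} (P : ℕ → Prop) [DecidablePred P]
    (h : ∀ i j, i ≤ j → j < n → P j → P i) :
    (Finset.range n).filter P = Finset.range ((Finset.range n).filter P).card := by
  set T := (Finset.range n).filter P with hT
  have hdown : ∀ j ∈ T, ∀ i ≤ j, i ∈ T := by
    intro j hj i hij
    simp only [hT, Finset.mem_filter, Finset.mem_range] at hj ⊢
    exact ⟨by omega, h i j hij hj.1 hj.2⟩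
  have hsub : T ⊆ Finset.range T.card := by
    intro j hj
    rw [Finset.mem_range]
    have h1 : Finset.range (j + 1) ⊆ T := fun i hi => hdown j hj i (by rw [Finset.mem_range] at hi; omega)
    have := Finset.card_le_card h1
    rw [Finset.card_range] at this; omega
  exact Finset.eq_of_subset_of_card_le hsub (by rw [Finset.card_range])

/-- For j < 2B the angles stay below 4 < 3π/2, so a positive cosine characterizes the first
quadrant. Counting these points determines a quarter turn up to one step, hence a full turn up to
four steps, without computing π. -/
theorem quadrantCount_bounds {B : ℕ} (hB : 0 < B) :
    2 * π ≤ ((4 * quadrantCount B : ℕ) : ℝ) * gridAngle B ∧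
      ((4 * quadrantCount B : ℕ) : ℝ) * gridAngle B ≤ 2 * π + 4 * gridAngle B := by
  have hB' : (0 : ℝ) < B := by exact_mod_cast hB
  have hθ := gridAngle_pos hB
  have hθ1 := le_gridAngle hB
  have hθ2 := gridAngle_le B
  have hp3 := Real.pi_gt_d2
  have hp4 := Real.pi_lt_d2
  have hD : (0 : ℝ) < gridDenom B := by exact_mod_cast gridDenom_pos B
  have hiff : ∀ j < 2 * B, (0 < (gridStep B ^ j).re ↔ (j : ℝ) * gridAngle B < π / 2) := by
    intro j hj
    have h1 := toComplex_gridStep_pow hB j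
    have h0 : 0 ≤ (j : ℝ) * gridAngle B := by positivity
    have h4 : (j : ℝ) * gridAngle B ≤ 4 := by
      have : (j : ℝ) ≤ 2 * B := by exact_mod_cast hj.le
      calc (j : ℝ) * gridAngle B ≤ 2 * B * (2 / B) := mul_le_mul this hθ2 hθ.le (by positivity)
        _ = 4 := by field_simp; norm_num
    rw [← Int.cast_pos (R := ℝ), h1, mul_pos_iff_of_pos_left (by positivity)]
    constructor
    · intro h
      by_contra hc
      have := Real.cos_nonpos_of_pi_div_two_le_of_le (x := (j : ℝ) * gridAngle B) (not_lt.mp hc) (by linarith)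
      linarith
    · intro h
      exact Real.cos_pos_of_mem_Ioo ⟨by linarith, h⟩
  have hfil := filter_range_eq_range_card (n := 2 * B) (fun j => 0 < (gridStep B ^ j).re) (fun i j hij hj h => by
    rw [hiff j hj] at h
    rw [hiff i (by omega)]
    have : (i : ℝ) ≤ j := by exact_mod_cast hij
    nlinarith)
  change _ = Finset.range (quadrantCount B) at hfil
  have hmem : ∀ j, (j < 2 * B ∧ 0 < (gridStep B ^ j).re) ↔ j < quadrantCount B := by
    intro j
    have := congrArg (j ∈ ·) hfil
    simpa using this
  constructor
  · have h1 : π / 2 ≤ (quadrantCount B : ℝ) * gridAngle B := by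
      -- If the count exhausts the table, the 2B steps of at least 1/B already cover 2 > π/2.
      by_cases h : quadrantCount B < 2 * B
      · by_contra hc
        exact lt_irrefl _ ((hmem _).mp ⟨h, (hiff _ h).mpr (not_le.mp hc)⟩)
      · have h2 : (2 * B : ℝ) ≤ quadrantCount B := by exact_mod_cast not_lt.mp h
        have h3 : (2 * B : ℝ) * (1 / B) ≤ quadrantCount B * gridAngle B :=
          mul_le_mul h2 hθ1 (by positivity) (by positivity)
        have h4 : (2 * B : ℝ) * (1 / B) = 2 := by field_simp
        linarith
    push_cast; linarith
  · rcases Nat.eq_zero_or_pos (quadrantCount B) with h0 | h0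
    · rw [h0]; simp; positivity
    · obtain ⟨h1, h2⟩ := (hmem (quadrantCount B - 1)).mpr (by omega)
      rw [hiff _ h1] at h2
      have h3 : ((quadrantCount B - 1 : ℕ) : ℝ) = quadrantCount B - 1 := by push_cast [Nat.cast_sub h0]; ring
      rw [h3] at h2
      push_cast; linarith

-- Put δ = 1/t; then β grid steps amount to an angle between δ and 2δ. Two picked points near the
-- same energy would be too close for the exclusion width of 40β + 32 steps, so picks belong to
-- different energies. Conversely, each energy has a grid point that passes, and the pick covering
-- this point can belong to no other energy, since energies are at least 40δ apart. So picks and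
-- energies are in bijection, and the number of picks is S.
set_option maxHeartbeats 800000 in
theorem IsSelection.exists_energies {pass : ℕ → Prop} {S L B β t c : ℕ} {κ : ℕ → ℕ} {s : Store} {E : Fin S → ℝ}
    (h : IsSelection pass (4 * quadrantCount B) (40 * β + 32) (8 * B) s c κ)
    (hs : s 3 0 = (4 * quadrantCount B : ℕ)) (hB : B = t * β) (hβ : 18 ≤ β) (hL : 0 < L) (ht : 40 * L ≤ t)
    (hE : ∀ j, 0 ≤ E j ∧ E j < 2 * π) (hsep : ∀ i j, i ≠ j → 1 / (L : ℝ) ≤ circDist (E i) (E j))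
    (hsound : ∀ k, pass k → ∃ j, circDist (k * gridAngle B) (E j) ≤ 5 / (2 * t))
    (hcomplete : ∀ (k : ℕ) (j : Fin S), |k * gridAngle B - E j| ≤ gridAngle B → pass k) :
    ∃ Eh : Fin S → ℝ, HoldsEnergies s Eh ∧ ∃ σ : Equiv.Perm (Fin S), ∀ j, circDist (Eh (σ j)) (E j) ≤ 3 / t := by
  have ht0 : 0 < t := by omega
  have hB0 : 0 < B := by rw [hB]; positivity
  have htR : (0 : ℝ) < t := by exact_mod_cast ht0
  have hβR : (18 : ℝ) ≤ β := by exact_mod_cast hβ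
  have hLR : (0 : ℝ) < L := by exact_mod_cast hL
  have htL : 40 * (L : ℝ) ≤ t := by exact_mod_cast ht
  have hBR : (B : ℝ) = t * β := by rw [hB]; push_cast; rfl
  have hpi := Real.pi_pos
  have hp3 := Real.pi_gt_d2
  have hp4 := Real.pi_lt_d2
  set θ := gridAngle B with hθdef
  have hθ : 0 < θ := gridAngle_pos hB0
  have hθ1 : 1 / (t * β : ℝ) ≤ θ := by rw [← hBR]; exact le_gridAngle hB0
  have hθ2 : θ ≤ 2 / (t * β : ℝ) := by rw [← hBR]; exact gridAngle_le B
  have hβθ1 : 1 / (t : ℝ) ≤ β * θ := by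
    calc 1 / (t : ℝ) = β * (1 / (t * β)) := by field_simp
      _ ≤ _ := by gcongr
  have hβθ2 : β * θ ≤ 2 / t := by
    calc β * θ ≤ β * (2 / (t * β)) := by gcongr
      _ = _ := by field_simp
  have h18 : 18 * θ ≤ 2 / t := le_trans (by gcongr) hβθ2
  obtain ⟨hG1, hG2⟩ := quadrantCount_bounds hB0
  have hqle := quadrantCount_le B
  set G := 4 * quadrantCount B with hG
  rw [← hθdef] at hG1 hG2
  have hG0 : 0 < G := by
    rcases Nat.eq_zero_or_pos G with h0 | h0
    · rw [h0] at hG1; simp at hG1; linarith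
    · exact h0
  have hGR : (0 : ℝ) < G := by exact_mod_cast hG0
  have e2 : 2 / (t : ℝ) = 2 * (1 / t) := by ring
  have e5 : 5 / (2 * (t : ℝ)) = 5 / 2 * (1 / t) := by field_simp
  have e3 : 3 / (t : ℝ) = 3 * (1 / t) := by ring
  rw [e2] at hβθ2 h18
  simp only [e5] at hsound
  rw [e3]
  set δ : ℝ := 1 / t with hδ
  have hδ0 : 0 < δ := by positivity
  have hδL : 40 * δ ≤ 1 / (L : ℝ) := by
    rw [hδ, ← mul_div_assoc, mul_one, div_le_div_iff₀ htR hLR]; linarith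
  choose near hnear using fun i : Fin c => hsound (κ i) (h.passes i i.isLt)
  have hinj' : ∀ i j : Fin c, i < j → near i ≠ near j := by
    intro i j hij heq
    obtain ⟨h1, h2⟩ := h.sep i j hij j.isLt
    have h3 := circDist_triangle (κ j * θ) (E (near i)) (κ i * θ)
    have h4 := hnear i
    have h5 := hnear j
    rw [← heq] at h5
    rw [circDist_comm] at h4
    have h1' : (κ i : ℝ) + (40 * β + 32) ≤ κ j := by exact_mod_cast h1.le
    have h2' : (κ j : ℝ) + (40 * β + 32) ≤ κ i + G := by exact_mod_cast h2.le
    -- G steps exceed a full turn by up to four steps, which reduces 32 to 28.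
    have h6 : (40 * β + 28) * θ ≤ circDist (κ j * θ) (κ i * θ) * (2 * π) := by
      have m1 := mul_le_mul_of_nonneg_right h1' hθ.le
      have m2 := mul_le_mul_of_nonneg_right h2' hθ.le
      apply circDist_ge <;> linarith
    have h7 : circDist (κ j * θ) (κ i * θ) * (2 * π) ≤ 5 * δ * (2 * 3.15) :=
      mul_le_mul (by linarith) (by linarith) (by positivity) (by positivity)
    linarith
  have hinj : Function.Injective near := by
    intro i j hij
    rcases lt_trichotomy i j with hlt | heq | hgt
    · exact absurd hij (hinj' i j hlt)
    · exact heq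
    · exact absurd hij.symm (hinj' j i hgt)
  have hsurj : Function.Surjective near := by
    intro j
    obtain ⟨hE0, hE1⟩ := hE j
    -- The grid point just below E j, within one step and therefore passing the test.
    set k := ⌊E j / θ⌋₊ with hk
    have hk1 : (k : ℝ) * θ ≤ E j := by
      have := Nat.floor_le (div_nonneg hE0 hθ.le)
      rwa [le_div_iff₀ hθ] at this
    have hk2 : E j < (k + 1) * θ := by
      have := Nat.lt_floor_add_one (E j / θ)
      rwa [div_lt_iff₀ hθ] at this
    have hkG : k < G := by
      have : (k : ℝ) < G := by
        by_contra hc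
        have := mul_le_mul_of_nonneg_right (not_lt.mp hc) hθ.le
        linarith
      exact_mod_cast this
    have habs : |(k : ℝ) * θ - E j| ≤ θ := by rw [abs_le]; constructor <;> linarith
    obtain ⟨i, hi, hcov⟩ := h.cover k (by omega) hkG (hcomplete k j habs)
    refine ⟨⟨i, hi⟩, ?_⟩
    have h1 : circDist (κ i * θ) (k * θ) * (2 * π) ≤ (40 * β + 32) * θ := by
      rcases hcov with ⟨ha, hb⟩ | ha
      · have ha' : (κ i : ℝ) ≤ k := by exact_mod_cast ha
        have hb' : (k : ℝ) ≤ κ i + (40 * β + 32) := by exact_mod_cast hb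
        refine (circDist_mul_two_pi_le _ _ 0).trans ?_
        simp only [Int.cast_zero, mul_zero, sub_zero]
        have m1 := mul_le_mul_of_nonneg_right ha' hθ.le
        have m2 := mul_le_mul_of_nonneg_right hb' hθ.le
        rw [abs_le]; constructor <;> linarith
      · have ha' : (κ i : ℝ) + G ≤ k + (40 * β + 32) := by exact_mod_cast ha
        have hb' : (k : ℝ) ≤ G := by exact_mod_cast hkG.le
        have hc' : (0 : ℝ) ≤ κ i := Nat.cast_nonneg _
        refine (circDist_mul_two_pi_le _ _ (-1)).trans ?_
        push_cast
        have m1 := mul_le_mul_of_nonneg_right ha' hθ.le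
        have m2 := mul_le_mul_of_nonneg_right hb' hθ.le
        have m3 := mul_le_mul_of_nonneg_right hc' hθ.le
        rw [abs_le]; constructor <;> linarith
    have h2 : circDist (k * θ) (E j) * (2 * π) ≤ θ := by
      refine (circDist_mul_two_pi_le _ _ 0).trans ?_
      simpa using habs
    have h3 := circDist_triangle (κ i * θ) (k * θ) (E j)
    have h4 := hnear ⟨i, hi⟩
    simp only at h4
    rw [circDist_comm] at h4
    by_contra hne
    have h5 := hsep _ _ hne
    have h6 := circDist_triangle (E (near ⟨i, hi⟩)) (κ i * θ) (E j)
    -- At most 40β + 33 steps: 40βθ ≤ 80δ, and 33θ is less than 4δ because 18θ ≤ 2δ.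
    have h7 : circDist (κ i * θ) (E j) * (2 * π) ≤ 84 * δ := by
      have m1 := mul_le_mul_of_nonneg_right h3 (show 0 ≤ 2 * π by positivity)
      linarith
    have h8 : 37 * δ ≤ circDist (κ i * θ) (E j) := by linarith
    have m2 := mul_le_mul h8 (show (6.28 : ℝ) ≤ 2 * π by linarith) (by norm_num) (circDist_nonneg _ _)
    linarith
  have hc : c = S := by
    have := Fintype.card_of_bijective (f := near) ⟨hinj, hsurj⟩
    simpa using this
  subst hc
  set σ := Equiv.ofBijective near ⟨hinj, hsurj⟩ with hσ
  refine ⟨fun i => 2 * π * ((κ i : ℝ) / G), ⟨?_, fun j => ?_⟩, σ.symm, fun j => ?_⟩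
  · rw [hs]; exact_mod_cast hG0
  · rw [h.out j j.isLt, hs]
    refine ⟨Int.natCast_nonneg _, by exact_mod_cast h.lt_grid j j.isLt, ?_⟩
    push_cast; rfl
  · obtain ⟨i, rfl⟩ := σ.surjective j
    rw [Equiv.symm_apply_apply]
    have h1 := hnear i
    have h2 := circDist_triangle (2 * π * ((κ i : ℝ) / G)) (κ i * θ) (E (σ i))
    -- The output is a fraction of a full turn instead of a multiple of the irrational step; since G
    -- steps are a full turn up to four steps, this costs at most four steps.
    have h3 : circDist (2 * π * ((κ i : ℝ) / G)) (κ i * θ) * (2 * π) ≤ 4 * θ := by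
      refine (circDist_mul_two_pi_le _ _ 0).trans ?_
      simp only [Int.cast_zero, mul_zero, sub_zero]
      have hκ : (κ i : ℝ) / G ≤ 1 := by
        rw [div_le_one hGR]; exact_mod_cast (h.lt_grid i i.isLt).le
      have hκ0 : 0 ≤ (κ i : ℝ) / G := by positivity
      have e : 2 * π * ((κ i : ℝ) / G) - κ i * θ = (κ i : ℝ) / G * (2 * π - G * θ) := by field_simp
      rw [e, abs_mul, abs_of_nonneg hκ0]
      have h4 : |2 * π - G * θ| ≤ 4 * θ := by rw [abs_le]; constructor <;> linarith
      calc _ ≤ 1 * (4 * θ) := mul_le_mul hκ h4 (abs_nonneg _) zero_le_one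
        _ = _ := one_mul _
    change circDist (κ i * θ) (E (σ i)) ≤ _ at h1
    have h5 : circDist (2 * π * ((κ i : ℝ) / G)) (κ i * θ) ≤ δ / 2 := by
      by_contra hlt
      have m1 := mul_le_mul (not_le.mp hlt).le (show (6.28 : ℝ) ≤ 2 * π by linarith) (by norm_num) (circDist_nonneg _ _)
      linarith
    simp only
    linarith

theorem matchingDist_le {S : ℕ} {E E' : Fin S → ℝ} {b : ℝ} (hb : 0 ≤ b) (σ : Equiv.Perm (Fin S))
    (h : ∀ j, circDist (E' (σ j)) (E j) ≤ b) : matchingDist E E' ≤ b := by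
  refine (ciInf_le (Set.finite_range _).bddBelow σ).trans ?_
  exact Real.iSup_le h hb

end Grid

/-! ### From an accurate signal to accurate energies, and the choice of the parameters -/

section Accuracy

theorem sum_norm_sq_eq_one {n S : ℕ} {prep : List (QOp (Fin n))} (hprep : ∀ g ∈ prep, IsGate g)
    {ψ : Fin S → EuclideanSpace ℂ (Bits (Fin n))} {a : Fin S → ℂ} (hψ : Orthonormal ℂ ψ)
    (hφ : circuitOp prep *ᵥ ketZero (Fin n) = ∑ j, a j • (ψ j).ofLp) : ∑ j, ‖a j‖ ^ 2 = 1 := by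
  have h1 : l2n (circuitOp prep *ᵥ ketZero (Fin n)) = 1 := by
    rw [l2n_mulVec_of_mem_unitaryGroup (circuitOp_mem_unitaryGroup hprep), l2n_ketZero]
  have h2 : WithLp.toLp 2 (∑ j, a j • (ψ j).ofLp) = ∑ j, a j • ψ j := by
    rw [WithLp.toLp_sum]
    exact Finset.sum_congr rfl fun j _ => by rw [WithLp.toLp_smul]
  rw [hφ, l2n, h2] at h1
  have h3 := hψ.inner_sum a a Finset.univ
  rw [inner_self_eq_norm_sq_to_K, h1] at h3
  have h4 : ((∑ j, ‖a j‖ ^ 2 : ℝ) : ℂ) = 1 := by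
    push_cast
    rw [Finset.sum_congr rfl fun j _ => (Complex.conj_mul' (a j)).symm]
    simpa using h3.symm
  exact_mod_cast h4

/-- The deterministic part. The choice of t gives t ≥ 40L and makes 3/t at most 1/(2(q + 1)); β
makes one grid step small against 1/(m²t); N makes the contraction strong enough. The two summands
in the condition on η are what ESPRIT and the iterated test need. Both lists of energies are within
1/(2(q + 1)) of the true one. -/
theorem accuracy_of_estSignal_close {n S L R lb q w t β B N c : ℕ} {κ : ℕ → ℕ} {s : Store} {p E : Fin S → ℝ} {η : ℝ}
    {ω : Run L R → Fin 2} (hSL : S ≤ L) (hS : 0 < S) (hR : 0 < R) (hL : 2 * L ≤ lb) (hw : 0 < w)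
    (ht : t = 40 * (lb + 1) * (q + 1)) (hβ : β = 18 * (2 * lb + 1) ^ 2) (hB : B = t * β)
    (hN : N = (2 * lb + 1) ^ 2 * t ^ 2 * w) (hη : 0 ≤ η)
    (hη1 : η * ((1000 * (lb + 1) ^ 5 * w * (q + 1) + 2 * N * (2 * lb + 1) * t : ℕ) : ℝ) ≤ 1)
    (hp : ∀ j, 1 / (w : ℝ) ≤ p j) (hsum : ∑ j, p j = 1) (hE : ∀ j, 0 ≤ E j ∧ E j < 2 * π)
    (hsep : ∀ i j, i ≠ j → 1 / (L : ℝ) ≤ circDist (E i) (E j))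
    (hω : ∀ k, ‖estSignal ω k - expSignal p E k‖ ≤ η)
    (hs : s 3 0 = (4 * quadrantCount B : ℕ))
    (h : IsSelection (PassesTest (2 * L + 1) R N B t (symbol (2 * L + 1) R (bitSum R (inputStore n S ω 1))))
      (4 * quadrantCount B) (40 * β + 32) (8 * B) s c κ) :
    (∃ Et : Fin S → ℝ, IsEspritOutput hSL (estSignal ω) Et) ∧
      ∃ Eh : Fin S → ℝ, HoldsEnergies s Eh ∧ (q : ℝ) * matchingDist E Eh ≤ 1 ∧
        ∀ Et : Fin S → ℝ, IsEspritOutput hSL (estSignal ω) Et →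
          (q : ℝ) * matchingDist E Et ≤ 1 ∧ (q : ℝ) * matchingDist Et Eh ≤ 1 := by
  have hL0 : 0 < L := by omega
  have hwR : (0 : ℝ) < w := by exact_mod_cast hw
  have hqR : (0 : ℝ) ≤ q := Nat.cast_nonneg _
  have hLR : (0 : ℝ) < L := by exact_mod_cast hL0
  have hLlb : 2 * (L : ℝ) ≤ lb := by exact_mod_cast hL
  have hp₀ : (0 : ℝ) < 1 / w := by positivity
  have htq : (t : ℝ) = 40 * (lb + 1) * (q + 1) := by rw [ht]; push_cast; rfl
  have ht1 : (1 : ℝ) ≤ t := by rw [htq]; nlinarith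
  have hpp : ∀ j, 0 ≤ p j := fun j => hp₀.le.trans (hp j)
  have hη2 : η * (1000 * ((lb : ℝ) + 1) ^ 5 * w * (q + 1)) + η * (2 * N * (2 * lb + 1) * t) ≤ 1 := by
    push_cast at hη1; rw [← mul_add]; exact hη1
  have hη3 : 0 ≤ η * (1000 * ((lb : ℝ) + 1) ^ 5 * w * (q + 1)) := by positivity
  have hη4 : 0 ≤ η * (2 * N * (2 * (lb : ℝ) + 1) * t) := by positivity
  have hη5 : η * (1000 * ((lb : ℝ) + 1) ^ 5 * w * (q + 1)) ≤ 1 := by linarith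
  have hNε : 2 * N * η * (2 * L + 1) * t ≤ 1 := by
    calc 2 * N * η * (2 * L + 1) * t ≤ 2 * N * η * (2 * lb + 1) * t := by gcongr; linarith
      _ = η * (2 * N * (2 * lb + 1) * t) := by ring
      _ ≤ 1 := by linarith
  have hesprit : 1000 * ((L : ℝ) + 1) ^ 5 * η ≤ 1 / w := by
    rw [le_div_iff₀ hwR]
    calc 1000 * ((L : ℝ) + 1) ^ 5 * η * w ≤ 1000 * ((lb : ℝ) + 1) ^ 5 * η * w := by gcongr; linarith
      _ ≤ 1000 * ((lb : ℝ) + 1) ^ 5 * η * w * (q + 1) := le_mul_of_one_le_right (by positivity) (by linarith)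
      _ = η * (1000 * ((lb : ℝ) + 1) ^ 5 * w * (q + 1)) := by ring
      _ ≤ 1 := hη5
  have hclose : 80 * ((L : ℝ) + 1) ^ 4 * η / (1 / w) ≤ 1 / (2 * (q + 1)) := by
    rw [div_div_eq_mul_div, div_one, le_div_iff₀ (by positivity)]
    calc 80 * ((L : ℝ) + 1) ^ 4 * η * w * (2 * (q + 1)) ≤ 80 * ((lb : ℝ) + 1) ^ 4 * η * w * (2 * (q + 1)) := by
          gcongr; linarith
      _ ≤ 80 * ((lb : ℝ) + 1) ^ 4 * η * w * (2 * (q + 1)) * (lb + 1) := le_mul_of_one_le_right (by positivity) (by linarith)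
      _ ≤ η * (1000 * ((lb : ℝ) + 1) ^ 5 * w * (q + 1)) := by nlinarith
      _ ≤ 1 := hη5
  have hA' := opBound_toeplitzMatrix_sub_deflation (n := n) hR hη ω hω
  have hB0 : 0 < B := by
    rw [hB, ht, hβ]; positivity
  obtain ⟨Eh, hEh, σ, hσ⟩ := h.exists_energies (L := L) (t := t) (E := E) hs hB (by rw [hβ]; nlinarith) hL0
    (by rw [ht]; nlinarith) hE hsep
    (fun k hk => by
      rw [passesTest_iff (by omega) hR hB0] at hk
      exact exists_circDist_le_of_lt hL0 hS hsep hpp hsum hη ht1 hA' hNε hk)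
    (fun k j hkj => by
      rw [passesTest_iff (by omega) hR hB0]
      refine lt_four_of_abs_sub_le hL0 hsep hp₀ hp hsum hη ht1 hA' hNε ?_ (j := j) ?_
      -- The factor w in N cancels against the lower bound 1/w of the weights.
      · rw [hN]
        push_cast
        rw [mul_one_div, mul_div_cancel_right₀ _ hwR.ne']
        gcongr; linarith
      · have hβR : (β : ℝ) = 18 * (2 * lb + 1) ^ 2 := by rw [hβ]; push_cast; rfl
        have hBR : (B : ℝ) = t * β := by rw [hB]; push_cast; rfl
        have h1 : |k * gridAngle B - E j| ≤ 2 / (t * β) := by rw [← hBR]; exact hkj.trans (gridAngle_le B)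
        calc (2 * (L : ℝ) + 1) ^ 2 * |k * gridAngle B - E j| * t
            ≤ (2 * (lb : ℝ) + 1) ^ 2 * (2 / (t * β)) * t := by gcongr; linarith
          _ = 1 / 9 := by rw [hβR]; field_simp; norm_num
          _ ≤ 1 := by norm_num)
  have hσ' : ∀ j, circDist (Eh (σ j)) (E j) ≤ 1 / (2 * (q + 1)) := fun j => (hσ j).trans (by
    rw [htq, div_le_div_iff₀ (by positivity) (by positivity)]
    have : 0 ≤ (lb : ℝ) * (q + 1) := by positivity
    nlinarith)
  have hhalf : (q : ℝ) * (1 / (2 * (q + 1))) ≤ 1 := by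
    rw [mul_one_div, div_le_one (by positivity)]; linarith
  have hone : (q : ℝ) * (1 / (q + 1)) ≤ 1 := by
    rw [mul_one_div, div_le_one (by positivity)]; linarith
  refine ⟨exists_isEspritOutput hSL hS hp hsep hω hη hp₀ hesprit, Eh, hEh,
    (mul_le_mul_of_nonneg_left (matchingDist_le (by positivity) σ hσ') hqR).trans hhalf, fun Et hEt => ?_⟩
  obtain ⟨υ, hυ⟩ := hEt.exists_perm hSL hS hp hsep hω hη hp₀ hesprit
  have hυ' : ∀ j, circDist (Et (υ j)) (E j) ≤ 1 / (2 * (q + 1)) := fun j => (hυ j).trans hclose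
  refine ⟨(mul_le_mul_of_nonneg_left (matchingDist_le (by positivity) υ hυ') hqR).trans hhalf,
    -- The two lists are matched through the true energies, so their errors add up to 1/(q + 1).
    (mul_le_mul_of_nonneg_left (matchingDist_le (by positivity) (υ.symm.trans σ) fun j => ?_) hqR).trans hone⟩
  have h1 := hσ' (υ.symm j)
  have h2 := hυ' (υ.symm j)
  rw [Equiv.apply_symm_apply, circDist_comm] at h2
  have h3 := circDist_triangle (Eh (σ (υ.symm j))) (E (υ.symm j)) (Et j)
  have h4 : 1 / ((q : ℝ) + 1) = 1 / (2 * (q + 1)) + 1 / (2 * (q + 1)) := by field_simp; norm_num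
  rw [h4]
  exact h3.trans (add_le_add h1 h2)

end Accuracy

theorem theorem3
    -- The constants: locality, `K ≤ κ S`, gap `≥ C / K`.
    (ℓ κ : ℕ) (C : ℝ) (hC : 2 < C)
    -- Polynomials: bounds for `S`, the number and the norms of the terms, the size of the
    -- preparation circuit, the inverse weights; the accuracy `1 / q(n)` and the failure
    -- probability `2 ^ (-d(n))` that are asked for.
    (pS pN pH pPrep pW q d : ℕ[X]) :
    -- The algorithm: size of the compiled propagators, Trotter number, repetitions, gate count,
    -- classical running time, and the classical program.
    ∃ (c : ℕ) (M R gates time : ℕ[X]) (post : Program),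
      (∀ n : ℕ, 0 < M.eval n ∧ 0 < R.eval n) ∧
      ∀ (n N S L : ℕ) (h : LocalHamiltonian n N ℓ) (prep : List (QOp (Fin n)))
        (E : Fin S → ℝ) (ψ : Fin S → EuclideanSpace ℂ (Bits (Fin n))) (a : Fin S → ℂ)
        (hSL : S ≤ L),
        N ≤ pN.eval n →
        (∀ i, opNorm (h.term i) ≤ ((pH.eval n : ℕ) : ℝ)) →
        (∀ g ∈ prep, IsGate g) →
        prep.length ≤ pPrep.eval n →
        0 < S → S ≤ pS.eval n → 2 * L ≤ κ * S →
        Orthonormal ℂ ψ →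
        (∀ j, h.op *ᵥ (ψ j).ofLp = (E j : ℂ) • (ψ j).ofLp) →
        circuitOp prep *ᵥ ketZero (Fin n) = ∑ j, a j • (ψ j).ofLp →
        (∀ j, 1 ≤ ((pW.eval n : ℕ) : ℝ) * ‖a j‖ ^ 2) →
        (∀ j, 0 ≤ E j ∧ E j < 2 * π) →
        (∀ i j, i ≠ j → C / ((2 * L : ℕ) : ℝ) ≤ circDist (E i) (E j)) →
        ∃ blk : Fin (2 * L + 1) → Fin N → List (QOp (Option (Fin n))),
          -- the circuits, and the quantum effort
          (∀ k l, CompilesControlled (h.supp l) (h.propagator (M.eval n) k.val l) (blk k l) ∧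
            (blk k l).length ≤ c) ∧
          (∀ ρ : Run L (R.eval n), ∀ g ∈ runCircuit prep (M.eval n) blk ρ, IsGate g) ∧
          ∑ ρ : Run L (R.eval n), (runCircuit prep (M.eval n) blk ρ).length ≤ gates.eval n ∧
          -- the classical effort
          (∀ ω : Run L (R.eval n) → Fin 2, (post.exec (inputStore n S ω)).2 ≤ time.eval n) ∧
          -- the accuracy, of exact ESPRIT and of its numerical implementation
          MeasureTheory.IsProbabilityMeasure
            (experimentLaw (R := R.eval n) prep (M.eval n) blk) ∧
          1 - (1 / 2 : ℝ) ^ (d.eval n) ≤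
            (experimentLaw (R := R.eval n) prep (M.eval n) blk).real
              {ω | (∃ Et : Fin S → ℝ, IsEspritOutput hSL (estSignal ω) Et) ∧
                ∃ Eh : Fin S → ℝ, HoldsEnergies (post.exec (inputStore n S ω)).1 Eh ∧
                  ((q.eval n : ℕ) : ℝ) * matchingDist E Eh ≤ 1 ∧
                  ∀ Et : Fin S → ℝ, IsEspritOutput hSL (estSignal ω) Et →
                    ((q.eval n : ℕ) : ℝ) * matchingDist E Et ≤ 1 ∧
                    ((q.eval n : ℕ) : ℝ) * matchingDist Et Eh ≤ 1} := by
  set lb : ℕ[X] := Polynomial.C κ * pS with hlbP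
  set t : ℕ[X] := 40 * (lb + 1) * (q + 1) with htP
  set β : ℕ[X] := 18 * (2 * lb + 1) ^ 2 with hβP
  set B : ℕ[X] := t * β with hBP
  set I : ℕ[X] := (2 * lb + 1) ^ 2 * t ^ 2 * pW with hIP
  -- 1/Y is the accuracy demanded of the signal; half of it is granted to the product formula
  -- through M, half to the sampling error through R. The final summand 1 keeps Y positive.
  set Y : ℕ[X] := 1000 * (lb + 1) ^ 5 * pW * (q + 1) + 2 * I * (2 * lb + 1) * t + 1 with hYP
  set M : ℕ[X] := 4 * (lb * pN * pH + 1) ^ 2 * Y with hMP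
  set R : ℕ[X] := 32 * Y ^ 2 * (d + 4 * (2 * lb + 1)) with hRP
  obtain ⟨time, post, hpost⟩ := exists_selection_program (2 * lb + 1) pS R I B (40 * β + 32) t
  have hlb : ∀ n, lb.eval n = κ * pS.eval n := fun n => by simp [hlbP]
  have ht : ∀ n, t.eval n = 40 * (lb.eval n + 1) * (q.eval n + 1) := fun n => by simp [htP]
  have hβ : ∀ n, β.eval n = 18 * (2 * lb.eval n + 1) ^ 2 := fun n => by simp [hβP]
  have hB : ∀ n, B.eval n = t.eval n * β.eval n := fun n => by simp [hBP]
  have hI : ∀ n, I.eval n = (2 * lb.eval n + 1) ^ 2 * t.eval n ^ 2 * pW.eval n := fun n => by simp [hIP]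
  have hY : ∀ n, Y.eval n = 1000 * (lb.eval n + 1) ^ 5 * pW.eval n * (q.eval n + 1)
      + 2 * I.eval n * (2 * lb.eval n + 1) * t.eval n + 1 := fun n => by simp [hYP]
  have hM : ∀ n, M.eval n = 4 * (lb.eval n * pN.eval n * pH.eval n + 1) ^ 2 * Y.eval n := fun n => by simp [hMP]
  have hR : ∀ n, R.eval n = 32 * Y.eval n ^ 2 * (d.eval n + 4 * (2 * lb.eval n + 1)) := fun n => by simp [hRP]
  have hmb : ∀ n, (2 * lb + 1 : ℕ[X]).eval n = 2 * lb.eval n + 1 := fun n => by simp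
  have hW : ∀ n, (40 * β + 32 : ℕ[X]).eval n = 40 * β.eval n + 32 := fun n => by simp
  clear_value lb t β B I Y M R
  have hY0 : ∀ n, 0 < Y.eval n := fun n => by rw [hY]; omega
  have hM0 : ∀ n, 0 < M.eval n := fun n => by
    rw [hM]; have := hY0 n; positivity
  have hR0 : ∀ n, 0 < R.eval n := fun n => by
    rw [hR]; have := hY0 n; positivity
  refine ⟨unitaryCount (ℓ + 1), M, R,
    (2 * lb + 1) * 2 * R * (pPrep + 3 + M * (pN * Polynomial.C (unitaryCount (ℓ + 1)))), time, post,
    fun n => ⟨hM0 n, hR0 n⟩, ?_⟩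
  intro n N S L h prep E ψ a hSL hN hH hprep hlen hS hSp hL hψ heig hφ hpW hE hsep
  have hLlb : 2 * L ≤ lb.eval n := by
    rw [hlb]; exact hL.trans (Nat.mul_le_mul_left _ hSp)
  have hL0 : 0 < L := by omega
  have hLR : (0 : ℝ) < L := by exact_mod_cast hL0
  have hw : 0 < pW.eval n := by
    rcases Nat.eq_zero_or_pos (pW.eval n) with h0 | h0
    · have := hpW ⟨0, hS⟩
      rw [h0] at this
      norm_num at this
    · exact h0
  have hwR : (0 : ℝ) < (pW.eval n : ℕ) := by exact_mod_cast hw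
  have hYR : (0 : ℝ) < (Y.eval n : ℕ) := by exact_mod_cast hY0 n
  have hMR : (0 : ℝ) < (M.eval n : ℕ) := by exact_mod_cast hM0 n
  obtain ⟨blk, hblk⟩ := h.exists_blocks L (M.eval n)
  have hgate : ∀ ρ : Run L (R.eval n), ∀ g ∈ runCircuit prep (M.eval n) blk ρ, IsGate g := fun ρ =>
    isGate_of_mem_hadamardTest hprep fun l g hg => ((hblk ρ.1 l).1.1 g hg).isGate
  -- The frequencies may deviate by 1/(8Y), which enters the signal with the factor 4; R is chosen
  -- so that 2ε²R supplies exactly the required exponent with `lb` in place of 2L.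
  obtain ⟨hprob, hconc⟩ := experiment_concentration hgate (hR0 n)
    (ε := 1 / (8 * ((Y.eval n : ℕ) : ℝ))) (by positivity) (d := d.eval n) (by
      have h1 : 2 * (1 / (8 * ((Y.eval n : ℕ) : ℝ))) ^ 2 * ((R.eval n : ℕ) : ℝ)
          = (d.eval n : ℕ) + 4 * (2 * ((lb.eval n : ℕ) : ℝ) + 1) := by
        rw [hR]; push_cast; field_simp; norm_num
      have h2 : 2 * (L : ℝ) ≤ (lb.eval n : ℕ) := by exact_mod_cast hLlb
      have h3 : (0 : ℝ) ≤ (lb.eval n : ℕ) := Nat.cast_nonneg _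
      rw [h1]; linarith)
  refine ⟨blk, hblk, hgate, ?_, fun ω => ?_, hprob, hconc.trans ?_⟩
  · calc ∑ ρ : Run L (R.eval n), (runCircuit prep (M.eval n) blk ρ).length
        ≤ ∑ _ρ : Run L (R.eval n), (pPrep.eval n + 3 + M.eval n * (pN.eval n * unitaryCount (ℓ + 1))) := by
          refine Finset.sum_le_sum fun ρ _ => ?_
          refine (length_hadamardTest_le prep _ _ fun l => (hblk ρ.1 l).2).trans ?_
          gcongr
      _ = (2 * L + 1) * (2 * R.eval n) * (pPrep.eval n + 3 + M.eval n * (pN.eval n * unitaryCount (ℓ + 1))) := by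
          simp
      _ ≤ (2 * lb.eval n + 1) * (2 * R.eval n) * (pPrep.eval n + 3 + M.eval n * (pN.eval n * unitaryCount (ℓ + 1))) := by
          gcongr; omega
      _ = _ := by simp; ring
  · exact (hpost n S L ω (by rw [hmb]; omega) hSp).1
  · refine MeasureTheory.measureReal_mono fun ω hω => ?_
    obtain ⟨-, hs, c, κ', hsel⟩ := hpost n S L ω (by rw [hmb]; omega) hSp
    rw [hW] at hsel
    refine accuracy_of_estSignal_close (p := fun j => ‖a j‖ ^ 2) (η := 1 / ((Y.eval n : ℕ) : ℝ)) hSL hS (hR0 n) hLlb hw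
      (ht n) (hβ n) (hB n) (hI n) (by positivity) ?_ (fun j => ?_) (sum_norm_sq_eq_one hprep hψ hφ) hE
      (fun i j hij => ?_) (fun k => ?_) hs hsel
    · rw [one_div_mul_eq_div, div_le_one hYR]
      exact_mod_cast (by rw [hY n]; omega)
    · rw [div_le_iff₀ hwR, mul_comm]; exact hpW j
    -- C/K ≥ 1/L since K = 2L and C > 2: this is where the constant 2 comes from.
    · refine le_trans ?_ (hsep i j hij)
      push_cast
      rw [div_le_div_iff₀ hLR (by positivity)]
      nlinarith
    · set b : ℝ := (lb.eval n : ℕ) * (pN.eval n : ℕ) * (pH.eval n : ℕ) with hb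
      have hb0 : 0 ≤ b := by positivity
      have hMb : ((M.eval n : ℕ) : ℝ) = 4 * (b + 1) ^ 2 * (Y.eval n : ℕ) := by rw [hM, hb]; push_cast; rfl
      have hY1 : (1 : ℝ) ≤ (Y.eval n : ℕ) := by exact_mod_cast hY0 n
      have herr := estSignal_error h hprep E ψ a hψ heig hφ (hM0 n) (α := b / (M.eval n : ℕ)) (by
          calc ∑ i, ((2 * L : ℕ) : ℝ) / (M.eval n : ℕ) * opNorm (h.term i)
              ≤ ∑ _i : Fin N, ((lb.eval n : ℕ) : ℝ) / (M.eval n : ℕ) * (pH.eval n : ℕ) := by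
                refine Finset.sum_le_sum fun i _ => mul_le_mul ?_ (hH i) (norm_nonneg _) (by positivity)
                gcongr
            _ = (N : ℝ) * (((lb.eval n : ℕ) : ℝ) / (M.eval n : ℕ) * (pH.eval n : ℕ)) := by simp
            _ ≤ (pN.eval n : ℕ) * (((lb.eval n : ℕ) : ℝ) / (M.eval n : ℕ) * (pH.eval n : ℕ)) := by gcongr
            _ = b / (M.eval n : ℕ) := by rw [hb]; ring)
        (by
          rw [div_le_one hMR, hMb]
          nlinarith) (fun k l => (hblk k l).1) hω k
      refine herr.trans ?_
      -- Here M steps, each with error 2(b/M)², give 2b²/M ≤ 1/(2Y), where b bounds the longest time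
      -- times the sum of the norms of the terms.
      have h1 : ((M.eval n : ℕ) : ℝ) * (2 * (b / (M.eval n : ℕ)) ^ 2) = 2 * b ^ 2 / (M.eval n : ℕ) := by field_simp
      have h2 : 2 * b ^ 2 / ((M.eval n : ℕ) : ℝ) ≤ 1 / (2 * (Y.eval n : ℕ)) := by
        rw [div_le_div_iff₀ hMR (by positivity), hMb]
        have : b ^ 2 ≤ (b + 1) ^ 2 := by nlinarith
        nlinarith
      have h3 : 4 * (1 / (8 * ((Y.eval n : ℕ) : ℝ))) = 1 / (2 * (Y.eval n : ℕ)) := by field_simp; norm_num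
      have h4 : 1 / ((Y.eval n : ℕ) : ℝ) = 1 / (2 * (Y.eval n : ℕ)) + 1 / (2 * (Y.eval n : ℕ)) := by field_simp; norm_num
      rw [h1, h3, h4]; linarith
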